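/- **Setting.** A transport network is a directed graph with $n=|E|$ edges, distinct origin–destination pairs $w=(i,j)$, $i\ne j$ (at least one pair), demands $d_w>0$, $d=\sum_w d_w$, $S$ different origins, and finite nonempty sets $P_w$ of admissible paths (walks along oriented edges from $i$ to $j$). $\Theta_{ep}$ is the number of times the path $p$ uses the edge $e$, $H=\max_p\|\Theta^{(p)}\|_2^2$ (for paths without repeated edges: the maximal number of edges of a path), $g_p(t)=\sum_e\Theta_{ep}t_e$, $X=\{x\ge0:\sum_{p\in P_w}x_p=d_w\ \forall w\}$, $f=\Theta x$, $\mathrm{Ent}(x)=\sum_w\sum_{p\in P_w}x_p\ln(x_p/d_w)$. For $\gamma>0$ put $\Phi_\gamma(t)=\gamma\sum_w d_w\ln\sum_{p\in P_w}e^{-g_p(t)/\gamma}$, and $\Phi_0(t)=\lim_{\gamma\to0+}\Phi_\gamma(t)=-\sum_w d_w\min_{p\in P_w}g_p(t)$. If $\gamma>0$ ("stochastic equilibria"), $P_w$ consists of all walks from $i$ to $j$ with at most $\ell$ edges, where $\ell$ is the maximal number of edges of an admissible path; if $\gamma=0$ ("ordinary equilibria"), $P_w$ is any finite set of walks that contains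 all walks from $i$ to $j$ without repeated vertices, and $n\ge2$. *Beckmann model.* $\tau_e$ is continuous and nondecreasing on $[0,\infty)$, $\bar t_e=\tau_e(0)\ge0$ (e.g. BPR functions), $\sigma_e(f)=\int_0^f\tau_e$. Primal: $\sum_e\sigma_e(f_e)+\gamma\,\mathrm{Ent}(x)\to\min$ over $f=\Theta x$, $x\in X$. Dual: $F(t)=\Phi_\gamma(t)+\sum_e\sigma_e^*(t_e)\to\min$ over $Q=\{t\ge\bar t,\ \sigma_e^*(t_e)<\infty\}$, where $\sigma_e^*(s)=\sup_{f\ge0}(sf-\sigma_e(f))$. *Stable dynamics.* $\bar t_e\ge0$, $\bar f_e>0$. Primal: $\langle f,\bar t\rangle+\gamma\,\mathrm{Ent}(x)\to\min$ over $f=\Theta x\le\bar f$, $x\in X$. Dual: $F(t)=\Phi_\gamma(t)+\langle\bar f,t-\bar t\rangle\to\min$ over $Q=\{t\ge\bar t\}$, assumed to have a solution $t_*$; $R\ge0$ is a number given to the method with $\frac12\|t_*-\bar t\|_2^2\le R^2$. **Method.** Let $h$ be the separable second term of $F$, $\nabla\Phi_\gamma$ the gradient of $\Phi_\gamma$ for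 $\gamma>0$ and an arbitrary selection of subgradients on $Q$ for $\gamma=0$, $y^0=\bar t$, $l_y(x)=\Phi_\gamma(y)+\langle\nabla\Phi_\gamma(y),x-y\rangle+h(x)$, $\varphi_k(x)=\frac12\|x-y^0\|_2^2+\sum_{i\le k}\alpha_i l_{y^i}(x)$. The universal method of similar triangles with accuracy $\varepsilon>0$ and initial constant $L_0>0$ computes at iteration $0$, for a constant $L$: $A_0=\alpha_0=1/L$, $t^0=u^0=\arg\min_Q\varphi_0$; and at iteration $k+1$: $\alpha_{k+1}=\frac1{2L}+\sqrt{\frac1{4L^2}+\frac{A_k}{L}}$, $A_{k+1}=A_k+\alpha_{k+1}$, $y^{k+1}=\frac{\alpha_{k+1}u^k+A_kt^k}{A_{k+1}}$, $u^{k+1}=\arg\min_Q\varphi_{k+1}$, $t^{k+1}=\frac{\alpha_{k+1}u^{k+1}+A_kt^k}{A_{k+1}}$. The candidate for iteration $k$ is accepted if $\Phi_\gamma(t^{k})\le\Phi_\gamma(y^{k})+\langle\nabla\Phi_\gamma(y^{k}),t^{k}-y^{k}\rangle+\frac L2\|t^{k}-y^{k}\|_2^2+\frac{\alpha_{k}}{2A_{k}}\varepsilon$;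 otherwise $L$ is doubled and the candidate recomputed. The first $L$ tried is $L_0$ at iteration $0$, and half of the previously accepted constant afterwards. Put $f^k=-\nabla\Phi_\gamma(y^k)$, $\bar f^N=\frac1{A_N}\sum_{k\le N}\alpha_kf^k$ and, for $\gamma>0$, let $x^k$ be the logit distribution $x^k_p=d_we^{-g_p(y^k)/\gamma}/\sum_{q\in P_w}e^{-g_q(y^k)/\gamma}$, $\bar x^N=\frac1{A_N}\sum_{k\le N}\alpha_kx^k$, $\mathcal E_N=\frac\gamma{A_N}\sum_{k\le N}\alpha_k\mathrm{Ent}(x^k)$; $\mathcal E_N=0$ for $\gamma=0$. The method stops at the first $N$ such that $$F(t^N)+\sum_e\sigma_e(\bar f^N_e)+\mathcal E_N<\varepsilon\quad\text{(Beckmann)},$$ $$F(t^N)+\langle\bar f^N,\bar t\rangle+\mathcal E_N+3R\,\|(\bar f^N-\bar f)_+\|_2<\varepsilon\quad\text{(stable dynamics)}.$$ Put $\bar R=\sqrt5R$ for stable dynamics and $\bar R=\tilde R_{N-1}$ for the Beckmann model ($\tilde R_0$ if $N=0$), where $\tilde R_k^2=\frac12\sum_e(\tau_e(\bar f^k_e)-\bar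 t_e)^2$ and $N$ is the stopping iteration. **Theorem.** There is an absolute constant $C$ such that the following holds in both models. Let $0<L_0\le Hd/\gamma$ if $\gamma>0$, and $0<L_0\le Hd^2/\varepsilon$ if $\gamma=0$. Then the method is well defined and stops, and at the stopping iteration $N$: 1. $\bar f^N=\Theta x$ for some $x\in X$ ($x=\bar x^N$ if $\gamma>0$), and the primal objective at $x$ exceeds the primal objective at any primal feasible path flow by at most $\varepsilon$; for stable dynamics moreover $R\,\|(\bar f^N-\bar f)_+\|_2\le\varepsilon$; and $F(t^N)\le\min_QF+\varepsilon$ (in the sense $F(t^N)\le F(t)+\varepsilon$ for all $t\in Q$); 2. the total number of candidates computed in the iterations $0,\dots,N$ is at most $C\,K$, where $$K=1+\sqrt{\frac{Hd\bar R^2}{\gamma\varepsilon}}+\log_2\frac{Hd}{\gamma L_0}\quad(\gamma>0),\qquad K=1+\frac{Hd^2\bar R^2}{\varepsilon^2}+\log_2\frac{Hd^2}{\varepsilon L_0}\quad(\gamma=0);$$ 3. for each of the two models, and each of the two cases $\gamma>0$, $\gamma=0$, there is one fixed program of a real random access machine, independent of the network and of all data, that performs the method (for $\gamma=0$, with some selection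 of subgradients), halts and outputs $t^N$ and $\bar f^N$ after at most $$C\cdot SHn\cdot K\quad(\gamma>0),\qquad C\cdot Sn\ln n\cdot K\quad(\gamma=0)$$ steps. The program receives the graph, the pairs, the demands, $\ell$ (if $\gamma>0$), $\bar t$, $\gamma,\varepsilon,L_0$ and, for stable dynamics, $\bar f$ and $R$, but not the sets $P_w$; arithmetic operations, $\exp$, $\ln$, square roots, comparisons, memory and index operations count as one step each, and in the Beckmann model so does each evaluation of $\sigma_e$ or $\sigma_e^*$ at a number and each solution of a scalar problem $a\sigma_e^*(s)+cs+\frac12(s-\bar t_e)^2\to\min_s$. With $L_0=Hd/\gamma$, respectively $L_0=Hd^2/\varepsilon$, the logarithm vanishes, and the step counts are $O\bigl(SHn\sqrt{Hd\bar R^2/(\gamma\varepsilon)}\bigr)$ and $O\bigl(Sn\ln n\cdot Hd^2\bar R^2/\varepsilon^2\bigr)$ as soon as the expression $\sqrt{Hd\bar R^2/(\gamma\varepsilon)}$, respectively $Hd^2\bar R^2/\varepsilon^2$, is at least $1$. The bounds do not depend on the number of paths. -/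

import Mathlib

open scoped BigOperators

noncomputable section

/-! ## A real random access machine with a step count

Memory consists of named two-dimensional arrays of natural numbers and of real numbers.  Every
arithmetic operation on reals (`+ - * /`, `exp`, `log`, `sqrt`), every addition and subtraction of
indices, every constant, memory access, comparison, assignment and oracle call counts as one step.
A program is a finite text; it does not depend on the data on which it is run. -/

namespace RealRAM

/-- Memory contents: `nat a i j` and `real a i j` are the entries `(i, j)` of the `a`-th arrays. -/
structure Mem where
  nat : ℕ → ℕ → ℕ → ℕ
  real : ℕ → ℕ → ℕ → ℝ

/-- Scalar functions attached to an edge (given by its number) that a program may call: the edge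
cost `sigma`, its conjugate `sigmaStar`, and the solution `prox` of a scalar auxiliary problem. -/
structure Oracles where
  sigma : ℕ → ℝ → ℝ
  sigmaStar : ℕ → ℝ → ℝ
  prox : ℕ → ℝ → ℝ → ℝ

/-- No oracle: all calls return `0`. -/
def Oracles.none : Oracles := ⟨fun _ _ => 0, fun _ _ => 0, fun _ _ _ => 0⟩

/-- Index expressions. -/
inductive NExp where
  | const (c : ℕ)
  | get (a : ℕ) (i j : NExp)
  | add (x y : NExp)
  | sub (x y : NExp)

/-- Real expressions. -/
inductive RExp where
  | const (c : ℕ)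
  | get (a : ℕ) (i j : NExp)
  | add (x y : RExp)
  | sub (x y : RExp)
  | mul (x y : RExp)
  | div (x y : RExp)
  | exp (x : RExp)
  | log (x : RExp)
  | sqrt (x : RExp)
  | sigma (e : NExp) (x : RExp)
  | sigmaStar (e : NExp) (x : RExp)
  | prox (e : NExp) (x y : RExp)

/-- Comparisons. -/
inductive BExp where
  | ltN (x y : NExp)
  | ltR (x y : RExp)

/-- Programs. -/
inductive Cmd where
  | skip
  | setN (a : ℕ) (i j : NExp) (v : NExp)
  | setR (a : ℕ) (i j : NExp) (v : RExp)
  | seq (c₁ c₂ : Cmd)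
  | ite (b : BExp) (c₁ c₂ : Cmd)
  | loop (b : BExp) (c : Cmd)

def NExp.eval (s : Mem) : NExp → ℕ
  | .const c => c
  | .get a i j => s.nat a (i.eval s) (j.eval s)
  | .add x y => x.eval s + y.eval s
  | .sub x y => x.eval s - y.eval s

def NExp.cost : NExp → ℕ
  | .const _ => 1
  | .get _ i j => 1 + i.cost + j.cost
  | .add x y => 1 + x.cost + y.cost
  | .sub x y => 1 + x.cost + y.cost

def RExp.eval (O : Oracles) (s : Mem) : RExp → ℝ
  | .const c => c
  | .get a i j => s.real a (i.eval s) (j.eval s)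
  | .add x y => x.eval O s + y.eval O s
  | .sub x y => x.eval O s - y.eval O s
  | .mul x y => x.eval O s * y.eval O s
  | .div x y => x.eval O s / y.eval O s
  | .exp x => Real.exp (x.eval O s)
  | .log x => Real.log (x.eval O s)
  | .sqrt x => Real.sqrt (x.eval O s)
  | .sigma e x => O.sigma (e.eval s) (x.eval O s)
  | .sigmaStar e x => O.sigmaStar (e.eval s) (x.eval O s)
  | .prox e x y => O.prox (e.eval s) (x.eval O s) (y.eval O s)

def RExp.cost : RExp → ℕ
  | .const _ => 1
  | .get _ i j => 1 + i.cost + j.cost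
  | .add x y => 1 + x.cost + y.cost
  | .sub x y => 1 + x.cost + y.cost
  | .mul x y => 1 + x.cost + y.cost
  | .div x y => 1 + x.cost + y.cost
  | .exp x => 1 + x.cost
  | .log x => 1 + x.cost
  | .sqrt x => 1 + x.cost
  | .sigma e x => 1 + e.cost + x.cost
  | .sigmaStar e x => 1 + e.cost + x.cost
  | .prox e x y => 1 + e.cost + x.cost + y.cost

def BExp.eval (O : Oracles) (s : Mem) : BExp → Prop
  | .ltN x y => x.eval s < y.eval s
  | .ltR x y => x.eval O s < y.eval O s

def BExp.cost : BExp → ℕ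
  | .ltN x y => 1 + x.cost + y.cost
  | .ltR x y => 1 + x.cost + y.cost

def Mem.setN (s : Mem) (a i j v : ℕ) : Mem :=
  { s with nat := fun a' i' j' => if a' = a ∧ i' = i ∧ j' = j then v else s.nat a' i' j' }

def Mem.setR (s : Mem) (a i j : ℕ) (v : ℝ) : Mem :=
  { s with real := fun a' i' j' => if a' = a ∧ i' = i ∧ j' = j then v else s.real a' i' j' }

/-- `Exec O c s s' k`: started in memory `s`, the program `c` halts in memory `s'` after exactly
`k` steps. -/
inductive Exec (O : Oracles) : Cmd → Mem → Mem → ℕ → Prop where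
  | skip (s : Mem) : Exec O .skip s s 1
  | setN (s : Mem) (a : ℕ) (i j v : NExp) :
      Exec O (.setN a i j v) s (s.setN a (i.eval s) (j.eval s) (v.eval s))
        (1 + i.cost + j.cost + v.cost)
  | setR (s : Mem) (a : ℕ) (i j : NExp) (v : RExp) :
      Exec O (.setR a i j v) s (s.setR a (i.eval s) (j.eval s) (v.eval O s))
        (1 + i.cost + j.cost + v.cost)
  | seq {c₁ c₂ : Cmd} {s s' s'' : Mem} {k₁ k₂ : ℕ} :
      Exec O c₁ s s' k₁ → Exec O c₂ s' s'' k₂ → Exec O (.seq c₁ c₂) s s'' (k₁ + k₂)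
  | iteTrue {b : BExp} {c₁ c₂ : Cmd} {s s' : Mem} {k : ℕ} :
      b.eval O s → Exec O c₁ s s' k → Exec O (.ite b c₁ c₂) s s' (b.cost + k)
  | iteFalse {b : BExp} {c₁ c₂ : Cmd} {s s' : Mem} {k : ℕ} :
      ¬ b.eval O s → Exec O c₂ s s' k → Exec O (.ite b c₁ c₂) s s' (b.cost + k)
  | loopDone {b : BExp} {c : Cmd} {s : Mem} :
      ¬ b.eval O s → Exec O (.loop b c) s s b.cost
  | loopStep {b : BExp} {c : Cmd} {s s' s'' : Mem} {k₁ k₂ : ℕ} :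
      b.eval O s → Exec O c s s' k₁ → Exec O (.loop b c) s' s'' k₂ →
        Exec O (.loop b c) s s'' (b.cost + k₁ + k₂)

end RealRAM

namespace Traffic

open RealRAM

/-- Vectors indexed by the edges, with the Euclidean norm. -/
abbrev Vec (n : ℕ) := EuclideanSpace ℝ (Fin n)

/-! ## The transport network -/

/-- `IsWalk src tgt i j p`: the list of edges `p` leads from the vertex `i` to the vertex `j`,
respecting orientations. -/
def IsWalk {nV n : ℕ} (src tgt : Fin n → Fin nV) (i j : Fin nV) : List (Fin n) → Prop
  | [] => i = j
  | e :: p => src e = i ∧ IsWalk src tgt (tgt e) j p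

/-- A directed graph with `nV` vertices and `n` edges, together with `m` origin-destination pairs
`w`, the demands `d_w`, and the finite nonempty sets `P_w` of admissible paths. -/
structure Network (nV n m : ℕ) where
  src : Fin n → Fin nV
  tgt : Fin n → Fin nV
  orig : Fin m → Fin nV
  dest : Fin m → Fin nV
  orig_ne_dest : ∀ w, orig w ≠ dest w
  pair_injective : Function.Injective fun w => (orig w, dest w)
  demand : Fin m → ℝ
  demand_pos : ∀ w, 0 < demand w
  paths : Fin m → Finset (List (Fin n))
  paths_nonempty : ∀ w, (paths w).Nonempty
  isWalk : ∀ w, ∀ p ∈ paths w, IsWalk src tgt (orig w) (dest w) p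

namespace Network

variable {nV n m : ℕ} (net : Network nV n m)

/-- The admissible paths are all the walks with at most `ℓ` edges, and `ℓ` is the maximal number
of edges of an admissible path. -/
def AllWalks (ℓ : ℕ) : Prop :=
  (∀ w p, p ∈ net.paths w ↔
    IsWalk net.src net.tgt (net.orig w) (net.dest w) p ∧ p.length ≤ ℓ) ∧
  ∃ w, ∃ p ∈ net.paths w, p.length = ℓ

/-- Every walk from an origin to its destination that visits no vertex twice is admissible. -/
def ContainsSimplePaths : Prop :=
  ∀ w p, IsWalk net.src net.tgt (net.orig w) (net.dest w) p →
    (net.orig w :: p.map net.tgt).Nodup → p ∈ net.paths w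

/-- The incidence matrix `Θ`: how often the path `p` uses the edge `e` (`0` or `1` if `p` does not
repeat edges). -/
def theta (e : Fin n) (p : List (Fin n)) : ℝ := (p.count e : ℝ)

/-- `S`, the number of origins. -/
def S : ℕ := (Finset.univ.image net.orig).card

/-- `H = max_p ‖Θ^(p)‖₂²`; for paths without repeated edges, the maximal number of edges. -/
def H : ℕ :=
  Finset.univ.sup fun w => (net.paths w).sup fun p => ∑ e : Fin n, (p.count e) ^ 2

/-- The total demand `d`. -/
def d : ℝ := ∑ w, net.demand w

/-- Length of the path `p` when the edges have weights `t`. -/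
def pathCost (t : Vec n) (p : List (Fin n)) : ℝ := ∑ e, theta e p * t e

/-- The set `X` of path flows. -/
def X : Set (Fin m → List (Fin n) → ℝ) :=
  {x | ∀ w, (∀ p ∈ net.paths w, 0 ≤ x w p) ∧ ∑ p ∈ net.paths w, x w p = net.demand w}

/-- The edge flow `Θ x`. -/
def flow (x : Fin m → List (Fin n) → ℝ) : Vec n :=
  WithLp.toLp 2 fun e => ∑ w, ∑ p ∈ net.paths w, theta e p * x w p

/-- `∑_w ∑_p x_p ln (x_p / d_w)`. -/
def entropy (x : Fin m → List (Fin n) → ℝ) : ℝ :=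
  ∑ w, ∑ p ∈ net.paths w, x w p * Real.log (x w p / net.demand w)

/-- The function `γ ψ(t / γ) = γ ∑_w d_w ln ∑_{p ∈ P_w} exp (-g_p(t) / γ)`, and for `γ = 0` its
limit as `γ → 0+`, namely minus the demand-weighted sum of the shortest path lengths. -/
def potential (γ : ℝ) (t : Vec n) : ℝ :=
  if γ = 0 then
    -∑ w, net.demand w * (net.paths w).inf' (net.paths_nonempty w) (pathCost t)
  else
    γ * ∑ w, net.demand w * Real.log (∑ p ∈ net.paths w, Real.exp (-(pathCost t p) / γ))

/-- The logit (Gibbs) distribution of the demands over the paths (used for `γ > 0`). -/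
def gibbs (γ : ℝ) (t : Vec n) (w : Fin m) (p : List (Fin n)) : ℝ :=
  net.demand w * (Real.exp (-(pathCost t p) / γ) /
    ∑ q ∈ net.paths w, Real.exp (-(pathCost t q) / γ))

end Network

/-- `g` is a subgradient of `f` at `t`. -/
def IsSubgradientAt {n : ℕ} (f : Vec n → ℝ) (g t : Vec n) : Prop :=
  ∀ s, f t + inner ℝ g (s - t) ≤ f s

/-! ## Composite convex problems and the universal method of similar triangles -/

/-- The problem `Φ(t) + ∑_e h_e(t_e) → min` over `t_e ∈ dom e`, with a (sub)gradient map `grad` of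
`Φ` and the starting point `start`. -/
structure Composite (n : ℕ) where
  Φ : Vec n → ℝ
  grad : Vec n → Vec n
  start : Vec n
  dom : Fin n → Set ℝ
  h : Fin n → ℝ → ℝ

namespace Composite

variable {n : ℕ} (P : Composite n)

/-- The feasible set. -/
def Q : Set (Vec n) := {t | ∀ e, t e ∈ P.dom e}

/-- The objective `F = Φ + h`. -/
def F (t : Vec n) : ℝ := P.Φ t + ∑ e, P.h e (t e)

/-- `Φ(y) + ⟨∇Φ(y), x - y⟩ + h(x)`. -/
def lin (y x : Vec n) : ℝ := P.Φ y + inner ℝ (P.grad y) (x - y) + ∑ e, P.h e (x e)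

/-- `u` is a minimizer of `φ` over the feasible set. -/
def IsArgmin (φ : Vec n → ℝ) (u : Vec n) : Prop := u ∈ P.Q ∧ ∀ x ∈ P.Q, φ u ≤ φ x

end Composite

/-- The quantities `α, A, y, u, t` of one iteration. -/
structure Iterate (n : ℕ) where
  α : ℝ
  A : ℝ
  y : Vec n
  u : Vec n
  t : Vec n

namespace Composite

variable {n : ℕ} (P : Composite n)

/-- The function `φ_k` built from the iterates `z 0, …, z k`. -/
def phi (z : ℕ → Iterate n) (k : ℕ) (x : Vec n) : ℝ :=
  1 / 2 * ‖x - P.start‖ ^ 2 + ∑ i ∈ Finset.range (k + 1), (z i).α * P.lin (z i).y x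

/-- The candidate for iteration `0` computed with the constant `L`. -/
def InitTrial (L : ℝ) (c : Iterate n) : Prop :=
  c.α = 1 / L ∧ c.A = c.α ∧ c.y = P.start ∧
  P.IsArgmin (fun x => 1 / 2 * ‖x - P.start‖ ^ 2 + c.α * P.lin c.y x) c.u ∧ c.t = c.u

/-- The candidate for iteration `k + 1` computed with the constant `L`. -/
def StepTrial (z : ℕ → Iterate n) (k : ℕ) (L : ℝ) (c : Iterate n) : Prop :=
  c.α = 1 / (2 * L) + Real.sqrt (1 / (4 * L ^ 2) + (z k).A / L) ∧
  c.A = (z k).A + c.α ∧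
  c.y = (1 / c.A) • (c.α • (z k).u + (z k).A • (z k).t) ∧
  P.IsArgmin (fun x => P.phi z k x + c.α * P.lin c.y x) c.u ∧
  c.t = (1 / c.A) • (c.α • c.u + (z k).A • (z k).t)

/-- The inequality that a candidate computed with `L` must satisfy in order to be accepted. -/
def Accepts (ε L : ℝ) (c : Iterate n) : Prop :=
  P.Φ c.t ≤ P.Φ c.y + inner ℝ (P.grad c.y) (c.t - c.y) + L / 2 * ‖c.t - c.y‖ ^ 2
    + c.α / (2 * c.A) * ε

/-- A run (without stopping criterion) of the universal method of similar triangles with the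
initial constant `L₀` and the accuracy `ε`: `z k` are the accepted quantities of iteration `k`,
`L k` the accepted constant and `j k` the number of doublings of the constant that were made. -/
structure Run (L₀ ε : ℝ) where
  z : ℕ → Iterate n
  L : ℕ → ℝ
  j : ℕ → ℕ
  init_L : L 0 = 2 ^ j 0 * L₀
  init_trial : P.InitTrial (L 0) (z 0)
  init_accepts : P.Accepts ε (L 0) (z 0)
  init_rejects : ∀ i < j 0, ∀ c, P.InitTrial (2 ^ i * L₀) c → ¬ P.Accepts ε (2 ^ i * L₀) c
  step_L : ∀ k, L (k + 1) = 2 ^ j (k + 1) * (L k / 2)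
  step_trial : ∀ k, P.StepTrial z k (L (k + 1)) (z (k + 1))
  step_accepts : ∀ k, P.Accepts ε (L (k + 1)) (z (k + 1))
  step_rejects : ∀ k, ∀ i < j (k + 1), ∀ c, P.StepTrial z k (2 ^ i * (L k / 2)) c →
    ¬ P.Accepts ε (2 ^ i * (L k / 2)) c

namespace Run

variable {P} {L₀ ε : ℝ} (run : P.Run L₀ ε)

/-- The averaged edge flow `(1 / A_N) ∑_{k ≤ N} α_k f^k`, where `f^k = -∇Φ(y^k)`. -/
def avgFlow (N : ℕ) : Vec n :=
  (1 / (run.z N).A) • ∑ k ∈ Finset.range (N + 1), (run.z k).α • (-(P.grad (run.z k).y))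

/-- The averaged path flow `(1 / A_N) ∑_{k ≤ N} α_k x^k`, where `x^k` is the logit distribution
at `y^k`. -/
def avgPathFlow {nV m : ℕ} (net : Network nV n m) (γ : ℝ) (N : ℕ) (w : Fin m)
    (p : List (Fin n)) : ℝ :=
  1 / (run.z N).A * ∑ k ∈ Finset.range (N + 1), (run.z k).α * net.gibbs γ (run.z k).y w p

/-- `(1 / A_N) ∑_{k ≤ N} α_k ∑_w ∑_p x^k_p ln (x^k_p / d_w)`. -/
def avgEntropy {nV m : ℕ} (net : Network nV n m) (γ : ℝ) (N : ℕ) : ℝ :=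
  1 / (run.z N).A *
    ∑ k ∈ Finset.range (N + 1), (run.z k).α * net.entropy (net.gibbs γ (run.z k).y)

/-- The number of candidates computed in the iterations `0, …, N`. -/
def trials (N : ℕ) : ℕ := ∑ k ∈ Finset.range (N + 1), (run.j k + 1)

end Run

end Composite

/-! ## The Beckmann model -/

/-- Travel times `τ_e` on the edges: continuous and nondecreasing functions of the flow
`f_e ≥ 0` with `τ_e(0) ≥ 0`.  The functions `t̄_e (1 + ρ (f_e / f̄_e)^(1/μ))`, `μ > 0`, are of this kind. -/
structure Beckmann (n : ℕ) where
  τ : Fin n → ℝ → ℝ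
  continuousOn : ∀ e, ContinuousOn (τ e) (Set.Ici 0)
  monotoneOn : ∀ e, MonotoneOn (τ e) (Set.Ici 0)
  nonneg : ∀ e, 0 ≤ τ e 0

namespace Beckmann

variable {nV n m : ℕ} (B : Beckmann n) (net : Network nV n m) (γ : ℝ)

/-- The free travel times `t̄_e = τ_e(0)`. -/
def freeTime : Vec n := WithLp.toLp 2 fun e => B.τ e 0

/-- `σ_e(f) = ∫₀^f τ_e(z) dz`. -/
def σ (e : Fin n) (f : ℝ) : ℝ := ∫ z in (0 : ℝ)..f, B.τ e z

/-- The conjugate function `σ_e^*(s) = sup_{f ≥ 0} (s f - σ_e(f))`, on the set `dom e`. -/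
def σStar (e : Fin n) (s : ℝ) : ℝ := sSup ((fun f => s * f - B.σ e f) '' Set.Ici 0)

/-- The set of the `s ≥ t̄_e` at which `σ_e^*` is finite. -/
def dom (e : Fin n) : Set ℝ :=
  {s | B.freeTime e ≤ s ∧ BddAbove ((fun f => s * f - B.σ e f) '' Set.Ici 0)}

/-- The solution of `a σ_e^*(s) + c s + (s - t̄_e)² / 2 → min` over `s ∈ dom e`. -/
def prox (e : Fin n) (a c : ℝ) : ℝ :=
  Classical.epsilon fun s => s ∈ B.dom e ∧ ∀ s' ∈ B.dom e,
    a * B.σStar e s + c * s + 1 / 2 * (s - B.freeTime e) ^ 2 ≤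
      a * B.σStar e s' + c * s' + 1 / 2 * (s' - B.freeTime e) ^ 2

/-- The scalar oracles of the model. -/
def oracles : Oracles where
  sigma e x := if he : e < n then B.σ ⟨e, he⟩ x else 0
  sigmaStar e x := if he : e < n then B.σStar ⟨e, he⟩ x else 0
  prox e a c := if he : e < n then B.prox ⟨e, he⟩ a c else 0

/-- The primal objective `∑_e σ_e(f_e) + γ ∑_w ∑_p x_p ln (x_p / d_w)`, `f = Θ x`. -/
def primal (x : Fin m → List (Fin n) → ℝ) : ℝ :=
  ∑ e, B.σ e (net.flow x e) + γ * net.entropy x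

/-- The dual problem `γ ψ(t / γ) + ∑_e σ_e^*(t_e) → min`, with the (sub)gradient map `G` of the
first term and the starting point `t̄`. -/
def dual (G : Vec n → Vec n) : Composite n where
  Φ := net.potential γ
  grad := G
  start := B.freeTime
  dom := B.dom
  h := B.σStar

variable {G : Vec n → Vec n} {L₀ ε : ℝ} (run : (B.dual net γ G).Run L₀ ε)

/-- The computable upper bound on the duality gap after iteration `N`. -/
def gap (N : ℕ) : ℝ :=
  (B.dual net γ G).F (run.z N).t +
    (∑ e, B.σ e (run.avgFlow N e) + γ * run.avgEntropy net γ N)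

/-- `N` is the first iteration after which the stopping criterion holds. -/
def StopsAt (N : ℕ) : Prop := IsLeast {k | B.gap net γ run k < ε} N

/-- `R̃ = (½ ∑_e (τ_e(f̄_e^k) - t̄_e)²)^{1/2}`, computed from the averaged flow of iteration `k`. -/
def Rtilde (k : ℕ) : ℝ :=
  Real.sqrt (1 / 2 * ∑ e, (B.τ e (run.avgFlow k e) - B.freeTime e) ^ 2)

/-- Accuracy `ε` after iteration `N`: the averaged flow comes from a path flow that is admissible
and `ε`-optimal for the primal problem (for `γ > 0`, from the averaged path flow), and `t^N` is
`ε`-optimal for the dual problem. -/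
def Accurate (N : ℕ) : Prop :=
  (∃ x ∈ net.X, net.flow x = run.avgFlow N ∧
    (0 < γ → ∀ w, ∀ p ∈ net.paths w, x w p = run.avgPathFlow net γ N w p) ∧
    ∀ x' ∈ net.X, B.primal net γ x ≤ B.primal net γ x' + ε) ∧
  (run.z N).t ∈ (B.dual net γ G).Q ∧
  ∀ t ∈ (B.dual net γ G).Q, (B.dual net γ G).F (run.z N).t ≤ (B.dual net γ G).F t + ε

end Beckmann

/-! ## The model of stable dynamics -/

/-- Free travel times `t̄_e ≥ 0` and capacities `f̄_e > 0` of the edges. -/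
structure StableDynamics (n : ℕ) where
  freeTime : Vec n
  cap : Vec n
  freeTime_nonneg : ∀ e, 0 ≤ freeTime e
  cap_pos : ∀ e, 0 < cap e

namespace StableDynamics

variable {nV n m : ℕ} (D : StableDynamics n) (net : Network nV n m) (γ : ℝ)

/-- The primal objective `∑_e f_e t̄_e + γ ∑_w ∑_p x_p ln (x_p / d_w)`, `f = Θ x`. -/
def primal (x : Fin m → List (Fin n) → ℝ) : ℝ :=
  ∑ e, net.flow x e * D.freeTime e + γ * net.entropy x

/-- The dual problem `γ ψ(t / γ) + ⟨f̄, t - t̄⟩ → min` over `t ≥ t̄`, with the (sub)gradient map `G`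
of the first term and the starting point `t̄`. -/
def dual (G : Vec n → Vec n) : Composite n where
  Φ := net.potential γ
  grad := G
  start := D.freeTime
  dom := fun e => Set.Ici (D.freeTime e)
  h := fun e s => D.cap e * (s - D.freeTime e)

/-- `t` solves the dual problem (whose objective does not involve the gradient map, here `0`). -/
def IsDualSolution (t : Vec n) : Prop :=
  (D.dual net γ 0).IsArgmin (D.dual net γ 0).F t

/-- `‖(f - f̄)_+‖₂`. -/
def excess (f : Vec n) : ℝ := Real.sqrt (∑ e, (max (f e - D.cap e) 0) ^ 2)

variable {G : Vec n → Vec n} {L₀ ε : ℝ} (R : ℝ) (run : (D.dual net γ G).Run L₀ ε)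

/-- The quantity that is compared with `ε` in the stopping criterion after iteration `N`. -/
def gap (N : ℕ) : ℝ :=
  (D.dual net γ G).F (run.z N).t + ∑ e, run.avgFlow N e * D.freeTime e +
    γ * run.avgEntropy net γ N + 3 * R * D.excess (run.avgFlow N)

/-- `N` is the first iteration after which the stopping criterion holds. -/
def StopsAt (N : ℕ) : Prop := IsLeast {k | D.gap net γ R run k < ε} N

/-- Accuracy `ε` after iteration `N`: the averaged flow comes from a path flow in `X` (for `γ > 0`,
from the averaged path flow), whose objective value exceeds that of no admissible path flow by
more than `ε`, and which violates the capacity constraints by at most `ε / R` in the Euclidean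
norm; and `t^N` is `ε`-optimal for the dual problem. -/
def Accurate (N : ℕ) : Prop :=
  (∃ x ∈ net.X, net.flow x = run.avgFlow N ∧
    (0 < γ → ∀ w, ∀ p ∈ net.paths w, x w p = run.avgPathFlow net γ N w p) ∧
    (∀ x' ∈ net.X, (∀ e, net.flow x' e ≤ D.cap e) →
      D.primal net γ x ≤ D.primal net γ x' + ε) ∧
    R * D.excess (net.flow x) ≤ ε) ∧
  (run.z N).t ∈ (D.dual net γ G).Q ∧
  ∀ t ∈ (D.dual net γ G).Q, (D.dual net γ G).F (run.z N).t ≤ (D.dual net γ G).F t + ε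

end StableDynamics

/-! ## Input, output and bounds -/

/-- The initial memory: the graph, the origin-destination pairs and the number `ℓ` in the arrays
of indices; `γ, ε, L₀, R`, the demands, the free travel times and the capacities in the arrays of
reals; zeros elsewhere.  The sets of paths are not part of the input. -/
def input {nV n m : ℕ} (net : Network nV n m) (ℓ : ℕ) (γ ε L₀ R : ℝ) (freeTime cap : Vec n) :
    Mem where
  nat a i k :=
    match a, i with
    | 0, 0 => if k = 0 then n else if k = 1 then m else if k = 2 then ℓ else 0
    | 1, 0 => if hk : k < n then (net.src ⟨k, hk⟩ : ℕ) else 0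
    | 2, 0 => if hk : k < n then (net.tgt ⟨k, hk⟩ : ℕ) else 0
    | 3, 0 => if hk : k < m then (net.orig ⟨k, hk⟩ : ℕ) else 0
    | 4, 0 => if hk : k < m then (net.dest ⟨k, hk⟩ : ℕ) else 0
    | _, _ => 0
  real a i k :=
    match a, i with
    | 0, 0 => if k = 0 then γ else if k = 1 then ε else if k = 2 then L₀ else
        if k = 3 then R else 0
    | 1, 0 => if hk : k < m then net.demand ⟨k, hk⟩ else 0
    | 2, 0 => if hk : k < n then freeTime ⟨k, hk⟩ else 0
    | 3, 0 => if hk : k < n then cap ⟨k, hk⟩ else 0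
    | _, _ => 0

/-- The final memory contains the vectors `t` and `f` in the real arrays `4` and `5`. -/
def Outputs {n : ℕ} (s : Mem) (t f : Vec n) : Prop :=
  ∀ e : Fin n, s.real 4 0 e = t e ∧ s.real 5 0 e = f e

/-- The bound on the number of candidates for `γ > 0`, up to a constant factor. -/
def smoothCount {nV n m : ℕ} (net : Network nV n m) (γ ε L₀ Rbar : ℝ) : ℝ :=
  1 + Real.sqrt (net.H * net.d * Rbar ^ 2 / (γ * ε)) +
    Real.logb 2 (net.H * net.d / (γ * L₀))

/-- The bound on the number of candidates for `γ = 0`, up to a constant factor. -/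
def nonsmoothCount {nV n m : ℕ} (net : Network nV n m) (ε L₀ Rbar : ℝ) : ℝ :=
  1 + net.H * net.d ^ 2 * Rbar ^ 2 / ε ^ 2 + Real.logb 2 (net.H * net.d ^ 2 / (ε * L₀))

end Traffic

end

open RealRAM Traffic

/-! The method is an accelerated composite gradient method. Its convergence rests on three facts.
(a) Every model function `φ_k` is, up to a constant, a sum over the edges of convex scalar functions
plus the square `½‖x - t̄‖²`. It therefore grows at least like `½‖x - u^k‖²` around its minimizer
`u^k`. (b) The weights satisfy `A_k = L α_k²`, and `t^k - y^k` is parallel to the difference of two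
consecutive minimizers (the similar triangles). Hence the quadratic term of the acceptance test is
paid exactly by that growth. (c) The error terms `α_k ε / (2 A_k)` add up to `ε/2` after averaging.
Together they give `A_N F(t^N) - A_N ε/2 ≤ min φ_N` (`Composite.Regular.estimate_step`,
`Composite.Run.estimate`).

The estimate is primal-dual. The constant term `Φ(y) - ⟨∇Φ(y), y⟩` of a linearization is `-γ Ent` of
the logit flow at `y`, and it is `0` for `γ = 0`. So the average of the linearizations is a
Lagrangian at the averaged flow `f̄`, and for every `x ∈ Q` `F(t^N) + 𝓔_N ≤ ‖x - t̄‖² / (2 A_N) -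
⟨f̄, x⟩ + h(x) + ε/2` (`Composite.IsTraffic.gap_le`). In the Beckmann model the choice `x = τ(f̄)`
turns Fenchel's inequality into an equality and bounds the tested quantity by `R̃² / A_N + ε/2`. For
stable dynamics the choice `x = t̄ + A_N (f̄ - cap)_+` minimizes the right-hand side and leads to `9
R² / (2 A_N) + ε/2`. The criterion thus holds once `A_N` exceeds a multiple of `R̄² / ε`.
Conversely, weak duality and Jensen's inequality for the entropy turn the criterion into the
accuracy claims.

It remains to see how fast `A_N` grows. For `γ > 0` a Hoeffding argument shows that `Φ` is smooth
with constant `4Hd/γ`, so the accepted constants stay below twice that and `A_N` grows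
quadratically. For `γ = 0` the subgradients are bounded by `d√H`. With `M = 2d√H`, a candidate with
`α M² ≤ ε` is always accepted, so every weight is at least `ε / (2M²)` and `A_N` grows linearly. The
number of candidates is `2N + 1 + log₂(L_N / L₀)`, because each iteration starts from half the
previous constant.

For the step count, strong convexity determines every candidate uniquely, so a program that solves
the scalar problems edge by edge follows a run exactly. A candidate costs `O(n)` steps and two
evaluations of `Φ` and a (sub)gradient. For `γ > 0` such an evaluation uses, for each origin, one
forward recursion over walks with at most `ℓ ≤ H` edges and one backward recursion that serves all
destinations at once (`Network.AllWalks.flow_eq`). This takes `O(S ℓ n)` steps. For `γ = 0` it uses,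
for each origin, Dijkstra's algorithm with a tournament tree over the edges, followed by a sweep of
the tree from the leaves to the root (`Dijkstra.reaches_tree`). This takes `O(S n ln n)` steps. -/

open RealRAM Traffic
-- Separable auxiliary problems and one step of the estimating sequence
namespace Traffic
namespace Composite

variable {n : ℕ} (P : Composite n)

/-- The scalar auxiliary objective attached to an edge. -/
noncomputable def scalarObj (e : Fin n) (a c s : ℝ) : ℝ :=
  a * P.h e s + c * s + 1 / 2 * (s - P.start e) ^ 2

/-- `s` minimizes the scalar auxiliary objective. -/
def IsProx (e : Fin n) (a c s : ℝ) : Prop :=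
  s ∈ P.dom e ∧ ∀ s' ∈ P.dom e, P.scalarObj e a c s ≤ P.scalarObj e a c s'

/-- The separable auxiliary objective. -/
noncomputable def sepObj (a : ℝ) (c x : Vec n) : ℝ := ∑ e, P.scalarObj e a (c e) (x e)

/-- The properties of a composite problem used in the analysis of the method. -/
structure Regular : Prop where
  start_mem : P.start ∈ P.Q
  convex_h : ∀ e, ConvexOn ℝ (P.dom e) (P.h e)
  subgrad : ∀ y ∈ P.Q, ∀ x ∈ P.Q, P.Φ y + inner ℝ (P.grad y) (x - y) ≤ P.Φ x
  exists_isProx : ∀ e a c, 0 < a → ∃ s, P.IsProx e a c s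

theorem inner_eq_sum (x y : Vec n) : inner ℝ x y = ∑ e, x e * y e := by
  simp [PiLp.inner_apply, mul_comm]

theorem norm_sq_eq_sum (x : Vec n) : ‖x‖ ^ 2 = ∑ e, (x e) ^ 2 := by
  rw [EuclideanSpace.norm_eq, Real.sq_sqrt (by positivity)]; simp

variable {P}

theorem Regular.convex_Q (hP : P.Regular) : Convex ℝ P.Q := by
  intro x hx y hy a b ha hb hab e
  exact (hP.convex_h e).1 (hx e) (hy e) ha hb hab

/-- On the segment from the minimizer `s` to `s'` the square lies below its chord by `½ θ (1 - θ)
(s' - s)²`, and the other terms are convex. Comparison with the minimum and division by `θ` give the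
claim with the factor `1 - θ`, which can be made as close to `1` as needed. -/
theorem Regular.prox_growth (hP : P.Regular) {e : Fin n} {a c s : ℝ} (ha : 0 ≤ a)
    (hs : P.IsProx e a c s) {s' : ℝ} (hs' : s' ∈ P.dom e) :
    P.scalarObj e a c s + 1 / 2 * (s' - s) ^ 2 ≤ P.scalarObj e a c s' := by
  have key : ∀ θ : ℝ, 0 < θ → θ < 1 →
      (1 - θ) * (1 / 2 * (s' - s) ^ 2) ≤ P.scalarObj e a c s' - P.scalarObj e a c s := by
    intro θ h0 h1
    have hm := (hP.convex_h e).1 hs.1 hs' (by linarith : 0 ≤ 1 - θ) h0.le (by ring)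
    have hc := (hP.convex_h e).2 hs.1 hs' (by linarith : 0 ≤ 1 - θ) h0.le (by ring)
    have hmin := hs.2 _ hm
    simp only [smul_eq_mul] at hm hc hmin
    have hc' := mul_le_mul_of_nonneg_left hc ha
    have : θ * ((1 - θ) * (1 / 2 * (s' - s) ^ 2)) ≤
        θ * (P.scalarObj e a c s' - P.scalarObj e a c s) := by
      simp only [scalarObj] at *
      nlinarith
    exact le_of_mul_le_mul_left this h0
  by_contra hlt
  push Not at hlt
  set D := 1 / 2 * (s' - s) ^ 2
  set Δ := P.scalarObj e a c s' - P.scalarObj e a c s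
  have hD : 0 ≤ D := by positivity
  have hΔ : 0 ≤ Δ := sub_nonneg.2 (hs.2 _ hs')
  have hDΔ : Δ < D := by simp only [Δ]; linarith
  have hDpos : 0 < D := by linarith
  -- This `θ` replaces the limit `θ → 0`: it makes `(1 - θ) D` the midpoint of `D` and `Δ`, which
  -- exceeds `Δ`.
  have hθ := key ((D - Δ) / (2 * D)) (by apply div_pos <;> linarith)
    (by rw [div_lt_one (by linarith)]; linarith)
  have : (1 - (D - Δ) / (2 * D)) * D = (D + Δ) / 2 := by field_simp; ring
  linarith

theorem Regular.sepObj_growth (hP : P.Regular) {a : ℝ} (ha : 0 ≤ a) {c u : Vec n}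
    (hu : ∀ e, P.IsProx e a (c e) (u e)) {x : Vec n} (hx : x ∈ P.Q) :
    P.sepObj a c u + 1 / 2 * ‖x - u‖ ^ 2 ≤ P.sepObj a c x := by
  rw [norm_sq_eq_sum, Finset.mul_sum, sepObj, sepObj, ← Finset.sum_add_distrib]
  exact Finset.sum_le_sum fun e _ => by simpa using hP.prox_growth ha (hu e) (hx e)

theorem Regular.isArgmin_of_isProx (hP : P.Regular) {a : ℝ} (ha : 0 ≤ a) {c u : Vec n}
    (hu : ∀ e, P.IsProx e a (c e) (u e)) : P.IsArgmin (P.sepObj a c) u := by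
  refine ⟨fun e => (hu e).1, fun x hx => ?_⟩
  have := hP.sepObj_growth ha hu hx
  nlinarith [sq_nonneg ‖x - u‖]

theorem Regular.exists_prox (hP : P.Regular) {a : ℝ} (ha : 0 < a) (c : Vec n) :
    ∃ u : Vec n, ∀ e, P.IsProx e a (c e) (u e) := by
  choose u hu using fun e => hP.exists_isProx e a (c e) ha
  exact ⟨WithLp.toLp 2 u, hu⟩

theorem Regular.eq_of_isArgmin (hP : P.Regular) {a : ℝ} (ha : 0 < a) {c u v : Vec n}
    (hu : ∀ e, P.IsProx e a (c e) (u e)) (hv : P.IsArgmin (P.sepObj a c) v) : v = u := by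
  have h1 := hP.sepObj_growth ha.le hu hv.1
  have h2 := hv.2 u fun e => (hu e).1
  have : ‖v - u‖ ^ 2 ≤ 0 := by linarith
  have : ‖v - u‖ = 0 := by nlinarith [norm_nonneg (v - u)]
  exact sub_eq_zero.1 (norm_eq_zero.1 this)

/-- All model functions have this shape: adding a linearization changes only the constant, the
coefficient of `h` and the linear term. -/
theorem Regular.isArgmin_growth (hP : P.Regular) {a : ℝ} (ha : 0 < a) {c u : Vec n} {φ : Vec n → ℝ}
    {κ : ℝ} (hφ : ∀ x, φ x = κ + P.sepObj a c x) (hu : P.IsArgmin φ u) {x : Vec n} (hx : x ∈ P.Q) :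
    φ u + 1 / 2 * ‖x - u‖ ^ 2 ≤ φ x := by
  have hu' : P.IsArgmin (P.sepObj a c) u :=
    ⟨hu.1, fun y hy => by have := hu.2 y hy; simp only [hφ] at this; linarith⟩
  obtain ⟨v, hv⟩ := hP.exists_prox ha c
  obtain rfl := hP.eq_of_isArgmin ha hv hu'
  have := hP.sepObj_growth ha.le hv hx
  rw [hφ, hφ]; linarith

variable (P)

/-- The candidate computed with the constant `L` from the accumulated weight `A`, the points
`u, t` and the model function `ψ`. -/
def Trial (A : ℝ) (u t : Vec n) (ψ : Vec n → ℝ) (L : ℝ) (c : Iterate n) : Prop :=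
  c.α = 1 / (2 * L) + Real.sqrt (1 / (4 * L ^ 2) + A / L) ∧
  c.A = A + c.α ∧
  c.y = (1 / c.A) • (c.α • u + A • t) ∧
  P.IsArgmin (fun x => ψ x + c.α * P.lin c.y x) c.u ∧
  c.t = (1 / c.A) • (c.α • c.u + A • t)

variable {P}

/-- With nothing accumulated (`A = 0`) the weight formula gives `1/(2L) + 1/(2L) = 1/L` and both
convex combinations collapse. Iteration `0` thus becomes an ordinary step and needs no separate
treatment. -/
theorem initTrial_iff {L : ℝ} (hL : 0 < L) (c : Iterate n) :
    P.InitTrial L c ↔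
      P.Trial 0 P.start P.start (fun x => 1 / 2 * ‖x - P.start‖ ^ 2) L c := by
  have h1 : 1 / (2 * L) + Real.sqrt (1 / (4 * L ^ 2) + 0 / L) = 1 / L := by
    rw [zero_div, add_zero, show 1 / (4 * L ^ 2) = (1 / (2 * L)) ^ 2 by field_simp; ring,
      Real.sqrt_sq (by positivity)]
    field_simp; ring
  unfold InitTrial Trial
  rw [h1]
  constructor
  · rintro ⟨ha, hA, hy, hu, ht⟩
    have hα : c.α ≠ 0 := by rw [ha]; positivity
    refine ⟨ha, by simp [hA], ?_, hu, ?_⟩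
    · rw [hA, hy, zero_smul, add_zero, smul_smul, one_div, inv_mul_cancel₀ hα, one_smul]
    · rw [hA, ht, zero_smul, add_zero, smul_smul, one_div, inv_mul_cancel₀ hα, one_smul]
  · rintro ⟨ha, hA, hy, hu, ht⟩
    have hα : c.α ≠ 0 := by rw [ha]; positivity
    rw [zero_add] at hA
    rw [hA, zero_smul, add_zero, smul_smul, one_div, inv_mul_cancel₀ hα, one_smul] at hy ht
    exact ⟨ha, hA, hy, hu, ht⟩

/-- The weight is the positive root of `L α² - α - A = 0`. -/
theorem weight_identity {A L : ℝ} (hA : 0 ≤ A) (hL : 0 < L) {α : ℝ}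
    (hα : α = 1 / (2 * L) + Real.sqrt (1 / (4 * L ^ 2) + A / L)) :
    0 < α ∧ A + α = L * α ^ 2 := by
  have h0 : 0 ≤ 1 / (4 * L ^ 2) + A / L := by positivity
  have hs := Real.sq_sqrt h0
  have hn := Real.sqrt_nonneg (1 / (4 * L ^ 2) + A / L)
  refine ⟨by rw [hα]; positivity, ?_⟩
  have : (α - 1 / (2 * L)) ^ 2 = 1 / (4 * L ^ 2) + A / L := by rw [hα]; ring_nf; ring_nf at hs; linarith
  field_simp at this
  nlinarith

/-- A linearization plus `h` is convex, since its first part is affine. The inequality is multiplied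
by the total weight to avoid quotients later. -/
theorem lin_add_combo (hP : P.Regular) {y x x' : Vec n} (hx : x ∈ P.Q) (hx' : x' ∈ P.Q) {a b : ℝ}
    (ha : 0 ≤ a) (hb : 0 < b) :
    (b + a) * P.lin y ((1 / (b + a)) • (b • x + a • x')) ≤ b * P.lin y x + a * P.lin y x' := by
  have hab : 0 < b + a := by linarith
  have hh : ∀ e, (b + a) * P.h e (((1 / (b + a)) • (b • x + a • x')) e) ≤
      b * P.h e (x e) + a * P.h e (x' e) := by
    intro e
    have := (hP.convex_h e).2 (hx e) (hx' e) (by positivity : 0 ≤ b / (b + a))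
      (by positivity : 0 ≤ a / (b + a)) (by field_simp)
    have h2 := mul_le_mul_of_nonneg_left this hab.le
    simp only [smul_eq_mul] at h2
    have e1 : ((1 / (b + a)) • (b • x + a • x')) e = b / (b + a) * x e + a / (b + a) * x' e := by
      simp; ring
    rw [e1]
    refine h2.trans (le_of_eq ?_)
    field_simp
  have hsum := Finset.sum_le_sum fun e (_ : e ∈ Finset.univ) => hh e
  rw [← Finset.mul_sum, Finset.sum_add_distrib, ← Finset.mul_sum, ← Finset.mul_sum] at hsum
  have hin : (b + a) * inner ℝ (P.grad y) ((1 / (b + a)) • (b • x + a • x') - y) =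
      b * inner ℝ (P.grad y) (x - y) + a * inner ℝ (P.grad y) (x' - y) := by
    simp only [inner_sub_right, inner_smul_right, inner_add_right]
    field_simp; ring
  simp only [lin]
  nlinarith

theorem Regular.combo_mem (hP : P.Regular) {x x' : Vec n} (hx : x ∈ P.Q) (hx' : x' ∈ P.Q) {a b : ℝ}
    (ha : 0 ≤ a) (hb : 0 < b) : (1 / (a + b)) • (b • x + a • x') ∈ P.Q := by
  have := hP.convex_Q hx hx' (by positivity : 0 ≤ b / (a + b)) (by positivity : 0 ≤ a / (a + b))
    (by rw [← add_div, add_comm, div_self (by positivity)])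
  convert this using 1
  rw [smul_add, smul_smul, smul_smul]; congr 2 <;> ring

/-- One step of the estimating sequence argument. -/
theorem Regular.estimate_step (hP : P.Regular) {A L ε : ℝ} {u t : Vec n} {ψ : Vec n → ℝ}
    {c : Iterate n} (hA : 0 ≤ A) (hL : 0 < L) (ht : t ∈ P.Q) (hu : u ∈ P.Q)
    (hc : P.Trial A u t ψ L c) (hacc : P.Accepts ε L c)
    (hgrow : ∀ x ∈ P.Q, A * P.F t - A * ε / 2 + 1 / 2 * ‖x - u‖ ^ 2 ≤ ψ x) :
    c.A * P.F c.t - c.A * ε / 2 ≤ ψ c.u + c.α * P.lin c.y c.u := by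
  obtain ⟨hα, hcA, hy, hcu, hct⟩ := hc
  obtain ⟨hαpos, hid⟩ := weight_identity hA hL hα
  have hcApos : 0 < c.A := by rw [hcA]; positivity
  have hyQ : c.y ∈ P.Q := by rw [hy, hcA]; exact hP.combo_mem hu ht hA hαpos
  have h1 := hgrow c.u hcu.1
  have h2 : P.lin c.y t ≤ P.F t := by
    have := hP.subgrad _ hyQ _ ht
    simp only [lin, F]; linarith
  have h3 := lin_add_combo (y := c.y) hP hcu.1 ht hA hαpos
  rw [add_comm c.α A, ← hcA, ← hct] at h3
  -- The similar triangles: `t` and `y` are the same convex combination, with the new and the old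
  -- `u` respectively.
  have h4 : c.α • (c.u - u) = c.A • (c.t - c.y) := by
    rw [hct, hy, ← smul_sub, smul_smul, mul_one_div_cancel hcApos.ne', one_smul, smul_sub]; abel
  have h5 : c.α ^ 2 * ‖c.u - u‖ ^ 2 = c.A ^ 2 * ‖c.t - c.y‖ ^ 2 := by
    have := congrArg (fun v => ‖v‖ ^ 2) h4
    simpa [norm_smul, mul_pow] using this
  -- Because `A = L α²`, the growth of the old model at the new minimizer equals `A` times the
  -- quadratic term of the acceptance test.
  have h6 : 1 / 2 * ‖c.u - u‖ ^ 2 = c.A * (L / 2 * ‖c.t - c.y‖ ^ 2) := by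
    have hsq : 0 < c.α ^ 2 := by positivity
    apply mul_left_cancel₀ hsq.ne'
    have : c.A = L * c.α ^ 2 := by rw [hcA, hid]
    linear_combination (1/2) * h5 + c.A * ‖c.t - c.y‖ ^ 2 / 2 * this
  -- Multiplied by `A`, the tolerance `α ε / (2A)` becomes `α ε / 2`; summed over the iterations
  -- this is `A ε / 2`.
  have h7 : c.A * P.F c.t ≤ c.A * (P.lin c.y c.t + L / 2 * ‖c.t - c.y‖ ^ 2) + c.α * ε / 2 := by
    have := mul_le_mul_of_nonneg_left hacc hcApos.le
    have h8 : c.A * (c.α / (2 * c.A) * ε) = c.α * ε / 2 := by field_simp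
    simp only [lin, F]
    nlinarith
  have h9 : A * P.lin c.y t ≤ A * P.F t := mul_le_mul_of_nonneg_left h2 hA
  rw [hcA] at h7 ⊢
  rw [hcA] at h6 h3
  nlinarith

end Composite
end Traffic

/-! ### Candidates, runs and the convergence estimate -/

namespace Traffic
namespace Composite

variable {n : ℕ} {P : Composite n}

/-- The minimization sees the model only through the accumulated weight `A` and the accumulated
gradient `b`; additive constants drop out. These two quantities are all that has to be carried
along. -/
theorem trial_sep_iff {A κ : ℝ} {u t b : Vec n} {ψ : Vec n → ℝ} {L : ℝ} {c : Iterate n}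
    (hψ : ∀ x, ψ x = κ + P.sepObj A b x) :
    P.Trial A u t ψ L c ↔
    (c.α = 1 / (2 * L) + Real.sqrt (1 / (4 * L ^ 2) + A / L) ∧
      c.A = A + c.α ∧ c.y = (1 / c.A) • (c.α • u + A • t) ∧
      P.IsArgmin (P.sepObj c.A (b + c.α • P.grad c.y)) c.u ∧
      c.t = (1 / c.A) • (c.α • c.u + A • t)) := by
  have hlin : ∀ x, c.A = A + c.α → ψ x + c.α * P.lin c.y x =
      (κ + c.α * (P.Φ c.y - inner ℝ (P.grad c.y) c.y)) +
        P.sepObj c.A (b + c.α • P.grad c.y) x := by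
    intro x hA
    rw [hψ, hA]
    simp only [lin, sepObj, scalarObj, inner_sub_right, inner_eq_sum (P.grad c.y) x,
      Finset.sum_add_distrib, PiLp.add_apply, PiLp.smul_apply, smul_eq_mul, add_mul,
      Finset.mul_sum, mul_add, mul_sub, mul_assoc]
    ring
  unfold Trial
  constructor
  · rintro ⟨h1, h2, h3, h4, h5⟩
    refine ⟨h1, h2, h3, ⟨h4.1, fun x hx => ?_⟩, h5⟩
    have := h4.2 x hx
    simp only [hlin _ h2] at this
    linarith
  · rintro ⟨h1, h2, h3, h4, h5⟩
    refine ⟨h1, h2, h3, ⟨h4.1, fun x hx => ?_⟩, h5⟩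
    have := h4.2 x hx
    simp only [hlin _ h2]
    linarith

theorem Regular.exists_trial (hP : P.Regular) {A κ : ℝ} {u t b : Vec n} {ψ : Vec n → ℝ} {L : ℝ}
    (hA : 0 ≤ A) (hL : 0 < L) (hψ : ∀ x, ψ x = κ + P.sepObj A b x) :
    ∃ c, P.Trial A u t ψ L c := by
  set α := 1 / (2 * L) + Real.sqrt (1 / (4 * L ^ 2) + A / L) with hα
  have hαpos := (weight_identity hA hL hα).1
  set y := (1 / (A + α)) • (α • u + A • t) with hy
  obtain ⟨v, hv⟩ := hP.exists_prox (by positivity : 0 < A + α) (b + α • P.grad y)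
  refine ⟨⟨α, A + α, y, v, (1 / (A + α)) • (α • v + A • t)⟩, (trial_sep_iff hψ).2 ?_⟩
  exact ⟨hα, rfl, hy, hP.isArgmin_of_isProx (by positivity) hv, rfl⟩

theorem Regular.trial_prox (hP : P.Regular) {A κ : ℝ} {u t b : Vec n} {ψ : Vec n → ℝ} {L : ℝ}
    (hA : 0 ≤ A) (hL : 0 < L) (hψ : ∀ x, ψ x = κ + P.sepObj A b x) {c : Iterate n}
    (hc : P.Trial A u t ψ L c) :
    ∀ v : Vec n, (∀ e, P.IsProx e c.A ((b + c.α • P.grad c.y) e) (v e)) → c.u = v := by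
  intro v hv
  obtain ⟨h1, h2, h3, h4, h5⟩ := (trial_sep_iff hψ).1 hc
  have hαpos := (weight_identity hA hL h1).1
  exact hP.eq_of_isArgmin (by rw [h2]; positivity) hv h4

/-- Weight and test point are given by formulas, and the minimizer is unique by strong convexity.
This identifies the candidate that a program computes with the one recorded in a run. -/
theorem Regular.trial_unique (hP : P.Regular) {A κ : ℝ} {u t b : Vec n} {ψ : Vec n → ℝ} {L : ℝ}
    (hA : 0 ≤ A) (hL : 0 < L) (hψ : ∀ x, ψ x = κ + P.sepObj A b x) {c c' : Iterate n}
    (hc : P.Trial A u t ψ L c) (hc' : P.Trial A u t ψ L c') : c = c' := by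
  have e1 : c.α = c'.α := hc.1.trans hc'.1.symm
  have e2 : c.A = c'.A := by rw [hc.2.1, hc'.2.1, e1]
  have e3 : c.y = c'.y := by rw [hc.2.2.1, hc'.2.2.1, e1, e2]
  have hαpos := (weight_identity hA hL hc.1).1
  obtain ⟨v, hv⟩ := hP.exists_prox (by rw [hc.2.1]; positivity : 0 < c.A) (b + c.α • P.grad c.y)
  have e4 : c.u = c'.u := by
    rw [hP.trial_prox hA hL hψ hc v hv, hP.trial_prox hA hL hψ hc' v]
    rw [← e1, ← e2, ← e3]; exact hv
  have e5 : c.t = c'.t := by rw [hc.2.2.2.2, hc'.2.2.2.2, e1, e2, e4]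
  cases c; cases c'; simp_all

theorem Regular.trial_mem (hP : P.Regular) {A : ℝ} {u t : Vec n} {ψ : Vec n → ℝ} {L : ℝ}
    (hA : 0 ≤ A) (hL : 0 < L) (hu : u ∈ P.Q) (ht : t ∈ P.Q) {c : Iterate n}
    (hc : P.Trial A u t ψ L c) : 0 < c.α ∧ 0 < c.A ∧ c.A = L * c.α ^ 2 ∧
      c.y ∈ P.Q ∧ c.u ∈ P.Q ∧ c.t ∈ P.Q := by
  obtain ⟨h1, h2, h3, h4, h5⟩ := hc
  obtain ⟨hα, hid⟩ := weight_identity hA hL h1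
  refine ⟨hα, by rw [h2]; positivity, by rw [h2, hid], ?_, h4.1, ?_⟩
  · rw [h3, h2]; exact hP.combo_mem hu ht hA hα
  · rw [h5, h2]; exact hP.combo_mem h4.1 ht hA hα

namespace Run

variable {L₀ ε : ℝ} (run : P.Run L₀ ε)

/-- The weight accumulated before iteration `k`. -/
def accum : ℕ → ℝ
  | 0 => 0
  | k + 1 => (run.z k).A

/-- The point `u` available before iteration `k`. -/
def prevU : ℕ → Vec n
  | 0 => P.start
  | k + 1 => (run.z k).u

/-- The point `t` available before iteration `k`. -/
def prevT : ℕ → Vec n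
  | 0 => P.start
  | k + 1 => (run.z k).t

/-- The first constant tried at iteration `k`. -/
noncomputable def base : ℕ → ℝ
  | 0 => L₀
  | k + 1 => run.L k / 2

/-- The model function available before iteration `k`. -/
noncomputable def model (k : ℕ) (x : Vec n) : ℝ :=
  1 / 2 * ‖x - P.start‖ ^ 2 + ∑ i ∈ Finset.range k, (run.z i).α * P.lin (run.z i).y x

/-- The weighted sum of the gradients available before iteration `k`. -/
noncomputable def gradSum (k : ℕ) : Vec n :=
  ∑ i ∈ Finset.range k, (run.z i).α • P.grad (run.z i).y

theorem L_eq (k : ℕ) : run.L k = 2 ^ run.j k * run.base k := by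
  cases k with
  | zero => exact run.init_L
  | succ k => exact run.step_L k

theorem L_pos (h0 : 0 < L₀) (k : ℕ) : 0 < run.L k := by
  induction k with
  | zero => rw [run.L_eq]; simp only [base]; positivity
  | succ k ih => rw [run.L_eq]; simp only [base]; positivity

theorem base_pos (h0 : 0 < L₀) (k : ℕ) : 0 < run.base k := by
  cases k with
  | zero => exact h0
  | succ k => have := run.L_pos h0 k; simp only [base]; positivity

theorem model_zero : run.model 0 = fun x => 1 / 2 * ‖x - P.start‖ ^ 2 := by
  funext x; simp [model]

theorem trial (h0 : 0 < L₀) (k : ℕ) :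
    P.Trial (run.accum k) (run.prevU k) (run.prevT k) (run.model k) (run.L k) (run.z k) := by
  cases k with
  | zero =>
    have := (initTrial_iff (run.L_pos h0 0) _).1 run.init_trial
    rwa [← run.model_zero] at this
  | succ k => exact run.step_trial k

theorem accepts (k : ℕ) : P.Accepts ε (run.L k) (run.z k) := by
  cases k with
  | zero => exact run.init_accepts
  | succ k => exact run.step_accepts k

theorem rejects (h0 : 0 < L₀) (k : ℕ) : ∀ i < run.j k, ∀ c,
    P.Trial (run.accum k) (run.prevU k) (run.prevT k) (run.model k) (2 ^ i * run.base k) c →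
      ¬ P.Accepts ε (2 ^ i * run.base k) c := by
  cases k with
  | zero =>
    intro i hi c hc
    refine run.init_rejects i hi c ((initTrial_iff (by positivity) _).2 ?_)
    rwa [← run.model_zero]
  | succ k => exact run.step_rejects k

theorem accum_succ (k : ℕ) : run.accum (k + 1) = (run.z k).A := rfl

section facts

variable (h0 : 0 < L₀)
include h0

theorem accum_eq (k : ℕ) : run.accum k = ∑ i ∈ Finset.range k, (run.z i).α := by
  induction k with
  | zero => simp [accum]
  | succ k ih => rw [Finset.sum_range_succ, ← ih, accum_succ]; exact (run.trial h0 k).2.1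

theorem state_mem (hP : P.Regular) (k : ℕ) :
    0 ≤ run.accum k ∧ run.prevU k ∈ P.Q ∧ run.prevT k ∈ P.Q := by
  induction k with
  | zero => exact ⟨le_rfl, hP.start_mem, hP.start_mem⟩
  | succ k ih =>
    have := hP.trial_mem ih.1 (run.L_pos h0 k) ih.2.1 ih.2.2 (run.trial h0 k)
    exact ⟨this.2.1.le, this.2.2.2.2.1, this.2.2.2.2.2⟩

theorem facts (hP : P.Regular) (k : ℕ) : 0 < (run.z k).α ∧ 0 < (run.z k).A ∧
    (run.z k).A = run.L k * (run.z k).α ^ 2 ∧ (run.z k).y ∈ P.Q ∧ (run.z k).u ∈ P.Q ∧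
    (run.z k).t ∈ P.Q :=
  have h := run.state_mem h0 hP k
  hP.trial_mem h.1 (run.L_pos h0 k) h.2.1 h.2.2 (run.trial h0 k)

theorem model_sep (k : ℕ) : ∃ κ, ∀ x, run.model k x =
    κ + P.sepObj (run.accum k) (run.gradSum k) x := by
  induction k with
  | zero =>
    refine ⟨0, fun x => ?_⟩
    simp [model, accum, gradSum, sepObj, scalarObj, norm_sq_eq_sum, Finset.mul_sum]
  | succ k ih =>
    obtain ⟨κ, hκ⟩ := ih
    refine ⟨κ + (run.z k).α * (P.Φ (run.z k).y - inner ℝ (P.grad (run.z k).y) (run.z k).y),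
      fun x => ?_⟩
    have h1 : run.model (k + 1) x = run.model k x + (run.z k).α * P.lin (run.z k).y x := by
      simp only [model, Finset.sum_range_succ]; ring
    have h2 : run.gradSum (k + 1) = run.gradSum k + (run.z k).α • P.grad (run.z k).y := by
      simp only [gradSum, Finset.sum_range_succ]
    rw [h1, hκ, h2, accum_succ, (run.trial h0 k).2.1]
    simp only [lin, sepObj, scalarObj, inner_sub_right, inner_eq_sum (P.grad _) x,
      Finset.sum_add_distrib, PiLp.add_apply, PiLp.smul_apply, smul_eq_mul, add_mul,
      Finset.mul_sum, mul_add, mul_sub, mul_assoc]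
    ring

theorem model_argmin (hP : P.Regular) (k : ℕ) : P.IsArgmin (run.model k) (run.prevU k) := by
  cases k with
  | zero =>
    refine ⟨hP.start_mem, fun x _ => ?_⟩
    simp [model, prevU]
  | succ k =>
    have := (run.trial h0 k).2.2.2.1
    have h1 : ∀ x, run.model (k + 1) x = run.model k x + (run.z k).α * P.lin (run.z k).y x := by
      intro x; simp only [model, Finset.sum_range_succ]; ring
    exact ⟨this.1, fun x hx => by rw [h1, h1]; exact this.2 x hx⟩

/-- Induction on `k`: `estimate_step` bounds the new model from below at its own minimizer, and
quadratic growth carries the bound to every `x ∈ Q`, where the next step needs it. -/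
theorem estimate (hP : P.Regular) (k : ℕ) {x : Vec n} (hx : x ∈ P.Q) :
    run.accum k * P.F (run.prevT k) - run.accum k * ε / 2 + 1 / 2 * ‖x - run.prevU k‖ ^ 2
      ≤ run.model k x := by
  induction k generalizing x with
  | zero => simp [accum, model, prevU]
  | succ k ih =>
    have hs := run.state_mem h0 hP k
    have h1 := hP.estimate_step hs.1 (run.L_pos h0 k) hs.2.2 hs.2.1 (run.trial h0 k)
      (run.accepts k) (fun x hx => ih hx)
    have h2 : run.model (k + 1) (run.z k).u =
        run.model k (run.z k).u + (run.z k).α * P.lin (run.z k).y (run.z k).u := by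
      simp only [model, Finset.sum_range_succ]; ring
    obtain ⟨κ, hκ⟩ := run.model_sep h0 (k + 1)
    have h3 := hP.isArgmin_growth (run.facts h0 hP k).2.1 hκ (run.model_argmin h0 hP (k + 1)) hx
    simp only [accum, prevU, prevT] at *
    linarith

/-- The convergence estimate of the method. -/
theorem estimate_F (hP : P.Regular) (N : ℕ) {x : Vec n} (hx : x ∈ P.Q) :
    P.F (run.z N).t ≤ 1 / (run.z N).A * (1 / 2 * ‖x - P.start‖ ^ 2 +
      ∑ k ∈ Finset.range (N + 1), (run.z k).α * P.lin (run.z k).y x) + ε / 2 := by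
  have h := run.estimate h0 hP (N + 1) hx
  have hA := (run.facts h0 hP N).2.1
  simp only [accum, prevT, model] at h
  have h2 : (run.z N).A * P.F (run.z N).t ≤ 1 / 2 * ‖x - P.start‖ ^ 2 +
      ∑ k ∈ Finset.range (N + 1), (run.z k).α * P.lin (run.z k).y x + (run.z N).A * ε / 2 := by
    nlinarith [sq_nonneg ‖x - run.prevU (N + 1)‖]
  have h3 : P.F (run.z N).t ≤ (1 / 2 * ‖x - P.start‖ ^ 2 +
      ∑ k ∈ Finset.range (N + 1), (run.z k).α * P.lin (run.z k).y x + (run.z N).A * ε / 2) /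
        (run.z N).A := by
    rw [le_div_iff₀ hA]; linarith
  refine h3.trans (le_of_eq ?_)
  field_simp

theorem accum_mono (hP : P.Regular) : Monotone run.accum :=
  monotone_nat_of_le_succ fun k => by
    rw [accum_succ, (run.trial h0 k).2.1]; linarith [(run.facts h0 hP k).1]

end facts

end Run

/-- The data carried from one iteration to the next. -/
structure Carry (P : Composite n) where
  A : ℝ
  u : Vec n
  t : Vec n
  b : Vec n
  L : ℝ
  A_nonneg : 0 ≤ A
  u_mem : u ∈ P.Q
  t_mem : t ∈ P.Q
  L_pos : 0 < L

/-- Every trial computed with a constant that has been doubled often enough is accepted. -/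
def EventuallyAccepts (P : Composite n) (ε : ℝ) : Prop :=
  ∀ (A : ℝ) (u t : Vec n) (ψ : Vec n → ℝ) (L : ℝ), 0 ≤ A → 0 < L → u ∈ P.Q → t ∈ P.Q →
    ∃ i : ℕ, ∀ c, P.Trial A u t ψ (2 ^ i * L) c → P.Accepts ε (2 ^ i * L) c

/-- The number of doublings is taken minimal, and minimality is precisely the clause that all
smaller constants were rejected. The carried constant is already halved for the next iteration. -/
theorem Regular.exists_step (hP : P.Regular) {ε : ℝ} (hacc : EventuallyAccepts P ε) (s : Carry P) :
    ∃ (s' : Carry P) (c : Iterate n) (j : ℕ),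
      P.Trial s.A s.u s.t (P.sepObj s.A s.b) (2 ^ j * s.L) c ∧
      P.Accepts ε (2 ^ j * s.L) c ∧
      (∀ i < j, ∀ c, P.Trial s.A s.u s.t (P.sepObj s.A s.b) (2 ^ i * s.L) c →
        ¬ P.Accepts ε (2 ^ i * s.L) c) ∧
      s'.A = c.A ∧ s'.u = c.u ∧ s'.t = c.t ∧ s'.b = s.b + c.α • P.grad c.y ∧
      s'.L = 2 ^ j * s.L / 2 := by
  classical
  have hsep : ∀ x, P.sepObj s.A s.b x = 0 + P.sepObj s.A s.b x := fun x => (zero_add _).symm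
  have hLp : ∀ i : ℕ, 0 < 2 ^ i * s.L := fun i => by have := s.L_pos; positivity
  have hex : ∃ j : ℕ, ∃ c, P.Trial s.A s.u s.t (P.sepObj s.A s.b) (2 ^ j * s.L) c ∧
      P.Accepts ε (2 ^ j * s.L) c := by
    obtain ⟨i, hi⟩ := hacc s.A s.u s.t (P.sepObj s.A s.b) s.L s.A_nonneg s.L_pos s.u_mem s.t_mem
    obtain ⟨c, hc⟩ := hP.exists_trial (u := s.u) (t := s.t) s.A_nonneg (hLp i) hsep
    exact ⟨i, c, hc, hi c hc⟩
  obtain ⟨c, hc, hca⟩ := Nat.find_spec hex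
  have hm := hP.trial_mem s.A_nonneg (hLp _) s.u_mem s.t_mem hc
  refine ⟨⟨c.A, c.u, c.t, s.b + c.α • P.grad c.y, 2 ^ Nat.find hex * s.L / 2, hm.2.1.le,
    hm.2.2.2.2.1, hm.2.2.2.2.2, by have := s.L_pos; positivity⟩, c, Nat.find hex, hc, hca, ?_,
    rfl, rfl, rfl, rfl, rfl⟩
  intro i hi c' hc' ha'
  exact Nat.find_min hex hi ⟨c', hc', ha'⟩

theorem trial_congr {A κ : ℝ} {u t b : Vec n} {ψ : Vec n → ℝ} {L : ℝ} {c : Iterate n}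
    (hψ : ∀ x, ψ x = κ + P.sepObj A b x) :
    P.Trial A u t ψ L c ↔ P.Trial A u t (P.sepObj A b) L c := by
  rw [trial_sep_iff hψ, trial_sep_iff (κ := 0) fun x => (zero_add _).symm]

theorem Regular.nonempty_run (hP : P.Regular) {ε L₀ : ℝ} (h0 : 0 < L₀)
    (hacc : EventuallyAccepts P ε) : Nonempty (P.Run L₀ ε) := by
  choose nxt c j h1 h2 h3 h4 h5 h6 h7 h8 using hP.exists_step hacc
  let s0 : Carry P := ⟨0, P.start, P.start, 0, L₀, le_rfl, hP.start_mem, hP.start_mem, h0⟩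
  let s : ℕ → Carry P := fun k => nxt^[k] s0
  have hs : ∀ k, s (k + 1) = nxt (s k) := fun k => Function.iterate_succ_apply' nxt k s0
  have hsep0 : ∀ x, 1 / 2 * ‖x - P.start‖ ^ 2 = 0 + P.sepObj 0 0 x := by
    intro x; simp [sepObj, scalarObj, norm_sq_eq_sum, Finset.mul_sum]
  let z : ℕ → Iterate n := fun k => c (s k)
  -- The carried vector `b` reproduces `φ_k` up to a constant, so trials for the carried data are
  -- trials for the run.
  have hsep : ∀ k, ∃ κ, ∀ x, P.phi z k x = κ + P.sepObj (s (k + 1)).A (s (k + 1)).b x := by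
    have base : ∀ (ψ : Vec n → ℝ) (k : ℕ) (κ : ℝ), (∀ x, ψ x = κ + P.sepObj (s k).A (s k).b x) →
        ∃ κ', ∀ x, ψ x + (z k).α * P.lin (z k).y x =
          κ' + P.sepObj (s (k + 1)).A (s (k + 1)).b x := by
      intro ψ k κ hκ
      refine ⟨κ + (z k).α * (P.Φ (z k).y - inner ℝ (P.grad (z k).y) (z k).y), fun x => ?_⟩
      rw [hs, h7, h4, hκ, (h1 (s k)).2.1]
      simp only [z, lin, sepObj, scalarObj, inner_sub_right, inner_eq_sum (P.grad _) x,
        Finset.sum_add_distrib, PiLp.add_apply, PiLp.smul_apply, smul_eq_mul, add_mul,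
        Finset.mul_sum, mul_add, mul_sub, mul_assoc]
      ring
    intro k
    induction k with
    | zero =>
      obtain ⟨κ, hκ⟩ := base _ 0 0 hsep0
      exact ⟨κ, fun x => by rw [← hκ]; simp [phi]⟩
    | succ k ih =>
      obtain ⟨κ, hκ⟩ := ih
      obtain ⟨κ', hκ'⟩ := base _ (k + 1) κ hκ
      refine ⟨κ', fun x => ?_⟩
      rw [← hκ']
      simp only [phi, Finset.sum_range_succ _ (k + 1)]
      ring
  have hzA : ∀ k, (s (k + 1)).A = (z k).A := fun k => by rw [hs, h4]
  have hzu : ∀ k, (s (k + 1)).u = (z k).u := fun k => by rw [hs, h5]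
  have hzt : ∀ k, (s (k + 1)).t = (z k).t := fun k => by rw [hs, h6]
  have hstep : ∀ k L c', P.StepTrial z k L c' ↔ P.Trial (s (k + 1)).A (s (k + 1)).u (s (k + 1)).t
      (P.sepObj (s (k + 1)).A (s (k + 1)).b) L c' := by
    intro k L c'
    obtain ⟨κ, hκ⟩ := hsep k
    rw [← trial_congr hκ, hzA, hzu, hzt]; rfl
  have hinit : ∀ L c', 0 < L → (P.InitTrial L c' ↔ P.Trial (s 0).A (s 0).u (s 0).t
      (P.sepObj (s 0).A (s 0).b) L c') := by
    intro L c' hL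
    rw [initTrial_iff hL]
    exact trial_congr hsep0
  refine ⟨⟨z, fun k => 2 ^ j (s k) * (s k).L, fun k => j (s k), rfl, ?_, h2 (s 0), ?_, ?_, ?_,
    fun k => ?_, ?_⟩⟩
  · exact (hinit _ _ (by have := (s 0).L_pos; positivity)).2 (h1 (s 0))
  · intro i hi c' hc'
    exact h3 (s 0) i hi c' ((hinit _ _ (by positivity)).1 hc')
  · intro k; simp only [hs, h8]
  · intro k; exact (hstep _ _ _).2 (h1 (s (k + 1)))
  · exact h2 (s (k + 1))
  · intro k i hi c' hc'
    have hL : (s (k + 1)).L = 2 ^ j (s k) * (s k).L / 2 := by rw [hs, h8]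
    rw [← hL] at hc' ⊢
    exact h3 (s (k + 1)) i hi c' ((hstep _ _ _).1 hc')

end Composite
end Traffic

/-! ### Growth of the weights and the number of candidates -/

namespace Traffic
namespace Composite

variable {n : ℕ} {P : Composite n}

/-- Quadratic upper bound for the first term of the objective. -/
def SmoothBound (P : Composite n) (Lip : ℝ) : Prop :=
  ∀ y ∈ P.Q, ∀ t ∈ P.Q, P.Φ t ≤ P.Φ y + inner ℝ (P.grad y) (t - y) + Lip / 2 * ‖t - y‖ ^ 2

/-- Upper bound for the first term of the objective with bounded subgradients. -/
def LipschitzBound (P : Composite n) (M : ℝ) : Prop :=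
  ∀ y ∈ P.Q, ∀ t ∈ P.Q, P.Φ t ≤ P.Φ y + inner ℝ (P.grad y) (t - y) + M * ‖t - y‖

theorem SmoothBound.accepts {Lip L ε : ℝ} (h : SmoothBound P Lip) (hε : 0 ≤ ε) (hL : Lip ≤ L)
    {c : Iterate n} (hy : c.y ∈ P.Q) (ht : c.t ∈ P.Q) (hα : 0 < c.α) (hA : 0 < c.A) :
    P.Accepts ε L c := by
  have h1 := h _ hy _ ht
  have h2 : 0 ≤ c.α / (2 * c.A) * ε := by positivity
  have h3 : Lip / 2 * ‖c.t - c.y‖ ^ 2 ≤ L / 2 * ‖c.t - c.y‖ ^ 2 := by gcongr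
  unfold Accepts; linarith

/-- By the arithmetic-geometric mean inequality `M‖v‖ ≤ (L/2)‖v‖² + M²/(2L)`. Since `A = L α²`, the
tolerance of the test is `ε / (2 L α)`, which covers `M²/(2L)` as soon as `α M² ≤ ε`. -/
theorem LipschitzBound.accepts {M L ε : ℝ} (h : LipschitzBound P M) (hL : 0 < L)
    {c : Iterate n} (hy : c.y ∈ P.Q) (ht : c.t ∈ P.Q) (hα : 0 < c.α) (hA : c.A = L * c.α ^ 2)
    (hs : c.α * M ^ 2 ≤ ε) : P.Accepts ε L c := by
  have h1 := h _ hy _ ht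
  have h2 : c.α / (2 * c.A) * ε = ε / (2 * L * c.α) := by rw [hA]; field_simp
  have h3 : M ^ 2 / (2 * L) ≤ ε / (2 * L * c.α) := by
    rw [div_le_div_iff₀ (by positivity) (by positivity)]
    nlinarith [mul_le_mul_of_nonneg_left hs (by positivity : 0 ≤ 2 * L)]
  have h4 : M * ‖c.t - c.y‖ ≤ L / 2 * ‖c.t - c.y‖ ^ 2 + M ^ 2 / (2 * L) := by
    have : L / 2 * ‖c.t - c.y‖ ^ 2 + M ^ 2 / (2 * L) - M * ‖c.t - c.y‖ =
        (L * ‖c.t - c.y‖ - M) ^ 2 / (2 * L) := by field_simp; ring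
    have h5 : 0 ≤ (L * ‖c.t - c.y‖ - M) ^ 2 / (2 * L) := by positivity
    linarith
  unfold Accepts; rw [h2]; linarith

/-- Solved for the constant, the weight identity reads `L = A/α² + 1/α`, which decreases in `α`; a
large constant forces a small weight. -/
theorem weight_le {A α L δ : ℝ} (hA : 0 ≤ A) (hα : 0 < α) (hδ : 0 < δ) (hid : A + α = L * α ^ 2)
    (hL : A / δ ^ 2 + 1 / δ ≤ L) : α ≤ δ := by
  by_contra hlt
  push Not at hlt
  have h1 : A / α ^ 2 ≤ A / δ ^ 2 := by gcongr
  have h2 : 1 / α < 1 / δ := one_div_lt_one_div_of_lt hδ hlt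
  have h3 : A / α ^ 2 + 1 / α = L := by field_simp; linarith
  linarith

theorem exists_two_pow_mul_ge {L B : ℝ} (hL : 0 < L) : ∃ i : ℕ, B ≤ 2 ^ i * L := by
  obtain ⟨i, hi⟩ := pow_unbounded_of_one_lt (B / L) (one_lt_two : (1 : ℝ) < 2)
  exact ⟨i, by rw [div_lt_iff₀ hL] at hi; exact hi.le⟩

theorem SmoothBound.eventuallyAccepts {Lip ε : ℝ} (h : SmoothBound P Lip) (hP : P.Regular)
    (hε : 0 ≤ ε) : EventuallyAccepts P ε := by
  intro A u t ψ L hA hL hu ht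
  obtain ⟨i, hi⟩ := exists_two_pow_mul_ge (B := Lip) hL
  refine ⟨i, fun c hc => ?_⟩
  have := hP.trial_mem hA (by positivity) hu ht hc
  exact h.accepts hε hi this.2.2.2.1 this.2.2.2.2.2 this.1 this.2.1

theorem LipschitzBound.accepts_of_trial {M ε : ℝ} (h : LipschitzBound P M) (hP : P.Regular)
    (hM : 0 < M) (hε : 0 < ε) {A L : ℝ} {u t : Vec n} {ψ : Vec n → ℝ} (hA : 0 ≤ A) (hL : 0 < L)
    (hu : u ∈ P.Q) (ht : t ∈ P.Q) (hLA : A / (ε / M ^ 2) ^ 2 + 1 / (ε / M ^ 2) ≤ L)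
    {c : Iterate n} (hc : P.Trial A u t ψ L c) : P.Accepts ε L c := by
  have hm := hP.trial_mem hA hL hu ht hc
  refine h.accepts hL hm.2.2.2.1 hm.2.2.2.2.2 hm.1 hm.2.2.1 ?_
  have := weight_le hA hm.1 (by positivity : 0 < ε / M ^ 2) (by rw [← hc.2.1, hm.2.2.1]) hLA
  rwa [le_div_iff₀ (by positivity)] at this

theorem LipschitzBound.eventuallyAccepts {M ε : ℝ} (h : LipschitzBound P M) (hP : P.Regular)
    (hM : 0 < M) (hε : 0 < ε) : EventuallyAccepts P ε := by
  intro A u t ψ L hA hL hu ht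
  obtain ⟨i, hi⟩ := exists_two_pow_mul_ge (B := A / (ε / M ^ 2) ^ 2 + 1 / (ε / M ^ 2)) hL
  exact ⟨i, fun c hc => h.accepts_of_trial hP hM hε hA (by positivity) hu ht hi hc⟩

namespace Run

variable {L₀ ε : ℝ} (run : P.Run L₀ ε)

theorem two_pow_sum_j (N : ℕ) :
    2 ^ (∑ k ∈ Finset.range (N + 1), run.j k) * L₀ = 2 ^ N * run.L N := by
  induction N with
  | zero => simp [run.init_L]
  | succ N ih =>
    rw [Finset.sum_range_succ, pow_add, mul_right_comm, ih, run.step_L N]; ring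

/-- Up to iteration `N` the constant is halved `N` times and doubled `∑ j k` times, so `∑ j k = N +
log₂ (L_N / L₀)`. The accepted candidates contribute `N + 1` more. -/
theorem trials_eq (h0 : 0 < L₀) (N : ℕ) :
    (run.trials N : ℝ) = 2 * N + 1 + Real.logb 2 (run.L N / L₀) := by
  have h1 := run.two_pow_sum_j N
  have h2 : run.L N / L₀ = 2 ^ (∑ k ∈ Finset.range (N + 1), run.j k) / 2 ^ N := by
    rw [div_eq_div_iff h0.ne' (by positivity)]; linarith
  rw [h2, Real.logb_div (by positivity) (by positivity), Real.logb_pow, Real.logb_pow,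
    Real.logb_self_eq_one (by norm_num), trials, Finset.sum_add_distrib]
  push_cast
  simp
  ring

variable (h0 : 0 < L₀)
include h0

/-- If the constant was doubled at all, the last rejected value was `L/2`. Rejection is stated for
all candidates, so the existence of one has to be supplied before it can be used. -/
theorem exists_rejected (hP : P.Regular) (k : ℕ) (hj : run.j k ≠ 0) :
    ∃ c, P.Trial (run.accum k) (run.prevU k) (run.prevT k) (run.model k) (run.L k / 2) c ∧
      ¬ P.Accepts ε (run.L k / 2) c := by
  obtain ⟨i, hi⟩ := Nat.exists_eq_succ_of_ne_zero hj
  obtain ⟨κ, hκ⟩ := run.model_sep h0 k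
  have hL := run.L_pos h0 k
  obtain ⟨c, hc⟩ := hP.exists_trial (u := run.prevU k) (t := run.prevT k) (L := run.L k / 2)
    (run.state_mem h0 hP k).1 (by positivity) hκ
  have e : run.L k / 2 = 2 ^ i * run.base k := by rw [run.L_eq, hi, Nat.succ_eq_add_one, pow_succ]; ring
  refine ⟨c, hc, ?_⟩
  rw [e] at hc ⊢
  exact run.rejects h0 k i (by omega) c hc

section smooth

variable {Lip : ℝ} (hP : P.Regular) (hsm : SmoothBound P Lip) (hε : 0 ≤ ε) (hL0 : L₀ ≤ Lip)
include hP hsm hε hL0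

/-- Constants from `Lip` on are never rejected, so a doubling can lead at most to `2 Lip`; without a
doubling the constant is `L₀` or half the previous one. -/
theorem L_le_smooth (k : ℕ) : run.L k ≤ 2 * Lip := by
  have hLip : 0 < Lip := by linarith
  induction k with
  | zero =>
    by_cases hj : run.j 0 = 0
    · rw [run.L_eq, hj]; simp only [base]; linarith
    · obtain ⟨c, hc, hna⟩ := run.exists_rejected h0 hP 0 hj
      by_contra hlt
      have hs := run.state_mem h0 hP 0
      have hm := hP.trial_mem hs.1 (by linarith) hs.2.1 hs.2.2 hc
      exact hna (hsm.accepts hε (by linarith) hm.2.2.2.1 hm.2.2.2.2.2 hm.1 hm.2.1)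
  | succ k ih =>
    by_cases hj : run.j (k + 1) = 0
    · rw [run.L_eq, hj]; simp only [base]; linarith
    · obtain ⟨c, hc, hna⟩ := run.exists_rejected h0 hP (k + 1) hj
      by_contra hlt
      have hs := run.state_mem h0 hP (k + 1)
      have hm := hP.trial_mem hs.1 (by linarith) hs.2.1 hs.2.2 hc
      exact hna (hsm.accepts hε (by linarith) hm.2.2.2.1 hm.2.2.2.2.2 hm.1 hm.2.1)

/-- With `L ≤ 2 Lip` the new weight is at least `1/(4 Lip) + √(A/L)`, and the induction hypothesis
makes the root at least `k/(4 Lip)`. Now `k² + 2k + 2 ≥ (k+1)²`. -/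
theorem accum_ge_smooth (k : ℕ) : (k : ℝ) ^ 2 / (8 * Lip) ≤ run.accum k := by
  have hLip : 0 < Lip := by linarith
  induction k with
  | zero => simp [accum]
  | succ k ih =>
    obtain ⟨hα, hA, -⟩ := run.trial h0 k
    have hL := run.L_pos h0 k
    have hL2 := run.L_le_smooth h0 hP hsm hε hL0 k
    have h1 : 1 / (4 * Lip) ≤ 1 / (2 * run.L k) := one_div_le_one_div_of_le (by positivity) (by linarith)
    have h2 : k / (4 * Lip) ≤ Real.sqrt (1 / (4 * run.L k ^ 2) + run.accum k / run.L k) := by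
      apply Real.le_sqrt_of_sq_le
      have h3 : (k / (4 * Lip)) ^ 2 ≤ run.accum k / run.L k := by
        rw [le_div_iff₀ hL]
        calc (k / (4 * Lip)) ^ 2 * run.L k ≤ (k / (4 * Lip)) ^ 2 * (2 * Lip) := by gcongr
          _ = (k : ℝ) ^ 2 / (8 * Lip) := by field_simp; ring
          _ ≤ _ := ih
      have : 0 ≤ 1 / (4 * run.L k ^ 2) := by positivity
      linarith
    rw [accum_succ, hA, hα]
    push_cast
    have h4 : ((k : ℝ) + 1) ^ 2 / (8 * Lip) ≤ (k : ℝ) ^ 2 / (8 * Lip) + 1 / (4 * Lip) + k / (4 * Lip) := by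
      rw [← sub_nonneg]
      have : (k : ℝ) ^ 2 / (8 * Lip) + 1 / (4 * Lip) + k / (4 * Lip) - ((k : ℝ) + 1) ^ 2 / (8 * Lip) =
        1 / (8 * Lip) := by field_simp; ring
      rw [this]; positivity
    linarith

/-- The quantity `accum N` is the total weight of the iterations before `N`. It is bounded through
the failure of the stopping test at iteration `N - 1`, hence only for `N ≠ 0`. -/
theorem trials_le_smooth (N : ℕ) {D : ℝ} (hD : N ≠ 0 → run.accum N ≤ D) :
    (run.trials N : ℝ) ≤ 2 + 2 * Real.sqrt (8 * Lip * D) + Real.logb 2 (Lip / L₀) := by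
  have hLip : 0 < Lip := by linarith
  have hN : (N : ℝ) ≤ Real.sqrt (8 * Lip * D) := by
    rcases eq_or_ne N 0 with rfl | h
    · simp
    · apply Real.le_sqrt_of_sq_le
      have := (run.accum_ge_smooth h0 hP hsm hε hL0 N).trans (hD h)
      rw [div_le_iff₀ (by positivity)] at this; linarith
  rw [run.trials_eq h0]
  have h1 : Real.logb 2 (run.L N / L₀) ≤ Real.logb 2 (2 * (Lip / L₀)) := by
    apply Real.logb_le_logb_of_le (by norm_num) (by have := run.L_pos h0 N; positivity)
    rw [← mul_div_assoc]
    gcongr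
    exact run.L_le_smooth h0 hP hsm hε hL0 N
  rw [Real.logb_mul (by norm_num) (by positivity), Real.logb_self_eq_one (by norm_num)] at h1
  linarith

end smooth

section nonsmooth

variable {M : ℝ} (hP : P.Regular) (hns : LipschitzBound P M) (hM : 0 < M) (hε : 0 < ε)
  (hL0 : L₀ ≤ M ^ 2 / ε)
include hP hns hM hε hL0

/-- If a candidate was rejected, the last rejected weight was at least `ε/M²`, and doubling the
constant at most halves the weight. If none was rejected, the constant was halved, and `A = L α²`
makes the new weight at least the previous one. The bound on `L₀` starts the induction. -/
theorem weight_ge_nonsmooth (k : ℕ) : ε / M ^ 2 / 2 ≤ (run.z k).α := by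
  have hrej : ∀ k, run.j k ≠ 0 → ε / M ^ 2 / 2 ≤ (run.z k).α := by
    intro k hj
    obtain ⟨c, hc, hna⟩ := run.exists_rejected h0 hP k hj
    have hs := run.state_mem h0 hP k
    have hL := run.L_pos h0 k
    have hm := hP.trial_mem hs.1 (by linarith) hs.2.1 hs.2.2 hc
    have h1 : ε / M ^ 2 ≤ c.α := by
      by_contra hlt
      push Not at hlt
      rw [lt_div_iff₀ (by positivity)] at hlt
      exact hna (hns.accepts (by linarith) hm.2.2.2.1 hm.2.2.2.2.2 hm.1 hm.2.2.1 hlt.le)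
    -- Here `c` was computed with half of the accepted constant, so both terms of its weight are at
    -- most twice those of the accepted weight.
    have h2 : c.α ≤ 2 * (run.z k).α := by
      rw [hc.1, (run.trial h0 k).1, mul_add]
      refine add_le_add (le_of_eq (by field_simp)) ?_
      have h4 : Real.sqrt 4 = 2 := by
        rw [show (4 : ℝ) = 2 ^ 2 by norm_num, Real.sqrt_sq (by norm_num)]
      rw [← h4, ← Real.sqrt_mul (by norm_num)]
      apply Real.sqrt_le_sqrt
      have : 0 ≤ run.accum k / run.L k := div_nonneg hs.1 hL.le
      have e : 4 * (1 / (4 * run.L k ^ 2) + run.accum k / run.L k) -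
        (1 / (4 * (run.L k / 2) ^ 2) + run.accum k / (run.L k / 2)) =
          2 * (run.accum k / run.L k) := by field_simp; ring
      linarith
    linarith
  induction k with
  | zero =>
    by_cases hj : run.j 0 = 0
    · have hL : run.L 0 = L₀ := by rw [run.L_eq, hj]; simp [base]
      rw [(run.trial h0 0).1, hL]
      have : ε / M ^ 2 / 2 ≤ 1 / (2 * L₀) := by
        rw [div_div, div_le_div_iff₀ (by positivity) (by positivity)]
        rw [le_div_iff₀ hε] at hL0
        nlinarith
      have := Real.sqrt_nonneg (1 / (4 * L₀ ^ 2) + run.accum 0 / L₀)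
      linarith
    · exact hrej 0 hj
  | succ k ih =>
    by_cases hj : run.j (k + 1) = 0
    · have hL : run.L (k + 1) = run.L k / 2 := by rw [run.L_eq, hj]; simp [base]
      have hLk := run.L_pos h0 k
      have hf := run.facts h0 hP k
      refine ih.trans ?_
      rw [(run.trial h0 (k + 1)).1, hL, accum_succ, hf.2.2.1]
      have h1 : (run.z k).α ≤ Real.sqrt (1 / (4 * (run.L k / 2) ^ 2) +
          run.L k * (run.z k).α ^ 2 / (run.L k / 2)) := by
        apply Real.le_sqrt_of_sq_le
        have : run.L k * (run.z k).α ^ 2 / (run.L k / 2) = 2 * (run.z k).α ^ 2 := by field_simp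
        rw [this]
        have : 0 ≤ 1 / (4 * (run.L k / 2) ^ 2) := by positivity
        nlinarith [sq_nonneg (run.z k).α]
      have : 0 ≤ 1 / (2 * (run.L k / 2)) := by positivity
      linarith
    · exact hrej _ hj

theorem accum_ge_nonsmooth (k : ℕ) : k * (ε / M ^ 2 / 2) ≤ run.accum k := by
  rw [run.accum_eq h0]
  calc _ = ∑ i ∈ Finset.range k, ε / M ^ 2 / 2 := by simp
    _ ≤ _ := Finset.sum_le_sum fun i _ => run.weight_ge_nonsmooth h0 hP hns hM hε hL0 i

/-- Let `δ = ε/M²`. A constant of at least `A/δ² + 1/δ` forces a weight of at most `δ` and is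
accepted, so an accepted constant reached by doubling is at most twice that. The bound grows with
`A`, which is harmless because only its logarithm enters. -/
theorem L_le_nonsmooth (k : ℕ) :
    run.L k ≤ 2 * (run.accum k / (ε / M ^ 2) ^ 2 + 1 / (ε / M ^ 2)) := by
  have hrej : ∀ k, run.j k ≠ 0 →
      run.L k ≤ 2 * (run.accum k / (ε / M ^ 2) ^ 2 + 1 / (ε / M ^ 2)) := by
    intro k hj
    obtain ⟨c, hc, hna⟩ := run.exists_rejected h0 hP k hj
    by_contra hlt
    push Not at hlt
    have hs := run.state_mem h0 hP k
    have hL := run.L_pos h0 k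
    exact hna (hns.accepts_of_trial hP hM hε hs.1 (by linarith) hs.2.1 hs.2.2 (by linarith) hc)
  induction k with
  | zero =>
    by_cases hj : run.j 0 = 0
    · have hL : run.L 0 = L₀ := by rw [run.L_eq, hj]; simp [base]
      have h1 : 1 / (ε / M ^ 2) = M ^ 2 / ε := by field_simp
      have h2 : 0 < M ^ 2 / ε := by positivity
      simp only [hL, accum, h1, zero_div]; linarith
    · exact hrej 0 hj
  | succ k ih =>
    by_cases hj : run.j (k + 1) = 0
    · have hL : run.L (k + 1) = run.L k / 2 := by rw [run.L_eq, hj]; simp [base]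
      have hm : run.accum k ≤ run.accum (k + 1) := run.accum_mono h0 hP (Nat.le_succ k)
      have hLk := run.L_pos h0 k
      have : run.accum k / (ε / M ^ 2) ^ 2 ≤ run.accum (k + 1) / (ε / M ^ 2) ^ 2 := by gcongr
      linarith
    · exact hrej _ hj

theorem trials_le_nonsmooth (N : ℕ) {D : ℝ} (hD0 : 0 ≤ D) (hD : N ≠ 0 → run.accum N ≤ D) :
    (run.trials N : ℝ) ≤ 2 + 6 * (M ^ 2 * D / ε) + Real.logb 2 (M ^ 2 / ε / L₀) := by
  have hM2 : 0 < M ^ 2 := by positivity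
  have hN : run.accum N ≤ D := by
    rcases eq_or_ne N 0 with rfl | h
    · exact hD0
    · exact hD h
  have hN2 : (N : ℝ) ≤ 2 * (M ^ 2 * D / ε) := by
    have := (run.accum_ge_nonsmooth h0 hP hns hM hε hL0 N).trans hN
    rw [div_div, mul_div_assoc', div_le_iff₀ (by positivity)] at this
    rw [mul_div_assoc', le_div_iff₀ hε]; linarith
  have hL := run.L_le_nonsmooth h0 hP hns hM hε hL0 N
  have hx : 0 ≤ M ^ 2 * D / ε := by positivity
  have hL2 : run.L N / L₀ ≤ 2 * ((M ^ 2 / ε / L₀) * (1 + M ^ 2 * D / ε)) := by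
    rw [div_le_iff₀ h0]
    refine hL.trans ?_
    have : run.accum N / (ε / M ^ 2) ^ 2 ≤ D / (ε / M ^ 2) ^ 2 := by gcongr
    have e : 2 * (M ^ 2 / ε / L₀ * (1 + M ^ 2 * D / ε)) * L₀ =
      2 * (D / (ε / M ^ 2) ^ 2 + 1 / (ε / M ^ 2)) := by field_simp; ring
    rw [e]; linarith
  rw [run.trials_eq h0]
  have h1 : Real.logb 2 (run.L N / L₀) ≤ Real.logb 2 (2 * ((M ^ 2 / ε / L₀) * (1 + M ^ 2 * D / ε))) :=
    Real.logb_le_logb_of_le (by norm_num) (by have := run.L_pos h0 N; positivity) hL2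
  rw [Real.logb_mul (by norm_num) (by positivity), Real.logb_self_eq_one (by norm_num),
    Real.logb_mul (by positivity) (by positivity)] at h1
  -- The growth of the constants contributes `log₂ (1 + x) ≤ x / ln 2 ≤ 2x`; with `2N ≤ 4x` this
  -- makes the coefficient `6`.
  have h2 : Real.logb 2 (1 + M ^ 2 * D / ε) ≤ 2 * (M ^ 2 * D / ε) := by
    rw [Real.logb, div_le_iff₀ (Real.log_pos (by norm_num))]
    have h3 := Real.log_le_sub_one_of_pos (by positivity : 0 < 1 + M ^ 2 * D / ε)
    have h4 := Real.log_two_gt_d9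
    nlinarith
  linarith

end nonsmooth

end Run

end Composite
end Traffic

/-! ### The potential of the network: duality, smoothness, subgradients -/

namespace Traffic
namespace Network

variable {nV n m : ℕ} (net : Network nV n m)

theorem pathCost_sub (s t : Vec n) (p : List (Fin n)) :
    pathCost (s - t) p = pathCost s p - pathCost t p := by
  simp [pathCost, mul_sub, Finset.sum_sub_distrib]

theorem inner_flow (x : Fin m → List (Fin n) → ℝ) (t : Vec n) :
    inner ℝ (net.flow x) t = ∑ w, ∑ p ∈ net.paths w, x w p * pathCost t p := by
  rw [Composite.inner_eq_sum]
  simp only [flow, pathCost, Finset.sum_mul, Finset.mul_sum]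
  rw [Finset.sum_comm]
  refine Finset.sum_congr rfl fun w _ => ?_
  rw [Finset.sum_comm]
  exact Finset.sum_congr rfl fun p _ => Finset.sum_congr rfl fun e _ => by ring

theorem sum_sq_le_H {w : Fin m} {p : List (Fin n)} (hp : p ∈ net.paths w) :
    ∑ e : Fin n, (p.count e) ^ 2 ≤ net.H :=
  (Finset.le_sup (f := fun p : List (Fin n) => ∑ e : Fin n, (p.count e) ^ 2) hp).trans
    (Finset.le_sup (f := fun w => (net.paths w).sup fun p => ∑ e : Fin n, (p.count e) ^ 2)
      (Finset.mem_univ w))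

/-- An edge used `c` times contributes `c ≤ c²`. This lets `H` bound the length `ℓ` of the
recursions over walks. -/
theorem length_le_H {w : Fin m} {p : List (Fin n)} (hp : p ∈ net.paths w) : p.length ≤ net.H := by
  refine le_trans ?_ (net.sum_sq_le_H hp)
  rw [← Multiset.coe_card, ← Multiset.sum_count_eq_card (s := Finset.univ) (by simp)]
  exact Finset.sum_le_sum fun e _ => by
    simp only [Multiset.coe_count]; exact Nat.le_self_pow (by norm_num) _

theorem H_pos (hm : 0 < m) : 1 ≤ net.H := by
  obtain ⟨p, hp⟩ := net.paths_nonempty ⟨0, hm⟩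
  refine le_trans ?_ (net.length_le_H hp)
  have := net.isWalk _ _ hp
  cases p with
  | nil => exact absurd this (net.orig_ne_dest _)
  | cons e p => simp

theorem d_pos (hm : 0 < m) : 0 < net.d :=
  Finset.sum_pos (fun w _ => net.demand_pos w) ⟨⟨0, hm⟩, Finset.mem_univ _⟩

/-- Cauchy-Schwarz inequality for the column `Θ^(p)`, whose squared norm is at most `H`. All
constants with `H` originate here. -/
theorem abs_pathCost_le {w : Fin m} {p : List (Fin n)} (hp : p ∈ net.paths w) (v : Vec n) :
    |pathCost v p| ≤ Real.sqrt net.H * ‖v‖ := by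
  apply abs_le_of_sq_le_sq _ (by positivity)
  rw [mul_pow, Real.sq_sqrt (by positivity), Composite.norm_sq_eq_sum]
  refine (Finset.sum_mul_sq_le_sq_mul_sq _ _ _).trans ?_
  refine mul_le_mul_of_nonneg_right ?_ (Finset.sum_nonneg fun _ _ => sq_nonneg _)
  have := net.sum_sq_le_H hp
  simp only [theta]
  exact_mod_cast this

variable {net}

theorem abs_inner_flow_le {x : Fin m → List (Fin n) → ℝ} (hx : x ∈ net.X) (v : Vec n) :
    |inner ℝ (net.flow x) v| ≤ net.d * (Real.sqrt net.H * ‖v‖) := by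
  rw [inner_flow, d, Finset.sum_mul]
  refine (Finset.abs_sum_le_sum_abs _ _).trans (Finset.sum_le_sum fun w _ => ?_)
  rw [← (hx w).2, Finset.sum_mul]
  refine (Finset.abs_sum_le_sum_abs _ _).trans (Finset.sum_le_sum fun p hp => ?_)
  rw [abs_mul, abs_of_nonneg ((hx w).1 p hp)]
  exact mul_le_mul_of_nonneg_left (net.abs_pathCost_le hp v) ((hx w).1 p hp)

theorem norm_flow_le {x : Fin m → List (Fin n) → ℝ} (hx : x ∈ net.X) :
    ‖net.flow x‖ ≤ net.d * Real.sqrt net.H := by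
  have h := abs_inner_flow_le hx (net.flow x)
  rw [real_inner_self_eq_norm_sq, abs_of_nonneg (by positivity)] at h
  by_contra hlt
  push Not at hlt
  have h0 : 0 ≤ net.d := Finset.sum_nonneg fun w _ => (net.demand_pos w).le
  have : 0 < ‖net.flow x‖ := lt_of_le_of_lt (by positivity) hlt
  nlinarith

theorem flow_nonneg {x : Fin m → List (Fin n) → ℝ} (hx : x ∈ net.X) (e : Fin n) :
    0 ≤ net.flow x e := by
  change 0 ≤ ∑ w, ∑ p ∈ net.paths w, theta e p * x w p
  exact Finset.sum_nonneg fun w _ => Finset.sum_nonneg fun p hp =>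
    mul_nonneg (Nat.cast_nonneg _) ((hx w).1 p hp)

variable (net) in
/-- The partition function of a pair. -/
noncomputable def partition (γ : ℝ) (t : Vec n) (w : Fin m) : ℝ :=
  ∑ p ∈ net.paths w, Real.exp (-(pathCost t p) / γ)

theorem partition_pos (γ : ℝ) (t : Vec n) (w : Fin m) : 0 < net.partition γ t w :=
  Finset.sum_pos (fun _ _ => Real.exp_pos _) (net.paths_nonempty w)

theorem gibbs_pos (γ : ℝ) (t : Vec n) (w : Fin m) (p : List (Fin n)) : 0 < net.gibbs γ t w p :=
  mul_pos (net.demand_pos w) (div_pos (Real.exp_pos _) (partition_pos γ t w))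

theorem gibbs_mem (γ : ℝ) (t : Vec n) : net.gibbs γ t ∈ net.X := by
  refine fun w => ⟨fun p _ => (gibbs_pos γ t w p).le, ?_⟩
  have := (partition_pos (net := net) γ t w).ne'
  simp only [gibbs]
  rw [← Finset.mul_sum, ← Finset.sum_div]
  exact (mul_eq_left₀ (net.demand_pos w).ne').2 (div_self this)

theorem potential_of_pos {γ : ℝ} (hγ : 0 < γ) (t : Vec n) :
    net.potential γ t = γ * ∑ w, net.demand w * Real.log (net.partition γ t w) := by
  simp [potential, hγ.ne', partition]

theorem log_gibbs (γ : ℝ) (t : Vec n) (w : Fin m) (p : List (Fin n)) :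
    Real.log (net.gibbs γ t w p / net.demand w) =
      -(pathCost t p) / γ - Real.log (net.partition γ t w) := by
  have h1 := (net.demand_pos w).ne'
  have h2 := (partition_pos (net := net) γ t w).ne'
  change Real.log (net.demand w * (_ / net.partition γ t w) / _) = _
  rw [mul_div_cancel_left₀ _ h1, Real.log_div (Real.exp_pos _).ne' h2, Real.log_exp]

/-- The logit flow satisfies `ln (x_p / d_w) = -g_p/γ - ln Z_w`, so it attains equality in the
variational inequality `weak_pos`. -/
theorem potential_eq_gibbs {γ : ℝ} (hγ : 0 < γ) (t : Vec n) :
    net.potential γ t = -inner ℝ (net.flow (net.gibbs γ t)) t -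
      γ * net.entropy (net.gibbs γ t) := by
  rw [potential_of_pos hγ, inner_flow, entropy, Finset.mul_sum, Finset.mul_sum,
    ← Finset.sum_neg_distrib, ← Finset.sum_sub_distrib]
  refine Finset.sum_congr rfl fun w _ => ?_
  simp only [log_gibbs, mul_sub, Finset.sum_sub_distrib, ← Finset.sum_mul]
  rw [(gibbs_mem γ t w).2]
  have : γ * ∑ x ∈ net.paths w, net.gibbs γ t w x * (-pathCost t x / γ) =
      -∑ x ∈ net.paths w, net.gibbs γ t w x * pathCost t x := by
    rw [Finset.mul_sum, ← Finset.sum_neg_distrib]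
    refine Finset.sum_congr rfl fun p _ => ?_
    field_simp
  rw [this]; ring

/-- Gibbs' variational principle: apply `ln u ≤ u - 1` to the quotient of the logit flow and `x_p`,
multiply by `x_p` and sum. The right-hand sides cancel because both flows have total `d_w`. Paths
with `x_p = 0` are treated separately. -/
theorem weak_pos {γ : ℝ} (hγ : 0 < γ) (t : Vec n) {x : Fin m → List (Fin n) → ℝ}
    (hx : x ∈ net.X) :
    -inner ℝ (net.flow x) t - γ * net.entropy x ≤ net.potential γ t := by
  rw [potential_of_pos hγ, inner_flow, entropy, Finset.mul_sum, Finset.mul_sum,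
    ← Finset.sum_neg_distrib, ← Finset.sum_sub_distrib]
  refine Finset.sum_le_sum fun w _ => ?_
  have hZ := partition_pos (net := net) γ t w
  have hd := net.demand_pos w
  set Z := net.partition γ t w with hZdef
  have key : ∀ p ∈ net.paths w, x w p * (-(pathCost t p) / γ) - x w p * Real.log (x w p / net.demand w)
      - x w p * Real.log Z ≤ net.demand w * Real.exp (-(pathCost t p) / γ) / Z - x w p := by
    intro p hp
    rcases ((hx w).1 p hp).eq_or_lt with h0 | hpos
    · rw [← h0]; simp; positivity
    · have h1 := Real.log_le_sub_one_of_pos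
        (by positivity : 0 < net.demand w * Real.exp (-(pathCost t p) / γ) / Z / x w p)
      rw [Real.log_div (by positivity) hpos.ne', Real.log_div (by positivity) hZ.ne',
        Real.log_mul hd.ne' (by positivity), Real.log_exp] at h1
      rw [Real.log_div hpos.ne' hd.ne']
      have h2 := mul_le_mul_of_nonneg_left h1 hpos.le
      have h3 : x w p * (net.demand w * Real.exp (-(pathCost t p) / γ) / Z / x w p - 1) =
        net.demand w * Real.exp (-(pathCost t p) / γ) / Z - x w p := by field_simp
      rw [h3] at h2
      nlinarith
  have hs := Finset.sum_le_sum key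
  have hsum := (hx w).2
  simp only [Finset.sum_sub_distrib, ← Finset.sum_mul, ← Finset.sum_div, ← Finset.mul_sum] at hs
  rw [hsum] at hs
  have e1 : net.demand w * ∑ i ∈ net.paths w, Real.exp (-pathCost t i / γ) / Z - net.demand w = 0 := by
    rw [← Finset.sum_div]
    have : (∑ i ∈ net.paths w, Real.exp (-pathCost t i / γ)) / Z = 1 := div_self hZ.ne'
    rw [this]; ring
  have e1' : net.demand w * (∑ i ∈ net.paths w, Real.exp (-pathCost t i / γ)) / Z - net.demand w = 0 := by
    rw [← e1, ← Finset.sum_div]; ring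
  have hs' := mul_le_mul_of_nonneg_left hs hγ.le
  have e2 : γ * ∑ p ∈ net.paths w, x w p * (-pathCost t p / γ) =
      -∑ p ∈ net.paths w, x w p * pathCost t p := by
    rw [Finset.mul_sum, ← Finset.sum_neg_distrib]
    exact Finset.sum_congr rfl fun p _ => by field_simp
  rw [e1', mul_zero, mul_sub, mul_sub, e2] at hs'
  linarith

theorem exp_le_chord {b R : ℝ} (hR : 0 < R) (hb : |b| ≤ R) :
    Real.exp b ≤ Real.cosh R + b * (Real.sinh R / R) := by
  obtain ⟨h1, h2⟩ := abs_le.1 hb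
  have := convexOn_exp.2 (Set.mem_univ R) (Set.mem_univ (-R))
    (div_nonneg (by linarith) (by positivity) : 0 ≤ (R + b) / (2 * R))
    (div_nonneg (by linarith) (by positivity) : 0 ≤ (R - b) / (2 * R)) (by field_simp; ring)
  simp only [smul_eq_mul] at this
  have e : (R + b) / (2 * R) * R + (R - b) / (2 * R) * -R = b := by field_simp; ring
  rw [e] at this
  refine this.trans (le_of_eq ?_)
  rw [Real.cosh_eq, Real.sinh_eq]; field_simp; ring

/-- A version of Hoeffding's lemma for finitely supported distributions. -/
theorem log_sum_exp_le {ι : Type*} (s : Finset ι) (q a : ι → ℝ) {r : ℝ} (hr : 0 < r)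
    (hq : ∀ i ∈ s, 0 ≤ q i) (hq1 : ∑ i ∈ s, q i = 1) (ha : ∀ i ∈ s, |a i| ≤ r) :
    Real.log (∑ i ∈ s, q i * Real.exp (a i)) ≤ ∑ i ∈ s, q i * a i + (2 * r) ^ 2 / 2 := by
  set μ := ∑ i ∈ s, q i * a i with hμ
  have hμr : |μ| ≤ r := by
    calc |μ| ≤ ∑ i ∈ s, |q i * a i| := Finset.abs_sum_le_sum_abs _ _
      _ ≤ ∑ i ∈ s, q i * r := Finset.sum_le_sum fun i hi => by
          rw [abs_mul, abs_of_nonneg (hq i hi)]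
          exact mul_le_mul_of_nonneg_left (ha i hi) (hq i hi)
      _ = r := by rw [← Finset.sum_mul, hq1, one_mul]
  -- The centred values lie in `[-2r, 2r]`. Replacing the exponential by its chord leaves only `cosh
  -- (2r)`, since the linear part has mean zero.
  have h1 : ∑ i ∈ s, q i * Real.exp (a i - μ) ≤ Real.cosh (2 * r) := by
    calc _ ≤ ∑ i ∈ s, q i * (Real.cosh (2 * r) + (a i - μ) * (Real.sinh (2 * r) / (2 * r))) :=
          Finset.sum_le_sum fun i hi => mul_le_mul_of_nonneg_left
            (exp_le_chord (by positivity) (by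
              have h1 := abs_le.1 (ha i hi); have h2 := abs_le.1 hμr
              rw [abs_le]; constructor <;> linarith)) (hq i hi)
      _ = Real.cosh (2 * r) * ∑ i ∈ s, q i +
          (∑ i ∈ s, q i * a i - μ * ∑ i ∈ s, q i) * (Real.sinh (2 * r) / (2 * r)) := by
        rw [Finset.mul_sum, Finset.mul_sum, ← Finset.sum_sub_distrib, Finset.sum_mul,
          ← Finset.sum_add_distrib]
        exact Finset.sum_congr rfl fun i _ => by ring
      _ = Real.cosh (2 * r) := by rw [hq1]; simp [hμ]
  have h2 : ∑ i ∈ s, q i * Real.exp (a i) = Real.exp μ * ∑ i ∈ s, q i * Real.exp (a i - μ) := by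
    rw [Finset.mul_sum]
    refine Finset.sum_congr rfl fun i _ => ?_
    rw [Real.exp_sub]; field_simp
  have h3 : ∑ i ∈ s, q i * Real.exp (a i) ≤ Real.exp (μ + (2 * r) ^ 2 / 2) := by
    rw [h2, Real.exp_add]
    exact mul_le_mul_of_nonneg_left (h1.trans (Real.cosh_le_exp_half_sq _)) (Real.exp_pos _).le
  have h4 : 0 < ∑ i ∈ s, q i * Real.exp (a i) := by
    obtain ⟨i, hi, hne⟩ : ∃ i ∈ s, q i ≠ 0 := by
      by_contra hcon
      push Not at hcon
      rw [Finset.sum_eq_zero hcon] at hq1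
      exact zero_ne_one hq1
    exact Finset.sum_pos' (fun i hi => mul_nonneg (hq i hi) (Real.exp_pos _).le)
      ⟨i, hi, mul_pos (lt_of_le_of_ne (hq i hi) hne.symm) (Real.exp_pos _)⟩
  rw [← Real.log_exp (μ + (2 * r) ^ 2 / 2)]
  exact Real.log_le_log h4 h3

/-- For each pair, `ln Z_w(t) - ln Z_w(y)` is the logarithm of an exponential moment of `-g_p(t -
y)/γ` under the logit distribution at `y`. Hoeffding's lemma with `r = √H ‖t - y‖ / γ` bounds it by
the mean plus `2 r²`, and the mean gives the linear term. The resulting factor `4` only affects the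
absolute constant. -/
theorem smooth_pos {γ : ℝ} (hγ : 0 < γ) (hm : 0 < m) (y t : Vec n) :
    net.potential γ t ≤ net.potential γ y + inner ℝ (-net.flow (net.gibbs γ y)) (t - y) +
      4 * (net.H * net.d / γ) / 2 * ‖t - y‖ ^ 2 := by
  rcases eq_or_ne t y with rfl | hne
  · simp
  have hv : 0 < ‖t - y‖ := norm_pos_iff.2 (sub_ne_zero.2 hne)
  have hH : (0 : ℝ) < net.H := by exact_mod_cast net.H_pos hm
  set r := Real.sqrt net.H * ‖t - y‖ / γ with hr
  have hr0 : 0 < r := by positivity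
  have key : ∀ w, Real.log (net.partition γ t w) ≤ Real.log (net.partition γ y w) +
      ∑ p ∈ net.paths w, net.gibbs γ y w p / net.demand w * (-(pathCost (t - y) p) / γ) +
        (2 * r) ^ 2 / 2 := by
    intro w
    have hZ := partition_pos (net := net) γ y w
    have hZt := partition_pos (net := net) γ t w
    have hd := net.demand_pos w
    have h1 := log_sum_exp_le (net.paths w) (fun p => net.gibbs γ y w p / net.demand w)
      (fun p => -(pathCost (t - y) p) / γ) hr0
      (fun p _ => (div_pos (gibbs_pos γ y w p) hd).le)
      (by rw [← Finset.sum_div, (gibbs_mem γ y w).2, div_self hd.ne'])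
      (fun p hp => by
        rw [abs_div, abs_neg, abs_of_pos hγ, hr]
        have := net.abs_pathCost_le hp (t - y)
        gcongr)
    have h2 : ∑ p ∈ net.paths w, net.gibbs γ y w p / net.demand w *
        Real.exp (-(pathCost (t - y) p) / γ) = net.partition γ t w / net.partition γ y w := by
      rw [partition, Finset.sum_div]
      refine Finset.sum_congr rfl fun p _ => ?_
      rw [gibbs, mul_div_cancel_left₀ _ hd.ne', div_mul_eq_mul_div, ← Real.exp_add, pathCost_sub]
      congr 2
      ring
    rw [h2, Real.log_div hZt.ne' hZ.ne'] at h1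
    linarith
  have hs := Finset.sum_le_sum fun w (_ : w ∈ Finset.univ) =>
    mul_le_mul_of_nonneg_left (key w) (net.demand_pos w).le
  have hs' := mul_le_mul_of_nonneg_left hs hγ.le
  rw [← potential_of_pos hγ] at hs'
  refine hs'.trans (le_of_eq ?_)
  rw [inner_neg_left, inner_flow, potential_of_pos hγ]
  simp only [mul_add, Finset.sum_add_distrib, ← Finset.sum_mul]
  have e1 : γ * ∑ w, net.demand w * ∑ p ∈ net.paths w,
      net.gibbs γ y w p / net.demand w * (-(pathCost (t - y) p) / γ) =
      -∑ w, ∑ p ∈ net.paths w, net.gibbs γ y w p * pathCost (t - y) p := by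
    rw [Finset.mul_sum, ← Finset.sum_neg_distrib]
    refine Finset.sum_congr rfl fun w _ => ?_
    rw [Finset.mul_sum, Finset.mul_sum, ← Finset.sum_neg_distrib]
    refine Finset.sum_congr rfl fun p _ => ?_
    have := (net.demand_pos w).ne'
    field_simp
  have e2 : γ * (net.d * ((2 * r) ^ 2 / 2)) = 4 * (net.H * net.d / γ) / 2 * ‖t - y‖ ^ 2 := by
    rw [hr, div_eq_mul_inv _ γ, mul_pow, mul_pow, mul_pow, Real.sq_sqrt hH.le]; field_simp; norm_num
  rw [e1]
  simp only [d] at e2 ⊢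
  linarith

/-- The variational inequality at `t`, tested with the logit flow of `y`, for which equality holds
at `y`. -/
theorem lower_pos {γ : ℝ} (hγ : 0 < γ) (y t : Vec n) :
    net.potential γ y + inner ℝ (-net.flow (net.gibbs γ y)) (t - y) ≤ net.potential γ t := by
  have h1 := weak_pos hγ t (gibbs_mem (net := net) γ y)
  rw [potential_eq_gibbs hγ y, inner_neg_left, inner_sub_right]
  linarith

/-- The potential lies between an affine function and the same function plus a quadratic term, so
the affine part is the derivative. -/
theorem gradient_potential {γ : ℝ} (hγ : 0 < γ) (hm : 0 < m) (t : Vec n) :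
    gradient (net.potential γ) t = -net.flow (net.gibbs γ t) := by
  apply HasGradientAt.gradient
  rw [hasGradientAt_iff_isLittleO, Asymptotics.isLittleO_iff]
  intro c hc
  set K := 4 * (net.H * net.d / γ) / 2 with hK
  have hK0 : 0 < K := by
    have hH : (0 : ℝ) < net.H := by exact_mod_cast net.H_pos hm
    have := net.d_pos hm
    positivity
  filter_upwards [Metric.ball_mem_nhds t (by positivity : 0 < c / K)] with s hs
  have h1 := smooth_pos (net := net) hγ hm t s
  have h2 := lower_pos (net := net) hγ t s
  rw [← hK] at h1
  rw [mem_ball_iff_norm, lt_div_iff₀ hK0] at hs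
  rw [Real.norm_eq_abs, abs_of_nonneg (by linarith)]
  nlinarith [norm_nonneg (s - t)]

theorem convex_X : Convex ℝ net.X := by
  intro x hx y hy a b ha hb hab w
  refine ⟨fun p hp => ?_, ?_⟩
  · have := (hx w).1 p hp; have := (hy w).1 p hp
    simp only [Pi.add_apply, Pi.smul_apply, smul_eq_mul]; positivity
  · simp only [Pi.add_apply, Pi.smul_apply, smul_eq_mul, Finset.sum_add_distrib, ← Finset.mul_sum,
      (hx w).2, (hy w).2]
    rw [← add_mul, hab, one_mul]

variable (net) in
/-- The map `x ↦ Θ x` as a linear map. -/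
def flowₗ : (Fin m → List (Fin n) → ℝ) →ₗ[ℝ] Vec n where
  toFun := net.flow
  map_add' x y := by
    ext e; simp [flow, mul_add, Finset.sum_add_distrib]
  map_smul' a x := by
    ext e
    simp only [flow, Pi.smul_apply, smul_eq_mul, RingHom.id_apply, PiLp.smul_apply, Finset.mul_sum]
    exact Finset.sum_congr rfl fun w _ => Finset.sum_congr rfl fun p _ => by ring

/-- Members of `X` are unconstrained off the admissible paths, so `X` is not compact. Setting these
irrelevant values to `0` keeps the flow and leads to a closed subset of a compact box. -/
theorem isClosed_flow_image : IsClosed (net.flow '' net.X) := by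
  classical
  let B : Set (Fin m → List (Fin n) → ℝ) := Set.univ.pi fun w => Set.univ.pi fun p =>
    if p ∈ net.paths w then Set.Icc 0 (net.demand w) else {0}
  have hB : IsCompact B := isCompact_univ_pi fun w => isCompact_univ_pi fun p => by
    split_ifs
    · exact isCompact_Icc
    · exact isCompact_singleton
  have hC : IsClosed {x : Fin m → List (Fin n) → ℝ |
      ∀ w, ∑ p ∈ net.paths w, x w p = net.demand w} := by
    simp only [Set.ofPred_forall]
    exact isClosed_iInter fun w => isClosed_eq (by fun_prop) continuous_const
  have hcont : Continuous net.flow := by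
    unfold flow
    fun_prop
  have himg : net.flow '' net.X = net.flow '' (B ∩ {x : Fin m → List (Fin n) → ℝ |
      ∀ w, ∑ p ∈ net.paths w, x w p = net.demand w}) := by
    apply Set.Subset.antisymm
    · rintro _ ⟨x, hx, rfl⟩
      refine ⟨fun w p => if p ∈ net.paths w then x w p else 0, ⟨?_, ?_⟩, ?_⟩
      · intro w _ p _
        by_cases hp : p ∈ net.paths w
        · simp only [hp, if_true]
          refine ⟨(hx w).1 p hp, ?_⟩
          rw [← (hx w).2]
          exact Finset.single_le_sum (f := x w) (fun q hq => (hx w).1 q hq) hp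
        · simp [hp]
      · intro w
        rw [← (hx w).2]
        exact Finset.sum_congr rfl fun p hp => by simp [hp]
      · ext e
        simp only [flow]
        exact Finset.sum_congr rfl fun w _ => Finset.sum_congr rfl fun p hp => by simp [hp]
    · rintro _ ⟨x, ⟨hxB, hxC⟩, rfl⟩
      refine ⟨x, fun w => ⟨fun p hp => ?_, hxC w⟩, rfl⟩
      have := hxB w trivial p trivial
      simp only [hp, if_true] at this
      exact this.1
  rw [himg]
  exact ((hB.inter_right hC).image hcont).isClosed

theorem weak_zero (t : Vec n) {x : Fin m → List (Fin n) → ℝ} (hx : x ∈ net.X) :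
    -inner ℝ (net.flow x) t ≤ net.potential 0 t := by
  rw [potential, if_pos rfl, inner_flow]
  apply neg_le_neg
  refine Finset.sum_le_sum fun w _ => ?_
  rw [← (hx w).2, Finset.sum_mul]
  exact Finset.sum_le_sum fun p hp =>
    mul_le_mul_of_nonneg_left (Finset.inf'_le _ hp) ((hx w).1 p hp)

theorem weak {γ : ℝ} (hγ : 0 ≤ γ) (t : Vec n) {x : Fin m → List (Fin n) → ℝ} (hx : x ∈ net.X) :
    -inner ℝ (net.flow x) t - γ * net.entropy x ≤ net.potential γ t := by
  rcases hγ.eq_or_lt with rfl | h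
  · simpa using weak_zero t hx
  · exact weak_pos h t hx

variable (net) in
/-- The path flow that sends all the demand of a pair along one path. -/
noncomputable def single (q : Fin m → List (Fin n)) (w : Fin m) (p : List (Fin n)) : ℝ :=
  open Classical in if p = q w then net.demand w else 0

theorem single_mem {q : Fin m → List (Fin n)} (hq : ∀ w, q w ∈ net.paths w) :
    net.single q ∈ net.X := by
  classical
  refine fun w => ⟨fun p _ => ?_, ?_⟩
  · unfold single; split_ifs
    · exact (net.demand_pos w).le
    · exact le_rfl
  · simp [single, hq w]

theorem inner_flow_single {q : Fin m → List (Fin n)} (hq : ∀ w, q w ∈ net.paths w) (t : Vec n) :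
    inner ℝ (net.flow (net.single q)) t = ∑ w, net.demand w * pathCost t (q w) := by
  classical
  rw [inner_flow]
  refine Finset.sum_congr rfl fun w _ => ?_
  simp [single, hq w, ite_mul]

theorem flow_single {q : Fin m → List (Fin n)} (hq : ∀ w, q w ∈ net.paths w) (e : Fin n) :
    net.flow (net.single q) e = ∑ w, net.demand w * theta e (q w) := by
  classical
  simp only [flow]
  refine Finset.sum_congr rfl fun w _ => ?_
  simp [single, hq w, mul_ite, mul_comm]

theorem potential_zero_of_min {q : Fin m → List (Fin n)} (hq : ∀ w, q w ∈ net.paths w) {t : Vec n}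
    (hmin : ∀ w, ∀ p ∈ net.paths w, pathCost t (q w) ≤ pathCost t p) :
    net.potential 0 t = -inner ℝ (net.flow (net.single q)) t := by
  rw [inner_flow_single hq, potential, if_pos rfl]
  congr 1
  refine Finset.sum_congr rfl fun w _ => ?_
  congr 1
  exact le_antisymm (Finset.inf'_le _ (hq w)) (Finset.le_inf' _ _ (hmin w))

theorem exists_min_flow (t : Vec n) : ∃ x ∈ net.X, net.potential 0 t = -inner ℝ (net.flow x) t := by
  choose q hq hmin using fun w =>
    Finset.exists_min_image (net.paths w) (pathCost t) (net.paths_nonempty w)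
  exact ⟨_, single_mem hq, potential_zero_of_min hq hmin⟩

theorem isSubgradientAt_of_min {x : Fin m → List (Fin n) → ℝ} (hx : x ∈ net.X) {t : Vec n}
    (h : net.potential 0 t = -inner ℝ (net.flow x) t) :
    IsSubgradientAt (net.potential 0) (-net.flow x) t := by
  intro s
  rw [h, inner_neg_left, inner_sub_right]
  linarith [weak_zero s hx]

/-- For `γ = 0` the potential is positively homogeneous; the subgradient inequality at `2t` and at
`0` gives the two directions. -/
theorem subgradient_inner {g t : Vec n} (hg : IsSubgradientAt (net.potential 0) g t) :
    net.potential 0 t = inner ℝ g t := by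
  obtain ⟨x, hx, h2⟩ := exists_min_flow (net := net) ((2 : ℝ) • t)
  obtain ⟨x0, hx0, h0⟩ := exists_min_flow (net := net) (0 : Vec n)
  have h3 := weak_zero t hx
  have h4 := hg ((2 : ℝ) • t)
  have h5 := hg 0
  rw [h2, two_smul, add_sub_cancel_right, inner_add_right] at h4
  rw [h0, inner_zero_right, zero_sub, inner_neg_right] at h5
  linarith

/-- The potential is the support function of `-Θ(X)`, a closed convex set. A subgradient outside of
it could be separated by a direction `v`, and at `v` the subgradient inequality would fail. Thus an
arbitrary selection of subgradients still consists of flows. -/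
theorem subgradient_mem {g t : Vec n} (hg : IsSubgradientAt (net.potential 0) g t) :
    ∃ x ∈ net.X, net.flow x = -g := by
  by_contra hcon
  have hnot : -g ∉ net.flow '' net.X := fun ⟨x, hx, h⟩ => hcon ⟨x, hx, h⟩
  have hconv : Convex ℝ (net.flow '' net.X) := convex_X.linear_image net.flowₗ
  obtain ⟨f, u, hu1, hu2⟩ := geometric_hahn_banach_point_closed hconv isClosed_flow_image hnot
  set v := (InnerProductSpace.toDual ℝ (Vec n)).symm f with hv
  have hf : ∀ s, f s = inner ℝ v s := fun s => by rw [hv, InnerProductSpace.toDual_symm_apply]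
  obtain ⟨x, hx, h⟩ := exists_min_flow (net := net) v
  have h1 := hu2 _ ⟨x, hx, rfl⟩
  have h2 := hg v
  rw [subgradient_inner hg, h, inner_sub_right] at h2
  rw [hf, real_inner_comm] at h1 hu1
  rw [inner_neg_left] at hu1
  linarith

/-- Both the subgradient at `y` and a minimizing flow at `t` act on `t - y` by at most `d √H ‖t -
y‖`; the factor `2` is their sum. -/
theorem lipschitz_zero {g y t : Vec n} (hg : IsSubgradientAt (net.potential 0) g y) :
    net.potential 0 t ≤ net.potential 0 y + inner ℝ g (t - y) +
      2 * (net.d * Real.sqrt net.H) * ‖t - y‖ := by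
  obtain ⟨x, hx, hxt⟩ := exists_min_flow (net := net) t
  obtain ⟨x', hx', hxg⟩ := subgradient_mem hg
  have h1 := weak_zero y hx
  have h2 : |inner ℝ (net.flow x) (t - y)| ≤ net.d * (Real.sqrt net.H * ‖t - y‖) :=
    abs_inner_flow_le hx _
  have h3 : |inner ℝ (net.flow x') (t - y)| ≤ net.d * (Real.sqrt net.H * ‖t - y‖) :=
    abs_inner_flow_le hx' _
  rw [hxg, inner_neg_left, abs_neg] at h3
  rw [inner_sub_right] at h2
  have := abs_le.1 h2
  have := abs_le.1 h3
  rw [hxt]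
  linarith

/-- Jensen's inequality for the convex function `u ln u` at `u = x_p / d_w`, scaled by `d_w`. -/
theorem entropy_average {ι : Type*} (s : Finset ι) (a : ι → ℝ) (x : ι → Fin m → List (Fin n) → ℝ)
    (ha : ∀ i ∈ s, 0 ≤ a i) (ha1 : ∑ i ∈ s, a i = 1) (hx : ∀ i ∈ s, x i ∈ net.X) :
    net.entropy (fun w p => ∑ i ∈ s, a i * x i w p) ≤ ∑ i ∈ s, a i * net.entropy (x i) := by
  simp only [entropy, Finset.mul_sum]
  rw [Finset.sum_comm]
  refine Finset.sum_le_sum fun w _ => ?_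
  rw [Finset.sum_comm]
  refine Finset.sum_le_sum fun p hp => ?_
  have hd := net.demand_pos w
  have := Real.convexOn_mul_log.map_sum_le ha ha1
    (p := fun i => x i w p / net.demand w)
    (fun i hi => div_nonneg ((hx i hi w).1 p hp) hd.le)
  simp only [smul_eq_mul] at this
  have e : ∑ i ∈ s, a i * (x i w p / net.demand w) = (∑ i ∈ s, a i * x i w p) / net.demand w := by
    rw [Finset.sum_div]; exact Finset.sum_congr rfl fun i _ => by ring
  rw [e] at this
  have h2 := mul_le_mul_of_nonneg_left this hd.le
  have e2 : net.demand w * ((∑ i ∈ s, a i * x i w p) / net.demand w *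
      Real.log ((∑ i ∈ s, a i * x i w p) / net.demand w)) = (∑ i ∈ s, a i * x i w p) *
      Real.log ((∑ i ∈ s, a i * x i w p) / net.demand w) := by field_simp
  rw [e2, Finset.mul_sum] at h2
  refine h2.trans (le_of_eq (Finset.sum_congr rfl fun i _ => ?_))
  field_simp

theorem average_mem {ι : Type*} (s : Finset ι) (a : ι → ℝ) (x : ι → Fin m → List (Fin n) → ℝ)
    (ha : ∀ i ∈ s, 0 ≤ a i) (ha1 : ∑ i ∈ s, a i = 1) (hx : ∀ i ∈ s, x i ∈ net.X) :
    (∑ i ∈ s, a i • x i) ∈ net.X :=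
  convex_X.sum_mem ha ha1 hx

theorem flow_average {ι : Type*} (s : Finset ι) (a : ι → ℝ) (x : ι → Fin m → List (Fin n) → ℝ) :
    net.flow (∑ i ∈ s, a i • x i) = ∑ i ∈ s, a i • net.flow (x i) := by
  have := map_sum net.flowₗ (fun i => a i • x i) s
  simp only [map_smul] at this
  exact this

end Network
end Traffic

/-! ### Conjugate costs and the scalar problems of the two models -/

namespace Traffic
namespace Beckmann

variable {nV n m : ℕ} (B : Beckmann n)

theorem intervalIntegrable {e : Fin n} {a b : ℝ} (ha : 0 ≤ a) (hb : 0 ≤ b) :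
    IntervalIntegrable (B.τ e) MeasureTheory.volume a b := by
  apply ContinuousOn.intervalIntegrable
  refine (B.continuousOn e).mono fun x hx => ?_
  rw [Set.mem_uIcc] at hx
  rcases hx with h | h
  · exact ha.trans h.1
  · exact hb.trans h.1

/-- Since `τ_e` is nondecreasing, its integral lies above the tangent at `f`. So the supremum
defining `σ_e^*` at `τ_e(f)` is attained at `f`; in particular `τ_e(f)` belongs to the domain and
equality holds in Fenchel's inequality. -/
theorem fenchel_le (e : Fin n) {f f' : ℝ} (hf : 0 ≤ f) (hf' : 0 ≤ f') :
    B.τ e f * f' - B.σ e f' ≤ B.τ e f * f - B.σ e f := by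
  have h1 : B.σ e f' - B.σ e f = ∫ z in f..f', B.τ e z :=
    intervalIntegral.integral_interval_sub_left (B.intervalIntegrable le_rfl hf')
      (B.intervalIntegrable le_rfl hf)
  have h2 : B.τ e f * (f' - f) ≤ ∫ z in f..f', B.τ e z := by
    rcases le_total f f' with h | h
    · have := intervalIntegral.integral_mono_on h (intervalIntegrable_const (c := B.τ e f))
        (B.intervalIntegrable hf hf') (fun x hx => B.monotoneOn e hf (hf.trans hx.1) hx.1)
      rw [intervalIntegral.integral_const, smul_eq_mul] at this
      linarith
    · have := intervalIntegral.integral_mono_on h (B.intervalIntegrable hf' hf)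
        (intervalIntegrable_const (c := B.τ e f))
        (fun x hx => B.monotoneOn e (hf'.trans hx.1) hf hx.2)
      rw [intervalIntegral.integral_const, smul_eq_mul] at this
      rw [intervalIntegral.integral_symm]
      linarith
  linarith

theorem le_σStar {e : Fin n} {s f : ℝ} (hs : s ∈ B.dom e) (hf : 0 ≤ f) :
    s * f - B.σ e f ≤ B.σStar e s :=
  le_csSup hs.2 ⟨f, hf, rfl⟩

theorem σStar_le {e : Fin n} {s v : ℝ} (h : ∀ f, 0 ≤ f → s * f - B.σ e f ≤ v) :
    B.σStar e s ≤ v :=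
  csSup_le ⟨_, 0, Set.mem_Ici.2 le_rfl, rfl⟩ (by rintro _ ⟨f, hf, rfl⟩; exact h f hf)

theorem mem_dom_of_le {e : Fin n} {s v : ℝ} (h0 : B.freeTime e ≤ s)
    (h : ∀ f, 0 ≤ f → s * f - B.σ e f ≤ v) : s ∈ B.dom e :=
  ⟨h0, v, by rintro _ ⟨f, hf, rfl⟩; exact h f hf⟩

theorem τ_mem_dom (e : Fin n) {f : ℝ} (hf : 0 ≤ f) : B.τ e f ∈ B.dom e :=
  B.mem_dom_of_le (B.monotoneOn e (Set.mem_Ici.2 le_rfl) hf hf) fun _ hf' => B.fenchel_le e hf hf'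

theorem σStar_τ (e : Fin n) {f : ℝ} (hf : 0 ≤ f) :
    B.σStar e (B.τ e f) = B.τ e f * f - B.σ e f :=
  le_antisymm (B.σStar_le fun _ hf' => B.fenchel_le e hf hf') (B.le_σStar (B.τ_mem_dom e hf) hf)

theorem convexOn_σStar (e : Fin n) : ConvexOn ℝ (B.dom e) (B.σStar e) := by
  have key : ∀ s ∈ B.dom e, ∀ s' ∈ B.dom e, ∀ a b : ℝ, 0 ≤ a → 0 ≤ b → a + b = 1 → ∀ f, 0 ≤ f →
      (a * s + b * s') * f - B.σ e f ≤ a * B.σStar e s + b * B.σStar e s' := by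
    intro s hs s' hs' a b ha hb hab f hf
    have h1 := mul_le_mul_of_nonneg_left (B.le_σStar hs hf) ha
    have h2 := mul_le_mul_of_nonneg_left (B.le_σStar hs' hf) hb
    have : B.σ e f = a * B.σ e f + b * B.σ e f := by rw [← add_mul, hab, one_mul]
    nlinarith
  refine ⟨fun s hs s' hs' a b ha hb hab => ?_, fun s hs s' hs' a b ha hb hab => ?_⟩
  · refine B.mem_dom_of_le ?_ (key s hs s' hs' a b ha hb hab)
    have h1 := mul_le_mul_of_nonneg_left hs.1 ha
    have h2 := mul_le_mul_of_nonneg_left hs'.1 hb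
    have : B.freeTime e = a * B.freeTime e + b * B.freeTime e := by rw [← add_mul, hab, one_mul]
    simp only [smul_eq_mul]; linarith
  · exact B.σStar_le (key s hs s' hs' a b ha hb hab)

/-- Here `σ_e^*` is known only as a supremum of affine functions on a domain that need not be
closed. The sublevel set of the objective at `t̄_e` is nevertheless compact, because it is described
by closed conditions, one for each `f`, which also force membership in the domain. On this set the
objective is lower semicontinuous, as a supremum of continuous functions. -/
theorem exists_min_prox (e : Fin n) {a : ℝ} (c : ℝ) (ha : 0 < a) :
    ∃ s ∈ B.dom e, ∀ s' ∈ B.dom e,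
      a * B.σStar e s + c * s + 1 / 2 * (s - B.freeTime e) ^ 2 ≤
        a * B.σStar e s' + c * s' + 1 / 2 * (s' - B.freeTime e) ^ 2 := by
  set b := B.freeTime e with hb
  have hbd : b ∈ B.dom e := B.τ_mem_dom e le_rfl
  let J : ℝ → ℝ := fun s => a * B.σStar e s + c * s + 1 / 2 * (s - b) ^ 2
  let g : ℝ → ℝ → ℝ := fun f s => a * (s * f - B.σ e f) + c * s + 1 / 2 * (s - b) ^ 2
  have hg : ∀ f, Continuous (g f) := fun f => by fun_prop
  have hgJ : ∀ s ∈ B.dom e, ∀ f, 0 ≤ f → g f s ≤ J s := by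
    intro s hs f hf
    have := mul_le_mul_of_nonneg_left (B.le_σStar hs hf) ha.le
    simp only [g, J]; linarith
  let S : Set ℝ := Set.Ici b ∩ ⋂ f ∈ Set.Ici (0 : ℝ), {s | g f s ≤ J b}
  have hSdom : ∀ s ∈ S, s ∈ B.dom e := by
    intro s hs
    refine B.mem_dom_of_le (v := (J b - c * s - 1 / 2 * (s - b) ^ 2) / a) hs.1 fun f hf => ?_
    have h1 : g f s ≤ J b := Set.mem_iInter₂.1 hs.2 f hf
    rw [le_div_iff₀ ha]
    simp only [g] at h1; linarith
  have hSJ : ∀ s, s ∈ B.dom e → J s ≤ J b → s ∈ S := fun s hs hJ =>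
    ⟨hs.1, Set.mem_iInter₂.2 fun f hf => (hgJ s hs f hf).trans hJ⟩
  have hclosed : IsClosed S := isClosed_Ici.inter
    (isClosed_biInter fun f _ => isClosed_le (hg f) continuous_const)
  have hσ0 : B.σ e 0 = 0 := by simp [σ]
  -- The condition for `f = 0` reads `c s + ½ (s - b)² ≤ J b`, which bounds `s` from above.
  have hbdd : S ⊆ Set.Icc b (b + 2 * |c| + 2 * |J b - c * b| + 2) := by
    intro s hs
    refine ⟨hs.1, ?_⟩
    have h1 : g 0 s ≤ J b := Set.mem_iInter₂.1 hs.2 0 (Set.mem_Ici.2 le_rfl)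
    simp only [g, hσ0, mul_zero, sub_zero, zero_add] at h1
    have h2 : 0 ≤ s - b := sub_nonneg.2 hs.1
    have h3 := neg_abs_le c
    have h4 := le_abs_self (J b - c * b)
    have h5 := abs_nonneg c
    have h6 := abs_nonneg (J b - c * b)
    by_contra hlt
    push Not at hlt
    have h7 : 2 * |c| + 2 * |J b - c * b| + 2 < s - b := by linarith
    nlinarith
  have hcomp : IsCompact S := isCompact_Icc.of_isClosed_subset hclosed hbdd
  have hlsc : LowerSemicontinuousOn J S := by
    intro s hs y hy
    have hsd := hSdom s hs
    have h1 : (y - c * s - 1 / 2 * (s - b) ^ 2) / a < B.σStar e s := by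
      rw [div_lt_iff₀ ha]; simp only [J] at hy; linarith
    obtain ⟨_, ⟨f, hf, rfl⟩, hlt⟩ := exists_lt_of_lt_csSup
      (s := (fun f => s * f - B.σ e f) '' Set.Ici 0) ⟨_, 0, Set.mem_Ici.2 le_rfl, rfl⟩ h1
    rw [div_lt_iff₀ ha] at hlt
    have h2 : y < g f s := by simp only [g]; linarith
    have h3 := (hg f).continuousAt.eventually (lt_mem_nhds h2)
    filter_upwards [nhdsWithin_le_nhds h3, self_mem_nhdsWithin] with s' hs' hsS
    exact lt_of_lt_of_le hs' (hgJ s' (hSdom s' hsS) f hf)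
  obtain ⟨s, hsS, hmin⟩ := hlsc.exists_isMinOn ⟨b, hSJ b hbd le_rfl⟩ hcomp
  refine ⟨s, hSdom s hsS, fun s' hs' => ?_⟩
  change J s ≤ J s'
  rcases le_total (J s') (J b) with h | h
  · exact hmin (hSJ s' hs' h)
  · exact (hmin (hSJ b hbd le_rfl)).trans h

variable (net : Network nV n m) {γ : ℝ} {G : Vec n → Vec n}

theorem isProx_prox (e : Fin n) {a : ℝ} (c : ℝ) (ha : 0 < a) :
    (B.dual net γ G).IsProx e a c (B.prox e a c) := by
  have := Classical.epsilon_spec (p := fun s => s ∈ B.dom e ∧ ∀ s' ∈ B.dom e,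
    a * B.σStar e s + c * s + 1 / 2 * (s - B.freeTime e) ^ 2 ≤
      a * B.σStar e s' + c * s' + 1 / 2 * (s' - B.freeTime e) ^ 2) (B.exists_min_prox e c ha)
  exact this

theorem regular (hG : ∀ t ∈ (B.dual net γ G).Q, IsSubgradientAt (net.potential γ) (G t) t) :
    (B.dual net γ G).Regular where
  start_mem e := B.τ_mem_dom e le_rfl
  convex_h := B.convexOn_σStar
  subgrad y hy x _ := hG y hy x
  exists_isProx e _ c ha := ⟨_, B.isProx_prox net e c ha⟩

end Beckmann

namespace StableDynamics

variable {nV n m : ℕ} (D : StableDynamics n) (net : Network nV n m) {γ : ℝ} {G : Vec n → Vec n}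

theorem isProx_max (e : Fin n) (a c : ℝ) :
    (D.dual net γ G).IsProx e a c (D.freeTime e + max (-(a * D.cap e + c)) 0) := by
  refine ⟨?_, fun s' hs' => ?_⟩
  · change D.freeTime e ≤ _
    linarith [le_max_right (-(a * D.cap e + c)) 0]
  · have h : D.freeTime e ≤ s' := hs'
    simp only [Composite.scalarObj, dual]
    rcases max_cases (-(a * D.cap e + c)) 0 with ⟨h1, h2⟩ | ⟨h1, h2⟩
    · rw [h1]; nlinarith [sq_nonneg (s' - D.freeTime e + (a * D.cap e + c))]
    · rw [h1]; nlinarith [sq_nonneg (s' - D.freeTime e), mul_nonneg (sub_nonneg.2 h) (by linarith : 0 ≤ a * D.cap e + c)]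

theorem regular (hG : ∀ t ∈ (D.dual net γ G).Q, IsSubgradientAt (net.potential γ) (G t) t) :
    (D.dual net γ G).Regular where
  start_mem e := Set.mem_Ici.2 le_rfl
  convex_h e := by
    refine ⟨convex_Ici _, fun s _ s' _ a b _ _ hab => le_of_eq ?_⟩
    simp only [dual, smul_eq_mul]
    linear_combination (D.cap e * D.freeTime e) * hab
  subgrad y hy x _ := hG y hy x
  exists_isProx e a c _ := ⟨_, D.isProx_max net e a c⟩

end StableDynamics

/-! ### The primal-dual estimate for traffic problems -/

namespace Composite
variable {nV n m : ℕ} {net : Network nV n m} {γ : ℝ} {P : Composite n}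

/-- The data of a traffic dual problem: the first term is the potential of the network, and the
gradient map selects subgradients (for `γ > 0`, gradients). -/
structure IsTraffic (P : Composite n) (net : Network nV n m) (γ : ℝ) : Prop where
  regular : P.Regular
  Φ_eq : P.Φ = net.potential γ
  nonneg : 0 ≤ γ
  m_pos : 0 < m
  subgradient : ∀ t ∈ P.Q, IsSubgradientAt (net.potential γ) (P.grad t) t
  grad_eq : 0 < γ → ∀ t, P.grad t = -net.flow (net.gibbs γ t)

namespace IsTraffic

variable (hT : P.IsTraffic net γ)
include hT

theorem exists_flow {y : Vec n} (hy : y ∈ P.Q) : ∃ x ∈ net.X, net.flow x = -P.grad y ∧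
    (0 < γ → x = net.gibbs γ y) := by
  rcases hT.nonneg.eq_or_lt with h | h
  · obtain ⟨x, hx, hf⟩ := Network.subgradient_mem (h ▸ hT.subgradient y hy)
    exact ⟨x, hx, hf, fun h' => absurd h' (by rw [← h]; exact lt_irrefl _)⟩
  · exact ⟨_, Network.gibbs_mem γ y, by rw [hT.grad_eq h, neg_neg], fun _ => rfl⟩

/-- For `γ > 0` this is equality in the variational principle; for `γ = 0` it is homogeneity, both
sides being `0`. It converts the constant terms of the linearizations into the entropy term of the
stopping test. -/
theorem Φ_sub_inner {y : Vec n} (hy : y ∈ P.Q) :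
    P.Φ y - inner ℝ (P.grad y) y = -(γ * net.entropy (net.gibbs γ y)) := by
  rw [hT.Φ_eq]
  rcases hT.nonneg.eq_or_lt with h | h
  · have := Network.subgradient_inner (h ▸ hT.subgradient y hy)
    rw [← h] at *
    rw [this]; simp
  · rw [Network.potential_eq_gibbs h, hT.grad_eq h, inner_neg_left]; ring

theorem smoothBound (hγ : 0 < γ) : P.SmoothBound (4 * (net.H * net.d / γ)) := by
  intro y _ t _
  rw [hT.Φ_eq, hT.grad_eq hγ]
  exact Network.smooth_pos hγ hT.m_pos y t

theorem lipschitzBound (hγ : γ = 0) : P.LipschitzBound (2 * (net.d * Real.sqrt net.H)) := by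
  subst hγ
  intro y hy t _
  rw [hT.Φ_eq]
  exact Network.lipschitz_zero (hT.subgradient y hy)

theorem nonempty_run {L₀ ε : ℝ} (h0 : 0 < L₀) (hε : 0 < ε) : Nonempty (P.Run L₀ ε) := by
  have hH : (0 : ℝ) < net.H := by exact_mod_cast net.H_pos hT.m_pos
  have hd := net.d_pos hT.m_pos
  refine hT.regular.nonempty_run h0 ?_
  rcases hT.nonneg.eq_or_lt with h | h
  · exact (hT.lipschitzBound h.symm).eventuallyAccepts hT.regular (by positivity) hε
  · exact (hT.smoothBound h).eventuallyAccepts hT.regular hε.le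

variable {L₀ ε : ℝ} (run : P.Run L₀ ε) (h0 : 0 < L₀)
include h0

theorem weights (N : ℕ) :
    (∀ k ∈ Finset.range (N + 1), 0 ≤ (run.z k).α / (run.z N).A) ∧
    ∑ k ∈ Finset.range (N + 1), (run.z k).α / (run.z N).A = 1 := by
  have hA := (run.facts h0 hT.regular N).2.1
  refine ⟨fun k _ => div_nonneg (run.facts h0 hT.regular k).1.le hA.le, ?_⟩
  rw [← Finset.sum_div, ← run.accum_eq h0, Composite.Run.accum_succ, div_self hA.ne']

/-- Every `f^k` is the flow of a member of the convex set `X`, and averaging commutes with `Θ`. By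
convexity, the entropy of the averaged path flow is at most the averaged entropy, so the tested
quantity overestimates the primal objective. -/
theorem exists_avg (N : ℕ) : ∃ x ∈ net.X, net.flow x = run.avgFlow N ∧
    (0 < γ → ∀ w, ∀ p ∈ net.paths w, x w p = run.avgPathFlow net γ N w p) ∧
    γ * net.entropy x ≤ γ * run.avgEntropy net γ N := by
  obtain ⟨hw0, hw1⟩ := hT.weights run h0 N
  choose x hx hflow hgibbs using fun k => hT.exists_flow (run.facts h0 hT.regular k).2.2.2.1
  refine ⟨∑ k ∈ Finset.range (N + 1), ((run.z k).α / (run.z N).A) • x k,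
    Network.average_mem _ _ x hw0 hw1 fun k _ => hx k, ?_, ?_, ?_⟩
  · rw [Network.flow_average, Composite.Run.avgFlow, Finset.smul_sum]
    refine Finset.sum_congr rfl fun k _ => ?_
    rw [hflow, smul_smul]; congr 1; ring
  · intro hγ w p _
    simp only [Composite.Run.avgPathFlow, Finset.sum_apply, Pi.smul_apply, smul_eq_mul,
      Finset.mul_sum]
    refine Finset.sum_congr rfl fun k _ => ?_
    rw [hgibbs k hγ]; ring
  · rcases hT.nonneg.eq_or_lt with h | h
    · rw [← h]; simp
    · refine mul_le_mul_of_nonneg_left ?_ h.le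
      have := Network.entropy_average (net := net) _ _ x hw0 hw1 fun k _ => hx k
      have e : (∑ k ∈ Finset.range (N + 1), ((run.z k).α / (run.z N).A) • x k) =
          fun w p => ∑ k ∈ Finset.range (N + 1), (run.z k).α / (run.z N).A * x k w p := by
        funext w p; simp [Finset.sum_apply]
      rw [e]
      refine this.trans (le_of_eq ?_)
      rw [Composite.Run.avgEntropy, Finset.mul_sum]
      refine Finset.sum_congr rfl fun k _ => ?_
      rw [hgibbs k h]; ring

theorem avgEntropy_eq (N : ℕ) : γ * run.avgEntropy net γ N = -(1 / (run.z N).A *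
    ∑ k ∈ Finset.range (N + 1), (run.z k).α *
      (P.Φ (run.z k).y - inner ℝ (P.grad (run.z k).y) (run.z k).y)) := by
  simp only [hT.Φ_sub_inner (run.facts h0 hT.regular _).2.2.2.1]
  rw [Composite.Run.avgEntropy]
  simp only [Finset.mul_sum]
  rw [← Finset.sum_neg_distrib]
  exact Finset.sum_congr rfl fun k _ => by ring

/-- Averaging the linearizations, the constant terms give `-𝓔_N` and the slopes give `-f̄^N`: the
result is a Lagrangian with the averaged flow as the primal variable. -/
theorem lin_avg (N : ℕ) (x : Vec n) :
    1 / (run.z N).A * ∑ k ∈ Finset.range (N + 1), (run.z k).α * P.lin (run.z k).y x =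
      -(γ * run.avgEntropy net γ N) - inner ℝ (run.avgFlow N) x + ∑ e, P.h e (x e) := by
  obtain ⟨-, hw1⟩ := hT.weights run h0 N
  have h1 : inner ℝ (run.avgFlow N) x = -(1 / (run.z N).A *
      ∑ k ∈ Finset.range (N + 1), (run.z k).α * inner ℝ (P.grad (run.z k).y) x) := by
    simp only [Composite.Run.avgFlow, inner_smul_left, sum_inner, inner_neg_left, RCLike.conj_to_real, mul_neg,
      Finset.sum_neg_distrib]
  rw [hT.avgEntropy_eq run h0, h1]
  have h2 : ∑ e, P.h e (x e) = 1 / (run.z N).A *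
      ∑ k ∈ Finset.range (N + 1), (run.z k).α * ∑ e, P.h e (x e) := by
    have : 1 / (run.z N).A * ∑ k ∈ Finset.range (N + 1), (run.z k).α = 1 := by
      rw [one_div_mul_eq_div, Finset.sum_div, hw1]
    rw [← Finset.sum_mul, ← mul_assoc, this, one_mul]
  rw [h2, neg_neg, sub_neg_eq_add, ← mul_add, ← mul_add, ← Finset.sum_add_distrib,
    ← Finset.sum_add_distrib]
  congr 1
  refine Finset.sum_congr rfl fun k _ => ?_
  simp only [Composite.lin, inner_sub_right]; ring

/-- The point `x` stays free; each model chooses it so that the right-hand side becomes minus its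
primal value plus a term that decays with `A_N`. -/
theorem gap_le (N : ℕ) {x : Vec n} (hx : x ∈ P.Q) :
    P.F (run.z N).t + γ * run.avgEntropy net γ N ≤
      1 / (run.z N).A * (1 / 2 * ‖x - P.start‖ ^ 2) - inner ℝ (run.avgFlow N) x +
        ∑ e, P.h e (x e) + ε / 2 := by
  have := run.estimate_F h0 hT.regular N hx
  rw [mul_add, hT.lin_avg run h0] at this
  linarith

theorem avgFlow_bounds (N : ℕ) (e : Fin n) :
    0 ≤ run.avgFlow N e ∧ run.avgFlow N e ≤ net.d * Real.sqrt net.H := by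
  obtain ⟨x, hx, hf, -⟩ := hT.exists_avg run h0 N
  rw [← hf]
  refine ⟨Network.flow_nonneg hx e, le_trans ?_ (Network.norm_flow_le hx)⟩
  exact (le_abs_self _).trans (by simpa using PiLp.norm_apply_le (net.flow x) e)

variable (hε : 0 < ε)
include hε

theorem exists_large (hL : if 0 < γ then L₀ ≤ net.H * net.d / γ else L₀ ≤ net.H * net.d ^ 2 / ε)
    (b : ℝ) : ∃ N, b < (run.z N).A := by
  have hH : (0 : ℝ) < net.H := by exact_mod_cast net.H_pos hT.m_pos
  have hd := net.d_pos hT.m_pos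
  rcases hT.nonneg.eq_or_lt with h | h
  · rw [if_neg (by rw [← h]; exact lt_irrefl _)] at hL
    have hM : 0 < 2 * (net.d * Real.sqrt net.H) := by positivity
    have hL' : L₀ ≤ (2 * (net.d * Real.sqrt net.H)) ^ 2 / ε := by
      refine hL.trans ?_
      apply div_le_div_of_nonneg_right _ hε.le
      rw [mul_pow, mul_pow, Real.sq_sqrt hH.le]
      nlinarith [mul_pos hH (pow_pos hd 2)]
    obtain ⟨N, hN⟩ := exists_nat_gt (b / (ε / (2 * (net.d * Real.sqrt net.H)) ^ 2 / 2))
    refine ⟨N, ?_⟩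
    rw [div_lt_iff₀ (by positivity)] at hN
    have h1 := run.accum_ge_nonsmooth h0 hT.regular (hT.lipschitzBound h.symm) hM hε hL' N
    have h2 := run.accum_mono h0 hT.regular (Nat.le_succ N)
    exact hN.trans_le (h1.trans h2)
  · rw [if_pos h] at hL
    have hLip : 0 < 4 * (net.H * net.d / γ) := by positivity
    obtain ⟨N, hN⟩ := exists_nat_gt (b * (8 * (4 * (net.H * net.d / γ))))
    have h1 := run.accum_ge_smooth h0 hT.regular (hT.smoothBound h) hε.le
      (hL.trans (by have : 0 < net.H * net.d / γ := by positivity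
                    linarith)) (N + 1)
    refine ⟨N, lt_of_lt_of_le ?_ h1⟩
    rw [lt_div_iff₀ (by positivity)]
    push_cast
    nlinarith [Nat.cast_nonneg (α := ℝ) N]

theorem trials_le_smoothCount (hγ : 0 < γ) (hL : L₀ ≤ net.H * net.d / γ) (N : ℕ) {R : ℝ}
    (hD : N ≠ 0 → run.accum N ≤ 2 * R ^ 2 / ε) :
    (run.trials N : ℝ) ≤ 48 * smoothCount net γ ε L₀ R := by
  have hH : (0 : ℝ) < net.H := by exact_mod_cast net.H_pos hT.m_pos
  have hd := net.d_pos hT.m_pos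
  have hq : 0 < net.H * net.d / γ := by positivity
  have h1 := run.trials_le_smooth h0 hT.regular (hT.smoothBound hγ) hε.le
    (hL.trans (by linarith)) N hD
  have e1 : Real.sqrt (8 * (4 * (net.H * net.d / γ)) * (2 * R ^ 2 / ε)) =
      8 * Real.sqrt (net.H * net.d * R ^ 2 / (γ * ε)) := by
    rw [show 8 * (4 * (net.H * net.d / γ)) * (2 * R ^ 2 / ε) =
      8 ^ 2 * (net.H * net.d * R ^ 2 / (γ * ε)) by field_simp; norm_num,
      Real.sqrt_mul (by norm_num), Real.sqrt_sq (by norm_num)]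
  have e2 : Real.logb 2 (4 * (net.H * net.d / γ) / L₀) =
      2 + Real.logb 2 (net.H * net.d / (γ * L₀)) := by
    rw [mul_div_assoc, Real.logb_mul (by norm_num) (by positivity), div_div,
      show (4 : ℝ) = 2 ^ 2 by norm_num, Real.logb_pow, Real.logb_self_eq_one (by norm_num)]
    norm_num
  have h3 : 0 ≤ Real.logb 2 (net.H * net.d / (γ * L₀)) := by
    apply Real.logb_nonneg (by norm_num)
    rw [← div_div, one_le_div h0]; exact hL
  have h4 := Real.sqrt_nonneg (net.H * net.d * R ^ 2 / (γ * ε))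
  rw [e1, e2] at h1
  unfold smoothCount
  linarith

/-- With `M² = 4 H d²` and `D = 2R²/ε`, the quantity `M² D / ε` is `8 H d² R² / ε²`; together with
the coefficient `6` this gives `48`, which also suffices for `γ > 0`. -/
theorem trials_le_nonsmoothCount (hγ : γ = 0) (hL : L₀ ≤ net.H * net.d ^ 2 / ε) (N : ℕ) {R : ℝ}
    (hD : N ≠ 0 → run.accum N ≤ 2 * R ^ 2 / ε) :
    (run.trials N : ℝ) ≤ 48 * nonsmoothCount net ε L₀ R := by
  have hH : (0 : ℝ) < net.H := by exact_mod_cast net.H_pos hT.m_pos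
  have hd := net.d_pos hT.m_pos
  have hM2 : (2 * (net.d * Real.sqrt net.H)) ^ 2 = 4 * (net.H * net.d ^ 2) := by
    rw [mul_pow, mul_pow, Real.sq_sqrt hH.le]; ring
  have hq : 0 < net.H * net.d ^ 2 / ε := by positivity
  have h1 := run.trials_le_nonsmooth h0 hT.regular (hT.lipschitzBound hγ) (by positivity) hε
    (by rw [hM2, mul_div_assoc]; linarith) N (by positivity) hD
  rw [hM2] at h1
  have e1 : 4 * (net.H * net.d ^ 2) * (2 * R ^ 2 / ε) / ε =
      8 * (net.H * net.d ^ 2 * R ^ 2 / ε ^ 2) := by field_simp; ring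
  have e2 : Real.logb 2 (4 * (net.H * net.d ^ 2) / ε / L₀) =
      2 + Real.logb 2 (net.H * net.d ^ 2 / (ε * L₀)) := by
    rw [mul_div_assoc, mul_div_assoc, Real.logb_mul (by norm_num) (by positivity), div_div,
      show (4 : ℝ) = 2 ^ 2 by norm_num, Real.logb_pow, Real.logb_self_eq_one (by norm_num)]
    norm_num
  have h3 : 0 ≤ Real.logb 2 (net.H * net.d ^ 2 / (ε * L₀)) := by
    apply Real.logb_nonneg (by norm_num)
    rw [← div_div, one_le_div h0]; exact hL
  have h4 : 0 ≤ net.H * net.d ^ 2 * R ^ 2 / ε ^ 2 := by positivity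
  rw [e1, e2] at h1
  unfold nonsmoothCount
  linarith

end IsTraffic
end Composite
end Traffic

/-! ### Stopping and accuracy in the two models -/

namespace Traffic

variable {nV n m : ℕ} {net : Network nV n m}

theorem isSubgradientAt_gradient {γ : ℝ} (hγ : 0 < γ) (hm : 0 < m) (t : Vec n) :
    IsSubgradientAt (net.potential γ) (gradient (net.potential γ) t) t := fun s => by
  rw [Network.gradient_potential hγ hm]; exact Network.lower_pos hγ t s

namespace Beckmann

variable (B : Beckmann n)

theorem isTraffic_pos {γ : ℝ} (hγ : 0 < γ) (hm : 0 < m) :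
    (B.dual net γ (gradient (net.potential γ))).IsTraffic net γ where
  regular := B.regular net fun t _ => isSubgradientAt_gradient hγ hm t
  Φ_eq := rfl
  nonneg := hγ.le
  m_pos := hm
  subgradient t _ := isSubgradientAt_gradient hγ hm t
  grad_eq _ t := Network.gradient_potential hγ hm t

theorem isTraffic_zero {G : Vec n → Vec n} (hm : 0 < m)
    (hG : ∀ t ∈ (B.dual net 0 G).Q, IsSubgradientAt (net.potential 0) (G t) t) :
    (B.dual net 0 G).IsTraffic net 0 where
  regular := B.regular net hG
  Φ_eq := rfl
  nonneg := le_rfl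
  m_pos := hm
  subgradient := hG
  grad_eq h := absurd h (lt_irrefl _)

variable {B} {γ : ℝ} {G : Vec n → Vec n} (hT : (B.dual net γ G).IsTraffic net γ) {L₀ ε : ℝ}
  (run : (B.dual net γ G).Run L₀ ε) (h0 : 0 < L₀)
include hT h0

/-- Take `x = τ(f̄)`. Then `σ_e^*(x_e) = x_e f̄_e - σ_e(f̄_e)`, so everything cancels except the
distance term, which is `R̃² / A_N`. -/
theorem gap_le (N : ℕ) : B.gap net γ run N ≤ B.Rtilde net γ run N ^ 2 / (run.z N).A + ε / 2 := by
  have hb := hT.avgFlow_bounds run h0 N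
  have hx : (WithLp.toLp 2 fun e => B.τ e (run.avgFlow N e) : Vec n) ∈ (B.dual net γ G).Q :=
    fun e => B.τ_mem_dom e (hb e).1
  have h := hT.gap_le run h0 N hx
  have h1 : B.Rtilde net γ run N ^ 2 =
      1 / 2 * ‖(WithLp.toLp 2 fun e => B.τ e (run.avgFlow N e) : Vec n) - B.freeTime‖ ^ 2 := by
    rw [Rtilde, Real.sq_sqrt (mul_nonneg (by norm_num) (Finset.sum_nonneg fun _ _ => sq_nonneg _)),
      Composite.norm_sq_eq_sum]
    simp
  have h2 : ∑ e, B.σStar e (B.τ e (run.avgFlow N e)) =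
      inner ℝ (run.avgFlow N) (WithLp.toLp 2 fun e => B.τ e (run.avgFlow N e) : Vec n) -
        ∑ e, B.σ e (run.avgFlow N e) := by
    rw [Composite.inner_eq_sum, ← Finset.sum_sub_distrib]
    refine Finset.sum_congr rfl fun e _ => ?_
    rw [B.σStar_τ e (hb e).1]; simp only; ring
  have h3 : ∑ e, (B.dual net γ G).h e ((WithLp.toLp 2 fun e => B.τ e (run.avgFlow N e) : Vec n) e) =
      ∑ e, B.σStar e (B.τ e (run.avgFlow N e)) := rfl
  have h4 : (B.dual net γ G).start = B.freeTime := rfl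
  rw [h3, h2, h4, ← h1] at h
  unfold gap
  have h5 : B.Rtilde net γ run N ^ 2 / (run.z N).A =
    1 / (run.z N).A * B.Rtilde net γ run N ^ 2 := by ring
  linarith

/-- The tested quantity bounds the true duality gap from above. By weak duality the dual value at
`t^N` and the primal value at the averaged flow are then both within `ε` of their optima. -/
theorem accurate {N : ℕ} (hN : B.gap net γ run N < ε) : B.Accurate net γ run N := by
  obtain ⟨x, hx, hflow, hg, hent⟩ := hT.exists_avg run h0 N
  have hweak : ∀ t ∈ (B.dual net γ G).Q, ∀ x' ∈ net.X,
      -B.primal net γ x' ≤ (B.dual net γ G).F t := by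
    intro t ht x' hx'
    have h1 := Network.weak hT.nonneg t hx'
    have h2 : inner ℝ (net.flow x') t - ∑ e, B.σ e (net.flow x' e) ≤ ∑ e, B.σStar e (t e) := by
      rw [Composite.inner_eq_sum, ← Finset.sum_sub_distrib]
      refine Finset.sum_le_sum fun e _ => ?_
      have := B.le_σStar (ht e) (Network.flow_nonneg hx' e)
      linarith
    have h3 : (B.dual net γ G).F t = net.potential γ t + ∑ e, B.σStar e (t e) := rfl
    rw [h3]; unfold primal; linarith
  have hQ := (run.facts h0 hT.regular N).2.2.2.2.2
  have hle : B.primal net γ x ≤ ∑ e, B.σ e (run.avgFlow N e) + γ * run.avgEntropy net γ N := by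
    unfold primal; rw [hflow]; linarith
  unfold gap at hN
  refine ⟨⟨x, hx, hflow, hg, fun x' hx' => ?_⟩, hQ, fun t ht => ?_⟩
  · have := hweak _ hQ x' hx'; linarith
  · have := hweak t ht x hx; linarith

variable (hε : 0 < ε)
  (hL : if 0 < γ then L₀ ≤ net.H * net.d / γ else L₀ ≤ net.H * net.d ^ 2 / ε)
include hε hL

/-- The weight `A_N` is unbounded while `R̃_N` stays bounded, so the test succeeds. If it fails at
`N - 1`, then `ε ≤ R̃² / A + ε/2` there, which bounds the weight accumulated before iteration `N`.
-/
theorem exists_stopsAt : ∃ N, B.StopsAt net γ run N ∧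
    (N ≠ 0 → run.accum N ≤ 2 * B.Rtilde net γ run (N - 1) ^ 2 / ε) := by
  have hH : (0 : ℝ) < net.H := by exact_mod_cast net.H_pos hT.m_pos
  have hd := net.d_pos hT.m_pos
  -- No averaged flow exceeds `f0` on any edge, so by monotonicity `τ_e(f0)` bounds all travel times
  -- that occur, uniformly in `N`.
  set f0 := net.d * Real.sqrt net.H with hf0
  have hex : ∃ N, B.gap net γ run N < ε := by
    obtain ⟨N, hN⟩ := hT.exists_large run h0 hε hL
      (2 * (1 / 2 * ∑ e, (B.τ e f0 - B.freeTime e) ^ 2) / ε)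
    refine ⟨N, ?_⟩
    have hb := hT.avgFlow_bounds run h0 N
    have h1 : B.Rtilde net γ run N ^ 2 ≤ 1 / 2 * ∑ e, (B.τ e f0 - B.freeTime e) ^ 2 := by
      rw [Rtilde, Real.sq_sqrt (mul_nonneg (by norm_num) (Finset.sum_nonneg fun _ _ => sq_nonneg _))]
      refine mul_le_mul_of_nonneg_left (Finset.sum_le_sum fun e _ => ?_) (by norm_num)
      have h2 : B.τ e (run.avgFlow N e) ≤ B.τ e f0 :=
        B.monotoneOn e (hb e).1 (by rw [Set.mem_Ici]; positivity) (hb e).2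
      have h3 : B.freeTime e ≤ B.τ e (run.avgFlow N e) :=
        B.monotoneOn e (Set.mem_Ici.2 le_rfl) (hb e).1 (hb e).1
      apply pow_le_pow_left₀ <;> linarith
    have hA := (run.facts h0 hT.regular N).2.1
    have h4 := gap_le hT run h0 N
    rw [div_lt_iff₀ hε] at hN
    have h5 : B.Rtilde net γ run N ^ 2 / (run.z N).A < ε / 2 := by
      rw [div_lt_iff₀ hA]; linarith
    linarith
  classical
  refine ⟨Nat.find hex, ⟨Nat.find_spec hex, fun k hk => Nat.find_min' hex hk⟩, fun hne => ?_⟩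
  obtain ⟨k, hk⟩ := Nat.exists_eq_succ_of_ne_zero hne
  have hnot := Nat.find_min hex (m := k) (by omega)
  rw [hk, Nat.succ_sub_one, Nat.succ_eq_add_one, Composite.Run.accum_succ]
  have hA := (run.facts h0 hT.regular k).2.1
  have h4 := gap_le hT run h0 k
  have h5 : ε / 2 ≤ B.Rtilde net γ run k ^ 2 / (run.z k).A := by linarith
  rw [le_div_iff₀ hA] at h5
  rw [le_div_iff₀ hε]; linarith

end Beckmann

namespace StableDynamics

variable (D : StableDynamics n)

theorem isTraffic_pos {γ : ℝ} (hγ : 0 < γ) (hm : 0 < m) :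
    (D.dual net γ (gradient (net.potential γ))).IsTraffic net γ where
  regular := D.regular net fun t _ => isSubgradientAt_gradient hγ hm t
  Φ_eq := rfl
  nonneg := hγ.le
  m_pos := hm
  subgradient t _ := isSubgradientAt_gradient hγ hm t
  grad_eq _ t := Network.gradient_potential hγ hm t

theorem isTraffic_zero {G : Vec n → Vec n} (hm : 0 < m)
    (hG : ∀ t ∈ (D.dual net 0 G).Q, IsSubgradientAt (net.potential 0) (G t) t) :
    (D.dual net 0 G).IsTraffic net 0 where
  regular := D.regular net hG
  Φ_eq := rfl
  nonneg := le_rfl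
  m_pos := hm
  subgradient := hG
  grad_eq h := absurd h (lt_irrefl _)

theorem excess_sq (f : Vec n) : D.excess f ^ 2 = ∑ e, (max (f e - D.cap e) 0) ^ 2 :=
  Real.sq_sqrt (Finset.sum_nonneg fun _ _ => sq_nonneg _)

theorem inner_excess_le (f : Vec n) {v : Vec n} (hv : ∀ e, 0 ≤ v e) :
    ∑ e, (f e - D.cap e) * v e ≤ D.excess f * ‖v‖ := by
  have h1 : ∑ e, (f e - D.cap e) * v e ≤ ∑ e, max (f e - D.cap e) 0 * v e :=
    Finset.sum_le_sum fun e _ => mul_le_mul_of_nonneg_right (le_max_left _ _) (hv e)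
  refine h1.trans ?_
  rw [EuclideanSpace.norm_eq]
  simpa [excess] using Real.sum_mul_le_sqrt_mul_sqrt Finset.univ
    (fun e => max (f e - D.cap e) 0) (fun e => v e)

variable {D} {γ : ℝ} {G : Vec n → Vec n} (hT : (D.dual net γ G).IsTraffic net γ) {L₀ ε : ℝ}
  (run : (D.dual net γ G).Run L₀ ε) (h0 : 0 < L₀) {R : ℝ}
include hT h0

/-- The point `x = t̄ + A (f̄ - cap)_+` minimizes `‖x - t̄‖²/(2A) - ⟨f̄ - cap, x - t̄⟩` over `Q`,
with the value `-(A/2) excess²`. This negative term absorbs the penalty: `3R·excess ≤ (A/2) excess²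
+ 9R²/(2A)`. -/
theorem gap_le (N : ℕ) : D.gap net γ R run N ≤ 9 * R ^ 2 / (2 * (run.z N).A) + ε / 2 := by
  have hA := (run.facts h0 hT.regular N).2.1
  set A := (run.z N).A
  set f := run.avgFlow N
  set x : Vec n := WithLp.toLp 2 fun e => D.freeTime e + A * max (f e - D.cap e) 0 with hx
  have hxe : ∀ e, x e = D.freeTime e + A * max (f e - D.cap e) 0 := fun e => rfl
  have hxQ : x ∈ (D.dual net γ G).Q := fun e => by
    change D.freeTime e ≤ x e
    rw [hxe]
    have := mul_nonneg hA.le (le_max_right (f e - D.cap e) 0)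
    linarith
  have h := hT.gap_le run h0 N hxQ
  have h1 : ‖x - (D.dual net γ G).start‖ ^ 2 = A ^ 2 * D.excess f ^ 2 := by
    rw [Composite.norm_sq_eq_sum, excess_sq, Finset.mul_sum]
    refine Finset.sum_congr rfl fun e _ => ?_
    have : (x - (D.dual net γ G).start) e = A * max (f e - D.cap e) 0 := by
      change x e - D.freeTime e = _
      rw [hxe]; ring
    rw [this]; ring
  have h2 : ∑ e, (D.dual net γ G).h e (x e) - inner ℝ f x =
      -∑ e, f e * D.freeTime e - A * D.excess f ^ 2 := by
    rw [Composite.inner_eq_sum, excess_sq, Finset.mul_sum, ← Finset.sum_neg_distrib,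
      ← Finset.sum_sub_distrib, ← Finset.sum_sub_distrib]
    refine Finset.sum_congr rfl fun e _ => ?_
    change D.cap e * (x e - D.freeTime e) - f e * x e = _
    rw [hxe]
    have : (f e - D.cap e) * max (f e - D.cap e) 0 = max (f e - D.cap e) 0 ^ 2 := by
      rcases max_cases (f e - D.cap e) 0 with ⟨h1, _⟩ | ⟨h1, _⟩ <;> rw [h1] <;> ring
    linear_combination (-A) * this
  rw [h1] at h
  have h3 : 1 / A * (1 / 2 * (A ^ 2 * D.excess f ^ 2)) = A / 2 * D.excess f ^ 2 := by
    field_simp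
  rw [h3] at h
  have h4 : 3 * R * D.excess f ≤ A / 2 * D.excess f ^ 2 + 9 * R ^ 2 / (2 * A) := by
    have : A / 2 * D.excess f ^ 2 + 9 * R ^ 2 / (2 * A) - 3 * R * D.excess f =
      (A * D.excess f - 3 * R) ^ 2 / (2 * A) := by field_simp; ring
    have h5 : 0 ≤ (A * D.excess f - 3 * R) ^ 2 / (2 * A) := by positivity
    linarith
  unfold gap
  linarith

/-- The dual solution acts as a vector of multipliers: violating the capacities lowers the primal
value by at most `‖t_* - t̄‖·excess ≤ 2R·excess`. The penalty `3R` in the test exceeds this by `R`,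
which yields `R·excess ≤ ε`. -/
theorem accurate {tstar : Vec n} (hs : D.IsDualSolution net γ tstar) (hR : 0 ≤ R)
    (hsR : 1 / 2 * ‖tstar - D.freeTime‖ ^ 2 ≤ R ^ 2) {N : ℕ}
    (hN : D.gap net γ R run N < ε) : D.Accurate net γ R run N := by
  obtain ⟨x, hx, hflow, hg, hent⟩ := hT.exists_avg run h0 N
  have hF : ∀ t, (D.dual net γ G).F t = (D.dual net γ 0).F t := fun t => rfl
  have hFt : ∀ t, (D.dual net γ G).F t =
    net.potential γ t + ∑ e, D.cap e * (t e - D.freeTime e) := fun t => rfl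
  have hstar : tstar ∈ (D.dual net γ G).Q := hs.1
  have hmin : ∀ t ∈ (D.dual net γ G).Q, (D.dual net γ G).F tstar ≤ (D.dual net γ G).F t := hs.2
  have hQ := (run.facts h0 hT.regular N).2.2.2.2.2
  have he0 : 0 ≤ D.excess (run.avgFlow N) := Real.sqrt_nonneg _
  have hsum : ∀ f : Vec n, inner ℝ f tstar = ∑ e, f e * D.freeTime e +
      ∑ e, (f e - D.cap e) * (tstar e - D.freeTime e) +
      ∑ e, D.cap e * (tstar e - D.freeTime e) := by
    intro f
    rw [Composite.inner_eq_sum, ← Finset.sum_add_distrib, ← Finset.sum_add_distrib]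
    exact Finset.sum_congr rfl fun e _ => by ring
  have hweak : ∀ x' ∈ net.X, (∀ e, net.flow x' e ≤ D.cap e) →
      -D.primal net γ x' ≤ (D.dual net γ G).F tstar := by
    intro x' hx' hcap
    have h1 := Network.weak hT.nonneg tstar hx'
    rw [hsum] at h1
    have h2 : ∑ e, (net.flow x' e - D.cap e) * (tstar e - D.freeTime e) ≤ 0 :=
      Finset.sum_nonpos fun e _ => mul_nonpos_of_nonpos_of_nonneg (by linarith [hcap e])
        (sub_nonneg.2 (hstar e))
    rw [hFt]; unfold primal; linarith
  -- The hypothesis gives `√2 R`, rounded up to `2R`.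
  have hnorm : ‖tstar - D.freeTime‖ ≤ 2 * R := by
    apply abs_le_of_sq_le_sq' _ (by positivity) |>.2
    nlinarith
  have hlow : -∑ e, run.avgFlow N e * D.freeTime e - γ * run.avgEntropy net γ N -
      2 * R * D.excess (run.avgFlow N) ≤ (D.dual net γ G).F tstar := by
    have h1 := Network.weak hT.nonneg tstar hx
    rw [hflow, hsum] at h1
    have h2 := D.inner_excess_le (run.avgFlow N) (v := tstar - D.freeTime)
      (fun e => sub_nonneg.2 (hstar e))
    have h3 : D.excess (run.avgFlow N) * ‖tstar - D.freeTime‖ ≤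
      D.excess (run.avgFlow N) * (2 * R) := mul_le_mul_of_nonneg_left hnorm he0
    simp only [PiLp.sub_apply] at h2
    rw [hFt]; linarith
  have hRe : 0 ≤ R * D.excess (run.avgFlow N) := mul_nonneg hR he0
  have hmN := hmin _ hQ
  unfold gap at hN
  refine ⟨⟨x, hx, hflow, hg, fun x' hx' hcap => ?_, ?_⟩, hQ, fun t ht => ?_⟩
  · have := hweak x' hx' hcap
    have h5 : D.primal net γ x ≤ ∑ e, run.avgFlow N e * D.freeTime e +
        γ * run.avgEntropy net γ N := by
      unfold primal; rw [hflow]; linarith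
    linarith
  · rw [hflow]; linarith
  · have := hmin t ht; linarith

variable (hε : 0 < ε)
  (hL : if 0 < γ then L₀ ≤ net.H * net.d / γ else L₀ ≤ net.H * net.d ^ 2 / ε)
include hε hL

/-- Failure of the test at `N - 1` gives `A ≤ 9R²/ε` there. The factor `√5` in `R̄` is chosen so
that `2 (√5 R)² = 10 R²` covers this. -/
theorem exists_stopsAt : ∃ N, D.StopsAt net γ R run N ∧
    (N ≠ 0 → run.accum N ≤ 2 * (Real.sqrt 5 * R) ^ 2 / ε) := by
  have hex : ∃ N, D.gap net γ R run N < ε := by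
    obtain ⟨N, hN⟩ := hT.exists_large run h0 hε hL (9 * R ^ 2 / ε)
    refine ⟨N, ?_⟩
    have hA := (run.facts h0 hT.regular N).2.1
    have h4 := gap_le hT run h0 (R := R) N
    rw [div_lt_iff₀ hε] at hN
    have h5 : 9 * R ^ 2 / (2 * (run.z N).A) < ε / 2 := by
      rw [div_lt_iff₀ (by positivity)]; linarith
    linarith
  classical
  refine ⟨Nat.find hex, ⟨Nat.find_spec hex, fun k hk => Nat.find_min' hex hk⟩, fun hne => ?_⟩
  obtain ⟨k, hk⟩ := Nat.exists_eq_succ_of_ne_zero hne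
  have hnot := Nat.find_min hex (m := k) (by omega)
  rw [hk, Nat.succ_eq_add_one, Composite.Run.accum_succ, mul_pow, Real.sq_sqrt (by norm_num)]
  have hA := (run.facts h0 hT.regular k).2.1
  have h4 := gap_le hT run h0 (R := R) k
  have h5 : ε / 2 ≤ 9 * R ^ 2 / (2 * (run.z k).A) := by linarith
  rw [le_div_iff₀ (by positivity)] at h5
  rw [le_div_iff₀ hε]; nlinarith [sq_nonneg R]

end StableDynamics
end Traffic

/-! ### Program logic: frame rule, loops, vector operations -/

namespace RealRAM

/-- The arrays of indices that a program may write. -/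
def Cmd.wN : Cmd → List ℕ
  | .skip => []
  | .setN a _ _ _ => [a]
  | .setR _ _ _ _ => []
  | .seq c₁ c₂ => c₁.wN ++ c₂.wN
  | .ite _ c₁ c₂ => c₁.wN ++ c₂.wN
  | .loop _ c => c.wN

/-- The arrays of reals that a program may write. -/
def Cmd.wR : Cmd → List ℕ
  | .skip => []
  | .setN _ _ _ _ => []
  | .setR a _ _ _ => [a]
  | .seq c₁ c₂ => c₁.wR ++ c₂.wR
  | .ite _ c₁ c₂ => c₁.wR ++ c₂.wR
  | .loop _ c => c.wR

@[simp] theorem setN_real (s : Mem) (a i j v : ℕ) : (s.setN a i j v).real = s.real := rfl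
@[simp] theorem setR_nat (s : Mem) (a i j : ℕ) (v : ℝ) : (s.setR a i j v).nat = s.nat := rfl

theorem setN_nat (s : Mem) (a i j v a' i' j' : ℕ) : (s.setN a i j v).nat a' i' j' =
    if a' = a ∧ i' = i ∧ j' = j then v else s.nat a' i' j' := rfl

theorem setR_real (s : Mem) (a i j : ℕ) (v : ℝ) (a' i' j' : ℕ) : (s.setR a i j v).real a' i' j' =
    if a' = a ∧ i' = i ∧ j' = j then v else s.real a' i' j' := rfl

@[simp] theorem setN_nat_self (s : Mem) (a i j v : ℕ) : (s.setN a i j v).nat a i j = v := by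
  simp [setN_nat]

@[simp] theorem setR_real_self (s : Mem) (a i j : ℕ) (v : ℝ) : (s.setR a i j v).real a i j = v := by
  simp [setR_real]

theorem setN_nat_of_ne (s : Mem) {a a' : ℕ} (i j v : ℕ) (h : a' ≠ a) :
    (s.setN a i j v).nat a' = s.nat a' := by
  funext i' j'; simp [setN_nat, h]

theorem setR_real_of_ne (s : Mem) {a a' : ℕ} (i j : ℕ) (v : ℝ) (h : a' ≠ a) :
    (s.setR a i j v).real a' = s.real a' := by
  funext i' j'; simp [setR_real, h]

variable {O : Oracles}

/-- The arrays that can change are visible in the program text. All later statements that some data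
survive a subroutine reduce to this and to a finite check of array numbers. -/
theorem Exec.frame {c : Cmd} {s s' : Mem} {k : ℕ} (h : Exec O c s s' k) :
    (∀ a ∉ c.wN, s'.nat a = s.nat a) ∧ (∀ a ∉ c.wR, s'.real a = s.real a) := by
  induction h with
  | skip s => exact ⟨fun _ _ => rfl, fun _ _ => rfl⟩
  | setN s a i j v =>
    exact ⟨fun b hb => setN_nat_of_ne _ _ _ _ (by simpa [Cmd.wN] using hb), fun _ _ => rfl⟩
  | setR s a i j v =>
    exact ⟨fun _ _ => rfl, fun b hb => setR_real_of_ne _ _ _ _ (by simpa [Cmd.wR] using hb)⟩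
  | seq _ _ ih1 ih2 =>
    refine ⟨fun a ha => ?_, fun a ha => ?_⟩
    · simp only [Cmd.wN, List.mem_append, not_or] at ha
      rw [ih2.1 a ha.2, ih1.1 a ha.1]
    · simp only [Cmd.wR, List.mem_append, not_or] at ha
      rw [ih2.2 a ha.2, ih1.2 a ha.1]
  | iteTrue _ _ ih =>
    refine ⟨fun a ha => ih.1 a ?_, fun a ha => ih.2 a ?_⟩
    · simp only [Cmd.wN, List.mem_append, not_or] at ha; exact ha.1
    · simp only [Cmd.wR, List.mem_append, not_or] at ha; exact ha.1
  | iteFalse _ _ ih =>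
    refine ⟨fun a ha => ih.1 a ?_, fun a ha => ih.2 a ?_⟩
    · simp only [Cmd.wN, List.mem_append, not_or] at ha; exact ha.2
    · simp only [Cmd.wR, List.mem_append, not_or] at ha; exact ha.2
  | loopDone _ => exact ⟨fun _ _ => rfl, fun _ _ => rfl⟩
  | loopStep _ _ _ ih1 ih2 =>
    refine ⟨fun a ha => ?_, fun a ha => ?_⟩
    · rw [ih2.1 a ha, ih1.1 a (by simpa [Cmd.wN] using ha)]
    · rw [ih2.2 a ha, ih1.2 a (by simpa [Cmd.wR] using ha)]

/-- Started in `s`, the program halts after at most `T` steps in a memory satisfying `Q`. -/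
def Reaches (O : Oracles) (c : Cmd) (s : Mem) (T : ℕ) (Q : Mem → Prop) : Prop :=
  ∃ s' k, Exec O c s s' k ∧ k ≤ T ∧ Q s'

namespace Reaches

variable {c c₁ c₂ : Cmd} {s : Mem} {T T₁ T₂ : ℕ} {Q Q' : Mem → Prop} {b : BExp}

theorem mono (h : Reaches O c s T₁ Q) (hT : T₁ ≤ T) (hQ : ∀ s', Q s' → Q' s') :
    Reaches O c s T Q' := by
  obtain ⟨s', k, h1, h2, h3⟩ := h
  exact ⟨s', k, h1, h2.trans hT, hQ s' h3⟩

theorem frame (h : Reaches O c s T Q) : Reaches O c s T fun s' => Q s' ∧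
    (∀ a ∉ c.wN, s'.nat a = s.nat a) ∧ (∀ a ∉ c.wR, s'.real a = s.real a) := by
  obtain ⟨s', k, h1, h2, h3⟩ := h
  exact ⟨s', k, h1, h2, h3, h1.frame⟩

theorem seq (h1 : Reaches O c₁ s T₁ Q') (h2 : ∀ s', Q' s' → Reaches O c₂ s' T₂ Q)
    (hT : T₁ + T₂ ≤ T) : Reaches O (.seq c₁ c₂) s T Q := by
  obtain ⟨s', k, e1, l1, q1⟩ := h1
  obtain ⟨s'', k', e2, l2, q2⟩ := h2 s' q1
  exact ⟨s'', k + k', .seq e1 e2, by omega, q2⟩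

theorem skip (hT : 1 ≤ T) (h : Q s) : Reaches O .skip s T Q := ⟨s, 1, .skip s, hT, h⟩

theorem setN {a : ℕ} {i j v : NExp} (hT : 1 + i.cost + j.cost + v.cost ≤ T)
    (h : Q (s.setN a (i.eval s) (j.eval s) (v.eval s))) : Reaches O (.setN a i j v) s T Q :=
  ⟨_, _, .setN s a i j v, hT, h⟩

theorem setR {a : ℕ} {i j : NExp} {v : RExp} (hT : 1 + i.cost + j.cost + v.cost ≤ T)
    (h : Q (s.setR a (i.eval s) (j.eval s) (v.eval O s))) : Reaches O (.setR a i j v) s T Q :=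
  ⟨_, _, .setR s a i j v, hT, h⟩

theorem ite (h1 : b.eval O s → Reaches O c₁ s T₁ Q) (h2 : ¬ b.eval O s → Reaches O c₂ s T₁ Q)
    (hT : b.cost + T₁ ≤ T) : Reaches O (.ite b c₁ c₂) s T Q := by
  by_cases hb : b.eval O s
  · obtain ⟨s', k, e1, l1, q1⟩ := h1 hb
    exact ⟨s', _, .iteTrue hb e1, by omega, q1⟩
  · obtain ⟨s', k, e1, l1, q1⟩ := h2 hb
    exact ⟨s', _, .iteFalse hb e1, by omega, q1⟩

/-- For loops whose number of rounds is known in advance. The cost may vary from round to round, as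
it does in the main loop, where an iteration costs as much as its candidates. -/
theorem loop_count (J : ℕ) (I : ℕ → Mem → Prop) (T : ℕ → ℕ) (h0 : I 0 s)
    (hstep : ∀ k < J, ∀ s, I k s → b.eval O s ∧ Reaches O c s (T k) (I (k + 1)))
    (hend : ∀ s, I J s → ¬ b.eval O s) :
    Reaches O (.loop b c) s (∑ k ∈ Finset.range J, (T k + b.cost) + b.cost) (I J) := by
  have key : ∀ r k, k + r = J → ∀ s, I k s →
      Reaches O (.loop b c) s (∑ i ∈ Finset.range r, (T (k + i) + b.cost) + b.cost) (I J) := by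
    intro r
    induction r with
    | zero =>
      intro k hk s hs
      obtain rfl : k = J := by omega
      exact ⟨s, _, .loopDone (hend s hs), by simp, hs⟩
    | succ r ih =>
      intro k hk s hs
      obtain ⟨hb, s', k1, e1, l1, q1⟩ := hstep k (by omega) s hs
      obtain ⟨s'', k2, e2, l2, q2⟩ := ih (k + 1) (by omega) s' q1
      refine ⟨s'', _, .loopStep hb e1 e2, ?_, q2⟩
      rw [Finset.sum_range_succ']
      simp only [add_zero]
      have : ∑ i ∈ Finset.range r, (T (k + 1 + i) + b.cost) =
          ∑ i ∈ Finset.range r, (T (k + (i + 1)) + b.cost) :=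
        Finset.sum_congr rfl fun i _ => by rw [add_right_comm, add_assoc]
      omega
  simpa using key J 0 (by simp) s h0

/-- Amortized analysis: the invariant carries a potential that pays for each round including its
test. Since a test costs at least one step, this also proves termination. -/
theorem loop_pot (I : ℕ → Mem → Prop) {p : ℕ} (h0 : I p s)
    (hstep : ∀ p s, I p s → b.eval O s →
      ∃ p' k, b.cost + k + p' ≤ p ∧ Reaches O c s k (I p'))
    (hend : ∀ p s, I p s → ¬ b.eval O s → Q s) :
    Reaches O (.loop b c) s (p + b.cost) Q := by
  have hbpos : 0 < b.cost := by cases b <;> simp [BExp.cost]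
  induction p using Nat.strong_induction_on generalizing s with
  | _ p ih =>
    by_cases hb : b.eval O s
    · obtain ⟨p', k, hle, s', k1, e1, l1, q1⟩ := hstep p s h0 hb
      obtain ⟨s'', k2, e2, l2, q2⟩ := ih p' (by omega) q1
      exact ⟨s'', _, .loopStep hb e1 e2, by omega, q2⟩
    · exact ⟨s, _, .loopDone hb, by omega, hend p s h0 hb⟩

end Reaches

/-- The value of an index variable. -/
abbrev V (i : ℕ) : NExp := .get i (.const 0) (.const 0)

/-- The value of a real variable. -/
abbrev S (a : ℕ) : RExp := .get a (.const 0) (.const 0)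

/-- The component of a vector given by an index variable. -/
abbrev W (a i : ℕ) : RExp := .get a (.const 0) (V i)

/-- Assignment to a real variable. -/
abbrev letR (a : ℕ) (v : RExp) : Cmd := .setR a (.const 0) (.const 0) v

/-- Assignment to an index variable. -/
abbrev letN (a : ℕ) (v : NExp) : Cmd := .setN a (.const 0) (.const 0) v

/-- `for i < bound do body`. -/
def forN (i : ℕ) (bound : NExp) (body : Cmd) : Cmd :=
  .seq (letN i (.const 0))
    (.loop (.ltN (V i) bound) (.seq body (letN i (.add (V i) (.const 1)))))

theorem forN_wR (i : ℕ) (bound : NExp) (body : Cmd) : (forN i bound body).wR = body.wR := by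
  simp [forN, Cmd.wR]

/-- The counter lives in memory, so the invariant must be insensitive to it (`hset`) and the body
must not write it; the bound is evaluated anew in every round and has to keep its value. -/
theorem Reaches.forN {i : ℕ} {bound : NExp} {body : Cmd} {s : Mem} {T Tb N : ℕ}
    (I : ℕ → Mem → Prop) (hi : i ∉ body.wN)
    (h0 : ∀ v, I 0 (s.setN i 0 0 v))
    (hbound : ∀ k ≤ N, ∀ s, I k s → s.nat i 0 0 = k → bound.eval s = N)
    (hset : ∀ k s v, I k s → I k (s.setN i 0 0 v))
    (hbody : ∀ k < N, ∀ s, I k s → s.nat i 0 0 = k → Reaches O body s Tb (I (k + 1)))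
    (hT : N * (Tb + 12 + bound.cost) + 8 + bound.cost ≤ T) :
    Reaches O (forN i bound body) s T (I N) := by
  refine Reaches.seq (Q' := fun s' => I 0 s' ∧ s'.nat i 0 0 = 0) (T₁ := 4)
    (T₂ := N * (Tb + 12 + bound.cost) + 4 + bound.cost)
    (Reaches.setN (by simp [NExp.cost]) ⟨h0 _, by simp [NExp.eval]⟩) ?_ (by omega)
  rintro s' ⟨hs', hi0⟩
  refine (Reaches.loop_count N (fun k s => I k s ∧ s.nat i 0 0 = k) (fun _ => Tb + 8)
    ⟨hs', hi0⟩ ?_ ?_).mono (T₁ := _) ?_ fun s h => h.1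
  · rintro k hk s ⟨hs, hik⟩
    refine ⟨?_, ?_⟩
    · simp only [BExp.eval, NExp.eval, hik, hbound k hk.le s hs hik]; exact hk
    · refine Reaches.seq (hbody k hk s hs hik).frame (T₂ := 8) ?_ le_rfl
      rintro s1 ⟨h1, h2, -⟩
      refine Reaches.setN (by simp [NExp.cost]) ⟨hset _ _ _ h1, ?_⟩
      simp [NExp.eval, h2 i hi, hik]
  · rintro s ⟨hs, hik⟩
    simp [BExp.eval, NExp.eval, hik, hbound N le_rfl s hs hik]
  · simp only [BExp.cost, NExp.cost, Finset.sum_const, Finset.card_range, smul_eq_mul]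
    have : Tb + 8 + (1 + (1 + 1 + 1) + bound.cost) = Tb + 12 + bound.cost := by ring
    rw [this]; omega

/-- The number of edges. -/
abbrev nE : NExp := .get 0 (.const 0) (.const 0)

/-- `for i < n do a[i] := v`. -/
def vmap (i a : ℕ) (v : RExp) : Cmd := forN i nE (.setR a (.const 0) (V i) v)

/-- `acc := 0; for i < n do acc := acc + v`. -/
def vsum (i acc : ℕ) (v : RExp) : Cmd :=
  .seq (letR acc (.const 0)) (forN i nE (letR acc (.add (S acc) v)))

theorem vmap_wN (i a : ℕ) (v : RExp) : (vmap i a v).wN = [i, i] := rfl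
theorem vmap_wR (i a : ℕ) (v : RExp) : (vmap i a v).wR = [a] := rfl
theorem vsum_wN (i a : ℕ) (v : RExp) : (vsum i a v).wN = [i, i] := rfl
theorem vsum_wR (i a : ℕ) (v : RExp) : (vsum i a v).wR = [a, a] := rfl

/-- The vector stored in the real array `a`. -/
def VecAt {n : ℕ} (s : Mem) (a : ℕ) (v : Vec n) : Prop := ∀ e : Fin n, s.real a 0 e = v e

/-- When entry `e` is computed, the old entry `e` of the target array is still intact; this permits
updates in place. -/
theorem Reaches.vmap {n : ℕ} {i a : ℕ} {r : RExp} {s : Mem} {T : ℕ} (v : Vec n)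
    (hn : s.nat 0 0 0 = n) (hi : i ≠ 0)
    (hv : ∀ (e : Fin n) (s' : Mem), (∀ b, b ≠ i → s'.nat b = s.nat b) → s'.nat i 0 0 = e →
      (∀ b, b ≠ a → s'.real b = s.real b) → s'.real a 0 e = s.real a 0 e → r.eval O s' = v e)
    (hT : n * (r.cost + 20) + 11 ≤ T) :
    Reaches O (vmap i a r) s T fun s' => VecAt s' a v ∧ (∀ b, b ≠ i → s'.nat b = s.nat b) ∧
      (∀ b, b ≠ a → s'.real b = s.real b) := by
  refine (Reaches.forN (N := n) (Tb := 5 + r.cost) (T := n * (r.cost + 20) + 11) (fun k s' => (∀ e : Fin n, (e : ℕ) < k → s'.real a 0 e = v e) ∧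
    (∀ e : Fin n, k ≤ (e : ℕ) → s'.real a 0 e = s.real a 0 e) ∧
    (∀ b, b ≠ i → s'.nat b = s.nat b) ∧ (∀ b, b ≠ a → s'.real b = s.real b))
    (by simp [Cmd.wN]) ?_ ?_ ?_ ?_ ?_).mono hT ?_
  · intro w
    exact ⟨fun e he => absurd he (Nat.not_lt_zero _), fun _ _ => rfl,
      fun b hb => setN_nat_of_ne _ _ _ _ hb, fun _ _ => rfl⟩
  · rintro k - s' ⟨-, -, h3, -⟩ -
    simp [NExp.eval, h3 0 hi.symm, hn]
  · rintro k s' w ⟨h1, h2, h3, h4⟩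
    exact ⟨h1, h2, fun b hb => by rw [setN_nat_of_ne _ _ _ _ hb, h3 b hb], h4⟩
  · rintro k hk s' ⟨h1, h2, h3, h4⟩ hik
    refine Reaches.setR (by simp [NExp.cost]) ⟨fun e he => ?_, fun e he => ?_, h3, fun b hb => ?_⟩
    · simp only [NExp.eval, hik, setR_real, true_and]
      split_ifs with hek
      · have hke : (⟨k, hk⟩ : Fin n) = e := Fin.ext hek.symm
        rw [← hke]
        exact hv ⟨k, hk⟩ s' h3 hik h4 (h2 ⟨k, hk⟩ le_rfl)
      · exact h1 e (by omega)
    · simp only [NExp.eval, hik, setR_real, true_and]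
      rw [if_neg (by omega)]
      exact h2 e (by omega)
    · rw [setR_real_of_ne _ _ _ _ hb, h4 b hb]
  · simp only [NExp.cost]
    have : n * (5 + r.cost + 12 + (1 + 1 + 1)) = n * (r.cost + 20) := by ring
    omega
  · rintro s' ⟨h1, -, h3, h4⟩
    exact ⟨fun e => h1 e e.2, h3, h4⟩

theorem Reaches.vsum {n : ℕ} {i a : ℕ} {r : RExp} {s : Mem} {T : ℕ} (v : Fin n → ℝ)
    (hn : s.nat 0 0 0 = n) (hi : i ≠ 0)
    (hv : ∀ (e : Fin n) (s' : Mem), (∀ b, b ≠ i → s'.nat b = s.nat b) → s'.nat i 0 0 = e →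
      (∀ b, b ≠ a → s'.real b = s.real b) → r.eval O s' = v e)
    (hT : n * (r.cost + 30) + 20 ≤ T) :
    Reaches O (vsum i a r) s T fun s' => s'.real a 0 0 = ∑ e, v e ∧
      (∀ b, b ≠ i → s'.nat b = s.nat b) ∧ (∀ b, b ≠ a → s'.real b = s.real b) := by
  refine Reaches.seq (Q' := fun s' => s'.real a 0 0 = 0 ∧ s'.nat = s.nat ∧
    (∀ b, b ≠ a → s'.real b = s.real b)) (T₁ := 4) (T₂ := n * (r.cost + 30) + 15)
    (Reaches.setR (by simp [NExp.cost, RExp.cost])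
      ⟨by simp [NExp.eval, RExp.eval], rfl, fun b hb => setR_real_of_ne _ _ _ _ hb⟩) ?_ (by omega)
  rintro s1 ⟨ha, hnat, hreal⟩
  refine (Reaches.forN (N := n) (Tb := 10 + r.cost) (T := n * (r.cost + 30) + 15) (fun k s' => s'.real a 0 0 = ∑ e : Fin n, (if (e : ℕ) < k then v e else 0) ∧
    (∀ b, b ≠ i → s'.nat b = s.nat b) ∧ (∀ b, b ≠ a → s'.real b = s.real b))
    (by simp [Cmd.wN]) ?_ ?_ ?_ ?_ ?_).mono le_rfl ?_
  · intro w
    exact ⟨by simpa using ha, fun b hb => by rw [setN_nat_of_ne _ _ _ _ hb, hnat], hreal⟩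
  · rintro k - s' ⟨-, h3, -⟩ -
    simp [NExp.eval, h3 0 hi.symm, hn]
  · rintro k s' w ⟨h1, h3, h4⟩
    exact ⟨h1, fun b hb => by rw [setN_nat_of_ne _ _ _ _ hb, h3 b hb], h4⟩
  · rintro k hk s' ⟨h1, h3, h4⟩ hik
    refine Reaches.setR (by simp [NExp.cost, RExp.cost]; omega) ⟨?_, h3, fun b hb => ?_⟩
    · simp only [NExp.eval, RExp.eval, setR_real_self]
      rw [h1, hv ⟨k, hk⟩ s' h3 hik h4]
      have : ∀ e : Fin n, (if (e : ℕ) < k + 1 then v e else 0) =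
          (if (e : ℕ) < k then v e else 0) + if e = ⟨k, hk⟩ then v e else 0 := by
        intro e
        by_cases h : e = ⟨k, hk⟩
        · subst h; simp
        · have hne : (e : ℕ) ≠ k := fun h' => h (Fin.ext h')
          simp only [h, if_false, add_zero]
          exact if_congr (by omega) rfl rfl
      simp only [this, Finset.sum_add_distrib]
      simp
    · rw [setR_real_of_ne _ _ _ _ hb, h4 b hb]
  · simp only [NExp.cost]
    have : n * (10 + r.cost + 12 + (1 + 1 + 1)) ≤ n * (r.cost + 30) :=
      Nat.mul_le_mul_left _ (by omega)
    omega
  · rintro s' ⟨h1, h3, h4⟩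
    exact ⟨by simpa using h1, h3, h4⟩

end RealRAM

namespace RealRAM

theorem Reaches.bind {O : Oracles} {c₁ c₂ : Cmd} {s : Mem} {T T₁ : ℕ} {Q Q' : Mem → Prop}
    (h1 : Reaches O c₁ s T₁ Q') (hT : T₁ ≤ T)
    (h2 : ∀ s', Q' s' → Reaches O c₂ s' (T - T₁) Q) : Reaches O (.seq c₁ c₂) s T Q :=
  Reaches.seq h1 h2 (by omega)

theorem Reaches.letR {O : Oracles} {a : ℕ} {v : RExp} {s : Mem} {T : ℕ} {x : ℝ}
    (hx : v.eval O s = x) (hT : 3 + v.cost ≤ T) :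
    Reaches O (letR a v) s T fun s' => s'.real a 0 0 = x ∧ (s'.nat = s.nat) ∧
      (∀ b, b ≠ a → s'.real b = s.real b) :=
  Reaches.setR (by simp only [NExp.cost]; omega)
    ⟨by simp [NExp.eval, hx], rfl, fun b hb => setR_real_of_ne _ _ _ _ hb⟩

theorem Reaches.letN {O : Oracles} {a : ℕ} {v : NExp} {s : Mem} {T : ℕ} {x : ℕ}
    (hx : v.eval s = x) (hT : 3 + v.cost ≤ T) :
    Reaches O (letN a v) s T fun s' => s'.nat a 0 0 = x ∧ (s'.real = s.real) ∧
      (∀ b, b ≠ a → s'.nat b = s.nat b) :=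
  Reaches.setN (by simp only [NExp.cost]; omega)
    ⟨by simp [NExp.eval, hx], rfl, fun b hb => setN_nat_of_ne _ _ _ _ hb⟩

end RealRAM

/-! ### The program for one candidate -/

namespace Traffic

/-- A subroutine `orc` that evaluates the first term of the objective and its (sub)gradient at the
vector in array `10`, in at most `To` steps, provided that the memory satisfies `Inv`. -/
structure OracleSpec {n : ℕ} (P : Composite n) (O : Oracles) (orc : Cmd) (To : ℕ)
    (Inv : Mem → Prop) : Prop where
  call : ∀ s x, x ∈ P.Q → Inv s → VecAt s 10 x →
    Reaches O orc s To fun s' => s'.real 12 0 0 = P.Φ x ∧ VecAt s' 11 (-P.grad x)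
  wN : ∀ a ∈ orc.wN, 30 ≤ a
  wR : ∀ a ∈ orc.wR, a = 11 ∨ a = 12 ∨ 50 ≤ a
  inv : ∀ s s' : Mem, (∀ a, a < 10 ∨ (20 ≤ a ∧ a < 30) → s'.nat a = s.nat a) →
    (∀ a, a < 4 ∨ (40 ≤ a ∧ a < 50) → s'.real a = s.real a) → Inv s → Inv s'

/-- The division of the memory: a subroutine writes index arrays only from `30` on, and real arrays
only `11`, `12` and from `50` on. The input and the tables (index arrays `20` to `29`, real arrays
`40` to `49`) therefore survive, and with them `Inv`. -/
theorem OracleSpec.call' {n : ℕ} {P : Composite n} {O : Oracles} {orc : Cmd} {To : ℕ}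
    {Inv : Mem → Prop} (h : OracleSpec P O orc To Inv) {s : Mem} {x : Vec n} (hx : x ∈ P.Q)
    (hI : Inv s) (hs : VecAt s 10 x) :
    Reaches O orc s To fun s' => Inv s' ∧ s'.real 12 0 0 = P.Φ x ∧ VecAt s' 11 (-P.grad x) ∧
      (∀ a, a < 30 → s'.nat a = s.nat a) ∧
      (∀ a, a < 50 → a ≠ 11 → a ≠ 12 → s'.real a = s.real a) := by
  refine (h.call s x hx hI hs).frame.mono le_rfl ?_
  rintro s' ⟨⟨h1, h2⟩, h3, h4⟩
  have hN : ∀ a, a < 30 → s'.nat a = s.nat a := fun a ha => h3 a fun hm => by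
    have := h.wN a hm; omega
  have hR : ∀ a, a < 50 → a ≠ 11 → a ≠ 12 → s'.real a = s.real a := fun a ha h11 h12 => h4 a fun hm => by
    have := h.wR a hm; omega
  exact ⟨h.inv s s' (fun a ha => hN a (by omega)) (fun a ha => hR a (by omega) (by omega) (by omega)) hI,
    h1, h2, hN, hR⟩

/-- One trial of the method: computes a candidate and tests it. -/
def trialCmd (orc : Cmd) (px : RExp) : Cmd :=
  -- On entry `13` holds `A`, `14` holds `L`, and `17`, `4`, `18` hold `u`, `t` and minus the
  -- gradient sum. The candidate goes to `15` (`α`), `16` (`A`), `24` (`y`), `23` (`u`) and `25`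
  -- (`t`); `22` receives minus the new gradient sum and `26` the constant term of the
  -- linearization.
  .seq (letR 15 (.add (.div (.const 1) (.mul (.const 2) (S 14))) (.sqrt (.add
    (.div (.const 1) (.mul (.const 4) (.mul (S 14) (S 14)))) (.div (S 13) (S 14)))))) <|
  .seq (letR 16 (.add (S 13) (S 15))) <|
  .seq (vmap 10 24 (.mul (.div (.const 1) (S 16))
    (.add (.mul (S 15) (W 17 10)) (.mul (S 13) (W 4 10))))) <|
  .seq (vmap 10 10 (W 24 10)) <|
  .seq orc <|
  .seq (letR 20 (S 12)) <|
  .seq (vmap 10 22 (.add (W 18 10) (.mul (S 15) (W 11 10)))) <|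
  .seq (vsum 10 27 (.mul (W 11 10) (W 24 10))) <|
  .seq (letR 26 (.add (S 20) (S 27))) <|
  -- The gradient at `y` is saved, since the second call, at `t`, overwrites array `11`.
  .seq (vmap 10 21 (W 11 10)) <|
  .seq (vmap 10 23 px) <|
  .seq (vmap 10 25 (.mul (.div (.const 1) (S 16))
    (.add (.mul (S 15) (W 23 10)) (.mul (S 13) (W 4 10))))) <|
  .seq (vmap 10 10 (W 25 10)) <|
  .seq orc <|
  .seq (vsum 10 27 (.mul (W 21 10) (.sub (W 24 10) (W 25 10)))) <|
  .seq (vsum 10 28 (.mul (.sub (W 25 10) (W 24 10)) (.sub (W 25 10) (W 24 10)))) <|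
  .seq (letR 29 (.add (.add (.add (S 20) (S 27)) (.mul (.div (S 14) (.const 2)) (S 28)))
    (.mul (.div (S 15) (.mul (.const 2) (S 16))) (.get 0 (.const 0) (.const 1))))) <|
  .ite (.ltR (S 29) (S 12)) (letR 14 (.mul (.const 2) (S 14))) (letN 11 (.const 1))

theorem trialCmd_wN {orc : Cmd} {px : RExp} (h : ∀ a ∈ orc.wN, 30 ≤ a) :
    ∀ a ∈ (trialCmd orc px).wN, a = 10 ∨ a = 11 ∨ 30 ≤ a := by
  intro a ha
  simp only [trialCmd, Cmd.wN, vmap_wN, vsum_wN, List.mem_append, List.mem_cons,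
    List.not_mem_nil, or_false, false_or] at ha
  by_cases ho : a ∈ orc.wN
  · have := h a ho; omega
  · simp only [ho, false_or] at ha; omega

theorem trialCmd_wR {orc : Cmd} {px : RExp} (h : ∀ a ∈ orc.wR, a = 11 ∨ a = 12 ∨ 50 ≤ a) :
    ∀ a ∈ (trialCmd orc px).wR, (10 ≤ a ∧ a < 30 ∧ a ≠ 13 ∧ a ≠ 17 ∧ a ≠ 18 ∧ a ≠ 19) ∨ 50 ≤ a := by
  intro a ha
  simp only [trialCmd, Cmd.wR, vmap_wR, vsum_wR, List.mem_append, List.mem_cons,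
    List.not_mem_nil, or_false] at ha
  by_cases ho : a ∈ orc.wR
  · have := h a ho; omega
  · simp only [ho, false_or] at ha; omega

namespace Composite
variable {n : ℕ} {P : Composite n}

theorem Regular.isProx_unique (hP : P.Regular) {e : Fin n} {a c s s' : ℝ} (ha : 0 ≤ a)
    (h : P.IsProx e a c s) (h' : P.IsProx e a c s') : s' = s := by
  have h1 := hP.prox_growth ha h h'.1
  have h2 := h'.2 s h.1
  nlinarith [sq_nonneg (s' - s)]

end Composite

variable {n : ℕ} {P : Composite n} {O : Oracles} {orc : Cmd} {px : RExp} {To : ℕ}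
  {Inv : Mem → Prop}

/-- The expression `px` solves the scalar auxiliary problems. -/
def ProxSpec (P : Composite n) (O : Oracles) (px : RExp) (s0 : Mem) : Prop :=
  ∀ (s : Mem) (e : Fin n) (a c : ℝ), 0 < a → s.nat 10 0 0 = e → s.real 16 0 0 = a →
    s.real 22 0 e = -c → (∀ b, b < 4 → s.real b = s0.real b) → P.IsProx e a c (px.eval O s)

/-- The program is executed symbolically along the states `s1, s2, …`. Each value written is the
corresponding component of the unique candidate `c`, and the final branch tests the negation of the
acceptance inequality. -/
theorem reaches_trialCmd (hP : P.Regular) (hO : OracleSpec P O orc To Inv) {s0 s : Mem}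
    (hpx : ProxSpec P O px s0) (hpc : px.cost ≤ 60) (hI : Inv s) (hn : s.nat 0 0 0 = n) {ε : ℝ}
    (hε : s.real 0 0 1 = ε) (hb : ∀ b, b < 4 → s.real b = s0.real b)
    {A L κ : ℝ} {u t b : Vec n} {ψ : Vec n → ℝ} {c : Iterate n}
    (hA : 0 ≤ A) (hL : 0 < L) (hu : u ∈ P.Q) (ht : t ∈ P.Q)
    (hψ : ∀ x, ψ x = κ + P.sepObj A b x) (hc : P.Trial A u t ψ L c)
    (h13 : s.real 13 0 0 = A) (h14 : s.real 14 0 0 = L) (h17 : VecAt s 17 u) (h4 : VecAt s 4 t)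
    (h18 : VecAt s 18 (-b)) (h11 : s.nat 11 0 0 = 0) :
    Reaches O (trialCmd orc px) s (2000 * (n + 1) + 2 * To) fun s' =>
      Inv s' ∧ s'.real 15 0 0 = c.α ∧ s'.real 16 0 0 = c.A ∧
      VecAt s' 22 (-(b + c.α • P.grad c.y)) ∧ VecAt s' 23 c.u ∧ VecAt s' 25 c.t ∧
      s'.real 26 0 0 = P.Φ c.y - inner ℝ (P.grad c.y) c.y ∧ s'.real 12 0 0 = P.Φ c.t ∧
      (P.Accepts ε L c → s'.nat 11 0 0 = 1 ∧ s'.real 14 0 0 = L) ∧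
      (¬ P.Accepts ε L c → s'.nat 11 0 0 = 0 ∧ s'.real 14 0 0 = 2 * L) := by
  obtain ⟨hα, hcA, hcy, hcu, hct⟩ := (Composite.trial_sep_iff hψ).1 hc
  obtain ⟨hαpos, hcApos, -, hyQ, huQ, htQ⟩ := hP.trial_mem hA hL hu ht hc
  have hprox : ∀ e, P.IsProx e c.A ((b + c.α • P.grad c.y) e) (c.u e) := by
    obtain ⟨v, hv⟩ := hP.exists_prox hcApos (b + c.α • P.grad c.y)
    rw [hP.eq_of_isArgmin hcApos hv hcu]; exact hv
  -- The budget for one vector operation; kept opaque so that the bookkeeping stays linear.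
  obtain ⟨U, hU⟩ : ∃ U, U = 100 * (n + 1) := ⟨_, rfl⟩
  have hTU : 2000 * (n + 1) + 2 * To = 20 * U + 2 * To := by rw [hU]; ring
  rw [hTU]
  unfold trialCmd
  refine Reaches.bind (T₁ := U) (Reaches.letR (x := c.α) ?_ ?_) (by omega) ?_
  · rw [hα]; simp [RExp.eval, NExp.eval, h13, h14, pow_two]
  · simp only [RExp.cost, NExp.cost]; omega
  rintro s1 ⟨e1, N1, R1⟩
  refine Reaches.bind (T₁ := U) (Reaches.letR (x := c.A) ?_ ?_) (by omega) ?_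
  · rw [hcA]; simp [RExp.eval, NExp.eval, h13, e1, R1]
  · simp only [RExp.cost, NExp.cost]; omega
  rintro s2 ⟨e2, N2, R2⟩
  refine Reaches.bind (T₁ := U) (Reaches.vmap (n := n) c.y ?_ (by decide) ?_ ?_) (by omega) ?_
  · simp [N2, N1, hn]
  · intro e s' hN hi hR ha
    simp [RExp.eval, NExp.eval, hi, hR, e2, R2, e1, R1, h13, h17 e, h4 e, hcy]
    ring
  · simp only [RExp.cost, NExp.cost]; omega
  rintro s3 ⟨e3, N3, R3⟩
  refine Reaches.bind (T₁ := U) (Reaches.vmap (n := n) c.y ?_ (by decide) ?_ ?_) (by omega) ?_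
  · simp [N3, N2, N1, hn]
  · intro e s' hN hi hR ha
    simp [RExp.eval, NExp.eval, hi, hR, e3 e]
  · simp only [RExp.cost, NExp.cost]; omega
  rintro s4 ⟨e4, N4, R4⟩
  have hI4 : Inv s4 := by
    refine hO.inv s s4 (fun a ha => ?_) (fun a ha => ?_) hI
    · rw [N4 a (by omega), N3 a (by omega), N2, N1]
    · rw [R4 a (by omega), R3 a (by omega), R2 a (by omega), R1 a (by omega)]
  refine Reaches.bind (T₁ := To) (hO.call' hyQ hI4 e4) (by omega) ?_
  rintro s5 ⟨hI5, e5, f5, N5, R5⟩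
  refine Reaches.bind (T₁ := U) (Reaches.letR (x := P.Φ c.y) ?_ ?_) (by omega) ?_
  · simp [RExp.eval, NExp.eval, e5]
  · simp only [RExp.cost, NExp.cost]; omega
  rintro s6 ⟨e6, N6, R6⟩
  refine Reaches.bind (T₁ := U) (Reaches.vmap (n := n) (-(b + c.α • P.grad c.y)) ?_ (by decide) ?_ ?_)
    (by omega) ?_
  · simp [N6, N5, N4, N3, N2, N1, hn]
  · intro e s' hN hi hR ha
    simp [RExp.eval, NExp.eval, hi, hR, R6, R5, R4, R3, R2, R1, e1, h18 e, f5 e]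
    ring
  · simp only [RExp.cost, NExp.cost]; omega
  rintro s7 ⟨e7, N7, R7⟩
  refine Reaches.bind (T₁ := U) (Reaches.vsum (n := n) (fun e => -P.grad c.y e * c.y e) ?_ (by decide) ?_ ?_)
    (by omega) ?_
  · simp [N7, N6, N5, N4, N3, N2, N1, hn]
  · intro e s' hN hi hR
    simp [RExp.eval, NExp.eval, hi, hR, R7, R6, R5, R4, e3 e, f5 e]
  · simp only [RExp.cost, NExp.cost]; omega
  rintro s8 ⟨e8, N8, R8⟩
  refine Reaches.bind (T₁ := U) (Reaches.letR (x := P.Φ c.y - inner ℝ (P.grad c.y) c.y) ?_ ?_)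
    (by omega) ?_
  · simp [RExp.eval, NExp.eval, e8, R8, R7, e6, Composite.inner_eq_sum]
    ring
  · simp only [RExp.cost, NExp.cost]; omega
  rintro s9 ⟨e9, N9, R9⟩
  refine Reaches.bind (T₁ := U) (Reaches.vmap (n := n) (-P.grad c.y) ?_ (by decide) ?_ ?_)
    (by omega) ?_
  · simp [N9, N8, N7, N6, N5, N4, N3, N2, N1, hn]
  · intro e s' hN hi hR ha
    simp [RExp.eval, NExp.eval, hi, hR, R9, R8, R7, R6, f5 e]
  · simp only [RExp.cost, NExp.cost]; omega
  rintro s10 ⟨e10, N10, R10⟩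
  refine Reaches.bind (T₁ := U) (Reaches.vmap (n := n) c.u ?_ (by decide) ?_ ?_)
    (by omega) ?_
  · simp [N10, N9, N8, N7, N6, N5, N4, N3, N2, N1, hn]
  · intro e s' hN hi hR ha
    -- The program only knows that it has some solution of the scalar problem; uniqueness makes it
    -- the component of `c.u`.
    refine hP.isProx_unique hcApos.le (hprox e) (hpx s' e c.A _ hcApos hi ?_ ?_ ?_)
    · simp [hR, R10, R9, R8, R7, R6, R5, R4, R3, e2]
    · simpa [hR, R10, R9, R8] using e7 e
    · intro a ha'
      rw [hR a (by omega), R10 a (by omega), R9 a (by omega), R8 a (by omega), R7 a (by omega),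
        R6 a (by omega), R5 a (by omega) (by omega) (by omega), R4 a (by omega), R3 a (by omega),
        R2 a (by omega), R1 a (by omega), hb a ha']
  · have := Nat.mul_le_mul_left n (show px.cost + 20 ≤ 80 by omega); omega
  rintro s11 ⟨e11, N11, R11⟩
  refine Reaches.bind (T₁ := U) (Reaches.vmap (n := n) c.t ?_ (by decide) ?_ ?_)
    (by omega) ?_
  · simp [N11, N10, N9, N8, N7, N6, N5, N4, N3, N2, N1, hn]
  · intro e s' hN hi hR ha
    simp [RExp.eval, NExp.eval, hi, hR, R11, R10, R9, R8, R7, R6, R5, R4, R3, e2, R2, e1, R1, h13,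
      e11 e, h4 e, hct]
    ring
  · simp only [RExp.cost, NExp.cost]; omega
  rintro s12 ⟨e12, N12, R12⟩
  refine Reaches.bind (T₁ := U) (Reaches.vmap (n := n) c.t ?_ (by decide) ?_ ?_) (by omega) ?_
  · simp [N12, N11, N10, N9, N8, N7, N6, N5, N4, N3, N2, N1, hn]
  · intro e s' hN hi hR ha
    simp [RExp.eval, NExp.eval, hi, hR, e12 e]
  · simp only [RExp.cost, NExp.cost]; omega
  rintro s13 ⟨e13, N13, R13⟩
  have hI13 : Inv s13 := by
    refine hO.inv s5 s13 (fun a ha => ?_) (fun a ha => ?_) hI5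
    · rw [N13 a (by omega), N12 a (by omega), N11 a (by omega), N10 a (by omega), N9,
        N8 a (by omega), N7 a (by omega), N6]
    · rw [R13 a (by omega), R12 a (by omega), R11 a (by omega), R10 a (by omega), R9 a (by omega),
        R8 a (by omega), R7 a (by omega), R6 a (by omega)]
  refine Reaches.bind (T₁ := To) (hO.call' htQ hI13 e13) (by omega) ?_
  rintro s14 ⟨hI14, e14, f14, N14, R14⟩
  refine Reaches.bind (T₁ := U) (Reaches.vsum (n := n) (fun e => -P.grad c.y e * (c.y e - c.t e))
    ?_ (by decide) ?_ ?_) (by omega) ?_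
  · simp [N14, N13, N12, N11, N10, N9, N8, N7, N6, N5, N4, N3, N2, N1, hn]
  · intro e s' hN hi hR
    simp [RExp.eval, NExp.eval, hi, hR, R14, R13, R12, R11, e10 e, R10, R9, R8, R7, R6, R5, R4, e3 e,
      e12 e]
  · simp only [RExp.cost, NExp.cost]; omega
  rintro s15 ⟨e15, N15, R15⟩
  refine Reaches.bind (T₁ := U) (Reaches.vsum (n := n) (fun e => (c.t e - c.y e) ^ 2)
    ?_ (by decide) ?_ ?_) (by omega) ?_
  · simp [N15, N14, N13, N12, N11, N10, N9, N8, N7, N6, N5, N4, N3, N2, N1, hn]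
  · intro e s' hN hi hR
    simp [RExp.eval, NExp.eval, hi, hR, R15, R14, R13, R12, R11, R10, R9, R8, R7, R6, R5, R4, e3 e,
      e12 e, pow_two]
  · simp only [RExp.cost, NExp.cost]; omega
  rintro s16 ⟨e16, N16, R16⟩
  refine Reaches.bind (T₁ := U) (Reaches.letR (x := P.Φ c.y + inner ℝ (P.grad c.y) (c.t - c.y) +
    L / 2 * ‖c.t - c.y‖ ^ 2 + c.α / (2 * c.A) * ε) ?_ ?_) (by omega) ?_
  · have e27 : ∑ e, P.grad c.y e * (c.t e - c.y e) = ∑ e, -P.grad c.y e * (c.y e - c.t e) :=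
      Finset.sum_congr rfl fun e _ => by ring
    rw [Composite.inner_eq_sum, Composite.norm_sq_eq_sum]
    simp only [PiLp.sub_apply]
    rw [e27, ← e16, ← e15]
    have a20 : s16.real 20 0 0 = P.Φ c.y := by
      simp [R16, R15, R14, R13, R12, R11, R10, R9, R8, R7, e6]
    have a15 : s16.real 15 0 0 = c.α := by
      simp [R16, R15, R14, R13, R12, R11, R10, R9, R8, R7, R6, R5, R4, R3, R2, e1]
    have a16 : s16.real 16 0 0 = c.A := by
      simp [R16, R15, R14, R13, R12, R11, R10, R9, R8, R7, R6, R5, R4, R3, e2]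
    have a14 : s16.real 14 0 0 = L := by
      simp [R16, R15, R14, R13, R12, R11, R10, R9, R8, R7, R6, R5, R4, R3, R2, R1, h14]
    have a0 : s16.real 0 0 1 = ε := by
      simp [R16, R15, R14, R13, R12, R11, R10, R9, R8, R7, R6, R5, R4, R3, R2, R1, hε]
    simp [RExp.eval, NExp.eval, a20, a15, a16, a14, a0, R16]
  · simp only [RExp.cost, NExp.cost]; omega
  rintro s17 ⟨e17, N17, R17⟩
  have a12 : s17.real 12 0 0 = P.Φ c.t := by simp [R17, R16, R15, e14]
  have hI17 : Inv s17 := by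
    refine hO.inv s14 s17 (fun a ha => ?_) (fun a ha => ?_) hI14
    · rw [N17, N16 a (by omega), N15 a (by omega)]
    · rw [R17 a (by omega), R16 a (by omega), R15 a (by omega)]
  have a15 : s17.real 15 0 0 = c.α := by
    simp [R17, R16, R15, R14, R13, R12, R11, R10, R9, R8, R7, R6, R5, R4, R3, R2, e1]
  have a16 : s17.real 16 0 0 = c.A := by
    simp [R17, R16, R15, R14, R13, R12, R11, R10, R9, R8, R7, R6, R5, R4, R3, e2]
  have a14 : s17.real 14 0 0 = L := by
    simp [R17, R16, R15, R14, R13, R12, R11, R10, R9, R8, R7, R6, R5, R4, R3, R2, R1, h14]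
  have a22 : VecAt s17 22 (-(b + c.α • P.grad c.y)) := fun e => by
    rw [← e7 e]; simp [R17, R16, R15, R14, R13, R12, R11, R10, R9, R8]
  have a23 : VecAt s17 23 c.u := fun e => by
    rw [← e11 e]; simp [R17, R16, R15, R14, R13, R12]
  have a25 : VecAt s17 25 c.t := fun e => by
    rw [← e12 e]; simp [R17, R16, R15, R14, R13]
  have a26 : s17.real 26 0 0 = P.Φ c.y - inner ℝ (P.grad c.y) c.y := by
    rw [← e9]; simp [R17, R16, R15, R14, R13, R12, R11, R10]
  have b11 : s17.nat 11 0 0 = 0 := by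
    simp [N17, N16, N15, N14, N13, N12, N11, N10, N9, N8, N7, N6, N5, N4, N3, N2, N1, h11]
  have hbe : BExp.eval O s17 (.ltR (S 29) (S 12)) ↔ ¬ P.Accepts ε L c := by
    simp only [BExp.eval, RExp.eval, NExp.eval, e17, a12, Composite.Accepts, not_le]
  refine Reaches.ite (T₁ := 20) (fun hb' => ?_) (fun hb' => ?_)
    (by simp only [BExp.cost, RExp.cost, NExp.cost]; omega)
  · refine (Reaches.letR (x := 2 * L) (by simp [RExp.eval, NExp.eval, a14])
      (by simp [RExp.cost, NExp.cost])).mono le_rfl ?_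
    rintro s18 ⟨e18, N18, R18⟩
    refine ⟨hO.inv s17 s18 (fun a _ => by rw [N18]) (fun a ha => R18 a (by omega)) hI17, ?_⟩
    refine ⟨by simp [R18, a15], by simp [R18, a16], fun e => by rw [← a22 e]; simp [R18],
      fun e => by rw [← a23 e]; simp [R18], fun e => by rw [← a25 e]; simp [R18],
      by rw [← a26]; simp [R18], by simp [R18, a12], fun h => absurd h (hbe.1 hb'),
      fun _ => ⟨by rw [N18, b11], e18⟩⟩
  · refine (Reaches.letN (x := 1) (by simp [NExp.eval])
      (by simp [NExp.cost])).mono le_rfl ?_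
    rintro s18 ⟨e18, R18, N18⟩
    refine ⟨hO.inv s17 s18 (fun a ha => N18 a (by omega)) (fun a _ => by rw [R18]) hI17, ?_⟩
    refine ⟨by rw [R18, a15], by rw [R18, a16], fun e => by rw [R18, a22 e],
      fun e => by rw [R18, a23 e], fun e => by rw [R18, a25 e], by rw [R18, a26],
      by rw [R18, a12], fun _ => ⟨e18, by rw [R18, a14]⟩, fun h => absurd (hbe.2 h) hb'⟩

end Traffic

/-! ### The program for the whole method -/

namespace Traffic

/-- The scalar compared with the accuracy in the stopping test. -/
def gapExp : RExp :=
  -- The quotient of `19` and `13` is `-𝓔_N`. Entry `3` of the parameter array is `R`, which is `0`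
  -- in the Beckmann model, so one expression serves both models.
  .sub (.add (.add (S 12) (S 30)) (.mul (.mul (.const 3) (.get 0 (.const 0) (.const 3)))
    (.sqrt (S 31)))) (.div (S 19) (S 13))

/-- One iteration of the method. -/
def iterCmd (orc : Cmd) (px ge qe : RExp) : Cmd :=
  .seq (letR 14 (.div (S 14) (.const 2))) <|
  .seq (letN 11 (.const 0)) <|
  .seq (.loop (.ltN (V 11) (.const 1)) (trialCmd orc px)) <|
  .seq (letR 19 (.add (S 19) (.mul (S 15) (S 26)))) <|
  .seq (letR 13 (S 16)) <|
  .seq (vmap 10 17 (W 23 10)) <|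
  .seq (vmap 10 4 (W 25 10)) <|
  .seq (vmap 10 18 (W 22 10)) <|
  .seq (vmap 10 5 (.mul (.div (.const 1) (S 13)) (W 18 10))) <|
  .seq (vsum 10 30 ge) <|
  .seq (vsum 10 31 qe) <|
  .ite (.ltR gapExp (.get 0 (.const 0) (.const 1))) (letN 12 (.const 1)) .skip

/-- The universal method of similar triangles. -/
def methodCmd (setup orc : Cmd) (px ge qe : RExp) : Cmd :=
  .seq setup <|
  .seq (letR 13 (.const 0)) <|
  -- Every iteration begins by halving the constant, so `2 L₀` is stored to make the first constant
  -- tried equal to `L₀`.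
  .seq (letR 14 (.mul (.const 2) (.get 0 (.const 0) (.const 2)))) <|
  .seq (letR 19 (.const 0)) <|
  .seq (vmap 10 17 (W 2 10)) <|
  .seq (vmap 10 4 (W 2 10)) <|
  .seq (vmap 10 18 (.const 0)) <|
  .seq (letN 12 (.const 0)) <|
  .loop (.ltN (V 12) (.const 1)) (iterCmd orc px ge qe)

variable {n : ℕ} {P : Composite n} {O : Oracles} {orc : Cmd} {px ge qe : RExp} {To : ℕ}
  {Inv : Mem → Prop}

/-- The expression `ge` evaluates the edge term `g e (t_e) (f_e)` from the arrays `4` and `5`. -/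
def EdgeSpec (n : ℕ) (O : Oracles) (ge : RExp) (g : Fin n → ℝ → ℝ → ℝ) (s0 : Mem) : Prop :=
  ∀ (s : Mem) (e : Fin n), s.nat 10 0 0 = e → (∀ b, b < 4 → s.real b = s0.real b) →
    ge.eval O s = g e (s.real 4 0 e) (s.real 5 0 e)

/-- The data of the problem that the main loop reads from the memory. -/
structure InputSpec (P : Composite n) (s0 : Mem) (ε L₀ R : ℝ) : Prop where
  hn : s0.nat 0 0 0 = n
  hε : s0.real 0 0 1 = ε
  hL : s0.real 0 0 2 = L₀
  hR : s0.real 0 0 3 = R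
  start : VecAt s0 2 P.start

variable {L₀ ε : ℝ} (run : P.Run L₀ ε)

/-- The sum `∑_{i<k} α_i (Φ(y_i) - ⟨∇Φ(y_i), y_i⟩)`. -/
noncomputable def lowSum (k : ℕ) : ℝ := ∑ i ∈ Finset.range k,
  (run.z i).α * (P.Φ (run.z i).y - inner ℝ (P.grad (run.z i).y) (run.z i).y)

/-- The value tested by the stopping criterion. -/
noncomputable def gapVal (g q : Fin n → ℝ → ℝ → ℝ) (R : ℝ) (k : ℕ) : ℝ :=
  P.Φ (run.z k).t + ∑ e, g e ((run.z k).t e) (run.avgFlow k e) +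
    3 * R * Real.sqrt (∑ e, q e ((run.z k).t e) (run.avgFlow k e)) -
      lowSum run (k + 1) / (run.z k).A

/-- The contents of the memory before iteration `k`. -/
structure IterState (Inv : Mem → Prop) (s0 : Mem) (k : ℕ) (s : Mem) : Prop where
  inv : Inv s
  nat0 : s.nat 0 = s0.nat 0
  real0 : ∀ b, b < 4 → s.real b = s0.real b
  h13 : s.real 13 0 0 = run.accum k
  h14 : s.real 14 0 0 = 2 * run.base k
  h17 : VecAt s 17 (run.prevU k)
  h4 : VecAt s 4 (run.prevT k)
  h18 : VecAt s 18 (-run.gradSum k)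
  h19 : s.real 19 0 0 = lowSum run k
  -- There is no averaged flow before the first iteration has finished.
  h5 : ∀ j, k = j + 1 → VecAt s 5 (run.avgFlow j)

/-- The contents of the memory after the trials of iteration `k`. -/
structure TrialState (Inv : Mem → Prop) (s0 : Mem) (k : ℕ) (s : Mem) : Prop where
  inv : Inv s
  nat0 : s.nat 0 = s0.nat 0
  real0 : ∀ b, b < 4 → s.real b = s0.real b
  h14 : s.real 14 0 0 = run.L k
  h15 : s.real 15 0 0 = (run.z k).α
  h16 : s.real 16 0 0 = (run.z k).A
  h22 : VecAt s 22 (-run.gradSum (k + 1))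
  h23 : VecAt s 23 (run.z k).u
  h25 : VecAt s 25 (run.z k).t
  h26 : s.real 26 0 0 = P.Φ (run.z k).y - inner ℝ (P.grad (run.z k).y) (run.z k).y
  h12 : s.real 12 0 0 = P.Φ (run.z k).t
  h19 : s.real 19 0 0 = lowSum run k

/-- The loop makes exactly `j k + 1` rounds: by `rejects` the first `j k` constants fail, and the
candidate for the next one is `z k` by uniqueness, hence accepted. -/
theorem reaches_trials (hP : P.Regular) (h0 : 0 < L₀) (hO : OracleSpec P O orc To Inv) {s0 : Mem}
    (hpx : ProxSpec P O px s0) (hpc : px.cost ≤ 60) {R : ℝ} (hin : InputSpec P s0 ε L₀ R)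
    {k : ℕ} {s : Mem} (hinv : Inv s) (hnat0 : s.nat 0 = s0.nat 0)
    (hreal0 : ∀ b, b < 4 → s.real b = s0.real b)
    (h13 : s.real 13 0 0 = run.accum k) (h14 : s.real 14 0 0 = run.base k)
    (h17 : VecAt s 17 (run.prevU k)) (h4 : VecAt s 4 (run.prevT k))
    (h18 : VecAt s 18 (-run.gradSum k)) (h19 : s.real 19 0 0 = lowSum run k)
    (h11 : s.nat 11 0 0 = 0) :
    Reaches O (.loop (.ltN (V 11) (.const 1)) (trialCmd orc px)) s
      ((run.j k + 1) * (2010 * (n + 1) + 2 * To) + 10) fun s' => TrialState run Inv s0 k s' ∧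
        s'.nat 12 = s.nat 12 := by
  obtain ⟨κ, hκ⟩ := run.model_sep h0 k
  have hst := run.state_mem h0 hP k
  have hbase := run.base_pos h0 k
  have hgs : run.gradSum k + (run.z k).α • P.grad (run.z k).y = run.gradSum (k + 1) := by
    simp only [Composite.Run.gradSum, Finset.sum_range_succ]
  -- Two phases: up to `j k` rounds the initial data are intact and only the constant has been
  -- doubled; after the last round the accepted candidate is in memory.
  let I : ℕ → Mem → Prop := fun i s' => (Inv s' ∧ s'.nat 0 = s0.nat 0 ∧
    (∀ b, b < 4 → s'.real b = s0.real b) ∧ s'.nat 12 = s.nat 12 ∧ s'.real 19 0 0 = lowSum run k) ∧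
    (i ≤ run.j k → s'.real 13 0 0 = run.accum k ∧ s'.real 14 0 0 = 2 ^ i * run.base k ∧
      VecAt s' 17 (run.prevU k) ∧ VecAt s' 4 (run.prevT k) ∧ VecAt s' 18 (-run.gradSum k) ∧
      s'.nat 11 0 0 = 0) ∧
    (i = run.j k + 1 → s'.nat 11 0 0 = 1 ∧ s'.real 14 0 0 = run.L k ∧
      s'.real 15 0 0 = (run.z k).α ∧ s'.real 16 0 0 = (run.z k).A ∧
      VecAt s' 22 (-run.gradSum (k + 1)) ∧ VecAt s' 23 (run.z k).u ∧ VecAt s' 25 (run.z k).t ∧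
      s'.real 26 0 0 = P.Φ (run.z k).y - inner ℝ (P.grad (run.z k).y) (run.z k).y ∧
      s'.real 12 0 0 = P.Φ (run.z k).t)
  refine (Reaches.loop_count (run.j k + 1) I (fun _ => 2000 * (n + 1) + 2 * To)
    ⟨⟨hinv, hnat0, hreal0, rfl, h19⟩, fun _ => ⟨h13, by simpa using h14, h17, h4, h18, h11⟩,
      fun h => absurd h (by omega)⟩ ?_ ?_).mono (T₁ := _) ?_ ?_
  · rintro i hi s1 ⟨⟨i1, i2, i3, i4, i5⟩, hpre, -⟩
    obtain ⟨p13, p14, p17, p4, p18, p11⟩ := hpre (by omega)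
    refine ⟨by simp [BExp.eval, NExp.eval, p11], ?_⟩
    have hLi : 0 < 2 ^ i * run.base k := by positivity
    obtain ⟨c, hc⟩ := hP.exists_trial (u := run.prevU k) (t := run.prevT k) hst.1 hLi hκ
    have hr := reaches_trialCmd hP hO hpx hpc i1 (by rw [i2, hin.hn]) (ε := ε)
      (by rw [i3 0 (by omega), hin.hε]) i3 hst.1 hLi hst.2.1 hst.2.2 hκ hc p13 p14 p17 p4 p18 p11
    refine hr.frame.mono le_rfl ?_
    rintro s2 ⟨⟨q1, q15, q16, q22, q23, q25, q26, q12, qa, qr⟩, fN, fR⟩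
    have hN : ∀ a, a < 30 → a ≠ 10 → a ≠ 11 → s2.nat a = s1.nat a := fun a h1 h2 h3 =>
      fN a fun hm => by have := trialCmd_wN hO.wN a hm; omega
    have hR : ∀ a, a < 50 → (a < 10 ∨ 30 ≤ a ∨ a = 13 ∨ a = 17 ∨ a = 18 ∨ a = 19) →
        s2.real a = s1.real a := fun a h1 h2 =>
      fR a fun hm => by have := trialCmd_wR (px := px) hO.wR a hm; omega
    refine ⟨⟨q1, by rw [hN 0 (by omega) (by omega) (by omega), i2], fun b hb => ?_,
      by rw [hN 12 (by omega) (by omega) (by omega), i4], by rw [hR 19 (by omega) (by omega), i5]⟩,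
      fun hle => ?_, fun heq => ?_⟩
    · rw [hR b (by omega) (by omega), i3 b hb]
    · have hna := run.rejects h0 k i (by omega) c hc
      obtain ⟨r11, r14⟩ := qr hna
      refine ⟨by rw [hR 13 (by omega) (by omega), p13], by rw [r14, pow_succ]; ring,
        fun e => by rw [hR 17 (by omega) (by omega), p17 e],
        fun e => by rw [hR 4 (by omega) (by omega), p4 e],
        fun e => by rw [hR 18 (by omega) (by omega), p18 e], r11⟩
    · have hij : i = run.j k := by omega
      have hL : 2 ^ i * run.base k = run.L k := by rw [run.L_eq, hij]
      have hcz : c = run.z k := by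
        rw [hL] at hc
        exact hP.trial_unique hst.1 (run.L_pos h0 k) hκ hc (run.trial h0 k)
      subst hcz
      have hacc := run.accepts k
      rw [hL] at qa
      obtain ⟨r11, r14⟩ := qa hacc
      rw [hgs] at q22
      exact ⟨r11, r14, q15, q16, q22, q23, q25, q26, q12⟩
  · rintro s1 ⟨-, -, hpost⟩
    simp [BExp.eval, NExp.eval, (hpost rfl).1]
  · simp only [BExp.cost, NExp.cost, Finset.sum_const, Finset.card_range, smul_eq_mul]
    have h1 : (run.j k + 1) * (2000 * (n + 1) + 2 * To + (1 + (1 + 1 + 1) + 1)) ≤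
      (run.j k + 1) * (2010 * (n + 1) + 2 * To) := Nat.mul_le_mul_left _ (by omega)
    omega
  · rintro s1 ⟨⟨i1, i2, i3, i4, i5⟩, -, hpost⟩
    obtain ⟨r11, r14, q15, q16, q22, q23, q25, q26, q12⟩ := hpost rfl
    exact ⟨⟨i1, i2, i3, r14, q15, q16, q22, q23, q25, q26, q12, i5⟩, i4⟩

theorem reaches_iterCmd (hP : P.Regular) (h0 : 0 < L₀) (hO : OracleSpec P O orc To Inv) {s0 : Mem}
    (hpx : ProxSpec P O px s0) (hpc : px.cost ≤ 60) {R : ℝ} (hin : InputSpec P s0 ε L₀ R)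
    {g q : Fin n → ℝ → ℝ → ℝ} (hg : EdgeSpec n O ge g s0) (hgc : ge.cost ≤ 60)
    (hq : EdgeSpec n O qe q s0) (hqc : qe.cost ≤ 60)
    {k : ℕ} {s : Mem} (hs : IterState run Inv s0 k s) (h12 : s.nat 12 0 0 = 0) :
    Reaches O (iterCmd orc px ge qe) s
      ((run.j k + 1) * (2010 * (n + 1) + 2 * To) + 1000 * (n + 1)) fun s' =>
        IterState run Inv s0 (k + 1) s' ∧
        (gapVal run g q R k < ε → s'.nat 12 0 0 = 1) ∧
        (¬ gapVal run g q R k < ε → s'.nat 12 0 0 = 0) := by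
  obtain ⟨U, hU⟩ : ∃ U, U = 100 * (n + 1) := ⟨_, rfl⟩
  obtain ⟨X, hX⟩ : ∃ X, X = (run.j k + 1) * (2010 * (n + 1) + 2 * To) := ⟨_, rfl⟩
  have hTU : (run.j k + 1) * (2010 * (n + 1) + 2 * To) + 1000 * (n + 1) = X + 10 * U := by
    rw [hX, hU]; ring
  rw [hTU]
  unfold iterCmd
  refine Reaches.bind (T₁ := 20) (Reaches.letR (x := run.base k) ?_ ?_) (by omega) ?_
  · simp [RExp.eval, NExp.eval, hs.h14]
  · simp [RExp.cost, NExp.cost]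
  rintro s1 ⟨e1, N1, R1⟩
  refine Reaches.bind (T₁ := 10) (Reaches.letN (x := 0) ?_ ?_) (by omega) ?_
  · simp [NExp.eval]
  · simp [NExp.cost]
  rintro s2 ⟨e2, R2, N2⟩
  have hI2 : Inv s2 := hO.inv s s2 (fun a ha => by rw [N2 a (by omega), N1])
    (fun a ha => by rw [R2, R1 a (by omega)]) hs.inv
  refine Reaches.bind (T₁ := X + 10) (hX ▸ reaches_trials run hP h0 hO hpx hpc hin hI2
    (by rw [N2 0 (by omega), N1, hs.nat0]) (fun b hb => by rw [R2, R1 b (by omega), hs.real0 b hb])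
    (by rw [R2, R1 13 (by omega), hs.h13]) (by rw [R2, e1])
    (fun e => by rw [R2, R1 17 (by omega), hs.h17 e]) (fun e => by rw [R2, R1 4 (by omega), hs.h4 e])
    (fun e => by rw [R2, R1 18 (by omega), hs.h18 e]) (by rw [R2, R1 19 (by omega), hs.h19]) e2)
    (by omega) ?_
  rintro s3 ⟨t3, n12⟩
  have hA := (run.facts h0 hP k).2.1
  have hn3 : s3.nat 0 0 0 = n := by rw [t3.nat0, hin.hn]
  have b12 : s3.nat 12 0 0 = 0 := by rw [n12, N2 12 (by omega), N1, h12]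
  refine Reaches.bind (T₁ := 30) (Reaches.letR (x := lowSum run (k + 1)) ?_ ?_) (by omega) ?_
  · simp [RExp.eval, NExp.eval, t3.h19, t3.h15, t3.h26, lowSum, Finset.sum_range_succ]
  · simp [RExp.cost, NExp.cost]
  rintro s4 ⟨e4, N4, R4⟩
  refine Reaches.bind (T₁ := 10) (Reaches.letR (x := (run.z k).A) ?_ ?_) (by omega) ?_
  · simp [RExp.eval, NExp.eval, R4, t3.h16]
  · simp [RExp.cost, NExp.cost]
  rintro s5 ⟨e5, N5, R5⟩
  refine Reaches.bind (T₁ := U) (Reaches.vmap (n := n) (run.z k).u ?_ (by decide) ?_ ?_) (by omega) ?_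
  · simp [N5, N4, hn3]
  · intro e s' hN hi hR ha
    simp [RExp.eval, NExp.eval, hi, hR, R5, R4, t3.h23 e]
  · simp only [RExp.cost, NExp.cost]; omega
  rintro s6 ⟨e6, N6, R6⟩
  refine Reaches.bind (T₁ := U) (Reaches.vmap (n := n) (run.z k).t ?_ (by decide) ?_ ?_) (by omega) ?_
  · simp [N6, N5, N4, hn3]
  · intro e s' hN hi hR ha
    simp [RExp.eval, NExp.eval, hi, hR, R6, R5, R4, t3.h25 e]
  · simp only [RExp.cost, NExp.cost]; omega
  rintro s7 ⟨e7, N7, R7⟩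
  refine Reaches.bind (T₁ := U) (Reaches.vmap (n := n) (-run.gradSum (k + 1)) ?_ (by decide) ?_ ?_)
    (by omega) ?_
  · simp [N7, N6, N5, N4, hn3]
  · intro e s' hN hi hR ha
    simpa [RExp.eval, NExp.eval, hi, hR, R7, R6, R5, R4] using t3.h22 e
  · simp only [RExp.cost, NExp.cost]; omega
  rintro s8 ⟨e8, N8, R8⟩
  have havg : run.avgFlow k = (1 / (run.z k).A) • (-run.gradSum (k + 1)) := by
    rw [Composite.Run.avgFlow, Composite.Run.gradSum, ← Finset.sum_neg_distrib]
    simp only [smul_neg]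
  refine Reaches.bind (T₁ := U) (Reaches.vmap (n := n) (run.avgFlow k) ?_ (by decide) ?_ ?_)
    (by omega) ?_
  · simp [N8, N7, N6, N5, N4, hn3]
  · intro e s' hN hi hR ha
    have := e8 e
    simp only [PiLp.neg_apply] at this
    simp [RExp.eval, NExp.eval, hi, hR, R8, R7, R6, e5, havg, this]
  · simp only [RExp.cost, NExp.cost]; omega
  rintro s9 ⟨e9, N9, R9⟩
  have hb9 : ∀ b, b < 4 → s9.real b = s0.real b := fun b hb => by
    rw [R9 b (by omega), R8 b (by omega), R7 b (by omega), R6 b (by omega), R5 b (by omega),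
      R4 b (by omega), t3.real0 b hb]
  have t9 : VecAt s9 4 (run.z k).t := fun e => by rw [R9 4 (by omega), R8 4 (by omega), e7 e]
  refine Reaches.bind (T₁ := U) (Reaches.vsum (n := n)
    (fun e => g e ((run.z k).t e) (run.avgFlow k e)) ?_ (by decide) ?_ ?_) (by omega) ?_
  · simp [N9, N8, N7, N6, N5, N4, hn3]
  · intro e s' hN hi hR
    rw [hg s' e hi (fun b hb => by rw [hR b (by omega), hb9 b hb]), hR 4 (by omega), hR 5 (by omega),
      t9 e, e9 e]
  · have := Nat.mul_le_mul_left n (show ge.cost + 30 ≤ 90 by omega); omega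
  rintro s10 ⟨e10, N10, R10⟩
  refine Reaches.bind (T₁ := U) (Reaches.vsum (n := n)
    (fun e => q e ((run.z k).t e) (run.avgFlow k e)) ?_ (by decide) ?_ ?_) (by omega) ?_
  · simp [N10, N9, N8, N7, N6, N5, N4, hn3]
  · intro e s' hN hi hR
    rw [hq s' e hi (fun b hb => by rw [hR b (by omega), R10 b (by omega), hb9 b hb]), hR 4 (by omega),
      hR 5 (by omega), R10 4 (by omega), R10 5 (by omega), t9 e, e9 e]
  · have := Nat.mul_le_mul_left n (show qe.cost + 30 ≤ 90 by omega); omega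
  rintro s11 ⟨e11, N11, R11⟩
  have hst : IterState run Inv s0 (k + 1) s11 := by
    refine ⟨hO.inv s3 s11 (fun a ha => ?_) (fun a ha => ?_) t3.inv, ?_, fun b hb => ?_, ?_, ?_, ?_, ?_,
      ?_, ?_, ?_⟩
    · rw [N11 a (by omega), N10 a (by omega), N9 a (by omega), N8 a (by omega), N7 a (by omega),
        N6 a (by omega), N5, N4]
    · rw [R11 a (by omega), R10 a (by omega), R9 a (by omega), R8 a (by omega), R7 a (by omega),
        R6 a (by omega), R5 a (by omega), R4 a (by omega)]
    · rw [N11 0 (by omega), N10 0 (by omega), N9 0 (by omega), N8 0 (by omega), N7 0 (by omega),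
        N6 0 (by omega), N5, N4, t3.nat0]
    · rw [R11 b (by omega), R10 b (by omega), hb9 b hb]
    · simp [R11, R10, R9, R8, R7, R6, e5, Composite.Run.accum]
    · simp [R11, R10, R9, R8, R7, R6, R5, R4, t3.h14, Composite.Run.base]; ring
    · exact fun e => by rw [R11 17 (by omega), R10 17 (by omega), R9 17 (by omega), R8 17 (by omega),
        R7 17 (by omega), e6 e]; rfl
    · exact fun e => by rw [R11 4 (by omega), R10 4 (by omega), t9 e]; rfl
    · exact fun e => by rw [R11 18 (by omega), R10 18 (by omega), R9 18 (by omega), e8 e]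
    · simp [R11, R10, R9, R8, R7, R6, R5, e4]
    · rintro j hj e
      obtain rfl : k = j := by omega
      rw [R11 5 (by omega), R10 5 (by omega), e9 e]
  have b12' : s11.nat 12 0 0 = 0 := by
    rw [N11 12 (by omega), N10 12 (by omega), N9 12 (by omega), N8 12 (by omega), N7 12 (by omega),
        N6 12 (by omega), N5, N4, b12]
  have hgap : BExp.eval O s11 (.ltR gapExp (.get 0 (.const 0) (.const 1))) ↔
      gapVal run g q R k < ε := by
    have a12 : s11.real 12 0 0 = P.Φ (run.z k).t := by
      simp [R11, R10, R9, R8, R7, R6, R5, R4, t3.h12]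
    have a30 : s11.real 30 0 0 = ∑ e, g e ((run.z k).t e) (run.avgFlow k e) := by
      simp [R11, e10]
    simp [BExp.eval, gapExp, RExp.eval, NExp.eval, a12, a30, e11, hst.h19, hst.h13,
      hst.real0, hin.hR, hin.hε, gapVal, Composite.Run.accum]
  refine Reaches.ite (T₁ := 10) (fun hb' => ?_) (fun hb' => ?_)
    (by simp only [gapExp, BExp.cost, RExp.cost, NExp.cost]; omega)
  · refine (Reaches.letN (x := 1) (by simp [NExp.eval]) (by simp [NExp.cost])).mono le_rfl ?_
    rintro s12 ⟨e12, R12, N12⟩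
    refine ⟨⟨hO.inv s11 s12 (fun a ha => N12 a (by omega)) (fun a _ => by rw [R12]) hst.inv,
      by rw [N12 0 (by omega), hst.nat0], by rw [R12]; exact hst.real0, by rw [R12, hst.h13],
      by rw [R12, hst.h14], fun e => by rw [R12, hst.h17 e], fun e => by rw [R12, hst.h4 e],
      fun e => by rw [R12, hst.h18 e], by rw [R12, hst.h19],
      fun j hj e => by rw [R12, hst.h5 j hj e]⟩, fun _ => e12, fun h => absurd (hgap.1 hb') h⟩
  · exact Reaches.skip (by norm_num) ⟨hst, fun h => absurd (hgap.2 h) hb', fun _ => b12'⟩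

/-- The program performs the method, stops at iteration `N` and outputs `t^N` and the averaged
flow. -/
theorem reaches_methodCmd {setup : Cmd} {Ts : ℕ} (hP : P.Regular) (h0 : 0 < L₀)
    (hO : OracleSpec P O orc To Inv) {s0 : Mem}
    (hsetup : Reaches O setup s0 Ts fun s => Inv s ∧ s.nat 0 = s0.nat 0 ∧
      ∀ b, b < 4 → s.real b = s0.real b)
    (hpx : ProxSpec P O px s0) (hpc : px.cost ≤ 60) {R : ℝ} (hin : InputSpec P s0 ε L₀ R)
    {g q : Fin n → ℝ → ℝ → ℝ} (hg : EdgeSpec n O ge g s0) (hgc : ge.cost ≤ 60)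
    (hq : EdgeSpec n O qe q s0) (hqc : qe.cost ≤ 60) {N : ℕ}
    (hN : IsLeast {k | gapVal run g q R k < ε} N) :
    Reaches O (methodCmd setup orc px ge qe) s0
      (Ts + (run.trials N + 1) * (4000 * (n + 1) + 2 * To))
      fun s' => Outputs s' (run.z N).t (run.avgFlow N) := by
  obtain ⟨U, hU⟩ : ∃ U, U = 100 * (n + 1) := ⟨_, rfl⟩
  have hTU : Ts + (run.trials N + 1) * (4000 * (n + 1) + 2 * To) =
      Ts + (run.trials N * (4000 * (n + 1) + 2 * To) + 40 * U + 2 * To) := by rw [hU]; ring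
  rw [hTU]
  unfold methodCmd
  refine Reaches.bind hsetup (by omega) ?_
  rintro s1 ⟨i1, n1, r1⟩
  have hn1 : s1.nat 0 0 0 = n := by rw [n1, hin.hn]
  refine Reaches.bind (T₁ := 10) (Reaches.letR (x := 0) ?_ ?_) (by omega) ?_
  · simp [RExp.eval]
  · simp [RExp.cost]
  rintro s2 ⟨e2, N2, R2⟩
  refine Reaches.bind (T₁ := 10) (Reaches.letR (x := 2 * L₀) ?_ ?_) (by omega) ?_
  · simp [RExp.eval, NExp.eval, R2, r1, hin.hL]
  · simp [RExp.cost, NExp.cost]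
  rintro s3 ⟨e3, N3, R3⟩
  refine Reaches.bind (T₁ := 10) (Reaches.letR (x := 0) ?_ ?_) (by omega) ?_
  · simp [RExp.eval]
  · simp [RExp.cost]
  rintro s4 ⟨e4, N4, R4⟩
  refine Reaches.bind (T₁ := U) (Reaches.vmap (n := n) P.start ?_ (by decide) ?_ ?_) (by omega) ?_
  · simp [N4, N3, N2, hn1]
  · intro e s' hN hi hR ha
    simp [RExp.eval, NExp.eval, hi, hR, R4, R3, R2, r1, hin.start e]
  · simp only [RExp.cost, NExp.cost]; omega
  rintro s5 ⟨e5, N5, R5⟩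
  refine Reaches.bind (T₁ := U) (Reaches.vmap (n := n) P.start ?_ (by decide) ?_ ?_) (by omega) ?_
  · simp [N5, N4, N3, N2, hn1]
  · intro e s' hN hi hR ha
    simp [RExp.eval, NExp.eval, hi, hR, R5, R4, R3, R2, r1, hin.start e]
  · simp only [RExp.cost, NExp.cost]; omega
  rintro s6 ⟨e6, N6, R6⟩
  refine Reaches.bind (T₁ := U) (Reaches.vmap (n := n) 0 ?_ (by decide) ?_ ?_) (by omega) ?_
  · simp [N6, N5, N4, N3, N2, hn1]
  · intro e s' hN hi hR ha
    simp [RExp.eval]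
  · simp only [RExp.cost]; omega
  rintro s7 ⟨e7, N7, R7⟩
  refine Reaches.bind (T₁ := 10) (Reaches.letN (x := 0) ?_ ?_) (by omega) ?_
  · simp [NExp.eval]
  · simp [NExp.cost]
  rintro s8 ⟨e8, R8, N8⟩
  have hst : IterState run Inv s0 0 s8 := by
    refine ⟨hO.inv s1 s8 (fun a ha => ?_) (fun a ha => ?_) i1, ?_, fun b hb => ?_, ?_, ?_, ?_, ?_,
      ?_, ?_, ?_⟩
    · rw [N8 a (by omega), N7 a (by omega), N6 a (by omega), N5 a (by omega), N4, N3, N2]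
    · rw [R8, R7 a (by omega), R6 a (by omega), R5 a (by omega), R4 a (by omega), R3 a (by omega),
        R2 a (by omega)]
    · rw [N8 0 (by omega), N7 0 (by omega), N6 0 (by omega), N5 0 (by omega), N4, N3, N2, n1]
    · rw [R8, R7 b (by omega), R6 b (by omega), R5 b (by omega), R4 b (by omega), R3 b (by omega),
        R2 b (by omega), r1 b hb]
    · simp [R8, R7, R6, R5, R4, R3, e2, Composite.Run.accum]
    · simp [R8, R7, R6, R5, R4, e3, Composite.Run.base]
    · exact fun e => by rw [R8, R7 17 (by omega), R6 17 (by omega), e5 e]; rfl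
    · exact fun e => by rw [R8, R7 4 (by omega), e6 e]; rfl
    · exact fun e => by rw [R8, e7 e]; simp [Composite.Run.gradSum]
    · simp [R8, R7, R6, R5, e4, lowSum]
    · intro j hj; omega
  -- Exactly `N + 1` rounds: since `N` is the least index at which the test succeeds, the flag in
  -- index array `12` is set precisely at the end of iteration `N`.
  refine (Reaches.loop_count (N + 1)
    (fun k s => IterState run Inv s0 k s ∧ s.nat 12 0 0 = if k = N + 1 then 1 else 0)
    (fun k => (run.j k + 1) * (2010 * (n + 1) + 2 * To) + 1000 * (n + 1)) ⟨hst, by simp [e8]⟩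
    ?_ ?_).mono (T₁ := _) ?_ ?_
  · rintro k hk s ⟨hs, h12⟩
    rw [if_neg (by omega)] at h12
    refine ⟨by simp [BExp.eval, NExp.eval, h12], ?_⟩
    refine (reaches_iterCmd run hP h0 hO hpx hpc hin hg hgc hq hqc hs h12).mono le_rfl ?_
    rintro s' ⟨hs', ha, hb⟩
    refine ⟨hs', ?_⟩
    by_cases hkN : k = N
    · subst hkN
      rw [ha hN.1, if_pos rfl]
    · rw [if_neg (by omega), hb fun hlt => ?_]
      have := hN.2 hlt
      omega
  · rintro s ⟨-, h12⟩
    simp [BExp.eval, NExp.eval, h12]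
  · have h1 : ∑ k ∈ Finset.range (N + 1), ((run.j k + 1) * (2010 * (n + 1) + 2 * To) +
        1000 * (n + 1) + BExp.cost (.ltN (V 12) (.const 1))) ≤
        run.trials N * (4000 * (n + 1) + 2 * To) := by
      rw [Composite.Run.trials, Finset.sum_mul]
      refine Finset.sum_le_sum fun k _ => ?_
      simp only [BExp.cost, NExp.cost]
      have e0 : 1000 * (n + 1) + (1 + (1 + 1 + 1) + 1) ≤ 1 * (1990 * (n + 1)) := by
        clear hTU; omega
      have e : (run.j k + 1) * (4000 * (n + 1) + 2 * To) =
        (run.j k + 1) * (2010 * (n + 1) + 2 * To) + (run.j k + 1) * (1990 * (n + 1)) := by ring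
      have e2 : 1 * (1990 * (n + 1)) ≤ (run.j k + 1) * (1990 * (n + 1)) :=
        Nat.mul_le_mul_right _ (by omega)
      rw [e, add_assoc]
      exact Nat.add_le_add_left (le_trans e0 e2) _
    have h2 : BExp.cost (.ltN (V 12) (.const 1)) = 5 := rfl
    omega
  · rintro s ⟨hs, -⟩ e
    exact ⟨hs.h4 e, hs.h5 N rfl e⟩

end Traffic

/-! ### Loops over the edges that write to vertex tables -/

namespace RealRAM

variable {O : Oracles}

/-- `for i < n do a[row][idx] := a[row][idx] + v`. -/
def scatterAdd (i a : ℕ) (row idx : NExp) (v : RExp) : Cmd :=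
  forN i nE (.setR a row idx (.add (.get a row idx) v))

/-- `for i < n do a[row][idx] := v`. -/
def scatterSet (i a : ℕ) (row idx : NExp) (v : RExp) : Cmd :=
  forN i nE (.setR a row idx v)

/-- Several edges may address the same entry, so contributions add up. The added expression may read
other rows of the same array, which is how row `k + 1` of a recursion is obtained from row `k`. -/
theorem Reaches.scatterAdd {n : ℕ} {i a : ℕ} {row idx : NExp} {r : RExp} {s : Mem} {T : ℕ}
    (ρ : ℕ) (ix : Fin n → ℕ) (v : Fin n → ℝ)
    (hn : s.nat 0 0 0 = n) (hi : i ≠ 0)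
    (hv : ∀ (e : Fin n) (s' : Mem), (∀ b, b ≠ i → s'.nat b = s.nat b) → s'.nat i 0 0 = e →
      (∀ b, b ≠ a → s'.real b = s.real b) → (∀ ρ', ρ' ≠ ρ → s'.real a ρ' = s.real a ρ') →
      row.eval s' = ρ ∧ idx.eval s' = ix e ∧ r.eval O s' = v e)
    (hT : n * (r.cost + 2 * row.cost + 2 * idx.cost + 20) + 11 ≤ T) :
    Reaches O (scatterAdd i a row idx r) s T fun s' =>
      (∀ j, s'.real a ρ j = s.real a ρ j + ∑ e, if ix e = j then v e else 0) ∧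
      (∀ ρ', ρ' ≠ ρ → s'.real a ρ' = s.real a ρ') ∧
      (∀ b, b ≠ i → s'.nat b = s.nat b) ∧ (∀ b, b ≠ a → s'.real b = s.real b) := by
  refine (Reaches.forN (N := n) (Tb := 5 + r.cost + 2 * row.cost + 2 * idx.cost) (T := T)
    (fun k s' =>
      (∀ j, s'.real a ρ j = s.real a ρ j + ∑ e : Fin n, if (e : ℕ) < k ∧ ix e = j then v e else 0) ∧
      (∀ ρ', ρ' ≠ ρ → s'.real a ρ' = s.real a ρ') ∧
      (∀ b, b ≠ i → s'.nat b = s.nat b) ∧ (∀ b, b ≠ a → s'.real b = s.real b))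
    (by simp [Cmd.wN]) ?_ ?_ ?_ ?_ ?_).mono le_rfl ?_
  · intro w
    exact ⟨fun j => by simp, fun _ _ => rfl,
      fun b hb => setN_nat_of_ne _ _ _ _ hb, fun _ _ => rfl⟩
  · rintro k - s' ⟨-, -, h3, -⟩ -
    simp [NExp.eval, h3 0 hi.symm, hn]
  · rintro k s' w ⟨h1, h2, h3, h4⟩
    exact ⟨h1, h2, fun b hb => by rw [setN_nat_of_ne _ _ _ _ hb, h3 b hb], h4⟩
  · rintro k hk s' ⟨h1, h2, h3, h4⟩ hik
    obtain ⟨er, ei, ev⟩ := hv ⟨k, hk⟩ s' h3 hik h4 h2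
    refine Reaches.setR (by simp only [RExp.cost]; omega)
      ⟨fun j => ?_, fun ρ' hρ => ?_, h3, fun b hb => ?_⟩
    · have hsum : (∑ e : Fin n, if (e : ℕ) < k + 1 ∧ ix e = j then v e else 0) =
          (∑ e : Fin n, if (e : ℕ) < k ∧ ix e = j then v e else 0) +
            if ix ⟨k, hk⟩ = j then v ⟨k, hk⟩ else 0 := by
        have : ∀ e : Fin n, (if (e : ℕ) < k + 1 ∧ ix e = j then v e else 0) =
            (if (e : ℕ) < k ∧ ix e = j then v e else 0) +
              if e = ⟨k, hk⟩ then (if ix ⟨k, hk⟩ = j then v ⟨k, hk⟩ else 0) else 0 := by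
          intro e
          by_cases h : e = ⟨k, hk⟩
          · subst h; simp
          · have hne : (e : ℕ) ≠ k := fun h' => h (Fin.ext h')
            simp only [h, if_false, add_zero]
            exact if_congr (by constructor <;> rintro ⟨h, h'⟩ <;> exact ⟨by omega, h'⟩) rfl rfl
        simp only [this, Finset.sum_add_distrib]
        simp
      simp only [RExp.eval, er, ei, ev, setR_real, true_and]
      rw [hsum]
      by_cases hj : ix ⟨k, hk⟩ = j
      · subst hj; simp [h1]; ring
      · simp [hj, Ne.symm hj, h1]
    · funext j
      simp [setR_real, er, hρ, h2 ρ' hρ]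
    · rw [setR_real_of_ne _ _ _ _ hb, h4 b hb]
  · simp only [NExp.cost]
    have : n * (5 + r.cost + 2 * row.cost + 2 * idx.cost + 12 + (1 + 1 + 1)) =
      n * (r.cost + 2 * row.cost + 2 * idx.cost + 20) := by ring
    omega
  · rintro s' ⟨h1, h2, h3, h4⟩
    exact ⟨fun j => by rw [h1]; simp, h2, h3, h4⟩

/-- The value depends only on the entry addressed, so repeated writes agree. Initializing vertex
tables through the edges costs `O(n)`, whereas the number of vertices is not bounded in terms of
`n`. -/
theorem Reaches.scatterSet {n : ℕ} {i a : ℕ} {row idx : NExp} {r : RExp} {s : Mem} {T : ℕ}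
    (ρ : ℕ) (ix : Fin n → ℕ) (g : ℕ → ℝ)
    (hn : s.nat 0 0 0 = n) (hi : i ≠ 0)
    (hv : ∀ (e : Fin n) (s' : Mem), (∀ b, b ≠ i → s'.nat b = s.nat b) → s'.nat i 0 0 = e →
      (∀ b, b ≠ a → s'.real b = s.real b) → (∀ ρ', ρ' ≠ ρ → s'.real a ρ' = s.real a ρ') →
      row.eval s' = ρ ∧ idx.eval s' = ix e ∧ r.eval O s' = g (ix e))
    (hT : n * (r.cost + row.cost + idx.cost + 20) + 11 ≤ T) :
    Reaches O (scatterSet i a row idx r) s T fun s' =>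
      (∀ e, s'.real a ρ (ix e) = g (ix e)) ∧ (∀ j, (∀ e, ix e ≠ j) → s'.real a ρ j = s.real a ρ j) ∧
      (∀ ρ', ρ' ≠ ρ → s'.real a ρ' = s.real a ρ') ∧
      (∀ b, b ≠ i → s'.nat b = s.nat b) ∧ (∀ b, b ≠ a → s'.real b = s.real b) := by
  refine (Reaches.forN (N := n) (Tb := 1 + r.cost + row.cost + idx.cost) (T := T)
    (fun k s' =>
      (∀ e : Fin n, (e : ℕ) < k → s'.real a ρ (ix e) = g (ix e)) ∧
      (∀ j, (∀ e, ix e ≠ j) → s'.real a ρ j = s.real a ρ j) ∧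
      (∀ ρ', ρ' ≠ ρ → s'.real a ρ' = s.real a ρ') ∧
      (∀ b, b ≠ i → s'.nat b = s.nat b) ∧ (∀ b, b ≠ a → s'.real b = s.real b))
    (by simp [Cmd.wN]) ?_ ?_ ?_ ?_ ?_).mono le_rfl ?_
  · intro w
    exact ⟨fun e he => absurd he (Nat.not_lt_zero _), fun _ _ => rfl, fun _ _ => rfl,
      fun b hb => setN_nat_of_ne _ _ _ _ hb, fun _ _ => rfl⟩
  · rintro k - s' ⟨-, -, -, h3, -⟩ -
    simp [NExp.eval, h3 0 hi.symm, hn]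
  · rintro k s' w ⟨h1, h1', h2, h3, h4⟩
    exact ⟨h1, h1', h2, fun b hb => by rw [setN_nat_of_ne _ _ _ _ hb, h3 b hb], h4⟩
  · rintro k hk s' ⟨h1, h1', h2, h3, h4⟩ hik
    obtain ⟨er, ei, ev⟩ := hv ⟨k, hk⟩ s' h3 hik h4 h2
    refine Reaches.setR (by omega) ⟨fun e he => ?_, fun j hj => ?_, fun ρ' hρ => ?_, h3, fun b hb => ?_⟩
    · simp only [er, ei, ev, setR_real, true_and]
      split_ifs with h
      · rw [h]
      · refine h1 e (lt_of_le_of_ne (by omega) fun h' => h ?_)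
        rw [show e = ⟨k, hk⟩ from Fin.ext h']
    · simp [er, ei, setR_real, Ne.symm (hj ⟨k, hk⟩), h1' j hj]
    · funext j
      simp [setR_real, er, hρ, h2 ρ' hρ]
    · rw [setR_real_of_ne _ _ _ _ hb, h4 b hb]
  · simp only [NExp.cost]
    have : n * (1 + r.cost + row.cost + idx.cost + 12 + (1 + 1 + 1)) ≤
      n * (r.cost + row.cost + idx.cost + 20) := Nat.mul_le_mul_left _ (by omega)
    omega
  · rintro s' ⟨h1, h1', h2, h3, h4⟩
    exact ⟨fun e => h1 e e.2, h1', h2, h3, h4⟩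

end RealRAM

/-! ### Tables of demands and origins -/

namespace Traffic

/-- The demand from `i` to `j`. -/
noncomputable def Network.dem {nV n m : ℕ} (net : Network nV n m) (i j : Fin nV) : ℝ :=
  ∑ w, if net.orig w = i ∧ net.dest w = j then net.demand w else 0

/-- The set of origins. -/
def Network.origins {nV n m : ℕ} (net : Network nV n m) : Finset (Fin nV) :=
  Finset.univ.image net.orig

/-- Tabulates the demands and lists the origins. -/
def originsCmd : Cmd :=
  forN 23 (.get 0 (.const 0) (.const 1)) <|
    .seq (.setR 40 (.get 3 (.const 0) (V 23)) (.get 4 (.const 0) (V 23)) (W 1 23)) <|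
    -- Array `22` marks the origins already listed; it is correct from the start because unused
    -- memory is zero.
    .ite (.ltN (.get 22 (.const 0) (.get 3 (.const 0) (V 23))) (.const 1))
      (.seq (.setN 22 (.const 0) (.get 3 (.const 0) (V 23)) (.const 1)) <|
       .seq (.setN 20 (.const 0) (V 21) (.get 3 (.const 0) (V 23))) <|
       letN 21 (.add (V 21) (.const 1)))
      .skip

/-- The network data in the memory. -/
structure NetData {nV n m : ℕ} (net : Network nV n m) (s : Mem) : Prop where
  n_eq : s.nat 0 0 0 = n
  m_eq : s.nat 0 0 1 = m
  src : ∀ e, s.nat 1 0 (e : Fin n) = net.src e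
  tgt : ∀ e, s.nat 2 0 (e : Fin n) = net.tgt e
  orig : ∀ w, s.nat 3 0 (w : Fin m) = net.orig w
  dest : ∀ w, s.nat 4 0 (w : Fin m) = net.dest w
  demand : ∀ w, s.real 1 0 (w : Fin m) = net.demand w

theorem NetData.congr {nV n m : ℕ} {net : Network nV n m} {s s' : Mem} (h : NetData net s)
    (hN : ∀ a, a < 10 → s'.nat a = s.nat a) (hR : ∀ a, a < 4 → s'.real a = s.real a) :
    NetData net s' := by
  refine ⟨?_, ?_, ?_, ?_, ?_, ?_, ?_⟩
  · rw [hN 0 (by omega), h.n_eq]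
  · rw [hN 0 (by omega), h.m_eq]
  · intro e; rw [hN 1 (by omega), h.src]
  · intro e; rw [hN 2 (by omega), h.tgt]
  · intro e; rw [hN 3 (by omega), h.orig]
  · intro e; rw [hN 4 (by omega), h.dest]
  · intro e; rw [hR 1 (by omega), h.demand]

/-- The tables prepared by `originsCmd`. -/
structure OriginData {nV n m : ℕ} (net : Network nV n m) (s : Mem) : Prop where
  data : NetData net s
  dem : ∀ i j : Fin nV, s.real 40 i j = net.dem i j
  count : s.nat 21 0 0 = net.S
  list : ∃ o : Fin net.S → Fin nV, (∀ q : Fin net.S, s.nat 20 0 q = o q) ∧ Function.Injective o ∧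
    ∀ w, ∃ q, o q = net.orig w

theorem OriginData.congr {nV n m : ℕ} {net : Network nV n m} {s s' : Mem} (h : OriginData net s)
    (hN : ∀ a, a < 10 ∨ (20 ≤ a ∧ a < 30) → s'.nat a = s.nat a)
    (hR : ∀ a, a < 4 ∨ (40 ≤ a ∧ a < 50) → s'.real a = s.real a) : OriginData net s' := by
  refine ⟨h.data.congr (fun a ha => hN a (by omega)) (fun a ha => hR a (by omega)), ?_, ?_, ?_⟩
  · intro i j; rw [hR 40 (by omega), h.dem]
  · rw [hN 21 (by omega), h.count]
  · rw [hN 20 (by omega)]; exact h.list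

/-- Pairs are grouped by origin, and distinct pairs are represented by distinct entries of the
demand table. One pass for each of the `S` origins then accounts for all pairs. -/
theorem sum_origins {nV n m : ℕ} {net : Network nV n m} {o : Fin net.S → Fin nV}
    (ho : Function.Injective o) (hs : ∀ w, ∃ q, o q = net.orig w) (X : Fin nV → Fin nV → ℝ) :
    ∑ q, ∑ j, net.dem (o q) j * X (o q) j = ∑ w, net.demand w * X (net.orig w) (net.dest w) := by
  classical
  have h1 : ∀ i, ∑ j, net.dem i j * X i j =
      ∑ w, if net.orig w = i then net.demand w * X (net.orig w) (net.dest w) else 0 := by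
    intro i
    simp only [Network.dem, Finset.sum_mul]
    rw [Finset.sum_comm]
    refine Finset.sum_congr rfl fun w _ => ?_
    by_cases h : net.orig w = i
    · subst h; simp [ite_mul]
    · simp [h]
  simp only [h1]
  rw [Finset.sum_comm]
  refine Finset.sum_congr rfl fun w _ => ?_
  obtain ⟨q, hq⟩ := hs w
  rw [Finset.sum_eq_single q]
  · simp [hq]
  · intro q' _ hne
    rw [if_neg]
    intro h
    exact hne (ho (by rw [hq, h]))
  · simp

theorem reaches_originsCmd {nV n m : ℕ} {net : Network nV n m} {O : Oracles} {s : Mem}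
    (hs : NetData net s) (h20 : ∀ a, 20 ≤ a → s.nat a = 0) (h40 : ∀ a, 40 ≤ a → s.real a = 0)
    {T : ℕ} (hT : 100 * m + 100 ≤ T) :
    Reaches O originsCmd s T fun s' => OriginData net s' := by
  classical
  -- The origins among the first `k` pairs.
  let A : ℕ → Finset (Fin nV) := fun k => (Finset.univ.filter fun w : Fin m => (w : ℕ) < k).image net.orig
  have hA : ∀ k (hk : k < m), A (k + 1) = insert (net.orig ⟨k, hk⟩) (A k) := by
    intro k hk
    ext v
    simp only [A, Finset.mem_image, Finset.mem_filter, Finset.mem_univ, true_and,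
      Finset.mem_insert]
    constructor
    · rintro ⟨w, hw, rfl⟩
      rcases Nat.lt_succ_iff_lt_or_eq.1 hw with h | h
      · exact Or.inr ⟨w, h, rfl⟩
      · exact Or.inl (by rw [show w = ⟨k, hk⟩ from Fin.ext h])
    · rintro (rfl | ⟨w, hw, rfl⟩)
      · exact ⟨⟨k, hk⟩, by simp, rfl⟩
      · exact ⟨w, by omega, rfl⟩
  let I : ℕ → Mem → Prop := fun k s' => NetData net s' ∧
    (∀ i j : Fin nV, s'.real 40 i j = ∑ w : Fin m, if (w : ℕ) < k ∧ net.orig w = i ∧ net.dest w = j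
      then net.demand w else 0) ∧
    (∀ v : Fin nV, s'.nat 22 0 v = if v ∈ A k then 1 else 0) ∧
    s'.nat 21 0 0 = (A k).card ∧ (∀ v ∈ A k, ∃ q < (A k).card, s'.nat 20 0 q = v)
  refine (Reaches.forN (N := m) (Tb := 60) I (by decide) ?_ ?_ ?_ ?_ ?_).mono (T₁ := T) le_rfl ?_
  · intro v
    refine ⟨hs.congr (fun a ha => setN_nat_of_ne _ _ _ _ (by omega)) fun _ _ => rfl, ?_, ?_, ?_, ?_⟩
    · intro i j; simp [h40]
    · intro v'; rw [setN_nat_of_ne _ _ _ _ (by decide), h20 22 (by omega)]; simp [A]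
    · rw [setN_nat_of_ne _ _ _ _ (by decide), h20 21 (by omega)]; simp [A]
    · intro v' hv'; simp [A] at hv'
  · rintro k - s' h -
    exact h.1.m_eq
  · rintro k s' v ⟨h1, h2, h3, h4, h5⟩
    refine ⟨h1.congr (fun a ha => setN_nat_of_ne _ _ _ _ (by omega)) fun _ _ => rfl, h2, ?_, ?_, ?_⟩
    · rw [setN_nat_of_ne _ _ _ _ (by decide)]; exact h3
    · rw [setN_nat_of_ne _ _ _ _ (by decide)]; exact h4
    · rw [setN_nat_of_ne _ _ _ _ (by decide)]; exact h5
  · rintro k hk s1 ⟨h1, h2, h3, h4, h5⟩ hik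
    set w : Fin m := ⟨k, hk⟩ with hw
    have eo : s1.nat 3 0 (s1.nat 23 0 0) = net.orig w := by rw [hik]; exact h1.orig w
    have ed : s1.nat 4 0 (s1.nat 23 0 0) = net.dest w := by rw [hik]; exact h1.dest w
    have ew : s1.real 1 0 (s1.nat 23 0 0) = net.demand w := by rw [hik]; exact h1.demand w
    refine Reaches.bind (T₁ := 20) (Q' := fun s2 => s2 = s1.setR 40 (net.orig w) (net.dest w) (net.demand w))
      (Reaches.setR (by simp [NExp.cost, RExp.cost]) (by simp [NExp.eval, RExp.eval, eo, ed, ew]))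
      (by omega) ?_
    rintro s2 rfl
    have h2' : ∀ i j : Fin nV, (s1.setR 40 (net.orig w) (net.dest w) (net.demand w)).real 40 i j =
        ∑ w : Fin m, if (w : ℕ) < k + 1 ∧ net.orig w = i ∧ net.dest w = j
          then net.demand w else 0 := by
      intro i j
      rw [setR_real]
      by_cases hij : net.orig w = i ∧ net.dest w = j
      · obtain ⟨rfl, rfl⟩ := hij
        rw [if_pos ⟨rfl, rfl, rfl⟩, Finset.sum_eq_single w]
        · rw [if_pos ⟨by simp [hw], rfl, rfl⟩]
        · intro w' _ hne
          rw [if_neg]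
          rintro ⟨-, h6, h7⟩
          exact hne (net.pair_injective (Prod.ext h6 h7))
        · simp
      · rw [if_neg (by
          rintro ⟨-, h6, h7⟩
          exact hij ⟨Fin.ext h6.symm, Fin.ext h7.symm⟩), h2]
        refine Finset.sum_congr rfl fun w' _ => if_congr ?_ rfl rfl
        constructor
        · rintro ⟨h6, h7⟩; exact ⟨by omega, h7⟩
        · rintro ⟨h6, h7⟩
          refine ⟨lt_of_le_of_ne (by omega) fun h8 => hij ?_, h7⟩
          rwa [show w = w' from Fin.ext h8.symm]
    have hcong : NetData net (s1.setR 40 (net.orig w) (net.dest w) (net.demand w)) :=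
      h1.congr (fun _ _ => rfl) fun a ha => setR_real_of_ne _ _ _ _ (by omega)
    set s2 := s1.setR 40 (net.orig w) (net.dest w) (net.demand w) with hs2
    have n2 : s2.nat = s1.nat := rfl
    have e22 : s2.nat 22 0 (s2.nat 3 0 (s2.nat 23 0 0)) = if net.orig w ∈ A k then 1 else 0 := by
      rw [n2, eo, h3]
    refine Reaches.ite (T₁ := 30) (fun hb => ?_) (fun hb => ?_) (by simp [BExp.cost, NExp.cost])
    · have hnot : net.orig w ∉ A k := fun hmem => by
        simp only [BExp.eval, NExp.eval, e22, hmem, if_true] at hb; omega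
      refine Reaches.bind (T₁ := 9) (Q' := fun s3 => s3 = s2.setN 22 0 (net.orig w) 1)
        (Reaches.setN (by simp [NExp.cost]) (by simp [NExp.eval, n2, eo])) (by omega) ?_
      rintro s3 rfl
      refine Reaches.bind (T₁ := 11)
        (Q' := fun s4 => s4 = (s2.setN 22 0 (net.orig w) 1).setN 20 0 (A k).card (net.orig w))
        (Reaches.setN (by simp [NExp.cost]) (by simp [NExp.eval, n2, setN_nat, eo, h4])) (by omega) ?_
      rintro s4 rfl
      refine Reaches.setN (by simp [NExp.cost]) ?_
      have hcard : (A (k + 1)).card = (A k).card + 1 := by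
        rw [hA k hk, Finset.card_insert_of_notMem hnot]
      refine ⟨hcong.congr (fun a ha => ?_) fun _ _ => rfl, h2', ?_, ?_, ?_⟩
      · rw [setN_nat_of_ne _ _ _ _ (by omega), setN_nat_of_ne _ _ _ _ (by omega),
          setN_nat_of_ne _ _ _ _ (by omega)]
      · intro v
        rw [setN_nat_of_ne _ _ _ _ (by decide), setN_nat_of_ne _ _ _ _ (by decide), setN_nat, n2, h3,
          hA k hk]
        by_cases hv : net.orig w = v
        · subst hv; simp [hw]
        · have hv' : ¬ (v : ℕ) = net.orig w := fun h => hv (Fin.ext h.symm)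
          have hv'' : ¬ v = net.orig ⟨k, hk⟩ := fun h => hv h.symm
          simp [hv', hv'']
      · simp [NExp.eval, setN_nat, n2, h4, hcard]
      · intro v hv
        rw [hA k hk, Finset.mem_insert] at hv
        rw [setN_nat_of_ne _ _ _ _ (by decide), hcard]
        rcases hv with rfl | hv
        · exact ⟨(A k).card, by omega, by simp [hw]⟩
        · obtain ⟨q, hq, hqe⟩ := h5 v hv
          refine ⟨q, by omega, ?_⟩
          rw [setN_nat, if_neg (by omega), setN_nat_of_ne _ _ _ _ (by decide), n2, hqe]
    · have hmem : net.orig w ∈ A k := by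
        by_contra hmem
        simp only [BExp.eval, NExp.eval, e22, hmem, if_false] at hb; omega
      have hAk : A (k + 1) = A k := by rw [hA k hk, Finset.insert_eq_of_mem hmem]
      refine Reaches.skip (by omega) ⟨hcong, h2', ?_, ?_, ?_⟩
      · rw [hAk]; exact h3
      · rw [hAk]; exact h4
      · rw [hAk]; exact h5
  · simp only [NExp.cost]; omega
  · rintro s' ⟨h1, h2, -, h4, h5⟩
    have hAm : A m = net.origins := by
      simp only [A, Network.origins]
      congr 1
      ext w; simp
    have hcard : (A m).card = net.S := by rw [hAm]; rfl
    rw [hcard] at h4 h5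
    refine ⟨h1, fun i j => by rw [h2]; simp [Network.dem], h4, ?_⟩
    choose! q hq hqe using h5
    -- The invariant only says that each origin occurs at some position below `S`. Positions of
    -- distinct origins differ, so by counting every position is taken and the list enumerates the
    -- origins without repetition.
    have hqinj : Set.InjOn q (A m) := by
      intro v hv v' hv' h
      have h6 := hqe v hv
      rw [h, hqe v' hv'] at h6
      exact Fin.ext h6.symm
    have himg : (A m).image q = Finset.range net.S := by
      apply Finset.eq_of_subset_of_card_le
      · intro x hx
        obtain ⟨v, hv, rfl⟩ := Finset.mem_image.1 hx
        exact Finset.mem_range.2 (hq v hv)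
      · rw [Finset.card_image_of_injOn hqinj, hcard, Finset.card_range]
    have hex : ∀ r : Fin net.S, ∃ v ∈ A m, q v = r := fun r => by
      have : (r : ℕ) ∈ (A m).image q := by rw [himg]; exact Finset.mem_range.2 r.2
      obtain ⟨v, hv, hvr⟩ := Finset.mem_image.1 this
      exact ⟨v, hv, hvr⟩
    choose o ho hqo using hex
    refine ⟨o, fun r => by rw [← hqe _ (ho r), hqo], fun r r' h => ?_, fun w => ?_⟩
    · apply Fin.ext
      rw [← hqo r, ← hqo r', h]
    · have hmem : net.orig w ∈ A m := by rw [hAm]; exact Finset.mem_image_of_mem _ (Finset.mem_univ _)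
      refine ⟨⟨q (net.orig w), hq _ hmem⟩, ?_⟩
      exact hqinj (ho _) hmem (hqo _)

end Traffic

/-! ### Sums over walks by forward and backward recursion -/

namespace Traffic

variable {nV n m : ℕ} (src tgt : Fin n → Fin nV)

open Classical in
/-- The walks from `u` to `j` with at most `r` edges. -/
noncomputable def walks (j : Fin nV) : ℕ → Fin nV → Finset (List (Fin n))
  | 0, u => if u = j then {[]} else ∅
  | r + 1, u => (if u = j then {[]} else ∅) ∪
      (Finset.univ.filter fun e => src e = u).biUnion fun e =>
        (walks j r (tgt e)).image (List.cons e)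

theorem mem_walks {j : Fin nV} {r : ℕ} {u : Fin nV} {p : List (Fin n)} :
    p ∈ walks src tgt j r u ↔ IsWalk src tgt u j p ∧ p.length ≤ r := by
  induction r generalizing u p with
  | zero =>
    cases p with
    | nil => by_cases h : u = j <;> simp [walks, IsWalk, h]
    | cons e p => by_cases h : u = j <;> simp [walks, h]
  | succ r ih =>
    cases p with
    | nil => by_cases h : u = j <;> simp [walks, IsWalk, h]
    | cons e p =>
      by_cases h : u = j <;> simp [walks, IsWalk, h, ih, and_assoc]

theorem sum_walks_succ (j : Fin nV) (r : ℕ) (u : Fin nV) (F : List (Fin n) → ℝ) :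
    ∑ p ∈ walks src tgt j (r + 1) u, F p = (if u = j then F [] else 0) +
      ∑ e, if src e = u then ∑ p ∈ walks src tgt j r (tgt e), F (e :: p) else 0 := by
  classical
  rw [walks, Finset.sum_union, Finset.sum_biUnion, Finset.sum_filter]
  · congr 1
    · split_ifs <;> simp
    · refine Finset.sum_congr rfl fun e _ => if_congr Iff.rfl ?_ rfl
      rw [Finset.sum_image]
      intro p _ q _ h
      exact (List.cons.inj h).2
  · intro e _ e' _ hne
    rw [Function.onFun, Finset.disjoint_left]
    intro p hp hp'
    obtain ⟨q, -, rfl⟩ := Finset.mem_image.1 hp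
    obtain ⟨q', -, h⟩ := Finset.mem_image.1 hp'
    exact hne (List.cons.inj h).1.symm
  · rw [Finset.disjoint_left]
    intro p hp hp'
    obtain ⟨e, -, h⟩ := Finset.mem_biUnion.1 hp'
    obtain ⟨q, -, rfl⟩ := Finset.mem_image.1 h
    split_ifs at hp <;> simp at hp

variable (x : Fin n → ℝ)

/-- The weight of a path: the product of the weights of its edges. -/
def weight (p : List (Fin n)) : ℝ := (p.map x).prod

/-- Total weight of the walks from `u` to `j` with at most `r` edges. -/
noncomputable def walkSum (j : Fin nV) (r : ℕ) (u : Fin nV) : ℝ :=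
  ∑ p ∈ walks src tgt j r u, weight x p

/-- Total weight of these walks, counted as often as they use the edge `e`. -/
noncomputable def useSum (e : Fin n) (j : Fin nV) (r : ℕ) (u : Fin nV) : ℝ :=
  ∑ p ∈ walks src tgt j r u, Network.theta e p * weight x p

/-- Moves the mass `μ` on the vertices along the edges. -/
def transfer (μ : Fin nV → ℝ) (v : Fin nV) : ℝ := ∑ e, if tgt e = v then μ (src e) * x e else 0

/-- Total weight of the walks with at most `r` edges that start in `u`, with weights `c` of the
end points. -/
def backward (c : Fin nV → ℝ) : ℕ → Fin nV → ℝ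
  | 0, u => c u
  | r + 1, u => c u + ∑ e, if src e = u then x e * backward c r (tgt e) else 0

variable {src tgt x}

theorem sum_walks_zero (j u : Fin nV) (F : List (Fin n) → ℝ) :
    ∑ p ∈ walks src tgt j 0 u, F p = if u = j then F [] else 0 := by
  rw [walks]; split_ifs <;> simp

theorem walkSum_zero (j u : Fin nV) : walkSum src tgt x j 0 u = if u = j then 1 else 0 := by
  rw [walkSum, sum_walks_zero]; simp [weight]

theorem walkSum_succ (j : Fin nV) (r : ℕ) (u : Fin nV) :
    walkSum src tgt x j (r + 1) u = (if u = j then 1 else 0) +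
      ∑ e, if src e = u then x e * walkSum src tgt x j r (tgt e) else 0 := by
  rw [walkSum, sum_walks_succ]
  simp [weight, walkSum, Finset.mul_sum]

theorem useSum_zero (e : Fin n) (j u : Fin nV) : useSum src tgt x e j 0 u = 0 := by
  rw [useSum, sum_walks_zero]; simp [Network.theta]

theorem useSum_succ (e : Fin n) (j : Fin nV) (r : ℕ) (u : Fin nV) :
    useSum src tgt x e j (r + 1) u =
      (∑ e', if src e' = u then x e' * useSum src tgt x e j r (tgt e') else 0) +
      if src e = u then x e * walkSum src tgt x j r (tgt e) else 0 := by
  rw [useSum, sum_walks_succ]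
  have h1 : ∀ e', (if src e' = u then ∑ p ∈ walks src tgt j r (tgt e'),
      Network.theta e (e' :: p) * weight x (e' :: p) else 0) =
      (if src e' = u then x e' * useSum src tgt x e j r (tgt e') else 0) +
        if e' = e then (if src e = u then x e * walkSum src tgt x j r (tgt e) else 0) else 0 := by
    intro e'
    by_cases hu : src e' = u
    · by_cases he : e' = e
      · subst he
        simp only [hu, if_true, useSum, walkSum, Finset.mul_sum, ← Finset.sum_add_distrib]
        refine Finset.sum_congr rfl fun p _ => ?_
        simp [Network.theta, weight]; ring
      · simp only [hu, he, if_true, if_false, useSum, Finset.mul_sum, add_zero]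
        refine Finset.sum_congr rfl fun p _ => ?_
        simp [Network.theta, weight, List.count_cons_of_ne he]; ring
    · by_cases he : e' = e
      · subst he; simp [hu]
      · simp [hu, he]
  simp only [h1, Finset.sum_add_distrib]
  simp [Network.theta]

/-- Walks may be built from either end: the first-edge recursion on the left corresponds to pushing
the mass `μ` along edges on the right, where the `k`-th iterate collects the walks with exactly `k`
edges. -/
theorem sum_mul_walkSum (j : Fin nV) (r : ℕ) (μ : Fin nV → ℝ) :
    ∑ u, μ u * walkSum src tgt x j r u =
      ∑ k ∈ Finset.range (r + 1), (transfer src tgt x)^[k] μ j := by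
  induction r generalizing μ with
  | zero => simp [walkSum_zero]
  | succ r ih =>
    rw [Finset.sum_range_succ']
    simp only [Function.iterate_succ_apply, ← ih, Function.iterate_zero, id]
    simp only [walkSum_succ, mul_add, Finset.sum_add_distrib, Finset.mul_sum, transfer,
      Finset.sum_mul]
    rw [add_comm, Finset.sum_comm]
    congr 1
    · simp only [mul_ite, ite_mul, mul_assoc, mul_zero, zero_mul]
      refine Eq.trans ?_ Finset.sum_comm
      simp
    · simp

theorem backward_eq_sum (c : Fin nV → ℝ) (r : ℕ) (u : Fin nV) :
    backward src tgt x c r u = ∑ j, c j * walkSum src tgt x j r u := by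
  induction r generalizing u with
  | zero => simp [backward, walkSum_zero]
  | succ r ih =>
    simp only [backward, walkSum_succ, mul_add, Finset.sum_add_distrib, ih]
    congr 1
    · simp
    · simp only [Finset.mul_sum]
      rw [Finset.sum_comm]
      refine Finset.sum_congr rfl fun e _ => ?_
      by_cases h : src e = u <;> simp [h, mul_left_comm]

/-- Each use of `e` in a walk splits it into `k` edges before `e` and at most `r - 1 - k` edges
after it. The first parts are summed by the forward iterates, the second parts by `backward`. -/
theorem sum_mul_useSum (c : Fin nV → ℝ) (e : Fin n) (r : ℕ) (μ : Fin nV → ℝ) :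
    ∑ u, μ u * ∑ j, c j * useSum src tgt x e j r u =
      ∑ k ∈ Finset.range r, (transfer src tgt x)^[k] μ (src e) * x e *
        backward src tgt x c (r - 1 - k) (tgt e) := by
  induction r generalizing μ with
  | zero => simp [useSum_zero]
  | succ r ih =>
    rw [Finset.sum_range_succ']
    have h1 : ∀ k ∈ Finset.range r, (transfer src tgt x)^[k + 1] μ (src e) * x e *
        backward src tgt x c (r + 1 - 1 - (k + 1)) (tgt e) =
        (transfer src tgt x)^[k] (transfer src tgt x μ) (src e) * x e *
        backward src tgt x c (r - 1 - k) (tgt e) := by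
      intro k _
      rw [Function.iterate_succ_apply, show r + 1 - 1 - (k + 1) = r - 1 - k by omega]
    rw [Finset.sum_congr rfl h1, ← ih]
    simp only [useSum_succ, mul_add, Finset.sum_add_distrib, Function.iterate_zero, id,
      Nat.add_sub_cancel, Nat.sub_zero, backward_eq_sum]
    congr 1
    · simp only [transfer, Finset.sum_mul]
      rw [Finset.sum_comm]
      have h2 : ∀ u, μ u * ∑ j, c j * ∑ e', (if src e' = u then
          x e' * useSum src tgt x e j r (tgt e') else 0) =
          ∑ e', if src e' = u then μ u * (x e' * ∑ j, c j * useSum src tgt x e j r (tgt e')) else 0 := by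
        intro u
        simp only [Finset.mul_sum]
        rw [Finset.sum_comm]
        refine Finset.sum_congr rfl fun e' _ => ?_
        by_cases h : src e' = u <;> simp [h, mul_left_comm]
      simp only [h2]
      rw [Finset.sum_comm]
      refine Finset.sum_congr rfl fun e' _ => ?_
      simp [ite_mul, mul_assoc]
    · simp only [mul_ite, mul_zero]
      rw [Finset.sum_eq_single (src e) (fun u _ hu => by simp [Ne.symm hu]) (by simp)]
      simp [Finset.mul_sum]
      refine Finset.sum_congr rfl fun j _ => ?_
      ring

/-- The point mass in `i`. -/
def pointMass (i : Fin nV) (v : Fin nV) : ℝ := if v = i then 1 else 0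

/-- Since `i ≠ j`, the empty walk does not contribute and the sum starts with one edge. -/
theorem walkSum_eq (i j : Fin nV) (r : ℕ) (hij : i ≠ j) :
    walkSum src tgt x j r i =
      ∑ k ∈ Finset.range r, (transfer src tgt x)^[k + 1] (pointMass i) j := by
  have h := sum_mul_walkSum (src := src) (tgt := tgt) (x := x) j r (pointMass i)
  rw [Finset.sum_range_succ'] at h
  simpa [pointMass, Ne.symm hij] using h

/-- Reversed summation: the backward table is built upwards and used row by row, while the stored
forward rows are read downwards. -/
theorem sum_useSum_eq (c : Fin nV → ℝ) (e : Fin n) (r : ℕ) (i : Fin nV) :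
    ∑ j, c j * useSum src tgt x e j r i =
      ∑ k ∈ Finset.range r, (transfer src tgt x)^[r - 1 - k] (pointMass i) (src e) * x e *
        backward src tgt x c k (tgt e) := by
  have h := sum_mul_useSum (src := src) (tgt := tgt) (x := x) c e r (pointMass i)
  rw [← Finset.sum_range_reflect] at h
  simp only [pointMass, ite_mul, one_mul, zero_mul, Finset.sum_ite_eq', Finset.mem_univ, if_true] at h
  rw [h]
  refine Finset.sum_congr rfl fun k hk => ?_
  have := Finset.mem_range.1 hk
  rw [show r - 1 - (r - 1 - k) = k by omega]

namespace Network

variable {net : Network nV n m} {ℓ : ℕ}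

theorem AllWalks.paths_eq (h : net.AllWalks ℓ) (w : Fin m) :
    net.paths w = walks net.src net.tgt (net.dest w) ℓ (net.orig w) := by
  ext p
  rw [h.1, mem_walks]

theorem weight_exp (γ : ℝ) (t : Vec n) (p : List (Fin n)) :
    weight (fun e => Real.exp ((0 - t e) / γ)) p = Real.exp (-(pathCost t p) / γ) := by
  induction p with
  | nil => simp [weight, pathCost, theta]
  | cons e p ih =>
    have h : pathCost t (e :: p) = t e + pathCost t p := by
      simp only [pathCost, theta, List.count_cons]
      push_cast
      simp [add_mul, Finset.sum_add_distrib, add_comm]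
    rw [weight, List.map_cons, List.prod_cons, ← weight, ih, ← Real.exp_add, h]
    congr 1; ring

theorem AllWalks.partition_eq (h : net.AllWalks ℓ) (γ : ℝ) (t : Vec n) (w : Fin m) :
    net.partition γ t w = ∑ k ∈ Finset.range ℓ,
      (transfer net.src net.tgt fun e => Real.exp ((0 - t e) / γ))^[k + 1]
        (pointMass (net.orig w)) (net.dest w) := by
  rw [← walkSum_eq _ _ _ (net.orig_ne_dest w), walkSum, partition, h.paths_eq]
  simp only [weight_exp]

/-- On an edge the logit flow of a pair is its demand times the weighted number of uses, divided by
the partition function. For a fixed origin, the ratios of demand and partition function are taken as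
weights of the end points, so a single backward recursion treats all destinations together. -/
theorem AllWalks.flow_eq (h : net.AllWalks ℓ) (γ : ℝ) (t : Vec n) {o : Fin net.S → Fin nV}
    (ho : Function.Injective o) (hs : ∀ w, ∃ q, o q = net.orig w) (e : Fin n) :
    let x : Fin n → ℝ := fun e => Real.exp ((0 - t e) / γ)
    let T := transfer net.src net.tgt x
    net.flow (net.gibbs γ t) e = ∑ q, ∑ k ∈ Finset.range ℓ,
      T^[ℓ - 1 - k] (pointMass (o q)) (net.src e) * x e *
        backward net.src net.tgt x (fun j => net.dem (o q) j /
          ∑ k ∈ Finset.range ℓ, T^[k + 1] (pointMass (o q)) j) k (net.tgt e) := by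
  intro x T
  have h1 := sum_origins ho hs fun i j => useSum net.src net.tgt x e j ℓ i /
    ∑ k ∈ Finset.range ℓ, T^[k + 1] (pointMass i) j
  have h2 : net.flow (net.gibbs γ t) e = ∑ w, net.demand w *
      (useSum net.src net.tgt x e (net.dest w) ℓ (net.orig w) /
        ∑ k ∈ Finset.range ℓ, T^[k + 1] (pointMass (net.orig w)) (net.dest w)) := by
    change ∑ w, ∑ p ∈ net.paths w, theta e p * net.gibbs γ t w p = _
    refine Finset.sum_congr rfl fun w _ => ?_
    rw [← h.partition_eq, useSum, ← h.paths_eq]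
    simp only [gibbs, x, weight_exp, Finset.mul_sum, Finset.sum_div]
    refine Finset.sum_congr rfl fun p _ => ?_
    rw [partition]; ring
  rw [h2, ← h1]
  refine Finset.sum_congr rfl fun q _ => ?_
  rw [← sum_useSum_eq]
  refine Finset.sum_congr rfl fun j _ => ?_
  ring

end Network

end Traffic

/-! ### The program that evaluates the potential for positive γ -/

namespace Traffic

variable {nV n m : ℕ} {O : Oracles}

/-- The tail of the current edge. -/
abbrev srcE : NExp := .get 1 (.const 0) (V 31)

/-- The head of the current edge. -/
abbrev tgtE : NExp := .get 2 (.const 0) (V 31)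

/-- The maximal number of edges. -/
abbrev lenE : NExp := .get 0 (.const 0) (.const 2)

/-- The mass that the current edge moves. -/
abbrev moveE : RExp := .mul (.get 51 (V 32) srcE) (W 50 31)

/-- The demand divided by the total weight of the walks. -/
abbrev ratioE : RExp := .div (.get 40 (V 33) tgtE) (.get 52 (V 33) tgtE)

/-- Clears the tables for the current origin. -/
def walkInitCmd : Cmd :=
  -- Row `k` of array `51` holds the mass after `k` forward steps, row `i` of `52` the partition
  -- functions of the origin `i`, the rows of `53` the backward recursion, and `50` the edge
  -- weights. Only entries at end points of edges are cleared.
  .seq (scatterSet 31 51 (.const 0) srcE (.const 0)) <|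
  .seq (scatterSet 31 51 (.const 0) tgtE (.const 0)) <|
  .seq (scatterSet 31 52 (V 33) tgtE (.const 0)) <|
  .setR 51 (.const 0) (V 33) (.const 1)

/-- One step of the forward recursion. -/
def walkFwdCmd : Cmd :=
  .seq (scatterSet 31 51 (.add (V 32) (.const 1)) srcE (.const 0)) <|
  .seq (scatterSet 31 51 (.add (V 32) (.const 1)) tgtE (.const 0)) <|
  .seq (scatterAdd 31 51 (.add (V 32) (.const 1)) tgtE moveE) <|
  scatterAdd 31 52 (V 33) tgtE moveE

/-- One step of the backward recursion. -/
def walkBwdCmd : Cmd :=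
  .seq (vmap 31 11 (.add (W 11 31) (.mul (.mul
    (.get 51 (.sub (.sub lenE (.const 1)) (V 32)) srcE) (W 50 31)) (.get 53 (V 32) tgtE)))) <|
  .seq (scatterSet 31 53 (.add (V 32) (.const 1)) tgtE ratioE) <|
  scatterAdd 31 53 (.add (V 32) (.const 1)) srcE (.mul (W 50 31) (.get 53 (V 32) tgtE))

/-- The contribution of one origin to the flow. -/
def walkOriginCmd : Cmd :=
  .seq walkInitCmd <| .seq (forN 32 lenE walkFwdCmd) <|
  .seq (scatterSet 31 53 (.const 0) tgtE ratioE) (forN 32 lenE walkBwdCmd)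

/-- The data used while treating the origin `i`. -/
structure WalkData (src tgt : Fin n → Fin nV) (ℓ : ℕ) (x : Fin n → ℝ) (dem : Fin nV → ℝ)
    (i : Fin nV) (s : Mem) : Prop where
  n_eq : s.nat 0 0 0 = n
  len : s.nat 0 0 2 = ℓ
  src_eq : ∀ e, s.nat 1 0 (e : Fin n) = src e
  tgt_eq : ∀ e, s.nat 2 0 (e : Fin n) = tgt e
  i_eq : s.nat 33 0 0 = i
  x_eq : ∀ e, s.real 50 0 (e : Fin n) = x e
  dem_eq : ∀ j : Fin nV, s.real 40 i j = dem j

variable {src tgt : Fin n → Fin nV} {ℓ : ℕ} {x : Fin n → ℝ} {dem : Fin nV → ℝ} {i : Fin nV}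
  {s s' : Mem}

theorem WalkData.congr (h : WalkData src tgt ℓ x dem i s)
    (hN : ∀ b, b ≠ 31 → b ≠ 32 → s'.nat b = s.nat b)
    (hR : ∀ b, b = 40 ∨ b = 50 → s'.real b = s.real b) : WalkData src tgt ℓ x dem i s' := by
  refine ⟨?_, ?_, ?_, ?_, ?_, ?_, ?_⟩
  · rw [hN 0 (by decide) (by decide), h.n_eq]
  · rw [hN 0 (by decide) (by decide), h.len]
  · intro e; rw [hN 1 (by decide) (by decide), h.src_eq]
  · intro e; rw [hN 2 (by decide) (by decide), h.tgt_eq]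
  · rw [hN 33 (by decide) (by decide), h.i_eq]
  · intro e; rw [hR 50 (by decide), h.x_eq]
  · intro j; rw [hR 40 (by decide), h.dem_eq]

/-- `v` is incident with an edge. -/
def IsEnd (src tgt : Fin n → Fin nV) (v : Fin nV) : Prop := (∃ e, src e = v) ∨ ∃ e, tgt e = v

/-- The forward tables after `k` steps. -/
structure FwdTables (src tgt : Fin n → Fin nV) (ℓ : ℕ) (x : Fin n → ℝ) (dem : Fin nV → ℝ)
    (i : Fin nV) (b0 : ℕ → ℕ → ℝ) (k : ℕ) (s : Mem) : Prop where
  data : WalkData src tgt ℓ x dem i s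
  mass : ∀ k' ≤ k, ∀ v, IsEnd src tgt v →
    s.real 51 k' (v : Fin nV) = (transfer src tgt x)^[k'] (pointMass i) v
  total : ∀ e, s.real 52 i (tgt e) =
    ∑ k' ∈ Finset.range k, (transfer src tgt x)^[k' + 1] (pointMass i) (tgt e)
  -- The rows of other origins must survive, as the partition functions are read only after all
  -- origins have been treated.
  other : ∀ ρ, ρ ≠ (i : ℕ) → s.real 52 ρ = b0 ρ

theorem FwdTables.congr {b0 : ℕ → ℕ → ℝ} {k : ℕ} (h : FwdTables src tgt ℓ x dem i b0 k s)
    (hN : ∀ b, b ≠ 31 → b ≠ 32 → s'.nat b = s.nat b)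
    (hR : ∀ b, b = 40 ∨ b = 50 ∨ b = 51 ∨ b = 52 → s'.real b = s.real b) :
    FwdTables src tgt ℓ x dem i b0 k s' := by
  refine ⟨h.data.congr hN (fun b hb => hR b (by omega)), ?_, ?_, ?_⟩
  · rw [hR 51 (by decide)]; exact h.mass
  · rw [hR 52 (by decide)]; exact h.total
  · rw [hR 52 (by decide)]; exact h.other

theorem WalkData.eval_src (h : WalkData src tgt ℓ x dem i s) {e : Fin n} (he : s.nat 31 0 0 = e) :
    srcE.eval s = src e := by simp only [NExp.eval, he, h.src_eq]

theorem WalkData.eval_tgt (h : WalkData src tgt ℓ x dem i s) {e : Fin n} (he : s.nat 31 0 0 = e) :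
    tgtE.eval s = tgt e := by simp only [NExp.eval, he, h.tgt_eq]

theorem reaches_walkInit (h : WalkData src tgt ℓ x dem i s) {T : ℕ} (hT : 200 * n + 200 ≤ T) :
    Reaches O walkInitCmd s T (FwdTables src tgt ℓ x dem i (s.real 52) 0) := by
  refine Reaches.bind (T₁ := 40 * n + 20) (Reaches.scatterSet (n := n) 0 (fun e => (src e : ℕ)) (fun _ => 0)
    h.n_eq (by decide) ?_ ?_) (by omega) ?_
  · intro e s' hN he hR _
    exact ⟨rfl, (h.congr (fun b hb _ => hN b hb) fun b hb => hR b (by omega)).eval_src he,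
      by simp [RExp.eval]⟩
  · simp only [RExp.cost, NExp.cost]; omega
  rintro s1 ⟨a1, -, -, N1, R1⟩
  have h1 : WalkData src tgt ℓ x dem i s1 := h.congr (fun b hb _ => N1 b hb) fun b hb => R1 b (by omega)
  refine Reaches.bind (T₁ := 40 * n + 20) (Reaches.scatterSet (n := n) 0 (fun e => (tgt e : ℕ)) (fun _ => 0)
    h1.n_eq (by decide) ?_ ?_) (by omega) ?_
  · intro e s' hN he hR _
    exact ⟨rfl, (h1.congr (fun b hb _ => hN b hb) fun b hb => hR b (by omega)).eval_tgt he,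
      by simp [RExp.eval]⟩
  · simp only [RExp.cost, NExp.cost]; omega
  rintro s2 ⟨a2, a2', -, N2, R2⟩
  have h2 : WalkData src tgt ℓ x dem i s2 := h1.congr (fun b hb _ => N2 b hb) fun b hb => R2 b (by omega)
  refine Reaches.bind (T₁ := 40 * n + 20) (Reaches.scatterSet (n := n) (i : ℕ) (fun e => (tgt e : ℕ)) (fun _ => 0)
    h2.n_eq (by decide) ?_ ?_) (by omega) ?_
  · intro e s' hN he hR _
    have h' : WalkData src tgt ℓ x dem i s' := h2.congr (fun b hb _ => hN b hb) fun b hb => hR b (by omega)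
    exact ⟨h'.i_eq, h'.eval_tgt he, by simp [RExp.eval]⟩
  · simp only [RExp.cost, NExp.cost]; omega
  rintro s3 ⟨b3, -, b3', N3, R3⟩
  have h3 : WalkData src tgt ℓ x dem i s3 := h2.congr (fun b hb _ => N3 b hb) fun b hb => R3 b (by omega)
  refine Reaches.setR (by simp only [RExp.cost, NExp.cost]; omega) ?_
  simp only [NExp.eval, RExp.eval, h3.i_eq]
  refine ⟨h3.congr (fun _ _ _ => rfl) fun b hb => setR_real_of_ne _ _ _ _ (by omega), ?_, ?_, ?_⟩
  · intro k' hk' v hv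
    obtain rfl : k' = 0 := by omega
    simp only [setR_real, Function.iterate_zero, id, pointMass, true_and, Fin.val_inj]
    split_ifs with hvi
    · simp
    · rw [R3 51 (by decide)]
      by_cases ht : ∃ e, tgt e = v
      · obtain ⟨e, rfl⟩ := ht; exact a2 e
      · rw [a2' v fun e he => ht ⟨e, Fin.ext he⟩]
        rcases hv with ⟨e, rfl⟩ | hv
        · exact a1 e
        · exact absurd hv ht
  · intro e
    rw [setR_real_of_ne _ _ _ _ (by decide), b3]; simp
  · intro ρ hρ
    rw [setR_real_of_ne _ _ _ _ (by decide), b3' ρ hρ, R2 52 (by decide), R1 52 (by decide)]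

theorem reaches_walkFwd {b0 : ℕ → ℕ → ℝ} {k : ℕ} (h : FwdTables src tgt ℓ x dem i b0 k s)
    (hk : s.nat 32 0 0 = k) {T : ℕ} (hT : 300 * n + 200 ≤ T) :
    Reaches O walkFwdCmd s T (FwdTables src tgt ℓ x dem i b0 (k + 1)) := by
  have hd := h.data
  refine Reaches.bind (T₁ := 50 * n + 20) (Reaches.scatterSet (n := n) (k + 1) (fun e => (src e : ℕ)) (fun _ => 0)
    hd.n_eq (by decide) ?_ ?_) (by omega) ?_
  · intro e s' hN he hR _
    exact ⟨by simp [NExp.eval, hN, hk], (hd.congr (fun b hb _ => hN b hb) fun b hb => hR b (by omega)).eval_src he,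
      by simp [RExp.eval]⟩
  · simp only [RExp.cost, NExp.cost]; omega
  rintro s1 ⟨a1, -, r1, N1, R1⟩
  have h1 : WalkData src tgt ℓ x dem i s1 := hd.congr (fun b hb _ => N1 b hb) fun b hb => R1 b (by omega)
  refine Reaches.bind (T₁ := 50 * n + 20) (Reaches.scatterSet (n := n) (k + 1) (fun e => (tgt e : ℕ)) (fun _ => 0)
    h1.n_eq (by decide) ?_ ?_) (by omega) ?_
  · intro e s' hN he hR _
    exact ⟨by simp [NExp.eval, hN, N1, hk],
      (h1.congr (fun b hb _ => hN b hb) fun b hb => hR b (by omega)).eval_tgt he, by simp [RExp.eval]⟩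
  · simp only [RExp.cost, NExp.cost]; omega
  rintro s2 ⟨a2, a2', r2, N2, R2⟩
  have h2 : WalkData src tgt ℓ x dem i s2 := h1.congr (fun b hb _ => N2 b hb) fun b hb => R2 b (by omega)
  have hz : ∀ v, IsEnd src tgt v → s2.real 51 (k + 1) (v : Fin nV) = 0 := by
    intro v hv
    by_cases ht : ∃ e, tgt e = v
    · obtain ⟨e, rfl⟩ := ht; exact a2 e
    · rw [a2' v fun e he => ht ⟨e, Fin.ext he⟩]
      rcases hv with ⟨e, rfl⟩ | hv
      · exact a1 e
      · exact absurd hv ht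
  refine Reaches.bind (T₁ := 60 * n + 20) (Reaches.scatterAdd (n := n) (k + 1) (fun e => (tgt e : ℕ))
    (fun e => (transfer src tgt x)^[k] (pointMass i) (src e) * x e) h2.n_eq (by decide) ?_ ?_) (by omega) ?_
  · intro e s' hN he hR hρ
    have h' : WalkData src tgt ℓ x dem i s' := h2.congr (fun b hb _ => hN b hb) fun b hb => hR b (by omega)
    have h32 : s'.nat 32 0 0 = k := by rw [hN 32 (by decide), N2 32 (by decide), N1 32 (by decide), hk]
    refine ⟨by simp [NExp.eval, h32], h'.eval_tgt he, ?_⟩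
    have e1 := h'.eval_src he
    simp only [RExp.eval, e1]
    simp only [NExp.eval, h32, he, h'.x_eq]
    rw [hρ k (by omega), r2 k (by omega), r1 k (by omega), h.mass k le_rfl _ (Or.inl ⟨e, rfl⟩)]
  · simp only [RExp.cost, NExp.cost]; omega
  rintro s3 ⟨a3, r3, N3, R3⟩
  have h3 : WalkData src tgt ℓ x dem i s3 := h2.congr (fun b hb _ => N3 b hb) fun b hb => R3 b (by omega)
  have hrow : ∀ k', k' ≠ k + 1 → s3.real 51 k' = s.real 51 k' := fun k' hk' => by
    rw [r3 k' hk', r2 k' hk', r1 k' hk']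
  refine (Reaches.scatterAdd (n := n) (i : ℕ) (fun e => (tgt e : ℕ))
    (fun e => (transfer src tgt x)^[k] (pointMass i) (src e) * x e) h3.n_eq (by decide) ?_ ?_).mono
    (T₁ := 60 * n + 20) (by omega) ?_
  · intro e s' hN he hR hρ
    have h' : WalkData src tgt ℓ x dem i s' := h3.congr (fun b hb _ => hN b hb) fun b hb => hR b (by omega)
    have h32 : s'.nat 32 0 0 = k := by
      rw [hN 32 (by decide), N3 32 (by decide), N2 32 (by decide), N1 32 (by decide), hk]
    refine ⟨h'.i_eq, h'.eval_tgt he, ?_⟩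
    have e1 := h'.eval_src he
    simp only [RExp.eval, e1]
    simp only [NExp.eval, h32, he, h'.x_eq]
    rw [hR 51 (by decide), hrow k (by omega), h.mass k le_rfl _ (Or.inl ⟨e, rfl⟩)]
  · simp only [RExp.cost, NExp.cost]; omega
  rintro s4 ⟨b4, r4, N4, R4⟩
  have hT1 : ∀ v : Fin nV, (transfer src tgt x)^[k + 1] (pointMass i) v =
      ∑ e, if (tgt e : ℕ) = v then (transfer src tgt x)^[k] (pointMass i) (src e) * x e else 0 := by
    intro v
    rw [Function.iterate_succ_apply']
    simp only [transfer, Fin.val_inj]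
  have e52 : s3.real 52 = s.real 52 := by rw [R3 52 (by decide), R2 52 (by decide), R1 52 (by decide)]
  refine ⟨h3.congr (fun b hb _ => N4 b hb) fun b hb => R4 b (by omega), ?_, ?_, ?_⟩
  · intro k' hk' v hv
    rw [R4 51 (by decide)]
    rcases hk'.lt_or_eq with hlt | rfl
    · rw [hrow k' (by omega), h.mass k' (by omega) v hv]
    · rw [a3, hz v hv, zero_add, hT1]
  · intro e
    rw [b4, e52, h.total, Finset.sum_range_succ, hT1]
  · intro ρ hρ
    rw [r4 ρ hρ, e52, h.other ρ hρ]

/-- The ratio of the demand and the total weight of the walks. -/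
noncomputable def walkRatio (src tgt : Fin n → Fin nV) (ℓ : ℕ) (x : Fin n → ℝ) (dem : Fin nV → ℝ)
    (i j : Fin nV) : ℝ :=
  dem j / ∑ k ∈ Finset.range ℓ, (transfer src tgt x)^[k + 1] (pointMass i) j

theorem FwdTables.eval_ratio {b0 : ℕ → ℕ → ℝ} (h : FwdTables src tgt ℓ x dem i b0 ℓ s) {e : Fin n}
    (he : s.nat 31 0 0 = e) : ratioE.eval O s = walkRatio src tgt ℓ x dem i (tgt e) := by
  have e1 := h.data.eval_tgt he
  simp only [RExp.eval, e1]
  simp only [NExp.eval, h.data.i_eq, h.data.dem_eq, h.total, walkRatio]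

/-- The tables after `r` steps of the backward recursion. -/
structure BwdTables (src tgt : Fin n → Fin nV) (ℓ : ℕ) (x : Fin n → ℝ) (dem : Fin nV → ℝ)
    (i : Fin nV) (b0 : ℕ → ℕ → ℝ) (f0 : Fin n → ℝ) (r : ℕ) (s : Mem) : Prop where
  fwd : FwdTables src tgt ℓ x dem i b0 ℓ s
  back : ∀ e, s.real 53 r (tgt e) = backward src tgt x (walkRatio src tgt ℓ x dem i) r (tgt e)
  flow : ∀ e : Fin n, s.real 11 0 e = f0 e + ∑ k ∈ Finset.range r,
    (transfer src tgt x)^[ℓ - 1 - k] (pointMass i) (src e) * x e *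
      backward src tgt x (walkRatio src tgt ℓ x dem i) k (tgt e)

theorem reaches_walkBwd {b0 : ℕ → ℕ → ℝ} {f0 : Fin n → ℝ} {r : ℕ}
    (h : BwdTables src tgt ℓ x dem i b0 f0 r s)
    (hk : s.nat 32 0 0 = r) {T : ℕ} (hT : 300 * n + 200 ≤ T) :
    Reaches O walkBwdCmd s T (BwdTables src tgt ℓ x dem i b0 f0 (r + 1)) := by
  have hd := h.fwd.data
  set c := walkRatio src tgt ℓ x dem i with hc
  refine Reaches.bind (T₁ := 70 * n + 20) (Reaches.vmap (n := n) (WithLp.toLp 2 fun e => f0 e +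
    ∑ k ∈ Finset.range (r + 1), (transfer src tgt x)^[ℓ - 1 - k] (pointMass i) (src e) * x e *
      backward src tgt x c k (tgt e)) hd.n_eq (by decide) ?_ ?_) (by omega) ?_
  · intro e s' hN he hR h11
    have h' : FwdTables src tgt ℓ x dem i b0 ℓ s' :=
      h.fwd.congr (fun b hb _ => hN b hb) fun b hb => hR b (by omega)
    have h32 : s'.nat 32 0 0 = r := by rw [hN 32 (by decide), hk]
    have e1 := h'.data.eval_src he
    have e2 := h'.data.eval_tgt he
    simp only [RExp.eval, e1, e2]
    simp only [NExp.eval, h32, he, h'.data.x_eq, h'.data.len]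
    rw [h11, h.flow, h'.mass _ (by omega) _ (Or.inl ⟨e, rfl⟩), hR 53 (by decide), h.back,
      Finset.sum_range_succ, add_assoc]
  · simp only [RExp.cost, NExp.cost]; omega
  rintro s1 ⟨f1, N1, R1⟩
  have h1 : FwdTables src tgt ℓ x dem i b0 ℓ s1 :=
    h.fwd.congr (fun b hb _ => N1 b hb) fun b hb => R1 b (by omega)
  refine Reaches.bind (T₁ := 70 * n + 20) (Reaches.scatterSet (n := n) (r + 1) (fun e => (tgt e : ℕ))
    (fun v => if hv : v < nV then c ⟨v, hv⟩ else 0) h1.data.n_eq (by decide) ?_ ?_) (by omega) ?_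
  · intro e s' hN he hR _
    have h' : FwdTables src tgt ℓ x dem i b0 ℓ s' :=
      h1.congr (fun b hb _ => hN b hb) fun b hb => hR b (by omega)
    refine ⟨by simp [NExp.eval, hN, N1, hk], h'.data.eval_tgt he, ?_⟩
    rw [h'.eval_ratio he]; simp [hc]
  · simp only [RExp.cost, NExp.cost]; omega
  rintro s2 ⟨c2, -, r2, N2, R2⟩
  have h2 : FwdTables src tgt ℓ x dem i b0 ℓ s2 :=
    h1.congr (fun b hb _ => N2 b hb) fun b hb => R2 b (by omega)
  refine (Reaches.scatterAdd (n := n) (r + 1) (fun e => (src e : ℕ))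
    (fun e => x e * backward src tgt x c r (tgt e)) h2.data.n_eq (by decide) ?_ ?_).mono
    (T₁ := 70 * n + 20) (by omega) ?_
  · intro e s' hN he hR hρ
    have h' : FwdTables src tgt ℓ x dem i b0 ℓ s' :=
      h2.congr (fun b hb _ => hN b hb) fun b hb => hR b (by omega)
    have h32 : s'.nat 32 0 0 = r := by rw [hN 32 (by decide), N2 32 (by decide), N1 32 (by decide), hk]
    refine ⟨by simp [NExp.eval, h32], h'.data.eval_src he, ?_⟩
    have e2 := h'.data.eval_tgt he
    simp only [RExp.eval, e2]
    simp only [NExp.eval, h32, he, h'.data.x_eq]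
    rw [hρ r (by omega), r2 r (by omega), R1 53 (by decide), h.back]
  · simp only [RExp.cost, NExp.cost]; omega
  rintro s3 ⟨b3, r3, N3, R3⟩
  refine ⟨h2.congr (fun b hb _ => N3 b hb) fun b hb => R3 b (by omega), ?_, ?_⟩
  · intro e
    rw [b3, c2, backward]
    simp [Fin.val_inj, hc]
  · intro e
    rw [R3 11 (by decide), R2 11 (by decide)]
    exact f1 e

theorem reaches_walkOrigin (h : WalkData src tgt ℓ x dem i s) {T : ℕ}
    (hT : 1000 * (ℓ + 1) * (n + 1) ≤ T) :
    Reaches O walkOriginCmd s T fun s' => WalkData src tgt ℓ x dem i s' ∧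
      (∀ e, s'.real 52 i (tgt e) =
        ∑ k ∈ Finset.range ℓ, (transfer src tgt x)^[k + 1] (pointMass i) (tgt e)) ∧
      (∀ ρ, ρ ≠ (i : ℕ) → s'.real 52 ρ = s.real 52 ρ) ∧
      ∀ e : Fin n, s'.real 11 0 e = s.real 11 0 e + ∑ k ∈ Finset.range ℓ,
        (transfer src tgt x)^[ℓ - 1 - k] (pointMass i) (src e) * x e *
          backward src tgt x (walkRatio src tgt ℓ x dem i) k (tgt e) := by
  obtain ⟨U, hU⟩ : ∃ U, U = ℓ * (300 * n + 250) := ⟨_, rfl⟩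
  have hTU : 2 * U + 300 * n + 400 ≤ T := by
    refine le_trans ?_ hT
    rw [hU]; nlinarith [Nat.zero_le (ℓ * n)]
  refine Reaches.bind (T₁ := 200 * n + 200) (reaches_walkInit h le_rfl).frame (by omega) ?_
  rintro s1 ⟨h1, -, R1⟩
  refine Reaches.bind (T₁ := U + 20) (Reaches.forN (N := ℓ) (Tb := 300 * n + 200)
    (FwdTables src tgt ℓ x dem i (s.real 52)) (by decide) ?_ ?_ ?_ ?_ ?_).frame (by omega) ?_
  · intro v
    exact h1.congr (fun b _ hb => setN_nat_of_ne _ _ _ _ hb) fun _ _ => rfl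
  · intro k _ s' h' _
    exact h'.data.len
  · intro k s' v h'
    exact h'.congr (fun b _ hb => setN_nat_of_ne _ _ _ _ hb) fun _ _ => rfl
  · intro k _ s' h' hk
    exact reaches_walkFwd h' hk le_rfl
  · have : ℓ * (300 * n + 200 + 12 + lenE.cost) ≤ U := by
      rw [hU]; exact Nat.mul_le_mul_left _ (by simp only [NExp.cost]; omega)
    simp only [NExp.cost] at this ⊢; omega
  rintro s2 ⟨h2, -, R2⟩
  refine Reaches.bind (T₁ := 70 * n + 20) (Reaches.scatterSet (n := n) 0 (fun e => (tgt e : ℕ))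
    (fun v => if hv : v < nV then walkRatio src tgt ℓ x dem i ⟨v, hv⟩ else 0)
    h2.data.n_eq (by decide) ?_ ?_) (by omega) ?_
  · intro e s' hN he hR _
    have h' : FwdTables src tgt ℓ x dem i (s.real 52) ℓ s' :=
      h2.congr (fun b hb _ => hN b hb) fun b hb => hR b (by omega)
    refine ⟨by simp [NExp.eval], h'.data.eval_tgt he, ?_⟩
    rw [h'.eval_ratio he]; simp
  · simp only [RExp.cost, NExp.cost]; omega
  rintro s3 ⟨c3, -, -, N3, R3⟩
  have h3 : FwdTables src tgt ℓ x dem i (s.real 52) ℓ s3 :=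
    h2.congr (fun b hb _ => N3 b hb) fun b hb => R3 b (by omega)
  have e11 : s3.real 11 = s.real 11 := by
    rw [R3 11 (by decide), R2 11 (by decide), R1 11 (by decide)]
  have hcong : ∀ k s' v, BwdTables src tgt ℓ x dem i (s.real 52) (fun e => s.real 11 0 e) k s' →
      BwdTables src tgt ℓ x dem i (s.real 52) (fun e => s.real 11 0 e) k (s'.setN 32 0 0 v) := by
    intro k s' v h'
    exact ⟨h'.fwd.congr (fun b _ hb => setN_nat_of_ne _ _ _ _ hb) fun _ _ => rfl, h'.back, h'.flow⟩
  refine (Reaches.forN (N := ℓ) (Tb := 300 * n + 200)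
    (BwdTables src tgt ℓ x dem i (s.real 52) (fun e => s.real 11 0 e)) (by decide) ?_ ?_ ?_ ?_ ?_).mono
    (T₁ := U + 20) (by omega) ?_
  · intro v
    refine hcong _ _ _ ⟨h3, fun e => ?_, fun e => ?_⟩
    · rw [c3]; simp [backward]
    · simp [e11]
  · intro k _ s' h' _
    exact h'.fwd.data.len
  · exact hcong
  · intro k _ s' h' hk
    exact reaches_walkBwd h' hk le_rfl
  · have : ℓ * (300 * n + 200 + 12 + lenE.cost) ≤ U := by
      rw [hU]; exact Nat.mul_le_mul_left _ (by simp only [NExp.cost]; omega)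
    simp only [NExp.cost] at this ⊢; omega
  · intro s' h'
    exact ⟨h'.fwd.data, h'.fwd.total, h'.fwd.other, h'.flow⟩

/-- Evaluates the potential and minus its gradient for `γ > 0`. -/
def smoothOracleCmd : Cmd :=
  .seq (vmap 31 50 (.exp (.div (.sub (.const 0) (W 10 31)) (S 0)))) <|
  .seq (vmap 31 11 (.const 0)) <|
  .seq (forN 30 (V 21) (.seq (letN 33 (.get 20 (.const 0) (V 30))) walkOriginCmd)) <|
  .seq (letR 12 (.const 0)) <|
  .seq (forN 34 (.get 0 (.const 0) (.const 1)) (letR 12 (.add (S 12) (.mul (W 1 34)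
    (.log (.get 52 (.get 3 (.const 0) (V 34)) (.get 4 (.const 0) (V 34)))))))) <|
  letR 12 (.mul (S 0) (S 12))

theorem walkOriginCmd_wN : ∀ a ∈ walkOriginCmd.wN, 31 ≤ a ∧ a ≤ 32 := by decide

theorem walkOriginCmd_wR : ∀ a ∈ walkOriginCmd.wR, a = 11 ∨ (51 ≤ a ∧ a ≤ 53) := by decide

theorem exists_tgt_eq {i j : Fin nV} {p : List (Fin n)} (h : IsWalk src tgt i j p) (hij : i ≠ j) :
    ∃ e, tgt e = j := by
  induction p generalizing i with
  | nil => exact absurd h hij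
  | cons e p ih =>
    by_cases he : tgt e = j
    · exact ⟨e, he⟩
    · exact ih h.2 he

theorem Network.exists_tgt_dest (net : Network nV n m) (w : Fin m) : ∃ e, net.tgt e = net.dest w := by
  obtain ⟨p, hp⟩ := net.paths_nonempty w
  exact exists_tgt_eq (net.isWalk w p hp) (net.orig_ne_dest w)

/-- Every destination is the head of an edge, and pairs are determined by origin and destination.
Loops over the pairs therefore cost no more than `S n`. -/
theorem Network.m_le (net : Network nV n m) : m ≤ net.S * n := by
  classical
  have h1 : (Finset.univ.image fun w => (net.orig w, net.dest w)) ⊆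
      (Finset.univ.image net.orig) ×ˢ (Finset.univ.image net.tgt) := by
    intro v hv
    obtain ⟨w, -, rfl⟩ := Finset.mem_image.1 hv
    obtain ⟨e, he⟩ := net.exists_tgt_dest w
    exact Finset.mem_product.2 ⟨Finset.mem_image_of_mem _ (Finset.mem_univ _),
      he ▸ Finset.mem_image_of_mem _ (Finset.mem_univ _)⟩
  have h2 := Finset.card_le_card h1
  rw [Finset.card_image_of_injective _ net.pair_injective, Finset.card_product] at h2
  simp only [Finset.card_univ, Fintype.card_fin] at h2
  refine h2.trans ?_
  have h3 : (Finset.univ.image net.tgt).card ≤ n := Finset.card_image_le.trans (by simp)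
  have h4 : (Finset.univ.image net.orig).card = net.S := rfl
  rw [h4]
  exact Nat.mul_le_mul_left _ h3

theorem Network.S_pos (net : Network nV n m) (hm : 0 < m) : 0 < net.S :=
  Finset.card_pos.2 ⟨net.orig ⟨0, hm⟩, Finset.mem_image_of_mem _ (Finset.mem_univ _)⟩

/-- What the evaluation of the potential for `γ > 0` needs. -/
def SmoothData (net : Network nV n m) (ℓ : ℕ) (γ : ℝ) (s : Mem) : Prop :=
  OriginData net s ∧ s.nat 0 0 2 = ℓ ∧ s.real 0 0 0 = γ

theorem SmoothData.congr {net : Network nV n m} {γ : ℝ} (h : SmoothData net ℓ γ s)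
    (hN : ∀ a, a < 10 ∨ (20 ≤ a ∧ a < 30) → s'.nat a = s.nat a)
    (hR : ∀ a, a < 4 ∨ (40 ≤ a ∧ a < 50) → s'.real a = s.real a) : SmoothData net ℓ γ s' :=
  ⟨h.1.congr hN hR, by rw [hN 0 (by omega), h.2.1], by rw [hR 0 (by omega), h.2.2]⟩

/-- Each origin costs two recursions of `ℓ` steps over the `n` edges. Afterwards the logarithms of
the tabulated partition functions give the potential. -/
theorem reaches_smoothOracle {net : Network nV n m} {γ : ℝ} (hm : 0 < m) (hγ : 0 < γ)
    (hW : net.AllWalks ℓ) (h : SmoothData net ℓ γ s) {t : Vec n} (ht : VecAt s 10 t) {T : ℕ}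
    (hT : 2000 * (net.S * (ℓ + 1) * (n + 1)) ≤ T) :
    Reaches O smoothOracleCmd s T fun s' => s'.real 12 0 0 = net.potential γ t ∧
      VecAt s' 11 (net.flow (net.gibbs γ t)) := by
  obtain ⟨o, ho1, ho2, ho3⟩ := h.1.list
  set x : Fin n → ℝ := fun e => Real.exp ((0 - t e) / γ) with hx
  set Z : Fin nV → Fin nV → ℝ := fun i j =>
    ∑ k ∈ Finset.range ℓ, (transfer net.src net.tgt x)^[k + 1] (pointMass i) j with hZ
  set g : Fin nV → Fin n → ℝ := fun i e => ∑ k ∈ Finset.range ℓ,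
    (transfer net.src net.tgt x)^[ℓ - 1 - k] (pointMass i) (net.src e) * x e *
      backward net.src net.tgt x (walkRatio net.src net.tgt ℓ x (net.dem i) i) k (net.tgt e) with hg
  obtain ⟨U, hU⟩ : ∃ U, U = net.S * (1000 * (ℓ + 1) * (n + 1) + 40) := ⟨_, rfl⟩
  have hS := net.S_pos hm
  have hTU : U + 200 * n + 100 * m + 200 ≤ T := by
    have h1 := net.m_le
    have h2 : 1 * (ℓ + 1) * (n + 1) ≤ net.S * (ℓ + 1) * (n + 1) :=
      Nat.mul_le_mul_right _ (Nat.mul_le_mul_right _ hS)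
    have h3 : net.S * 1 * (n + 1) ≤ net.S * (ℓ + 1) * (n + 1) :=
      Nat.mul_le_mul_right _ (Nat.mul_le_mul_left _ (by omega))
    have h4 : 1 * 1 * (n + 1) ≤ 1 * (ℓ + 1) * (n + 1) :=
      Nat.mul_le_mul_right _ (Nat.mul_le_mul_left _ (by omega))
    have h5 : U = 1000 * (net.S * (ℓ + 1) * (n + 1)) + 40 * net.S := by rw [hU]; ring
    have h6 : net.S * 1 * (n + 1) = net.S * n + net.S := by ring
    omega
  have hn := h.1.data.n_eq
  refine Reaches.bind (T₁ := 50 * n + 20) (Reaches.vmap (n := n) (WithLp.toLp 2 x) hn (by decide) ?_ ?_)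
    (by omega) ?_
  · intro e s' hN he hR _
    simp only [RExp.eval, NExp.eval, he]
    rw [hR 10 (by decide), hR 0 (by decide), ht e, h.2.2]
    simp [hx]
  · simp only [RExp.cost, NExp.cost]; omega
  rintro s1 ⟨x1, N1, R1⟩
  refine Reaches.bind (T₁ := 50 * n + 20) (Reaches.vmap (n := n) 0 (by rw [N1 0 (by decide), hn])
    (by decide) ?_ ?_) (by omega) ?_
  · intro e s' hN he hR _
    simp [RExp.eval]
  · simp only [RExp.cost]; omega
  rintro s2 ⟨z2, N2, R2⟩
  have d2 : SmoothData net ℓ γ s2 := h.congr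
    (fun a ha => by rw [N2 a (by omega), N1 a (by omega)])
    (fun a ha => by rw [R2 a (by omega), R1 a (by omega)])
  let I : ℕ → Mem → Prop := fun q s' => SmoothData net ℓ γ s' ∧ s'.nat 20 = s2.nat 20 ∧
    (∀ e : Fin n, s'.real 50 0 e = x e) ∧
    (∀ q' : Fin net.S, (q' : ℕ) < q → ∀ e, s'.real 52 (o q') (net.tgt e) = Z (o q') (net.tgt e)) ∧
    ∀ e : Fin n, s'.real 11 0 e =
      ∑ q' ∈ Finset.range q, if hq : q' < net.S then g (o ⟨q', hq⟩) e else 0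
  refine Reaches.bind (T₁ := U + 20) (Reaches.forN (N := net.S) (Tb := 1000 * (ℓ + 1) * (n + 1) + 10)
    I (by decide) ?_ ?_ ?_ ?_ ?_) (by omega) ?_
  · intro v
    refine ⟨d2.congr (fun a ha => setN_nat_of_ne _ _ _ _ (by omega)) (fun _ _ => rfl), ?_, ?_, ?_, ?_⟩
    · exact setN_nat_of_ne _ _ _ _ (by decide)
    · intro e; rw [setN_real, R2 50 (by decide)]; exact x1 e
    · intro q' hq'; omega
    · intro e; simpa using z2 e
  · intro k _ s' h' _
    exact h'.1.1.count
  · rintro k s' v ⟨h1, h2, h3⟩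
    exact ⟨h1.congr (fun a ha => setN_nat_of_ne _ _ _ _ (by omega)) (fun _ _ => rfl),
      (setN_nat_of_ne _ _ _ _ (by decide)).trans h2, h3⟩
  · rintro k hk s3 ⟨h1, h2, h3, h4, h5⟩ hik
    refine Reaches.bind (T₁ := 10) (Reaches.letN (x := (o ⟨k, hk⟩ : ℕ)) ?_ ?_) (by omega) ?_
    · simp only [NExp.eval, hik, h2, N2 20 (by decide), N1 20 (by decide)]
      exact ho1 ⟨k, hk⟩
    · simp [NExp.cost]
    rintro s4 ⟨e4, R4, N4⟩
    have h1' := h1.1.data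
    have d4 : WalkData net.src net.tgt ℓ x (net.dem (o ⟨k, hk⟩)) (o ⟨k, hk⟩) s4 := by
      refine ⟨?_, ?_, ?_, ?_, e4, ?_, ?_⟩
      · rw [N4 0 (by decide), h1'.n_eq]
      · rw [N4 0 (by decide), h1.2.1]
      · intro e; rw [N4 1 (by decide), h1'.src]
      · intro e; rw [N4 2 (by decide), h1'.tgt]
      · rw [R4]; exact h3
      · intro j; rw [R4, h1.1.dem]
    refine (reaches_walkOrigin d4 le_rfl).frame.mono (by omega) ?_
    rintro s5 ⟨⟨h6, h7, h8, h9⟩, N5, R5⟩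
    have N5' : ∀ a, a < 30 → s5.nat a = s3.nat a := fun a ha => by
      rw [N5 a, N4 a (by omega)]
      intro hmem
      have := walkOriginCmd_wN a hmem
      clear hTU hT hU
      omega
    have R5' : ∀ a, a < 51 → a ≠ 11 → s5.real a = s3.real a := fun a ha ha' => by
      rw [R5 a, R4]
      intro hmem
      have := walkOriginCmd_wR a hmem
      clear hTU hT hU
      omega
    refine ⟨h1.congr (fun a ha => N5' a (by omega)) (fun a ha => R5' a (by omega) (by omega)), ?_,
      h6.x_eq, ?_, ?_⟩
    · rw [N5' 20 (by decide), h2]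
    · intro q' hq' e
      rcases Nat.lt_succ_iff_lt_or_eq.1 hq' with hlt | heq
      · rw [h8 _ fun hc => ?_, R4, h4 q' hlt]
        have := ho2 (Fin.ext hc)
        subst this
        exact lt_irrefl _ hlt
      · have : q' = ⟨k, hk⟩ := Fin.ext heq
        subst this
        exact h7 e
    · intro e
      rw [h9, R4, h5, Finset.sum_range_succ, dif_pos hk]
  · have : net.S * (1000 * (ℓ + 1) * (n + 1) + 10 + 12 + (V 21).cost) ≤ U := by
      rw [hU]; exact Nat.mul_le_mul_left _ (by simp only [NExp.cost]; omega)
    clear hTU hT hU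
    simp only [NExp.cost] at this ⊢
    refine (Nat.add_le_add_right (Nat.add_le_add_right this 8) _).trans (by omega)
  rintro s3 ⟨d3, -, -, b3, f3⟩
  refine Reaches.bind (T₁ := 10) (Reaches.letR (x := 0) ?_ ?_) (by omega) ?_
  · simp [RExp.eval]
  · simp [RExp.cost]
  rintro s4 ⟨e4, N4, R4⟩
  let J : ℕ → Mem → Prop := fun k s' => (∀ a, a ≠ 34 → s'.nat a = s3.nat a) ∧
    (∀ a, a ≠ 12 → s'.real a = s3.real a) ∧
    s'.real 12 0 0 = ∑ w ∈ Finset.range k, if hw : w < m then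
      net.demand ⟨w, hw⟩ * Real.log (net.partition γ t ⟨w, hw⟩) else 0
  have hmU : m * 50 + 20 ≤ 100 * m + 20 := by omega
  refine Reaches.bind (T₁ := 100 * m + 20) (Reaches.forN (N := m) (Tb := 30)
    J (by decide) ?_ ?_ ?_ ?_ ?_) (by omega) ?_
  · intro v
    exact ⟨fun a ha => by rw [setN_nat_of_ne _ _ _ _ ha, N4], R4, by simpa using e4⟩
  · intro k _ s' h' _
    simp only [NExp.eval]
    rw [h'.1 0 (by decide), d3.1.data.m_eq]
  · rintro k s' v ⟨h1, h2, h3⟩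
    exact ⟨fun a ha => by rw [setN_nat_of_ne _ _ _ _ ha, h1 a ha], h2, h3⟩
  · rintro k hk s5 ⟨h1, h2, h3⟩ hik
    refine (Reaches.letR (x := ∑ w ∈ Finset.range (k + 1), if hw : w < m then
      net.demand ⟨w, hw⟩ * Real.log (net.partition γ t ⟨w, hw⟩) else 0) ?_ ?_).mono le_rfl ?_
    · simp only [RExp.eval, NExp.eval, hik]
      have e1 : s5.nat 3 0 k = net.orig ⟨k, hk⟩ := by
        rw [h1 3 (by decide)]; exact d3.1.data.orig ⟨k, hk⟩
      have e2 : s5.nat 4 0 k = net.dest ⟨k, hk⟩ := by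
        rw [h1 4 (by decide)]; exact d3.1.data.dest ⟨k, hk⟩
      have e3 : s5.real 1 0 k = net.demand ⟨k, hk⟩ := by
        rw [h2 1 (by decide)]; exact d3.1.data.demand ⟨k, hk⟩
      rw [e1, e2, e3, h3, Finset.sum_range_succ, dif_pos hk, hW.partition_eq, h2 52 (by decide)]
      obtain ⟨q, hq⟩ := ho3 ⟨k, hk⟩
      obtain ⟨e, he⟩ := net.exists_tgt_dest ⟨k, hk⟩
      rw [← hq, ← he, b3 q q.2]
    · simp [RExp.cost, NExp.cost]
    · rintro s6 ⟨e6, N6, R6⟩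
      exact ⟨fun a ha => by rw [N6, h1 a ha], fun a ha => by rw [R6 a ha, h2 a ha], e6⟩
  · simp only [NExp.cost]; omega
  rintro s5 ⟨-, h2, h3⟩
  refine (Reaches.letR (x := net.potential γ t) ?_ ?_).mono le_rfl ?_
  · simp only [RExp.eval, NExp.eval, h3]
    rw [h2 0 (by decide), d3.2.2, Network.potential_of_pos hγ, Finset.sum_range]
    simp
  · simp only [RExp.cost, NExp.cost]; omega
  · rintro s6 ⟨e6, N6, R6⟩
    refine ⟨e6, fun e => ?_⟩
    rw [R6 11 (by decide), h2 11 (by decide), f3, Finset.sum_range, hW.flow_eq γ t ho2 ho3]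
    simp only [hg, hx, Fin.is_lt, dif_pos, Fin.eta]
    rfl

theorem smoothOracleSpec {net : Network nV n m} {γ : ℝ} (hm : 0 < m) (hγ : 0 < γ)
    (hW : net.AllWalks ℓ) {P : Composite n} (hΦ : P.Φ = net.potential γ)
    (hG : P.grad = gradient (net.potential γ)) :
    OracleSpec P O smoothOracleCmd (2000 * (net.S * (ℓ + 1) * (n + 1))) (SmoothData net ℓ γ) where
  call s x _ hs hx := by
    refine (reaches_smoothOracle hm hγ hW hs hx le_rfl).mono le_rfl ?_
    rintro s' ⟨h1, h2⟩
    refine ⟨by rw [h1, hΦ], ?_⟩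
    rw [hG, Network.gradient_potential hγ hm, neg_neg]
    exact h2
  wN := by decide
  wR := by decide
  inv _ _ hN hR h := h.congr hN hR

end Traffic

/-! ### Dijkstra's algorithm: trees and invariants -/

namespace Traffic.Dijkstra

variable {nV n m : ℕ}

section tree

variable (src tgt : Fin n → Fin nV) (i : Fin nV)

/-- The path to `v` in the tree whose edges are listed in `L`, the most recent first. -/
def pathOf : List (Fin n) → Fin nV → List (Fin n)
  | [], _ => []
  | e :: L, v => if v = tgt e then pathOf L (src e) ++ [e] else pathOf L v

/-- The vertices of the tree with root `i` and edges `L`. -/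
def verts : List (Fin n) → Finset (Fin nV)
  | [] => {i}
  | e :: L => insert (tgt e) (verts L)

/-- Every edge of `L` leads from a vertex of the preceding tree to a new vertex. -/
def IsTree : List (Fin n) → Prop
  | [] => True
  | e :: L => IsTree L ∧ src e ∈ verts tgt i L ∧ tgt e ∉ verts tgt i L

variable {src tgt i} {L : List (Fin n)}

theorem root_mem_verts : i ∈ verts tgt i L := by
  induction L with
  | nil => simp [verts]
  | cons e L ih => exact Finset.mem_insert_of_mem ih

theorem isWalk_append {i j : Fin nV} {p : List (Fin n)} {e : Fin n} (h : IsWalk src tgt i j p)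
    (he : src e = j) : IsWalk src tgt i (tgt e) (p ++ [e]) := by
  induction p generalizing i with
  | nil => exact ⟨he.trans (Eq.symm h), rfl⟩
  | cons a p ih => exact ⟨h.1, ih h.2⟩

theorem IsTree.isWalk (h : IsTree src tgt i L) {v : Fin nV} (hv : v ∈ verts tgt i L) :
    IsWalk src tgt i v (pathOf src tgt L v) := by
  induction L generalizing v with
  | nil => exact (Finset.mem_singleton.1 hv).symm
  | cons e L ih =>
    rw [pathOf]
    split_ifs with hve
    · subst hve
      exact isWalk_append (ih h.1 h.2.1) rfl
    · exact ih h.1 (Finset.mem_of_mem_insert_of_ne hv hve)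

/-- Each edge leads to a vertex outside the preceding tree, so tree paths repeat no vertex. This
makes them admissible whenever all simple paths are. -/
theorem IsTree.simple (h : IsTree src tgt i L) {v : Fin nV} (hv : v ∈ verts tgt i L) :
    (i :: (pathOf src tgt L v).map tgt).Nodup ∧
      ∀ u ∈ (pathOf src tgt L v).map tgt, u ∈ verts tgt i L := by
  induction L generalizing v with
  | nil => simp [pathOf]
  | cons e L ih =>
    rw [pathOf]
    split_ifs with hve
    · obtain ⟨h1, h2⟩ := ih h.1 h.2.1
      rw [List.map_append, ← List.cons_append]
      refine ⟨List.nodup_append.2 ⟨h1, by simp, ?_⟩, ?_⟩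
      · rintro a ha b hb rfl
        simp only [List.map_cons, List.map_nil, List.mem_singleton] at hb
        subst hb
        rcases List.mem_cons.1 ha with ha | ha
        · exact h.2.2 (ha ▸ root_mem_verts)
        · exact h.2.2 (h2 _ ha)
      · intro u hu
        rcases List.mem_append.1 hu with hu | hu
        · exact Finset.mem_insert_of_mem (h2 u hu)
        · simp only [List.map_cons, List.map_nil, List.mem_singleton] at hu
          exact hu ▸ Finset.mem_insert_self _ _
    · obtain ⟨h1, h2⟩ := ih h.1 (Finset.mem_of_mem_insert_of_ne hv hve)
      exact ⟨h1, fun u hu => Finset.mem_insert_of_mem (h2 u hu)⟩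

theorem tgt_mem_verts {e : Fin n} (he : e ∈ L) : tgt e ∈ verts tgt i L := by
  induction L with
  | nil => simp at he
  | cons a L ih =>
    rcases List.mem_cons.1 he with rfl | he
    · exact Finset.mem_insert_self _ _
    · exact Finset.mem_insert_of_mem (ih he)

theorem IsTree.length_le (h : IsTree src tgt i L) : L.length ≤ n := by
  have : L.Nodup := by
    induction L with
    | nil => simp
    | cons e L ih => exact List.nodup_cons.2 ⟨fun he => h.2.2 (tgt_mem_verts he), ih h.1⟩
  simpa using this.length_le_card

/-- Collecting the amounts `c` from the leaves to the root. -/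
theorem IsTree.sweep {e : Fin n} (h : IsTree src tgt i (e :: L)) (c c' : Fin nV → ℝ)
    (hc : ∀ v ∈ verts tgt i L, c' v = c v + if v = src e then c (tgt e) else 0) (a : Fin n) :
    ∑ v ∈ verts tgt i (e :: L), c v * Network.theta a (pathOf src tgt (e :: L) v) =
      (if a = e then c (tgt e) else 0) +
        ∑ v ∈ verts tgt i L, c' v * Network.theta a (pathOf src tgt L v) := by
  obtain ⟨h1, h2, h3⟩ := h
  rw [verts, Finset.sum_insert h3]
  have e1 : ∑ v ∈ verts tgt i L, c v * Network.theta a (pathOf src tgt (e :: L) v) =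
      ∑ v ∈ verts tgt i L, c v * Network.theta a (pathOf src tgt L v) := by
    refine Finset.sum_congr rfl fun v hv => ?_
    rw [pathOf, if_neg]
    rintro rfl
    exact h3 hv
  -- The path to the head of `e` is the path to its tail followed by `e`; moving the amount from
  -- head to tail changes only the contribution of `e` itself.
  have e2 : ∑ v ∈ verts tgt i L, c' v * Network.theta a (pathOf src tgt L v) =
      ∑ v ∈ verts tgt i L, c v * Network.theta a (pathOf src tgt L v) +
        c (tgt e) * Network.theta a (pathOf src tgt L (src e)) := by
    rw [Finset.sum_congr rfl fun v hv => by rw [hc v hv, add_mul], Finset.sum_add_distrib]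
    congr 1
    simp [ite_mul, h2]
  rw [e1, e2, pathOf, if_pos rfl]
  simp only [Network.theta, List.count_append, List.count_singleton]
  by_cases hae : a = e
  · subst hae; simp; ring
  · have : ¬ e = a := fun h => hae h.symm
    simp [hae, this]; ring

end tree

section state

variable (src tgt : Fin n → Fin nV) (t : Vec n) (i : Fin nV)

/-- Length of the path to `v` in the tree. -/
noncomputable def dist (L : List (Fin n)) (v : Fin nV) : ℝ := Network.pathCost t (pathOf src tgt L v)

/-- Length of the path to the head of `e` through the tree and `e`. -/
noncomputable def key (L : List (Fin n)) (e : Fin n) : ℝ := dist src tgt t L (src e) + t e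

/-- The edges with tail `v`. -/
def out (v : Fin nV) : Finset (Fin n) := Finset.univ.filter fun e => src e = v

/-- The invariants of Dijkstra's algorithm for the tree `L` and the set `A` of active edges. -/
structure Good (L : List (Fin n)) (A : Finset (Fin n)) : Prop where
  tree : IsTree src tgt i L
  src_mem : ∀ e ∈ A, src e ∈ verts tgt i L
  edge : ∀ e, src e ∈ verts tgt i L → e ∈ A ∨
    (tgt e ∈ verts tgt i L ∧ dist src tgt t L (tgt e) ≤ key src tgt t L e)
  -- No active key lies below a settled distance; so an active edge whose head is already settled
  -- can be discarded.
  le : ∀ v ∈ verts tgt i L, ∀ e ∈ A, dist src tgt t L v ≤ key src tgt t L e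

variable {src tgt t i} {L : List (Fin n)} {A : Finset (Fin n)} {e : Fin n}

theorem mem_out {v : Fin nV} : e ∈ out src v ↔ src e = v := by simp [out]

theorem pathCost_append (p : List (Fin n)) :
    Network.pathCost t (p ++ [e]) = Network.pathCost t p + t e := by
  simp only [Network.pathCost, Network.theta, List.count_append, List.count_singleton]
  push_cast
  simp [add_mul, Finset.sum_add_distrib]

theorem pathCost_cons (p : List (Fin n)) :
    Network.pathCost t (e :: p) = t e + Network.pathCost t p := by
  simp only [Network.pathCost, Network.theta, List.count_cons]
  push_cast
  simp [add_mul, Finset.sum_add_distrib, add_comm]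

theorem dist_cons_self : dist src tgt t (e :: L) (tgt e) = key src tgt t L e := by
  rw [dist, pathOf, if_pos rfl, pathCost_append]; rfl

theorem dist_cons_of_mem (he : tgt e ∉ verts tgt i L) {v : Fin nV} (hv : v ∈ verts tgt i L) :
    dist src tgt t (e :: L) v = dist src tgt t L v := by
  rw [dist, pathOf, if_neg]; · rfl
  rintro rfl
  exact he hv

theorem key_cons_of_mem (he : tgt e ∉ verts tgt i L) {a : Fin n} (ha : src a ∈ verts tgt i L) :
    key src tgt t (e :: L) a = key src tgt t L a := by
  rw [key, dist_cons_of_mem he ha]; rfl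

theorem good_init (ht : ∀ e, 0 ≤ t e) : Good src tgt t i [] (out src i) where
  tree := trivial
  src_mem e he := by rw [mem_out.1 he]; exact root_mem_verts
  edge e he := Or.inl (mem_out.2 (Finset.mem_singleton.1 he))
  le v _ e _ := by
    have := ht e
    simp only [key, dist, pathOf]
    linarith

theorem Good.erase (h : Good src tgt t i L A) (he : e ∈ A) (hv : tgt e ∈ verts tgt i L) :
    Good src tgt t i L (A.erase e) where
  tree := h.tree
  src_mem a ha := h.src_mem a (Finset.mem_of_mem_erase ha)
  edge a ha := by
    by_cases hae : a = e
    · subst hae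
      exact Or.inr ⟨hv, h.le _ hv _ he⟩
    · exact (h.edge a ha).imp_left fun h' => Finset.mem_erase.2 ⟨hae, h'⟩
  le v hv a ha := h.le v hv a (Finset.mem_of_mem_erase ha)

/-- The new vertex gets the minimal key, which is at least every settled distance and at most every
remaining key. The new active edges have still larger keys because `t ≥ 0`. -/
theorem Good.cons (h : Good src tgt t i L A) (ht : ∀ e, 0 ≤ t e) (he : e ∈ A)
    (hmin : ∀ a ∈ A, key src tgt t L e ≤ key src tgt t L a) (hv : tgt e ∉ verts tgt i L) :
    Good src tgt t i (e :: L) (A.erase e ∪ out src (tgt e)) where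
  tree := ⟨h.tree, h.src_mem e he, hv⟩
  src_mem a ha := by
    rcases Finset.mem_union.1 ha with ha | ha
    · exact Finset.mem_insert_of_mem (h.src_mem a (Finset.mem_of_mem_erase ha))
    · rw [mem_out.1 ha]; exact Finset.mem_insert_self _ _
  edge a ha := by
    by_cases hae : src a = tgt e
    · exact Or.inl (Finset.mem_union_right _ (mem_out.2 hae))
    · have ha' := Finset.mem_of_mem_insert_of_ne ha hae
      by_cases hae' : a = e
      · subst hae'
        exact Or.inr ⟨Finset.mem_insert_self _ _, by rw [dist_cons_self, key_cons_of_mem hv ha']⟩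
      · rcases h.edge a ha' with h1 | ⟨h1, h2⟩
        · exact Or.inl (Finset.mem_union_left _ (Finset.mem_erase.2 ⟨hae', h1⟩))
        · exact Or.inr ⟨Finset.mem_insert_of_mem h1, by
            rwa [dist_cons_of_mem hv h1, key_cons_of_mem hv ha']⟩
  le v hv' a ha := by
    have h1 : dist src tgt t (e :: L) v ≤ key src tgt t L e := by
      rcases Finset.mem_insert.1 hv' with rfl | hv'
      · rw [dist_cons_self]
      · rw [dist_cons_of_mem hv hv']
        exact h.le v hv' e he
    refine h1.trans ?_
    rcases Finset.mem_union.1 ha with ha | ha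
    · have ha' := Finset.mem_of_mem_erase ha
      rw [key_cons_of_mem hv (h.src_mem a ha')]
      exact hmin a ha'
    · have h2 : key src tgt t (e :: L) a = key src tgt t L e + t a := by
        rw [key, mem_out.1 ha, dist_cons_self]
      linarith [ht a]

/-- Without active edges, every edge leaving the tree's vertices ends in the tree and satisfies the
relaxed distance inequality. Adding these inequalities along the walk gives the claim, for arbitrary
walks. -/
theorem Good.walk_le (h : Good src tgt t i L ∅) {u j : Fin nV} {p : List (Fin n)}
    (hp : IsWalk src tgt u j p) (hu : u ∈ verts tgt i L) :
    j ∈ verts tgt i L ∧ dist src tgt t L j ≤ dist src tgt t L u + Network.pathCost t p := by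
  induction p generalizing u with
  | nil =>
    obtain rfl : u = j := hp
    exact ⟨hu, by simp [Network.pathCost, Network.theta]⟩
  | cons e p ih =>
    obtain ⟨rfl, hp⟩ := hp
    obtain h1 | ⟨h1, h2⟩ := h.edge e hu
    · simp at h1
    · obtain ⟨h3, h4⟩ := ih hp h1
      refine ⟨h3, ?_⟩
      rw [pathCost_cons]
      rw [key] at h2
      linarith

theorem IsTree.dist_root (h : IsTree src tgt i L) : dist src tgt t L i = 0 := by
  induction L with
  | nil => simp [dist, pathOf, Network.pathCost, Network.theta]
  | cons e L ih => rw [dist_cons_of_mem h.2.2 root_mem_verts, ih h.1]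

end state

/-! ### Tournament trees -/

section tournament

/-- The better one of two entries of the tournament tree: `0` stands for no entry, `x + 1` for the
edge `x`. -/
noncomputable def better (k : ℕ → ℝ) (a b : ℕ) : ℕ :=
  open Classical in
  if 0 < b then if 0 < a then if k (b - 1) < k (a - 1) then b else a else b else a

/-- The winner below the node `p` of the tournament tree with the leaves `n, …, 2 n - 1`. -/
noncomputable def winner (n : ℕ) (k : ℕ → ℝ) (leaf : ℕ → ℕ) (p : ℕ) : ℕ :=
  if 0 < p ∧ p < n then better k (winner n k leaf (p + p)) (winner n k leaf (p + p + 1))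
  else leaf (p - n)
termination_by n - p
decreasing_by all_goals omega

variable {k k' : ℕ → ℝ} {leaf : ℕ → ℕ}

theorem winner_of_lt {p : ℕ} (h0 : 0 < p) (hp : p < n) :
    winner n k leaf p = better k (winner n k leaf (p + p)) (winner n k leaf (p + p + 1)) := by
  rw [winner, if_pos ⟨h0, hp⟩]

theorem winner_of_le {p : ℕ} (hp : n ≤ p) : winner n k leaf p = leaf (p - n) := by
  rw [winner, if_neg (by omega)]

/-- Correct leaves and consistency of every inner node with its two children determine all nodes, by
induction from the leaves upwards. After an update only this local consistency has to be checked. -/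
theorem eq_winner {w : ℕ → ℕ} (hl : ∀ x < n, w (n + x) = leaf x)
    (hw : ∀ p, 0 < p → p < n → w p = better k (w (p + p)) (w (p + p + 1))) {p : ℕ} (h0 : 0 < p)
    (hp : p < 2 * n) : w p = winner n k leaf p := by
  induction h : 2 * n - p using Nat.strong_induction_on generalizing p with
  | _ r ih =>
    by_cases hpn : p < n
    · rw [hw p h0 hpn, winner_of_lt h0 hpn, ih (2 * n - (p + p)) (by omega) (by omega) (by omega) rfl,
        ih (2 * n - (p + p + 1)) (by omega) (by omega) (by omega) rfl]
    · rw [winner_of_le (by omega), ← hl (p - n) (by omega)]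
      congr 1; omega

theorem better_eq (k : ℕ → ℝ) (a b : ℕ) : better k a b = a ∨ better k a b = b := by
  unfold better; split_ifs <;> simp

theorem winner_spec (hl : ∀ x < n, leaf x = 0 ∨ leaf x = x + 1) {p : ℕ} (h0 : 0 < p)
    (hp : p < 2 * n) : winner n k leaf p = 0 ∨
      ∃ x < n, leaf x = x + 1 ∧ winner n k leaf p = x + 1 := by
  induction h : 2 * n - p using Nat.strong_induction_on generalizing p with
  | _ r ih =>
    by_cases hpn : p < n
    · rw [winner_of_lt h0 hpn]
      rcases better_eq k (winner n k leaf (p + p)) (winner n k leaf (p + p + 1)) with h1 | h1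
      · rw [h1]; exact ih (2 * n - (p + p)) (by omega) (by omega) (by omega) rfl
      · rw [h1]; exact ih (2 * n - (p + p + 1)) (by omega) (by omega) (by omega) rfl
    · rw [winner_of_le (by omega)]
      rcases hl (p - n) (by omega) with h1 | h1
      · exact Or.inl h1
      · exact Or.inr ⟨p - n, by omega, h1, h1⟩

theorem better_left {a b : ℕ} (ha : 0 < a) :
    0 < better k a b ∧ k (better k a b - 1) ≤ k (a - 1) := by
  unfold better
  split_ifs with h1 h2
  · exact ⟨h1, h2.le⟩
  · exact ⟨ha, le_rfl⟩
  · exact ⟨ha, le_rfl⟩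

theorem better_right {a b : ℕ} (hb : 0 < b) :
    0 < better k a b ∧ k (better k a b - 1) ≤ k (b - 1) := by
  unfold better
  rw [if_pos hb]
  split_ifs with h1 h2
  · exact ⟨hb, le_rfl⟩
  · exact ⟨h1, not_lt.1 h2⟩
  · exact ⟨hb, le_rfl⟩

/-- Climbing from `p` to `p / 2` never increases the key of the winner, so the root carries a
minimal key. -/
theorem winner_one_le {p : ℕ} (h0 : 0 < p) (hp : p < 2 * n) (hw : 0 < winner n k leaf p) :
    0 < winner n k leaf 1 ∧ k (winner n k leaf 1 - 1) ≤ k (winner n k leaf p - 1) := by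
  induction p using Nat.strong_induction_on with
  | _ p ih =>
    rcases Nat.lt_or_ge 1 p with h1 | h1
    · have h2 := winner_of_lt (k := k) (leaf := leaf) (p := p / 2) (n := n) (by omega) (by omega)
      have h3 : 0 < winner n k leaf (p / 2) ∧
          k (winner n k leaf (p / 2) - 1) ≤ k (winner n k leaf p - 1) := by
        rcases Nat.even_or_odd' p with ⟨q, hq | hq⟩
        · have : p / 2 + p / 2 = p := by omega
          rw [h2, this]; exact better_left hw
        · have : p / 2 + p / 2 + 1 = p := by omega
          rw [h2, this]; exact better_right hw
      obtain ⟨h4, h5⟩ := ih (p / 2) (by omega) (by omega) (by omega) h3.1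
      exact ⟨h4, h5.trans h3.2⟩
    · obtain rfl : p = 1 := by omega
      exact ⟨hw, le_rfl⟩

/-- Keys of absent entries are never compared. The tree thus remains valid when a distance is
written that affects only inactive edges. -/
theorem winner_congr (hl : ∀ x < n, leaf x = 0 ∨ leaf x = x + 1)
    (hk : ∀ x < n, leaf x = x + 1 → k x = k' x) {p : ℕ} (h0 : 0 < p) (hp : p < 2 * n) :
    winner n k leaf p = winner n k' leaf p := by
  refine eq_winner (k := k') (fun x _ => by rw [winner_of_le (by omega)]; congr 1; omega) (fun q hq hqn => ?_) h0 hp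
  rw [winner_of_lt hq hqn]
  have h1 := winner_spec (k := k) hl (p := q + q) (by omega) (by omega)
  have h2 := winner_spec (k := k) hl (p := q + q + 1) (by omega) (by omega)
  rcases h1 with h1 | ⟨x, hx, hx1, h1⟩ <;> rcases h2 with h2 | ⟨y, hy, hy1, h2⟩ <;>
    rw [h1, h2] <;> simp [better]
  rw [hk x hx hx1, hk y hy hy1]

end tournament

end Traffic.Dijkstra

/-! ### Dijkstra's algorithm: steps, termination, shortest path flows -/

namespace Traffic.Dijkstra

variable {nV n m : ℕ}

section step

variable (src tgt : Fin n → Fin nV) (t : Vec n) (i : Fin nV)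

/-- The leaves of the tournament tree for the set `A` of active edges. -/
def leafOf (A : Finset (Fin n)) (x : ℕ) : ℕ := if h : x < n then if ⟨x, h⟩ ∈ A then x + 1 else 0 else 0

/-- The keys of the tournament tree. -/
noncomputable def keyN (L : List (Fin n)) (x : ℕ) : ℝ :=
  if h : x < n then key src tgt t L ⟨x, h⟩ else 0

/-- The root of the tournament tree. -/
noncomputable def top (L : List (Fin n)) (A : Finset (Fin n)) : ℕ :=
  winner n (keyN src tgt t L) (leafOf A) 1

/-- One step of Dijkstra's algorithm. -/
noncomputable def step (σ : List (Fin n) × Finset (Fin n)) : List (Fin n) × Finset (Fin n) :=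
  if h : 0 < top src tgt t σ.1 σ.2 ∧ top src tgt t σ.1 σ.2 - 1 < n then
    let e : Fin n := ⟨top src tgt t σ.1 σ.2 - 1, h.2⟩
    if tgt e ∈ verts tgt i σ.1 then (σ.1, σ.2.erase e)
    else (e :: σ.1, σ.2.erase e ∪ out src (tgt e))
  else σ

/-- `L` is the final tree. -/
def IsFinal (L : List (Fin n)) : Prop :=
  ∃ k, (step src tgt t i)^[k] ([], out src i) = (L, ∅)

/-- The final tree. -/
noncomputable def finalTree : List (Fin n) := Classical.epsilon (IsFinal src tgt t i)

/-- Bounds the remaining work. -/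
def work (L : List (Fin n)) (A : Finset (Fin n)) : ℕ :=
  A.card + 2 * (Finset.univ.filter fun e => src e ∉ verts tgt i L).card

variable {src tgt t i} {L : List (Fin n)} {A : Finset (Fin n)} {e : Fin n}

theorem leafOf_spec (x : ℕ) (_ : x < n) : leafOf A x = 0 ∨ leafOf A x = x + 1 := by
  unfold leafOf; split_ifs <;> simp

theorem leafOf_val (e : Fin n) : leafOf A e = if e ∈ A then (e : ℕ) + 1 else 0 := by
  simp [leafOf]

theorem leafOf_eq {x : ℕ} (hx : x < n) (h : leafOf A x = x + 1) : (⟨x, hx⟩ : Fin n) ∈ A := by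
  unfold leafOf at h
  rw [dif_pos hx] at h
  by_contra h'
  rw [if_neg h'] at h
  omega

theorem keyN_val (e : Fin n) : keyN src tgt t L e = key src tgt t L e := by simp [keyN]

theorem winner_mem {p : ℕ} (h0 : 0 < p) (hp : p < 2 * n) {k : ℕ → ℝ} :
    winner n k (leafOf A) p = 0 ∨ ∃ e ∈ A, winner n k (leafOf A) p = (e : ℕ) + 1 := by
  rcases winner_spec (k := k) (leafOf_spec (A := A)) h0 hp with h | ⟨x, hx, h1, h2⟩
  · exact Or.inl h
  · exact Or.inr ⟨⟨x, hx⟩, leafOf_eq hx h1, h2⟩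

theorem top_spec (hA : A.Nonempty) : ∃ e ∈ A, top src tgt t L A = (e : ℕ) + 1 ∧
    ∀ a ∈ A, key src tgt t L e ≤ key src tgt t L a := by
  have hle : ∀ a ∈ A, 0 < top src tgt t L A ∧
      keyN src tgt t L (top src tgt t L A - 1) ≤ key src tgt t L a := by
    intro a ha
    have h1 : winner n (keyN src tgt t L) (leafOf A) (n + a) = a + 1 := by
      rw [winner_of_le (by omega), Nat.add_sub_cancel_left, leafOf_val, if_pos ha]
    have h2 := winner_one_le (k := keyN src tgt t L) (leaf := leafOf A) (n := n) (p := n + a)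
      (by have := a.2; omega) (by have := a.2; omega) (by omega)
    rw [h1, Nat.add_sub_cancel, keyN_val] at h2
    exact h2
  obtain ⟨a, ha⟩ := hA
  have hn := a.2
  rcases winner_mem (A := A) (k := keyN src tgt t L) (p := 1) one_pos (by omega) with h | ⟨e, he, h⟩
  · have := (hle a ha).1
    rw [top, h] at this
    omega
  · refine ⟨e, he, h, fun a ha => ?_⟩
    have := (hle a ha).2
    rwa [top, h, Nat.add_sub_cancel, keyN_val] at this

theorem top_eq_zero (hn : 0 < n) : top src tgt t L A = 0 ↔ A = ∅ := by
  constructor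
  · intro h
    by_contra hA
    obtain ⟨e, -, he, -⟩ := top_spec (src := src) (tgt := tgt) (t := t) (L := L)
      (Finset.nonempty_iff_ne_empty.2 hA)
    omega
  · rintro rfl
    rcases winner_mem (A := (∅ : Finset (Fin n))) (k := keyN src tgt t L) (p := 1) one_pos (by omega) with
      h | ⟨e, he, -⟩
    · exact h
    · simp at he

theorem step_eq (h : top src tgt t L A = (e : ℕ) + 1) : step src tgt t i (L, A) =
    if tgt e ∈ verts tgt i L then (L, A.erase e) else (e :: L, A.erase e ∪ out src (tgt e)) := by
  have h1 : 0 < top src tgt t L A ∧ top src tgt t L A - 1 < n := by have := e.2; omega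
  have h2 : (⟨top src tgt t L A - 1, h1.2⟩ : Fin n) = e := Fin.ext (by simp [h])
  rw [step, dif_pos h1]
  simp only [h2]

theorem step_empty (hn : 0 < n) : step src tgt t i (L, ∅) = (L, ∅) := by
  have h : top src tgt t L (∅ : Finset (Fin n)) = 0 := (top_eq_zero hn).2 rfl
  rw [step, dif_neg (by rw [h]; omega)]

theorem good_step (ht : ∀ e, 0 ≤ t e) (h : Good src tgt t i L A) (hA : A.Nonempty) :
    Good src tgt t i (step src tgt t i (L, A)).1 (step src tgt t i (L, A)).2 := by
  obtain ⟨e, he, h1, h2⟩ := top_spec (src := src) (tgt := tgt) (t := t) (L := L) hA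
  rw [step_eq h1]
  split_ifs with hv
  · exact h.erase he hv
  · exact h.cons ht he h2 hv

theorem work_erase (he : e ∈ A) : work src tgt i L (A.erase e) + 1 = work src tgt i L A := by
  have := Finset.card_erase_add_one he
  unfold work; omega

/-- An edge with unsettled tail counts twice and an active edge once. Settling the head of `e`
activates its outgoing edges, which releases one unit for each of them, and removing `e` releases
another. -/
theorem work_cons (he : e ∈ A) (hv : tgt e ∉ verts tgt i L) :
    work src tgt i (e :: L) (A.erase e ∪ out src (tgt e)) + (out src (tgt e)).card + 1 ≤
      work src tgt i L A := by
  have h1 := Finset.card_erase_add_one he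
  have h2 := Finset.card_union_le (A.erase e) (out src (tgt e))
  have h3 : (Finset.univ.filter fun a => src a ∉ verts tgt i (e :: L)).card + (out src (tgt e)).card =
      (Finset.univ.filter fun a => src a ∉ verts tgt i L).card := by
    rw [← Finset.card_union_of_disjoint]
    · congr 1
      ext a
      simp only [verts, out, Finset.mem_union, Finset.mem_filter, Finset.mem_univ, true_and,
        Finset.mem_insert, not_or]
      constructor
      · rintro (h | h)
        · exact h.2
        · rwa [h]
      · intro h
        by_cases ha : src a = tgt e
        · exact Or.inr ha
        · exact Or.inl ⟨ha, h⟩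
    · rw [Finset.disjoint_left]
      intro a ha ha'
      simp only [Finset.mem_filter, verts, Finset.mem_insert, not_or] at ha
      exact ha.2.1 (mem_out.1 ha')
  unfold work; omega

theorem exists_isFinal (ht : ∀ e, 0 ≤ t e) : ∃ L, IsFinal src tgt t i L ∧ Good src tgt t i L ∅ := by
  have key : ∀ p L A, work src tgt i L A ≤ p → Good src tgt t i L A →
      ∃ k L', (step src tgt t i)^[k] (L, A) = (L', ∅) ∧ Good src tgt t i L' ∅ := by
    intro p
    induction p with
    | zero =>
      intro L A hp hg
      have : A = ∅ := Finset.card_eq_zero.1 (by unfold work at hp; omega)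
      subst this
      exact ⟨0, L, rfl, hg⟩
    | succ p ih =>
      intro L A hp hg
      rcases A.eq_empty_or_nonempty with rfl | hA
      · exact ⟨0, L, rfl, hg⟩
      · obtain ⟨e, he, h1, h2⟩ := top_spec (src := src) (tgt := tgt) (t := t) (L := L) hA
        obtain ⟨k, L', h3, h4⟩ := ih (step src tgt t i (L, A)).1 (step src tgt t i (L, A)).2 (by
          rw [step_eq h1]
          split_ifs with hv
          · have := work_erase (src := src) (tgt := tgt) (i := i) (L := L) he
            simp only; omega
          · have := work_cons (src := src) he hv
            simp only; omega) (good_step ht hg hA)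
        exact ⟨k + 1, L', h3, h4⟩
  obtain ⟨k, L, h1, h2⟩ := key _ _ _ le_rfl (good_init (src := src) (tgt := tgt) (i := i) ht)
  exact ⟨L, ⟨k, h1⟩, h2⟩

/-- A state without active edges is a fixed point of `step`, so the number of iterations is
irrelevant. The final tree, and with it the selected subgradient, depends only on the edge lengths
and the origin. -/
theorem IsFinal.unique (hn : 0 < n) {L L' : List (Fin n)} (h : IsFinal src tgt t i L)
    (h' : IsFinal src tgt t i L') : L = L' := by
  have hfix : ∀ r L, (step src tgt t i)^[r] (L, ∅) = (L, ∅) := fun r L =>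
    Function.iterate_fixed (step_empty hn) r
  have key : ∀ k k' (L L' : List (Fin n)), k ≤ k' → (step src tgt t i)^[k] ([], out src i) = (L, ∅) →
      (step src tgt t i)^[k'] ([], out src i) = (L', ∅) → L = L' := by
    intro k k' L L' hk h h'
    obtain ⟨r, rfl⟩ := Nat.exists_eq_add_of_le' hk
    rw [Function.iterate_add_apply, h, hfix] at h'
    exact (Prod.mk.inj h').1
  obtain ⟨k, hk⟩ := h
  obtain ⟨k', hk'⟩ := h'
  rcases le_total k k' with hkk | hkk
  · exact key k k' L L' hkk hk hk'
  · exact (key k' k L' L hkk hk' hk).symm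

theorem finalTree_spec (hn : 0 < n) (ht : ∀ e, 0 ≤ t e) :
    IsFinal src tgt t i (finalTree src tgt t i) ∧ Good src tgt t i (finalTree src tgt t i) ∅ := by
  obtain ⟨L, h1, h2⟩ := exists_isFinal (src := src) (tgt := tgt) (i := i) ht
  have h3 : IsFinal src tgt t i (finalTree src tgt t i) := Classical.epsilon_spec ⟨L, h1⟩
  exact ⟨h3, h3.unique hn h1 ▸ h2⟩

end step

variable (net : Network nV n m) (t : Vec n)

/-- The shortest path found for the pair `w`. -/
noncomputable def shortest (w : Fin m) : List (Fin n) :=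
  pathOf net.src net.tgt (finalTree net.src net.tgt t (net.orig w)) (net.dest w)

/-- The flow that sends all demands along the shortest paths found. -/
noncomputable def shortestFlow : Vec n := net.flow (net.single (shortest net t))

variable {net t}

theorem dest_mem_verts (hn : 0 < n) (ht : ∀ e, 0 ≤ t e) (w : Fin m) :
    net.dest w ∈ verts net.tgt (net.orig w) (finalTree net.src net.tgt t (net.orig w)) := by
  obtain ⟨p, hp⟩ := net.paths_nonempty w
  exact ((finalTree_spec hn ht).2.walk_le (net.isWalk w p hp) root_mem_verts).1

theorem shortest_mem (hn : 0 < n) (hc : net.ContainsSimplePaths) (ht : ∀ e, 0 ≤ t e) (w : Fin m) :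
    shortest net t w ∈ net.paths w := by
  have h := (finalTree_spec (src := net.src) (tgt := net.tgt) (i := net.orig w) hn ht).2.tree
  have hd := dest_mem_verts (net := net) hn ht w
  exact hc w _ (h.isWalk hd) (h.simple hd).1

theorem shortest_le (hn : 0 < n) (ht : ∀ e, 0 ≤ t e) (w : Fin m) {p : List (Fin n)}
    (hp : p ∈ net.paths w) :
    Network.pathCost t (shortest net t w) ≤ Network.pathCost t p := by
  have h := (finalTree_spec (src := net.src) (tgt := net.tgt) (i := net.orig w) hn ht).2
  have h1 := (h.walk_le (net.isWalk w p hp) root_mem_verts).2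
  rw [h.tree.dist_root, zero_add] at h1
  exact h1

theorem potential_eq (hn : 0 < n) (hc : net.ContainsSimplePaths) (ht : ∀ e, 0 ≤ t e) :
    net.potential 0 t = -inner ℝ (shortestFlow net t) t :=
  Network.potential_zero_of_min (shortest_mem hn hc ht) fun w _ hp => shortest_le hn ht w hp

theorem isSubgradientAt (hn : 0 < n) (hc : net.ContainsSimplePaths) (ht : ∀ e, 0 ≤ t e) :
    IsSubgradientAt (net.potential 0) (-shortestFlow net t) t :=
  Network.isSubgradientAt_of_min (Network.single_mem (shortest_mem hn hc ht)) (potential_eq hn hc ht)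

/-- Grouped by origin, the flow becomes a sum over tree vertices. Vertices outside the tree have no
demand, because each destination is reachable by an admissible walk. -/
theorem shortestFlow_eq (hn : 0 < n) (hc : net.ContainsSimplePaths) (ht : ∀ e, 0 ≤ t e)
    {o : Fin net.S → Fin nV} (ho : Function.Injective o) (hs : ∀ w, ∃ q, o q = net.orig w)
    (e : Fin n) :
    shortestFlow net t e = ∑ q, ∑ v ∈ verts net.tgt (o q) (finalTree net.src net.tgt t (o q)),
      net.dem (o q) v *
        Network.theta e (pathOf net.src net.tgt (finalTree net.src net.tgt t (o q)) v) := by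
  rw [shortestFlow, Network.flow_single (shortest_mem hn hc ht)]
  unfold shortest
  rw [← sum_origins ho hs fun i j =>
    Network.theta e (pathOf net.src net.tgt (finalTree net.src net.tgt t i) j)]
  refine Finset.sum_congr rfl fun q _ => ?_
  symm
  refine Finset.sum_subset (Finset.subset_univ _) fun v _ hv => ?_
  have : net.dem (o q) v = 0 := by
    unfold Network.dem
    refine Finset.sum_eq_zero fun w _ => if_neg ?_
    rintro ⟨h1, rfl⟩
    rw [← h1] at hv
    exact hv (dest_mem_verts hn ht w)
  rw [this, zero_mul]

end Traffic.Dijkstra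

/-! ### The tournament tree in memory and the settling of a vertex -/

namespace Traffic.Dijkstra

variable {nV n m : ℕ} {O : Oracles}

/-- The length of the path to the head of the edge `x`. -/
abbrev keyE (x : NExp) : RExp := .add (.get 51 (.const 0) (.get 1 (.const 0) x)) (.get 10 (.const 0) x)

/-- The entry of the left child of the current node of the tournament tree. -/
abbrev leftE : NExp := .get 51 (.const 0) (.add (V 35) (V 35))

/-- The entry of the right child of the current node of the tournament tree. -/
abbrev rightE : NExp := .get 51 (.const 0) (.add (.add (V 35) (V 35)) (.const 1))

/-- Recomputes the current node of the tournament tree. -/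
def betterCmd : Cmd :=
  .ite (.ltN (.const 0) rightE)
    (.ite (.ltN (.const 0) leftE)
      (.ite (.ltR (keyE (.sub rightE (.const 1))) (keyE (.sub leftE (.const 1))))
        (.setN 51 (.const 0) (V 35) rightE) (.setN 51 (.const 0) (V 35) leftE))
      (.setN 51 (.const 0) (V 35) rightE))
    (.setN 51 (.const 0) (V 35) leftE)

/-- Recomputes the nodes above the current node. -/
def updateCmd : Cmd :=
  -- The machine cannot divide indices; the parent `p / 2` is read from the table in array `26`.
  .loop (.ltN (.const 1) (V 35)) (.seq (letN 35 (.get 26 (.const 0) (V 35))) betterCmd)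

/-- Sets the leaf of the edge `nat 36` to `v`. -/
def setLeafCmd (v : NExp) : Cmd :=
  .seq (letN 35 (.add nE (V 36))) <| .seq (.setN 51 (.const 0) (V 35) v) updateCmd

/-- The keys computed from the memory. -/
def memKey (s : Mem) (x : ℕ) : ℝ := s.real 51 0 (s.nat 1 0 x) + s.real 10 0 x

theorem memKey_congr {s s' : Mem} (hN : s'.nat 1 = s.nat 1) (hR : s'.real = s.real) :
    memKey s' = memKey s := by
  funext x; simp only [memKey, hN, hR]

theorem reaches_better (s : Mem) : Reaches O betterCmd s 150 fun s' =>
    s' = s.setN 51 0 (s.nat 35 0 0) (better (memKey s)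
      (s.nat 51 0 (s.nat 35 0 0 + s.nat 35 0 0)) (s.nat 51 0 (s.nat 35 0 0 + s.nat 35 0 0 + 1))) := by
  unfold betterCmd
  refine Reaches.ite (T₁ := 130) (fun h1 => ?_) (fun h1 => ?_) (by simp [BExp.cost, NExp.cost])
  · refine Reaches.ite (T₁ := 110) (fun h2 => ?_) (fun h2 => ?_) (by simp [BExp.cost, NExp.cost])
    · refine Reaches.ite (T₁ := 20) (fun h3 => ?_) (fun h3 => ?_)
        (by simp [BExp.cost, NExp.cost, RExp.cost]) <;>
      · simp only [BExp.eval, NExp.eval, RExp.eval] at h1 h2 h3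
        refine Reaches.setN (by simp [NExp.cost]) ?_
        simp [NExp.eval, better, h1, h2, memKey, h3]
    · simp only [BExp.eval, NExp.eval] at h1 h2
      refine Reaches.setN (by simp [NExp.cost]) ?_
      simp [NExp.eval, better, h1, h2]
  · simp only [BExp.eval, NExp.eval] at h1
    refine Reaches.setN (by simp [NExp.cost]) ?_
    simp [NExp.eval, better, h1]

/-- After a leaf has changed, at most the parent of the current node is inconsistent with its
children. Recomputing it moves the defect one level up, and it disappears at the root after at most
`log₂ (2n)` rounds. -/
theorem reaches_update {s : Mem} (hhalf : ∀ p < 2 * n, s.nat 26 0 p = p / 2)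
    (h0 : 0 < s.nat 35 0 0) (hp : s.nat 35 0 0 < 2 * n)
    (hw : ∀ q, 0 < q → q < n → q ≠ s.nat 35 0 0 / 2 →
      s.nat 51 0 q = better (memKey s) (s.nat 51 0 (q + q)) (s.nat 51 0 (q + q + 1))) :
    Reaches O updateCmd s (170 * Nat.log 2 (2 * n) + 5) fun s' =>
      (∀ q, 0 < q → q < n →
        s'.nat 51 0 q = better (memKey s) (s'.nat 51 0 (q + q)) (s'.nat 51 0 (q + q + 1))) ∧
      (∀ q, n ≤ q → s'.nat 51 0 q = s.nat 51 0 q) ∧ s'.real = s.real ∧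
      ∀ b, b ≠ 35 → b ≠ 51 → s'.nat b = s.nat b := by
  let I : ℕ → Mem → Prop := fun pot s' => pot = 170 * Nat.log 2 (s'.nat 35 0 0) ∧
    0 < s'.nat 35 0 0 ∧ s'.nat 35 0 0 < 2 * n ∧
    (∀ q, 0 < q → q < n → q ≠ s'.nat 35 0 0 / 2 →
      s'.nat 51 0 q = better (memKey s) (s'.nat 51 0 (q + q)) (s'.nat 51 0 (q + q + 1))) ∧
    (∀ q, n ≤ q → s'.nat 51 0 q = s.nat 51 0 q) ∧ s'.real = s.real ∧
    ∀ b, b ≠ 35 → b ≠ 51 → s'.nat b = s.nat b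
  refine (Reaches.loop_pot I (p := 170 * Nat.log 2 (s.nat 35 0 0)) ?_ ?_ ?_).mono
    (T₁ := 170 * Nat.log 2 (s.nat 35 0 0) + 5) ?_ (fun _ h => h)
  · exact ⟨rfl, h0, hp, hw, fun _ _ => rfl, rfl, fun _ _ _ => rfl⟩
  · rintro pot s1 ⟨i1, i2, i3, i4, i5, i6, i7⟩ hb
    simp only [BExp.eval, NExp.eval] at hb
    obtain ⟨p, hpe⟩ : ∃ p, p = s1.nat 35 0 0 := ⟨_, rfl⟩
    rw [← hpe] at i1 i2 i3 i4 hb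
    have hlog : Nat.log 2 p = Nat.log 2 (p / 2) + 1 := Nat.log_of_one_lt_of_le (by omega) (by omega)
    refine ⟨170 * Nat.log 2 (p / 2), 160, by simp [BExp.cost, NExp.cost]; omega, ?_⟩
    refine Reaches.bind (T₁ := 10) (Reaches.letN (x := p / 2) ?_ ?_) (by omega) ?_
    · simp only [NExp.eval, ← hpe]
      rw [i7 26 (by decide) (by decide), hhalf p i3]
    · simp [NExp.cost]
    rintro s2 ⟨e2, R2, N2⟩
    refine (reaches_better s2).mono le_rfl ?_
    rintro s3 rfl
    have hk : memKey s2 = memKey s := memKey_congr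
      (by rw [N2 1 (by decide), i7 1 (by decide) (by decide)]) (by rw [R2, i6])
    have e51 : s2.nat 51 = s1.nat 51 := N2 51 (by decide)
    rw [e2, hk, e51]
    have hq35 : ∀ v, (s2.setN 51 0 (p / 2) v).nat 35 0 0 = p / 2 := fun v => by
      rw [setN_nat_of_ne _ _ _ _ (by decide), e2]
    have hat : ∀ v q, q ≠ p / 2 → (s2.setN 51 0 (p / 2) v).nat 51 0 q = s1.nat 51 0 q := by
      intro v q hq
      rw [setN_nat, if_neg (by omega), e51]
    refine ⟨?_, ?_, ?_, ?_, ?_, ?_, ?_⟩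
    · rw [hq35]
    · rw [hq35]; omega
    · rw [hq35]; omega
    · intro q hq0 hqn hq
      rw [hq35] at hq
      rw [hat _ (q + q) (by omega), hat _ (q + q + 1) (by omega)]
      by_cases hqp : q = p / 2
      · subst hqp
        rw [setN_nat_self]
      · rw [hat _ q hqp, i4 q hq0 hqn hqp]
    · intro q hq
      rw [hat _ q (by omega), i5 q hq]
    · rw [setN_real, R2, i6]
    · intro b hb1 hb2
      rw [setN_nat_of_ne _ _ _ _ hb2, N2 b hb1, i7 b hb1 hb2]
  · rintro pot s1 ⟨-, i2, i3, i4, i5⟩ hb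
    simp only [BExp.eval, NExp.eval] at hb
    exact ⟨fun q hq0 hqn => i4 q hq0 hqn (by omega), i5⟩
  · have : Nat.log 2 (s.nat 35 0 0) ≤ Nat.log 2 (2 * n) := Nat.log_mono_right hp.le
    omega

/-- The memory contains the tournament tree for the set `A` of active edges. -/
def WinAt (n : ℕ) (k : ℕ → ℝ) (A : Finset (Fin n)) (s : Mem) : Prop :=
  ∀ p, 0 < p → p < 2 * n → s.nat 51 0 p = winner n k (leafOf A) p

theorem reaches_setLeaf {s : Mem} {A A' : Finset (Fin n)} {e : Fin n} {v : NExp}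
    (hn : s.nat 0 0 0 = n) (hhalf : ∀ p < 2 * n, s.nat 26 0 p = p / 2) (he : s.nat 36 0 0 = e)
    (hw : WinAt n (memKey s) A s) (hA : ∀ a, a ≠ e → (a ∈ A' ↔ a ∈ A))
    (hv : ∀ s' : Mem, (∀ b, b ≠ 35 → s'.nat b = s.nat b) → v.eval s' = leafOf A' e)
    (hvc : v.cost ≤ 10) :
    Reaches O (setLeafCmd v) s (170 * Nat.log 2 (2 * n) + 50) fun s' =>
      WinAt n (memKey s) A' s' ∧ s'.real = s.real ∧ ∀ b, b ≠ 35 → b ≠ 51 → s'.nat b = s.nat b := by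
  refine Reaches.bind (T₁ := 12) (Reaches.letN (x := n + e) ?_ ?_) (by omega) ?_
  · simp only [NExp.eval, hn, he]
  · simp [NExp.cost]
  rintro s1 ⟨e1, R1, N1⟩
  refine Reaches.bind (T₁ := 20) (Q' := fun s2 => s2 = s1.setN 51 0 (n + e) (leafOf A' e))
    (Reaches.setN (by simp only [NExp.cost]; omega) ?_) (by omega) ?_
  · simp only [NExp.eval, e1, hv s1 N1]
  rintro s2 rfl
  have hen := e.2
  have hk : memKey (s1.setN 51 0 (n + e) (leafOf A' e)) = memKey s := memKey_congr
    (by rw [setN_nat_of_ne _ _ _ _ (by decide), N1 1 (by decide)]) (by rw [setN_real, R1])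
  have h35 : (s1.setN 51 0 (n + e) (leafOf A' e)).nat 35 0 0 = n + e := by
    rw [setN_nat_of_ne _ _ _ _ (by decide), e1]
  have hat : ∀ q, q ≠ n + e → (s1.setN 51 0 (n + e) (leafOf A' e)).nat 51 0 q = s.nat 51 0 q := by
    intro q hq
    rw [setN_nat, if_neg (by omega), N1 51 (by decide)]
  refine (reaches_update (n := n) ?_ ?_ ?_ ?_).mono (by omega) ?_
  · intro p hp
    rw [setN_nat_of_ne _ _ _ _ (by decide), N1 26 (by decide), hhalf p hp]
  · rw [h35]; omega
  · rw [h35]; omega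
  · intro q hq0 hqn hq
    rw [h35] at hq
    rw [hk, hat q (by omega), hat (q + q) (by omega), hat (q + q + 1) (by omega), hw q hq0 (by omega),
      hw (q + q) (by omega) (by omega), hw (q + q + 1) (by omega) (by omega), winner_of_lt hq0 hqn]
  · rintro s3 ⟨h1, h2, h3, h4⟩
    rw [hk] at h1
    refine ⟨fun p hp0 hp => ?_, by rw [h3, setN_real, R1], fun b hb1 hb2 => ?_⟩
    · refine eq_winner (w := fun q => s3.nat 51 0 q) (fun x hx => ?_) h1 hp0 hp
      rw [h2 (n + x) (by omega)]
      by_cases hxe : x = e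
      · subst hxe
        rw [setN_nat_self]
      · rw [hat (n + x) (by omega), hw (n + x) (by omega) (by omega), winner_of_le (by omega),
          Nat.add_sub_cancel_left]
        have := hA ⟨x, hx⟩ fun h => hxe (congrArg Fin.val h)
        simp [leafOf, hx, this]
    · rw [h4 b hb1 hb2, setN_nat_of_ne _ _ _ _ hb2, N1 b hb1]

/-- The data that are fixed while treating an origin. -/
structure Fixed (src tgt : Fin n → Fin nV) (t : Vec n) (dem : Fin nV → ℝ) (i : Fin nV) (s : Mem) :
    Prop where
  n_eq : s.nat 0 0 0 = n
  src_eq : ∀ e, s.nat 1 0 (e : Fin n) = src e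
  tgt_eq : ∀ e, s.nat 2 0 (e : Fin n) = tgt e
  half : ∀ p < 2 * n, s.nat 26 0 p = p / 2
  deg : ∀ v : Fin nV, s.nat 25 0 v = (out src v).card
  adj : ∀ v : Fin nV, ∀ r < (out src v).card, ∃ e ∈ out src v, s.nat 24 v r = e
  adj_surj : ∀ v : Fin nV, ∀ e ∈ out src v, ∃ r < (out src v).card, s.nat 24 v r = e
  t_eq : ∀ e : Fin n, s.real 10 0 e = t e
  i_eq : s.nat 33 0 0 = i
  dem_eq : ∀ j : Fin nV, s.real 40 i j = dem j

variable {src tgt : Fin n → Fin nV} {t : Vec n} {dem : Fin nV → ℝ} {i : Fin nV} {s s' : Mem}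

theorem Fixed.congr (h : Fixed src tgt t dem i s)
    (hN : ∀ b, b < 30 ∨ b = 33 → s'.nat b = s.nat b)
    (hR : ∀ b, b = 10 ∨ b = 40 → s'.real b = s.real b) : Fixed src tgt t dem i s' := by
  refine ⟨?_, ?_, ?_, ?_, ?_, ?_, ?_, ?_, ?_, ?_⟩
  · rw [hN 0 (by decide), h.n_eq]
  · rw [hN 1 (by decide)]; exact h.src_eq
  · rw [hN 2 (by decide)]; exact h.tgt_eq
  · rw [hN 26 (by decide)]; exact h.half
  · rw [hN 25 (by decide)]; exact h.deg
  · rw [hN 24 (by decide)]; exact h.adj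
  · rw [hN 24 (by decide)]; exact h.adj_surj
  · rw [hR 10 (by decide)]; exact h.t_eq
  · rw [hN 33 (by decide), h.i_eq]
  · rw [hR 40 (by decide)]; exact h.dem_eq

/-- The memory describes the settled vertices `U`, their distances `D` and the active edges `A`. -/
structure Rep (src tgt : Fin n → Fin nV) (t : Vec n) (dem : Fin nV → ℝ) (i : Fin nV)
    (U : Finset (Fin nV)) (D : Fin nV → ℝ) (A : Finset (Fin n)) (s : Mem) : Prop where
  fixed : Fixed src tgt t dem i s
  settled : ∀ v ∈ U, s.nat 50 0 (v : Fin nV) = 1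
  fresh : ∀ e, tgt e ∉ U → s.nat 50 0 (tgt e) = 0
  win : WinAt n (memKey s) A s
  dist_eq : ∀ v ∈ U, s.real 51 0 (v : Fin nV) = D v
  dem_at : ∀ v ∈ U, s.real 52 0 (v : Fin nV) = dem v

variable {U : Finset (Fin nV)} {D : Fin nV → ℝ} {A : Finset (Fin n)}

theorem Rep.congr (h : Rep src tgt t dem i U D A s)
    (hN : ∀ b, b < 30 ∨ b = 33 ∨ b = 50 ∨ b = 51 → s'.nat b = s.nat b)
    (hR : ∀ b, b = 10 ∨ b = 40 ∨ b = 51 ∨ b = 52 → s'.real b = s.real b) :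
    Rep src tgt t dem i U D A s' := by
  have hk : memKey s' = memKey s := by
    funext x; simp only [memKey, hN 1 (by decide), hR 51 (by decide), hR 10 (by decide)]
  refine ⟨h.fixed.congr (fun b hb => hN b (by omega)) (fun b hb => hR b (by omega)), ?_, ?_, ?_, ?_, ?_⟩
  · rw [hN 50 (by decide)]; exact h.settled
  · rw [hN 50 (by decide)]; exact h.fresh
  · intro p hp0 hp
    rw [hk, hN 51 (by decide)]; exact h.win p hp0 hp
  · rw [hR 51 (by decide)]; exact h.dist_eq
  · rw [hR 52 (by decide)]; exact h.dem_at

theorem Rep.memKey_eq (h : Rep src tgt t dem i U D A s) {e : Fin n} (he : src e ∈ U) :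
    memKey s e = D (src e) + t e := by
  rw [memKey, h.fixed.src_eq, h.dist_eq _ he, h.fixed.t_eq]

/-- Settles the vertex `nat 38` with the distance `real 53`. -/
def settleCmd : Cmd :=
  .seq (.setN 50 (.const 0) (V 38) (.const 1)) <|
  .seq (.setR 51 (.const 0) (V 38) (S 53)) <|
  .seq (.setR 52 (.const 0) (V 38) (.get 40 (V 33) (V 38))) <|
  forN 37 (.get 25 (.const 0) (V 38)) <|
    .seq (letN 36 (.get 24 (V 38) (V 37))) (setLeafCmd (.add (V 36) (.const 1)))

theorem reaches_settle (h : Rep src tgt t dem i U D A s) (hA : ∀ e ∈ A, src e ∈ U) {v : Fin nV}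
    (hv : v ∉ U) (h38 : s.nat 38 0 0 = v) :
    Reaches O settleCmd s ((out src v).card * (170 * Nat.log 2 (2 * n) + 100) + 100)
      (Rep src tgt t dem i (insert v U) (Function.update D v (s.real 53 0 0)) (A ∪ out src v)) := by
  classical
  set d := s.real 53 0 0 with hd
  set K := 170 * Nat.log 2 (2 * n) with hK
  obtain ⟨W, hW⟩ : ∃ W, W = (out src v).card * (K + 100) := ⟨_, rfl⟩
  rw [← hW]
  refine Reaches.bind (T₁ := 10) (Q' := fun s1 => s1 = s.setN 50 0 v 1)
    (Reaches.setN (by simp [NExp.cost]) (by simp only [NExp.eval, h38])) (by omega) ?_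
  rintro s1 hs1
  have R1 : s1.real = s.real := by rw [hs1]; rfl
  have N1 : ∀ b, b ≠ 50 → s1.nat b = s.nat b := fun b hb => by
    rw [hs1, setN_nat_of_ne _ _ _ _ hb]
  refine Reaches.bind (T₁ := 15) (Q' := fun s2 => s2 = s1.setR 51 0 v d)
    (Reaches.setR (by simp [NExp.cost, RExp.cost])
      (by simp only [NExp.eval, RExp.eval, N1 38 (by decide), h38, R1, hd])) (by omega) ?_
  rintro s2 hs2
  have N2 : s2.nat = s1.nat := by rw [hs2]; rfl
  have R2 : ∀ b, b ≠ 51 → s2.real b = s.real b := fun b hb => by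
    rw [hs2, setR_real_of_ne _ _ _ _ hb, R1]
  refine Reaches.bind (T₁ := 15) (Q' := fun s3 => s3 = s2.setR 52 0 v (dem v))
    (Reaches.setR (by simp [NExp.cost, RExp.cost])
      (by simp only [NExp.eval, RExp.eval, N2, N1 38 (by decide), h38, N1 33 (by decide),
            h.fixed.i_eq, R2 40 (by decide), h.fixed.dem_eq])) (by omega) ?_
  rintro s3 hs3
  have N3 : s3.nat = s1.nat := by rw [hs3, setR_nat, N2]
  have R3 : ∀ b, b ≠ 51 → b ≠ 52 → s3.real b = s.real b := fun b hb hb' => by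
    rw [hs3, setR_real_of_ne _ _ _ _ hb', R2 b hb]
  have e51 : ∀ u, s3.real 51 0 u = if u = (v : ℕ) then d else s.real 51 0 u := fun u => by
    rw [hs3, setR_real_of_ne _ _ _ _ (by decide), hs2, setR_real, R1]; simp
  have e52 : ∀ u, s3.real 52 0 u = if u = (v : ℕ) then dem v else s.real 52 0 u := fun u => by
    rw [hs3, setR_real, R2 52 (by decide)]; simp
  have e50 : ∀ u, s3.nat 50 0 u = if u = (v : ℕ) then 1 else s.nat 50 0 u := fun u => by
    rw [N3, hs1, setN_nat]; simp
  -- Active edges have settled tails, so writing the distance of the new vertex `v` leaves their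
  -- keys unchanged.
  have hkey : ∀ e ∈ A, memKey s3 e = memKey s e := by
    intro e he
    have hne : (src e : ℕ) ≠ v := fun h' => hv (Fin.ext h' ▸ hA e he)
    rw [memKey, memKey, N3, N1 1 (by decide), h.fixed.src_eq, e51, if_neg hne,
      R3 10 (by decide) (by decide)]
  have h3 : Rep src tgt t dem i (insert v U) (Function.update D v d) A s3 := by
    refine ⟨h.fixed.congr (fun b hb => by rw [N3, N1 b (by omega)])
      (fun b hb => R3 b (by omega) (by omega)), ?_, ?_, ?_, ?_, ?_⟩
    · intro u hu
      rw [e50]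
      split_ifs with huv
      · rfl
      · exact h.settled u (Finset.mem_of_mem_insert_of_ne hu fun h' => huv (congrArg Fin.val h'))
    · intro e he
      rw [Finset.mem_insert, not_or] at he
      rw [e50, if_neg fun h' => he.1 (Fin.ext h'), h.fresh e he.2]
    · intro p hp0 hp
      rw [N3, N1 51 (by decide), h.win p hp0 hp]
      refine winner_congr leafOf_spec (fun x hx hl => ?_) hp0 hp
      exact (hkey ⟨x, hx⟩ (leafOf_eq hx hl)).symm
    · intro u hu
      rw [e51]
      by_cases huv : u = v
      · subst huv; simp
      · rw [if_neg fun h' => huv (Fin.ext h'), Function.update_of_ne huv,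
          h.dist_eq u (Finset.mem_of_mem_insert_of_ne hu huv)]
    · intro u hu
      rw [e52]
      by_cases huv : u = v
      · subst huv; simp
      · rw [if_neg fun h' => huv (Fin.ext h'), h.dem_at u (Finset.mem_of_mem_insert_of_ne hu huv)]
  have h38' : s3.nat 38 0 0 = v := by rw [N3, N1 38 (by decide), h38]
  -- The outgoing edges of `v` inserted in the first `k` rounds.
  let B : ℕ → Finset (Fin n) := fun k => (out src v).filter fun e => ∃ r < k, s.nat 24 v r = e
  have e24 : s3.nat 24 = s.nat 24 := by rw [N3, N1 24 (by decide)]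
  let I : ℕ → Mem → Prop := fun k s' =>
    Rep src tgt t dem i (insert v U) (Function.update D v d) (A ∪ B k) s' ∧
    s'.nat 38 0 0 = v ∧ s'.nat 24 = s.nat 24
  refine (Reaches.forN (N := (out src v).card) (Tb := K + 70) I (by decide) ?_ ?_ ?_ ?_ ?_).mono
    (T₁ := W + 60) (by omega) ?_
  · intro w
    have hB : A ∪ B 0 = A := by simp [B]
    refine ⟨?_, ?_, ?_⟩
    · rw [hB]
      exact h3.congr (fun b hb => setN_nat_of_ne _ _ _ _ (by omega)) fun _ _ => rfl
    · rw [setN_nat_of_ne _ _ _ _ (by decide), h38']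
    · rw [setN_nat_of_ne _ _ _ _ (by decide), e24]
  · rintro k - s' ⟨h1, h2, -⟩ -
    simp only [NExp.eval, h2, h1.fixed.deg]
  · rintro k s' w ⟨h1, h2, h4⟩
    exact ⟨h1.congr (fun b hb => setN_nat_of_ne _ _ _ _ (by omega)) fun _ _ => rfl,
      by rw [setN_nat_of_ne _ _ _ _ (by decide), h2], by rw [setN_nat_of_ne _ _ _ _ (by decide), h4]⟩
  · rintro k hk s4 ⟨h1, h2, h4⟩ hik
    obtain ⟨e, he, hek⟩ := h.fixed.adj v k hk
    refine Reaches.bind (T₁ := 15) (Reaches.letN (x := (e : ℕ)) ?_ ?_) (by omega) ?_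
    · simp only [NExp.eval, h2, hik, h4, hek]
    · simp [NExp.cost]
    rintro s5 ⟨e5, R5, N5⟩
    have h5 : Rep src tgt t dem i (insert v U) (Function.update D v d) (A ∪ B k) s5 :=
      h1.congr (fun b hb => N5 b (by omega)) fun b _ => by rw [R5]
    have heB : e ∈ A ∪ B (k + 1) := Finset.mem_union_right _
      (Finset.mem_filter.2 ⟨he, k, by omega, hek⟩)
    refine (reaches_setLeaf (A' := A ∪ B (k + 1)) h5.fixed.n_eq h5.fixed.half e5 h5.win ?_ ?_ ?_).mono
      (by omega) ?_
    · intro a hae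
      simp only [B, Finset.mem_union, Finset.mem_filter]
      refine or_congr_right (and_congr_right fun _ => ?_)
      constructor
      · rintro ⟨r, hr, hra⟩
        rcases Nat.lt_succ_iff_lt_or_eq.1 hr with hr | rfl
        · exact ⟨r, hr, hra⟩
        · exact absurd (Fin.ext (hra.symm.trans hek)) hae
      · rintro ⟨r, hr, hra⟩
        exact ⟨r, by omega, hra⟩
    · intro s' hs'
      simp only [NExp.eval, hs' 36 (by decide), e5, leafOf_val, if_pos heB]
    · simp [NExp.cost]
    · rintro s6 ⟨h6, R6, N6⟩
      refine ⟨⟨h5.fixed.congr (fun b hb => N6 b (by omega) (by omega)) fun b _ => by rw [R6], ?_, ?_, ?_,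
        ?_, ?_⟩, ?_, ?_⟩
      · rw [N6 50 (by decide) (by decide)]; exact h5.settled
      · rw [N6 50 (by decide) (by decide)]; exact h5.fresh
      · rw [memKey_congr (N6 1 (by decide) (by decide)) R6]; exact h6
      · rw [R6]; exact h5.dist_eq
      · rw [R6]; exact h5.dem_at
      · rw [N6 38 (by decide) (by decide), N5 38 (by decide), h2]
      · rw [N6 24 (by decide) (by decide), N5 24 (by decide), h4]
  · have : (out src v).card * (K + 70 + 12 + (NExp.get 25 (.const 0) (V 38)).cost) ≤ W := by
      rw [hW]; exact Nat.mul_le_mul_left _ (by simp [NExp.cost])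
    simp only [NExp.cost] at this ⊢; omega
  · rintro s' ⟨h1, -⟩
    have hB : B (out src v).card = out src v := by
      refine Finset.filter_true_of_mem fun e he => ?_
      exact h.fixed.adj_surj v e he
    rwa [hB] at h1

end Traffic.Dijkstra

/-! ### The program for one origin -/

namespace Traffic.Dijkstra

variable {nV n m : ℕ} {O : Oracles} {src tgt : Fin n → Fin nV} {t : Vec n} {dem : Fin nV → ℝ}
  {i : Fin nV} {s s' : Mem} {U : Finset (Fin nV)} {D : Fin nV → ℝ} {L : List (Fin n)}
  {A : Finset (Fin n)}

/-- Removes the best active edge and settles its head if that is new. -/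
def stepCmd : Cmd :=
  .seq (letN 36 (.sub (.get 51 (.const 0) (.const 1)) (.const 1))) <|
  .seq (setLeafCmd (.const 0)) <|
  .ite (.ltN (.get 50 (.const 0) (.get 2 (.const 0) (V 36))) (.const 1))
    (.seq (.setN 52 (.const 0) (V 34) (V 36)) <|
     .seq (letN 34 (.add (V 34) (.const 1))) <|
     .seq (letN 38 (.get 2 (.const 0) (V 36))) <|
     .seq (letR 53 (keyE (V 36))) settleCmd)
    .skip

/-- The array `a` lists the tree, the most recent edge last. -/
def ListAt (a : ℕ → ℕ) : List (Fin n) → Prop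
  | [] => True
  | e :: L => a L.length = e ∧ ListAt a L

theorem ListAt.congr {a a' : ℕ → ℕ} (h : ListAt a L) (ha : ∀ r < L.length, a' r = a r) :
    ListAt a' L := by
  induction L with
  | nil => trivial
  | cons e L ih =>
    exact ⟨by rw [ha _ (by simp), h.1], ih h.2 fun r hr => ha r (by simp; omega)⟩

/-- The memory describes the tree `L` and the active edges `A`. -/
structure TreeRep (src tgt : Fin n → Fin nV) (t : Vec n) (dem : Fin nV → ℝ) (i : Fin nV)
    (L : List (Fin n)) (A : Finset (Fin n)) (s : Mem) : Prop where
  rep : Rep src tgt t dem i (verts tgt i L) (dist src tgt t L) A s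
  count : s.nat 34 0 0 = L.length
  list : ListAt (s.nat 52 0) L

theorem Rep.congr_dist (h : Rep src tgt t dem i U D A s) {D' : Fin nV → ℝ}
    (hD : ∀ v ∈ U, D' v = D v) : Rep src tgt t dem i U D' A s :=
  ⟨h.fixed, h.settled, h.fresh, h.win, fun v hv => by rw [h.dist_eq v hv, hD v hv], h.dem_at⟩

theorem TreeRep.top_eq (h : TreeRep src tgt t dem i L A s) (hA : ∀ e ∈ A, src e ∈ verts tgt i L)
    (hn : 0 < n) : s.nat 51 0 1 = top src tgt t L A := by
  rw [h.rep.win 1 one_pos (by omega), top]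
  refine winner_congr leafOf_spec (fun x hx hl => ?_) one_pos (by omega)
  have he := leafOf_eq hx hl
  have := h.rep.memKey_eq (hA _ he)
  rw [show x = ((⟨x, hx⟩ : Fin n) : ℕ) from rfl, this, keyN_val]
  rfl

/-- Each unit of `work` is worth `170 log₂(2n) + 500` steps, enough for changing one leaf together
with the fixed overhead. One unit pays for the removed edge and, by `work_cons`, one for each
inserted edge. The difference of `300` and `280` is left for the loop test. -/
theorem reaches_step (h : TreeRep src tgt t dem i L A s) (hg : Good src tgt t i L A)
    (hA : A.Nonempty) :
    ∃ k, k + (170 * Nat.log 2 (2 * n) + 500) * work src tgt i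
        (step src tgt t i (L, A)).1 (step src tgt t i (L, A)).2 + 300 ≤
        (170 * Nat.log 2 (2 * n) + 500) * work src tgt i L A + 280 ∧
      Reaches O stepCmd s k
        (TreeRep src tgt t dem i (step src tgt t i (L, A)).1 (step src tgt t i (L, A)).2) := by
  obtain ⟨e, he, htop, hmin⟩ := top_spec (src := src) (tgt := tgt) (t := t) (L := L) hA
  have hn : 0 < n := lt_of_le_of_lt (Nat.zero_le _) e.2
  have h51 := h.top_eq hg.src_mem hn
  rw [htop] at h51
  set K := 170 * Nat.log 2 (2 * n) with hK
  rw [step_eq htop]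
  have pre : ∀ T c Q, (∀ s1, TreeRep src tgt t dem i L (A.erase e) s1 → s1.nat 36 0 0 = e →
      Reaches O c s1 T Q) →
      Reaches O (.seq (letN 36 (.sub (.get 51 (.const 0) (.const 1)) (.const 1))) <|
        .seq (setLeafCmd (.const 0)) c) s (K + 70 + T) Q := by
    intro T c Q hc
    refine Reaches.bind (T₁ := 15) (Reaches.letN (x := (e : ℕ)) ?_ ?_) (by omega) ?_
    · simp only [NExp.eval, h51, Nat.add_sub_cancel]
    · simp [NExp.cost]
    rintro s1 ⟨e1, R1, N1⟩
    have h1 : Rep src tgt t dem i (verts tgt i L) (dist src tgt t L) A s1 :=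
      h.rep.congr (fun b hb => N1 b (by omega)) fun b _ => by rw [R1]
    refine Reaches.bind (T₁ := K + 50) (reaches_setLeaf (A' := A.erase e) h1.fixed.n_eq h1.fixed.half e1
      h1.win ?_ ?_ ?_) (by omega) ?_
    · intro a hae
      simp [hae]
    · intro s' _
      simp [NExp.eval, leafOf_val]
    · simp [NExp.cost]
    rintro s2 ⟨h2, R2, N2⟩
    refine (hc s2 ⟨⟨h1.fixed.congr (fun b hb => N2 b (by omega) (by omega)) fun b _ => by rw [R2],
      ?_, ?_, ?_, ?_, ?_⟩, ?_, ?_⟩ ?_).mono (by omega) fun _ hq => hq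
    · rw [N2 50 (by decide) (by decide)]; exact h1.settled
    · rw [N2 50 (by decide) (by decide)]; exact h1.fresh
    · rw [memKey_congr (N2 1 (by decide) (by decide)) R2]; exact h2
    · rw [R2]; exact h1.dist_eq
    · rw [R2]; exact h1.dem_at
    · rw [N2 34 (by decide) (by decide), N1 34 (by decide), h.count]
    · rw [N2 52 (by decide) (by decide), N1 52 (by decide)]; exact h.list
    · rw [N2 36 (by decide) (by decide), e1]
  have hb : ∀ s1, TreeRep src tgt t dem i L (A.erase e) s1 → s1.nat 36 0 0 = e →
      ((BExp.ltN (.get 50 (.const 0) (.get 2 (.const 0) (V 36))) (.const 1)).eval O s1 ↔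
        tgt e ∉ verts tgt i L) := by
    intro s1 h1 he1
    simp only [BExp.eval, NExp.eval, he1, h1.rep.fixed.tgt_eq]
    constructor
    · intro h2 h3
      rw [h1.rep.settled _ h3] at h2
      omega
    · intro h2
      rw [h1.rep.fresh _ h2]; omega
  by_cases hv : tgt e ∈ verts tgt i L
  · rw [if_pos hv]
    refine ⟨K + 70 + 30, ?_, pre 30 _ _ fun s1 h1 he1 => ?_⟩
    · rw [← work_erase (src := src) (tgt := tgt) (i := i) (L := L) he]
      simp only [mul_add, mul_one]
      have : ∀ K X : ℕ, K + 70 + 30 + X + 300 ≤ X + (K + 500) + 280 := by intro K X; omega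
      exact this K _
    · refine Reaches.ite (T₁ := 1) (fun hc => absurd hv ((hb s1 h1 he1).1 hc)) (fun _ => ?_)
        (by simp [BExp.cost, NExp.cost])
      exact Reaches.skip le_rfl h1
  · rw [if_neg hv]
    obtain ⟨W, hW⟩ : ∃ W, W = (out src (tgt e)).card * (K + 100) := ⟨_, rfl⟩
    refine ⟨K + 70 + (W + 300), ?_, pre (W + 300) _ _ fun s1 h1 he1 => ?_⟩
    · have h2 := Nat.mul_le_mul_left (K + 500) (work_cons (src := src) (A := A) he hv)
      have h3 : W ≤ (K + 500) * (out src (tgt e)).card := by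
        rw [hW, mul_comm]; exact Nat.mul_le_mul_right _ (by omega)
      simp only [mul_add, mul_one] at h2
      have h4 : ∀ K X Y Z W : ℕ, X + Y + (K + 500) ≤ Z → W ≤ Y →
          K + 70 + (W + 300) + X + 300 ≤ Z + 280 := by
        intro K X Y Z W h h'; linarith
      exact h4 K _ _ _ _ h2 h3
    · refine Reaches.ite (T₁ := W + 250) (fun _ => ?_) (fun hc => absurd ((hb s1 h1 he1).2 hv) hc)
        (by simp only [BExp.cost, NExp.cost]; omega)
      refine Reaches.bind (T₁ := 15) (Q' := fun s2 => s2 = s1.setN 52 0 L.length e)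
        (Reaches.setN (by simp [NExp.cost]) (by simp only [NExp.eval, h1.count, he1])) (by omega) ?_
      rintro s2 hs2
      have N2 : ∀ b, b ≠ 52 → s2.nat b = s1.nat b := fun b hb => by
        rw [hs2, setN_nat_of_ne _ _ _ _ hb]
      have R2 : s2.real = s1.real := by rw [hs2]; rfl
      have hlist : ListAt (s2.nat 52 0) (e :: L) := by
        rw [hs2]
        refine ⟨setN_nat_self _ _ _ _ _, h1.list.congr fun r hr => ?_⟩
        rw [setN_nat, if_neg (by omega)]
      refine Reaches.bind (T₁ := 15) (Reaches.letN (x := L.length + 1) ?_ ?_) (by omega) ?_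
      · simp only [NExp.eval, N2 34 (by decide), h1.count]
      · simp [NExp.cost]
      rintro s3 ⟨e3, R3, N3⟩
      refine Reaches.bind (T₁ := 15) (Reaches.letN (x := (tgt e : ℕ)) ?_ ?_) (by omega) ?_
      · simp only [NExp.eval, N3 36 (by decide), N2 36 (by decide), N3 2 (by decide), N2 2 (by decide),
          he1, h1.rep.fixed.tgt_eq]
      · simp [NExp.cost]
      rintro s4 ⟨e4, R4, N4⟩
      have hN4 : ∀ b, b ≠ 52 → b ≠ 34 → b ≠ 38 → s4.nat b = s1.nat b := fun b h1 h2 h3 => by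
        rw [N4 b h3, N3 b h2, N2 b h1]
      have hR4 : s4.real = s1.real := by rw [R4, R3, R2]
      refine Reaches.bind (T₁ := 40) (Reaches.letR (x := key src tgt t L e) ?_ ?_) (by omega) ?_
      · simp only [RExp.eval, NExp.eval, hN4 36 (by decide) (by decide) (by decide),
          hN4 1 (by decide) (by decide) (by decide), he1, hR4]
        exact h1.rep.memKey_eq (hg.src_mem e he)
      · simp [RExp.cost, NExp.cost]
      rintro s5 ⟨e5, N5, R5⟩
      have h5 : Rep src tgt t dem i (verts tgt i L) (dist src tgt t L) (A.erase e) s5 :=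
        h1.rep.congr (fun b hb => by rw [N5, hN4 b (by omega) (by omega) (by omega)])
          fun b hb => by rw [R5 b (by omega), hR4]
      refine (reaches_settle h5 (fun a ha => hg.src_mem a (Finset.mem_of_mem_erase ha)) hv
        (by rw [N5, e4])).frame.mono (by rw [← hK, ← hW]; omega) ?_
      rintro s6 ⟨h6, N6, -⟩
      rw [e5] at h6
      refine ⟨h6.congr_dist fun v hv' => ?_, ?_, ?_⟩
      · by_cases hve : v = tgt e
        · subst hve; rw [Function.update_self, dist_cons_self]
        · rw [Function.update_of_ne hve,
            dist_cons_of_mem hv (Finset.mem_of_mem_insert_of_ne hv' hve)]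
      · rw [N6 34 (by decide), N5, N4 34 (by decide), e3]; rfl
      · rw [N6 52 (by decide), N5, N4 52 (by decide), N3 52 (by decide)]; exact hlist

/-- Adds the flow on the tree to the total flow. -/
def sweepCmd : Cmd :=
  .loop (.ltN (.const 0) (V 34)) <|
  .seq (letN 34 (.sub (V 34) (.const 1))) <|
  .seq (letN 36 (.get 52 (.const 0) (V 34))) <|
  .seq (.setR 11 (.const 0) (V 36)
    (.add (W 11 36) (.get 52 (.const 0) (.get 2 (.const 0) (V 36))))) <|
  .setR 52 (.const 0) (.get 1 (.const 0) (V 36))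
    (.add (.get 52 (.const 0) (.get 1 (.const 0) (V 36))) (.get 52 (.const 0) (.get 2 (.const 0) (V 36))))

/-- The edges are removed in reverse order of insertion, so the head of the current edge is a leaf
of the remaining tree. The flow already assigned plus the flow still owed by the remaining tree is
invariant by `IsTree.sweep`. -/
theorem reaches_sweep (hsrc : ∀ e, s.nat 1 0 (e : Fin n) = src e)
    (htgt : ∀ e, s.nat 2 0 (e : Fin n) = tgt e) (hL : IsTree src tgt i L)
    (hcount : s.nat 34 0 0 = L.length) (hlist : ListAt (s.nat 52 0) L) :
    Reaches O sweepCmd s (150 * L.length + 10) fun s' => ∀ a : Fin n, s'.real 11 0 a =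
      s.real 11 0 a + ∑ v ∈ verts tgt i L, s.real 52 0 v * Network.theta a (pathOf src tgt L v) := by
  let I : ℕ → Mem → Prop := fun pot s' => ∃ L' : List (Fin n), pot = 150 * L'.length ∧
    IsTree src tgt i L' ∧ s'.nat 34 0 0 = L'.length ∧ ListAt (s'.nat 52 0) L' ∧
    s'.nat 1 = s.nat 1 ∧ s'.nat 2 = s.nat 2 ∧
    ∀ a : Fin n, s'.real 11 0 a +
      ∑ v ∈ verts tgt i L', s'.real 52 0 v * Network.theta a (pathOf src tgt L' v) =
      s.real 11 0 a + ∑ v ∈ verts tgt i L, s.real 52 0 v * Network.theta a (pathOf src tgt L v)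
  refine (Reaches.loop_pot I (p := 150 * L.length) ⟨L, rfl, hL, hcount, hlist, rfl, rfl, fun _ => rfl⟩
    ?_ ?_).mono (T₁ := 150 * L.length + 5) (by omega) (fun _ h => h)
  · rintro pot s1 ⟨L', i1, i2, i3, i4, i5, i6, i7⟩ hb
    simp only [BExp.eval, NExp.eval, i3] at hb
    cases L' with
    | nil => simp at hb
    | cons e L' =>
    refine ⟨150 * L'.length, 140, by simp [BExp.cost, NExp.cost, i1]; omega, ?_⟩
    refine Reaches.bind (T₁ := 10) (Reaches.letN (x := L'.length) ?_ ?_) (by omega) ?_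
    · simp only [NExp.eval, i3, List.length_cons, Nat.add_sub_cancel]
    · simp [NExp.cost]
    rintro s2 ⟨e2, R2, N2⟩
    refine Reaches.bind (T₁ := 10) (Reaches.letN (x := (e : ℕ)) ?_ ?_) (by omega) ?_
    · simp only [NExp.eval, e2, N2 52 (by decide), i4.1]
    · simp [NExp.cost]
    rintro s3 ⟨e3, R3, N3⟩
    have hs3 : s3.nat 1 0 e = src e := by rw [N3 1 (by decide), N2 1 (by decide), i5, hsrc]
    have ht3 : s3.nat 2 0 e = tgt e := by rw [N3 2 (by decide), N2 2 (by decide), i6, htgt]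
    refine Reaches.bind (T₁ := 40)
      (Q' := fun s4 => s4 = s3.setR 11 0 e (s1.real 11 0 e + s1.real 52 0 (tgt e)))
      (Reaches.setR (by simp [NExp.cost, RExp.cost])
        (by simp only [NExp.eval, RExp.eval, e3, ht3, R3, R2])) (by omega) ?_
    rintro s4 hs4
    have N4 : s4.nat = s3.nat := by rw [hs4]; rfl
    have R4 : s4.real 52 = s1.real 52 := by
      rw [hs4, setR_real_of_ne _ _ _ _ (by decide), R3, R2]
    refine (Reaches.setR (Q := fun s5 => s5 = s4.setR 52 0 (src e)
      (s1.real 52 0 (src e) + s1.real 52 0 (tgt e))) (by simp [NExp.cost, RExp.cost])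
        (by simp only [NExp.eval, RExp.eval, N4, e3, ht3, hs3, R4])).mono le_rfl ?_
    rintro s5 hs5
    have N5 : s5.nat = s3.nat := by rw [hs5, setR_nat, N4]
    refine ⟨L', rfl, i2.1, ?_, ?_, ?_, ?_, fun a => ?_⟩
    · rw [N5, N3 34 (by decide), e2]
    · rw [N5, N3 52 (by decide), N2 52 (by decide)]; exact i4.2
    · rw [N5, N3 1 (by decide), N2 1 (by decide), i5]
    · rw [N5, N3 2 (by decide), N2 2 (by decide), i6]
    · rw [← i7 a, i2.sweep (fun v => s1.real 52 0 v) (fun v => s5.real 52 0 v), ← add_assoc]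
      · congr 1
        rw [hs5, setR_real_of_ne _ _ _ _ (by decide), hs4, setR_real, R3, R2]
        by_cases hae : a = e
        · subst hae; simp
        · have : ¬ (a : ℕ) = e := fun h => hae (Fin.ext h)
          simp [hae, this]
      · intro v _
        rw [hs5, setR_real, R4]
        by_cases hve : v = src e
        · subst hve; simp
        · have : ¬ (v : ℕ) = src e := fun h => hve (Fin.ext h)
          simp [hve, this]
  · rintro pot s1 ⟨L', -, -, i3, -, -, -, i7⟩ hb
    simp only [BExp.eval, NExp.eval, i3] at hb
    obtain rfl : L' = [] := List.length_eq_zero_iff.1 (by omega)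
    intro a
    rw [← i7 a]
    simp [pathOf, Network.theta]

/-- Adds the flow from the origin `nat 33` to the total flow. -/
def treeCmd : Cmd :=
  .seq (forN 31 nE (.setN 50 (.const 0) tgtE (.const 0))) <|
  .seq (forN 31 (.add nE nE) (.setN 51 (.const 0) (V 31) (.const 0))) <|
  .seq (letN 34 (.const 0)) <|
  .seq (letN 38 (V 33)) <|
  .seq (letR 53 (.const 0)) <|
  .seq settleCmd <|
  .seq (.loop (.ltN (.const 0) (.get 51 (.const 0) (.const 1))) stepCmd) sweepCmd

theorem work_init : work src tgt i [] (out src i) + (out src i).card ≤ 2 * n := by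
  have : (out src i).card + (Finset.univ.filter fun e => src e ∉ verts tgt i []).card = n := by
    rw [← Finset.card_union_of_disjoint]
    · rw [show out src i ∪ (Finset.univ.filter fun e => src e ∉ verts tgt i []) = Finset.univ from ?_]
      · simp
      · ext a
        simp [out, verts, em]
    · rw [Finset.disjoint_left]
      intro a ha ha'
      simp only [Finset.mem_filter, verts, Finset.mem_singleton] at ha'
      exact ha'.2 (mem_out.1 ha)
  unfold work; omega

/-- Each edge is activated and removed at most once, so at most `2n` leaf changes of logarithmic
cost occur. The marks are cleared only at heads of edges, since only these are ever tested. -/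
theorem reaches_tree (ht : ∀ e, 0 ≤ t e) (hn : 0 < n) (h : Fixed src tgt t dem i s) :
    Reaches O treeCmd s (n * (400 * Nat.log 2 (2 * n) + 2000)) fun s' => ∀ a : Fin n,
      s'.real 11 0 a = s.real 11 0 a + ∑ v ∈ verts tgt i (finalTree src tgt t i),
        dem v * Network.theta a (pathOf src tgt (finalTree src tgt t i) v) := by
  classical
  obtain ⟨K, hK⟩ : ∃ K, K = 170 * Nat.log 2 (2 * n) := ⟨_, rfl⟩
  obtain ⟨W, hW⟩ : ∃ W, W = n * K := ⟨_, rfl⟩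
  have hT : 2 * W + 1700 * n ≤ n * (400 * Nat.log 2 (2 * n) + 2000) := by
    rw [hW, hK]; nlinarith [Nat.zero_le (n * Nat.log 2 (2 * n))]
  have hwork := work_init (src := src) (tgt := tgt) (i := i)
  obtain ⟨w0, hw0⟩ : ∃ w0, w0 = work src tgt i [] (out src i) := ⟨_, rfl⟩
  obtain ⟨g0, hg0⟩ : ∃ g0, g0 = (out src i).card := ⟨_, rfl⟩
  rw [← hw0, ← hg0] at hwork
  obtain ⟨T1, hT1⟩ : ∃ T1, T1 = g0 * (K + 100) + 100 := ⟨_, rfl⟩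
  obtain ⟨T2, hT2⟩ : ∃ T2, T2 = (K + 500) * w0 := ⟨_, rfl⟩
  have hT12 : T1 + T2 ≤ 2 * W + 1000 * n + 100 := by
    have h1 : g0 * (K + 100) ≤ g0 * (K + 500) := Nat.mul_le_mul_left _ (by omega)
    have h2 : (w0 + g0) * (K + 500) ≤ 2 * n * (K + 500) := Nat.mul_le_mul_right _ hwork
    rw [hT1, hT2, hW]
    nlinarith
  refine Reaches.mono (T₁ := 2 * W + 1700 * n) ?_ hT (fun _ h => h)
  clear hT
  refine Reaches.bind (T₁ := n * 30 + 20) (Reaches.forN (N := n) (Tb := 10) (fun k s' =>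
    (∀ b, b ≠ 31 → b ≠ 50 → s'.nat b = s.nat b) ∧ s'.real = s.real ∧
    (∀ e : Fin n, (e : ℕ) < k → s'.nat 50 0 (tgt e) = 0)) (by decide) ?_ ?_ ?_ ?_ ?_) (by omega) ?_
  · intro v
    exact ⟨fun b hb _ => setN_nat_of_ne _ _ _ _ hb, rfl, fun e he => absurd he (Nat.not_lt_zero _)⟩
  · rintro k - s1 ⟨h1, -⟩ -
    simp only [NExp.eval, h1 0 (by decide) (by decide), h.n_eq]
  · rintro k s1 v ⟨h1, h2, h3⟩
    exact ⟨fun b hb hb' => by rw [setN_nat_of_ne _ _ _ _ hb, h1 b hb hb'], h2, fun e he => by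
      rw [setN_nat_of_ne _ _ _ _ (by decide), h3 e he]⟩
  · rintro k hk s1 ⟨h1, h2, h3⟩ hik
    refine Reaches.setN (by simp [NExp.cost]) ?_
    have e1 : s1.nat 2 0 k = tgt ⟨k, hk⟩ := by
      rw [h1 2 (by decide) (by decide)]; exact h.tgt_eq ⟨k, hk⟩
    simp only [NExp.eval, hik, e1]
    refine ⟨fun b hb hb' => by rw [setN_nat_of_ne _ _ _ _ hb', h1 b hb hb'], h2, fun e he => ?_⟩
    rw [setN_nat]
    split_ifs with hc
    · rfl
    · refine h3 e (lt_of_le_of_ne (by omega) fun hek => hc ?_)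
      rw [show e = ⟨k, hk⟩ from Fin.ext hek]; simp
  · simp only [NExp.cost]; omega
  rintro s1 ⟨N1, R1, Z1⟩
  refine Reaches.bind (T₁ := 2 * n * 40 + 20) (Reaches.forN (N := 2 * n) (Tb := 10) (fun k s' =>
    (∀ b, b ≠ 31 → b ≠ 51 → s'.nat b = s1.nat b) ∧ s'.real = s.real ∧
    (∀ p < k, s'.nat 51 0 p = 0)) (by decide) ?_ ?_ ?_ ?_ ?_) (by omega) ?_
  · intro v
    exact ⟨fun b hb _ => setN_nat_of_ne _ _ _ _ hb, R1, fun e he => absurd he (Nat.not_lt_zero _)⟩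
  · rintro k - s1 ⟨h1, -⟩ -
    simp only [NExp.eval, h1 0 (by decide) (by decide), N1 0 (by decide) (by decide), h.n_eq]; omega
  · rintro k s1 v ⟨h1, h2, h3⟩
    exact ⟨fun b hb hb' => by rw [setN_nat_of_ne _ _ _ _ hb, h1 b hb hb'], h2, fun e he => by
      rw [setN_nat_of_ne _ _ _ _ (by decide), h3 e he]⟩
  · rintro k hk s1 ⟨h1, h2, h3⟩ hik
    refine Reaches.setN (by simp [NExp.cost]) ?_
    simp only [NExp.eval, hik]
    refine ⟨fun b hb hb' => by rw [setN_nat_of_ne _ _ _ _ hb', h1 b hb hb'], h2, fun p hp => ?_⟩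
    rw [setN_nat]
    split_ifs with hc
    · rfl
    · exact h3 p (by omega)
  · simp only [NExp.cost]; omega
  rintro s2 ⟨N2, R2, Z2⟩
  refine Reaches.bind (T₁ := 10) (Reaches.letN (x := 0) ?_ ?_) (by omega) ?_
  · simp [NExp.eval]
  · simp [NExp.cost]
  rintro s3 ⟨e3, R3, N3⟩
  refine Reaches.bind (T₁ := 10) (Reaches.letN (x := (i : ℕ)) ?_ ?_) (by omega) ?_
  · simp only [NExp.eval, N3 33 (by decide), N2 33 (by decide) (by decide),
      N1 33 (by decide) (by decide), h.i_eq]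
  · simp [NExp.cost]
  rintro s4 ⟨e4, R4, N4⟩
  refine Reaches.bind (T₁ := 10) (Reaches.letR (x := 0) ?_ ?_) (by omega) ?_
  · simp [RExp.eval]
  · simp [RExp.cost]
  rintro s5 ⟨e5, N5, R5⟩
  have hN5 : ∀ b, b ≠ 31 → b ≠ 34 → b ≠ 38 → b ≠ 50 → b ≠ 51 → s5.nat b = s.nat b :=
    fun b h1 h2 h3 h4 h5 => by rw [N5, N4 b h3, N3 b h2, N2 b h1 h5, N1 b h1 h4]
  have hR5 : ∀ b, b ≠ 53 → s5.real b = s.real b := fun b hb => by rw [R5 b hb, R4, R3, R2]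
  have h5 : Rep src tgt t dem i ∅ (fun _ => 0) ∅ s5 := by
    refine ⟨h.congr (fun b hb => hN5 b (by omega) (by omega) (by omega) (by omega) (by omega))
      (fun b hb => hR5 b (by omega)), by simp, fun e _ => ?_, fun p hp0 hp => ?_, by simp, by simp⟩
    · rw [N5, N4 50 (by decide), N3 50 (by decide), N2 50 (by decide) (by decide), Z1 e e.2]
    · rw [N5, N4 51 (by decide), N3 51 (by decide), Z2 p hp]
      rcases winner_mem (A := (∅ : Finset (Fin n))) (k := memKey s5) hp0 hp with h' | ⟨e, he, -⟩
      · exact h'.symm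
      · simp at he
  refine Reaches.bind (T₁ := T1) ((reaches_settle h5 (by simp) (Finset.notMem_empty i)
    (by rw [N5, e4])).frame.mono (by rw [hT1, hg0, hK]) (fun _ h => h)) (by omega) ?_
  rintro s6 ⟨h6, N6, R6⟩
  have h6' : TreeRep src tgt t dem i [] (out src i) s6 := by
    refine ⟨?_, ?_, trivial⟩
    · rw [Finset.empty_union] at h6
      have : Rep src tgt t dem i {i} (Function.update (fun _ => 0) i (s5.real 53 0 0)) (out src i) s6 := h6
      refine this.congr_dist fun v hv => ?_
      rw [Finset.mem_singleton.1 hv, Function.update_self, e5]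
      simp [dist, pathOf, Network.pathCost, Network.theta]
    · rw [N6 34 (by decide), N5, N4 34 (by decide), e3]; rfl
  let I : ℕ → Mem → Prop := fun pot s' => ∃ L A, pot = (K + 500) * work src tgt i L A ∧
    (∃ k, (step src tgt t i)^[k] ([], out src i) = (L, A)) ∧ Good src tgt t i L A ∧
    TreeRep src tgt t dem i L A s'
  refine Reaches.bind (T₁ := T2 + 10) ((Reaches.loop_pot I (p := (K + 500) * w0)
    (Q := fun s' => IsFinal src tgt t i (finalTree src tgt t i) ∧
      Good src tgt t i (finalTree src tgt t i) ∅ ∧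
      TreeRep src tgt t dem i (finalTree src tgt t i) ∅ s')
    ⟨[], out src i, by rw [hw0], ⟨0, rfl⟩, good_init ht, h6'⟩ ?_ ?_).frame.mono
    (by simp only [BExp.cost, NExp.cost]; omega) (fun _ h => h)) (by omega) ?_
  · rintro pot s7 ⟨L, A, i1, ⟨k, hk⟩, i3, i4⟩ hb
    simp only [BExp.eval, NExp.eval] at hb
    rw [i4.top_eq i3.src_mem hn] at hb
    have hA : A.Nonempty := by
      rw [Finset.nonempty_iff_ne_empty]
      intro hA
      have := (top_eq_zero (src := src) (tgt := tgt) (t := t) (L := L) hn).2 hA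
      omega
    obtain ⟨c, hc, hr⟩ := reaches_step (O := O) i4 i3 hA
    rw [← hK] at hc
    refine ⟨(K + 500) * work src tgt i (step src tgt t i (L, A)).1 (step src tgt t i (L, A)).2, c, ?_, ?_⟩
    · rw [i1]; simp only [BExp.cost, NExp.cost]; omega
    · refine hr.mono le_rfl fun s8 h8 => ⟨_, _, rfl, ⟨k + 1, ?_⟩, good_step ht i3 hA, h8⟩
      rw [Function.iterate_succ_apply', hk]
  · rintro pot s7 ⟨L, A, -, ⟨k, hk⟩, i3, i4⟩ hb
    simp only [BExp.eval, NExp.eval] at hb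
    rw [i4.top_eq i3.src_mem hn] at hb
    obtain rfl : A = ∅ := (top_eq_zero (src := src) (tgt := tgt) (t := t) (L := L) hn).1 (by omega)
    obtain ⟨h1, h2⟩ := finalTree_spec (src := src) (tgt := tgt) (i := i) hn ht
    obtain rfl : L = finalTree src tgt t i := IsFinal.unique hn ⟨k, hk⟩ h1
    exact ⟨h1, h2, i4⟩
  rintro s7 ⟨⟨-, h7, h8⟩, N7, R7⟩
  have e11 : s7.real 11 = s.real 11 := by
    rw [R7 11 (by decide), R6 11 (by decide), hR5 11 (by decide)]
  have hlen := h7.tree.length_le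
  refine (reaches_sweep (i := i) (L := finalTree src tgt t i) h8.rep.fixed.src_eq h8.rep.fixed.tgt_eq
    h7.tree h8.count h8.list).mono (by omega) ?_
  intro s8 h9 a
  rw [h9 a, e11]
  congr 1
  exact Finset.sum_congr rfl fun v hv => by rw [h8.rep.dem_at v hv]

end Traffic.Dijkstra

/-! ### Tables and the program that evaluates the potential for γ = 0 -/

namespace Traffic.Dijkstra

variable {nV n m : ℕ} {O : Oracles} {s s' : Mem} {net : Network nV n m}

/-- Lists the edges that leave each vertex. -/
def adjacencyCmd : Cmd :=
  forN 27 nE <|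
    .seq (.setN 24 (.get 1 (.const 0) (V 27)) (.get 25 (.const 0) (.get 1 (.const 0) (V 27))) (V 27)) <|
    .setN 25 (.const 0) (.get 1 (.const 0) (V 27))
      (.add (.get 25 (.const 0) (.get 1 (.const 0) (V 27))) (.const 1))

/-- Tabulates the halves of the numbers below `2 n`. -/
def halfCmd : Cmd :=
  forN 28 nE <|
    .seq (.setN 26 (.const 0) (.add (V 28) (V 28)) (V 28)) <|
    .setN 26 (.const 0) (.add (.add (V 28) (V 28)) (.const 1)) (V 28)

/-- The tables used by Dijkstra's algorithm. -/
structure Tables (net : Network nV n m) (s : Mem) : Prop where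
  origin : OriginData net s
  half : ∀ p < 2 * n, s.nat 26 0 p = p / 2
  deg : ∀ v : Fin nV, s.nat 25 0 v = (out net.src v).card
  adj : ∀ v : Fin nV, ∀ r < (out net.src v).card, ∃ e ∈ out net.src v, s.nat 24 v r = e
  adj_surj : ∀ v : Fin nV, ∀ e ∈ out net.src v, ∃ r < (out net.src v).card, s.nat 24 v r = e

theorem Tables.congr (h : Tables net s)
    (hN : ∀ a, a < 10 ∨ (20 ≤ a ∧ a < 30) → s'.nat a = s.nat a)
    (hR : ∀ a, a < 4 ∨ (40 ≤ a ∧ a < 50) → s'.real a = s.real a) : Tables net s' := by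
  refine ⟨h.origin.congr hN hR, ?_, ?_, ?_, ?_⟩
  · rw [hN 26 (by decide)]; exact h.half
  · rw [hN 25 (by decide)]; exact h.deg
  · rw [hN 24 (by decide)]; exact h.adj
  · rw [hN 24 (by decide)]; exact h.adj_surj

theorem reaches_adjacency (hn : s.nat 0 0 0 = n) (hsrc : ∀ e, s.nat 1 0 (e : Fin n) = net.src e)
    (h25 : s.nat 25 = 0) :
    Reaches O adjacencyCmd s (n * 80 + 20) fun s' =>
      (∀ v : Fin nV, s'.nat 25 0 v = (out net.src v).card) ∧
      (∀ v : Fin nV, ∀ r < (out net.src v).card, ∃ e ∈ out net.src v, s'.nat 24 v r = e) ∧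
      (∀ v : Fin nV, ∀ e ∈ out net.src v, ∃ r < (out net.src v).card, s'.nat 24 v r = e) := by
  classical
  let B : ℕ → Fin nV → Finset (Fin n) := fun k v => (out net.src v).filter fun e => (e : ℕ) < k
  let I : ℕ → Mem → Prop := fun k s' => s'.nat 0 = s.nat 0 ∧ s'.nat 1 = s.nat 1 ∧
    (∀ v : Fin nV, s'.nat 25 0 v = (B k v).card) ∧
    (∀ v : Fin nV, ∀ r < (B k v).card, ∃ e ∈ B k v, s'.nat 24 v r = e) ∧
    (∀ v : Fin nV, ∀ e ∈ B k v, ∃ r < (B k v).card, s'.nat 24 v r = e)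
  refine (Reaches.forN (N := n) (Tb := 50) I (by decide) ?_ ?_ ?_ ?_ ?_).mono le_rfl ?_
  · intro w
    have hB : ∀ v, B 0 v = ∅ := fun v => by simp [B]
    refine ⟨setN_nat_of_ne _ _ _ _ (by decide), setN_nat_of_ne _ _ _ _ (by decide), ?_, ?_, ?_⟩
    · intro v
      rw [setN_nat_of_ne _ _ _ _ (by decide), h25, hB]; rfl
    · intro v r hr; simp [hB] at hr
    · intro v e he; simp [hB] at he
  · rintro k - s1 ⟨h0, -⟩ -
    simp only [NExp.eval, h0, hn]
  · rintro k s1 w ⟨h0, h1, h2, h3, h4⟩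
    refine ⟨by rw [setN_nat_of_ne _ _ _ _ (by decide), h0],
      by rw [setN_nat_of_ne _ _ _ _ (by decide), h1], ?_, ?_, ?_⟩ <;>
      rw [setN_nat_of_ne _ _ _ _ (by decide)] <;> assumption
  · rintro k hk s1 ⟨h0, h1, h2, h3, h4⟩ hik
    set e : Fin n := ⟨k, hk⟩ with he
    set v := net.src e with hv
    have esrc : s1.nat 1 0 k = v := by rw [h1]; exact hsrc e
    refine Reaches.bind (T₁ := 20) (Q' := fun s2 => s2 = s1.setN 24 v (B k v).card k)
      (Reaches.setN (by simp [NExp.cost]) (by simp only [NExp.eval, hik, esrc, h2])) (by omega) ?_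
    rintro s2 hs2
    have N2 : ∀ b, b ≠ 24 → s2.nat b = s1.nat b := fun b hb => by
      rw [hs2, setN_nat_of_ne _ _ _ _ hb]
    refine (Reaches.setN (Q := fun s3 => s3 = s2.setN 25 0 v ((B k v).card + 1)) (by simp [NExp.cost])
      (by simp only [NExp.eval, N2 27 (by decide), N2 1 (by decide), N2 25 (by decide), hik, esrc, h2])).mono
      le_rfl ?_
    rintro s3 hs3
    have hnot : e ∉ B k v := by simp [B, he]
    have hBv : B (k + 1) v = insert e (B k v) := by
      ext a
      simp only [B, Finset.mem_filter, Finset.mem_insert, mem_out]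
      constructor
      · rintro ⟨ha, hak⟩
        rcases Nat.lt_succ_iff_lt_or_eq.1 hak with h | h
        · exact Or.inr ⟨ha, h⟩
        · exact Or.inl (Fin.ext h)
      · rintro (rfl | ⟨ha, hak⟩)
        · exact ⟨rfl, by simp [he]⟩
        · exact ⟨ha, by omega⟩
    have hBu : ∀ u, u ≠ v → B (k + 1) u = B k u := by
      intro u hu
      ext a
      simp only [B, Finset.mem_filter, mem_out]
      refine and_congr_right fun ha => ⟨fun hak => ?_, fun hak => by omega⟩
      refine lt_of_le_of_ne (by omega) fun h => hu ?_
      rw [← ha, show a = e from Fin.ext h]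
    have hcard : (B (k + 1) v).card = (B k v).card + 1 := by
      rw [hBv, Finset.card_insert_of_notMem hnot]
    have e24 : ∀ u : Fin nV, ∀ r, s3.nat 24 u r =
        if u = v ∧ r = (B k v).card then k else s1.nat 24 u r := by
      intro u r
      rw [hs3, setN_nat_of_ne _ _ _ _ (by decide), hs2, setN_nat]
      simp [Fin.val_inj]
    refine ⟨?_, ?_, ?_, ?_, ?_⟩
    · rw [hs3, setN_nat_of_ne _ _ _ _ (by decide), N2 0 (by decide), h0]
    · rw [hs3, setN_nat_of_ne _ _ _ _ (by decide), N2 1 (by decide), h1]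
    · intro u
      rw [hs3, setN_nat]
      by_cases huv : u = v
      · subst huv; simp [hcard]
      · have : ¬ (u : ℕ) = v := fun h => huv (Fin.ext h)
        simp only [this, and_false, if_false]
        rw [N2 25 (by decide), h2, hBu u huv]
    · intro u r hr
      rw [e24]
      by_cases huv : u = v
      · subst huv
        rw [hcard] at hr
        by_cases hrc : r = (B k v).card
        · exact ⟨e, by rw [hBv]; exact Finset.mem_insert_self _ _, by simp [hrc, he]⟩
        · obtain ⟨a, ha, har⟩ := h3 v r (by omega)
          exact ⟨a, by rw [hBv]; exact Finset.mem_insert_of_mem ha, by simp [hrc, har]⟩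
      · rw [hBu u huv] at hr ⊢
        obtain ⟨a, ha, har⟩ := h3 u r hr
        exact ⟨a, ha, by simp [huv, har]⟩
    · intro u a ha
      by_cases huv : u = v
      · subst huv
        rw [hcard]
        rw [hBv, Finset.mem_insert] at ha
        rcases ha with rfl | ha
        · exact ⟨(B k v).card, by omega, by rw [e24]; simp [he]⟩
        · obtain ⟨r, hr, hra⟩ := h4 v a ha
          refine ⟨r, by omega, ?_⟩
          rw [e24, if_neg (by rintro ⟨-, h⟩; omega), hra]
      · rw [hBu u huv] at ha ⊢
        obtain ⟨r, hr, hra⟩ := h4 u a ha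
        exact ⟨r, hr, by rw [e24, if_neg (by tauto), hra]⟩
  · simp only [NExp.cost]; omega
  · rintro s1 ⟨-, -, h2, h3, h4⟩
    have hB : ∀ v, B n v = out net.src v := fun v => Finset.filter_true_of_mem fun e _ => e.2
    simp only [hB] at h2 h3 h4
    exact ⟨h2, h3, h4⟩

theorem reaches_half (hn : s.nat 0 0 0 = n) :
    Reaches O halfCmd s (n * 60 + 20) fun s' => ∀ p < 2 * n, s'.nat 26 0 p = p / 2 := by
  refine (Reaches.forN (N := n) (Tb := 40) (fun k s' => s'.nat 0 = s.nat 0 ∧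
    ∀ p < 2 * k, s'.nat 26 0 p = p / 2) (by decide) ?_ ?_ ?_ ?_ ?_).mono le_rfl ?_
  · intro w
    exact ⟨setN_nat_of_ne _ _ _ _ (by decide), fun p hp => by omega⟩
  · rintro k - s1 ⟨h0, -⟩ -
    simp only [NExp.eval, h0, hn]
  · rintro k s1 w ⟨h0, h1⟩
    refine ⟨by rw [setN_nat_of_ne _ _ _ _ (by decide), h0], ?_⟩
    rw [setN_nat_of_ne _ _ _ _ (by decide)]
    exact h1
  · rintro k hk s1 ⟨h0, h1⟩ hik
    refine Reaches.bind (T₁ := 20) (Q' := fun s2 => s2 = s1.setN 26 0 (k + k) k)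
      (Reaches.setN (by simp [NExp.cost]) (by simp only [NExp.eval, hik])) (by omega) ?_
    rintro s2 hs2
    have e28 : s2.nat 28 0 0 = k := by rw [hs2, setN_nat_of_ne _ _ _ _ (by decide), hik]
    refine Reaches.setN (by simp [NExp.cost]) ?_
    simp only [NExp.eval, e28]
    refine ⟨by rw [setN_nat_of_ne _ _ _ _ (by decide), hs2, setN_nat_of_ne _ _ _ _ (by decide), h0],
      fun p hp => ?_⟩
    rw [setN_nat]
    split_ifs with hc
    · omega
    · rw [hs2, setN_nat]
      split_ifs with hc'
      · omega
      · exact h1 p (by omega)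
  · simp only [NExp.cost]; omega
  · rintro s1 ⟨-, h1⟩
    exact h1

/-- Prepares all tables. -/
def tablesCmd : Cmd := .seq originsCmd (.seq adjacencyCmd halfCmd)

theorem reaches_tables (hs : NetData net s) (h20 : ∀ a, 20 ≤ a → s.nat a = 0)
    (h40 : ∀ a, 40 ≤ a → s.real a = 0) :
    Reaches O tablesCmd s (100 * m + 200 * n + 200) fun s' => Tables net s' ∧ s'.nat 0 = s.nat 0 ∧
      ∀ b, b < 4 → s'.real b = s.real b := by
  refine Reaches.bind (T₁ := 100 * m + 100) (reaches_originsCmd hs h20 h40 le_rfl).frame (by omega) ?_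
  rintro s1 ⟨h1, N1, R1⟩
  have hN1 : ∀ b, b < 20 ∨ 24 ≤ b → s1.nat b = s.nat b := fun b hb => N1 b fun hm => by
    have : ∀ a ∈ originsCmd.wN, 20 ≤ a ∧ a < 24 := by decide
    have := this b hm
    omega
  have hR1 : ∀ b, b < 40 → s1.real b = s.real b := fun b hb => R1 b fun hm => by
    have : ∀ a ∈ originsCmd.wR, 40 ≤ a := by decide
    have := this b hm
    omega
  refine Reaches.bind (T₁ := n * 80 + 20) (reaches_adjacency (net := net) (n := n) h1.data.n_eq h1.data.src
    (by rw [hN1 25 (by omega), h20 25 (by omega)])).frame (by omega) ?_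
  rintro s2 ⟨⟨h2, h3, h4⟩, N2, R2⟩
  have hN2 : ∀ b, b ≠ 24 → b ≠ 25 → b ≠ 27 → s2.nat b = s1.nat b := fun b h1 h2 h3 =>
    N2 b fun hm => by
      have : ∀ a ∈ adjacencyCmd.wN, a = 24 ∨ a = 25 ∨ a = 27 := by decide
      have := this b hm
      omega
  have hR2 : s2.real = s1.real := by
    funext b
    exact R2 b (by simp [adjacencyCmd, forN_wR, Cmd.wR])
  refine (reaches_half (n := n) (by rw [hN2 0 (by decide) (by decide) (by decide), h1.data.n_eq])).frame.mono
    (by omega) ?_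
  rintro s3 ⟨h5, N3, R3⟩
  have hN3 : ∀ b, b ≠ 26 → b ≠ 28 → s3.nat b = s2.nat b := fun b h1 h2 => N3 b fun hm => by
    have : ∀ a ∈ halfCmd.wN, a = 26 ∨ a = 28 := by decide
    have := this b hm
    omega
  have hR3 : s3.real = s2.real := by
    funext b
    exact R3 b (by simp [halfCmd, forN_wR, Cmd.wR])
  have hN : ∀ b, b < 24 → s3.nat b = s1.nat b := fun b hb => by
    rw [hN3 b (by omega) (by omega), hN2 b (by omega) (by omega) (by omega)]
  have d1 := h1.data
  refine ⟨⟨⟨d1.congr (fun a ha => hN a (by omega)) (fun a _ => by rw [hR3, hR2]), ?_, ?_, ?_⟩, h5, ?_, ?_, ?_⟩,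
    ?_, ?_⟩
  · intro i j; rw [hR3, hR2, h1.dem]
  · rw [hN 21 (by omega), h1.count]
  · rw [hN 20 (by omega)]; exact h1.list
  · rw [hN3 25 (by decide) (by decide)]; exact h2
  · rw [hN3 24 (by decide) (by decide)]; exact h3
  · rw [hN3 24 (by decide) (by decide)]; exact h4
  · rw [hN 0 (by omega), hN1 0 (by omega)]
  · intro b hb
    rw [hR3, hR2, hR1 b (by omega)]

/-- Evaluates the potential and minus a subgradient for `γ = 0`. -/
def oracleCmd : Cmd :=
  .seq (vmap 31 11 (.const 0)) <|
  .seq (forN 30 (V 21) (.seq (letN 33 (.get 20 (.const 0) (V 30))) treeCmd)) <|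
  vsum 31 12 (.sub (.const 0) (.mul (W 11 31) (W 10 31)))

theorem treeCmd_wN : ∀ a ∈ treeCmd.wN, 31 ≤ a ∧ a ≠ 33 := by decide

theorem treeCmd_wR : ∀ a ∈ treeCmd.wR, a = 11 ∨ 50 ≤ a := by decide

/-- By homogeneity, the value of the potential is minus the inner product of the shortest path flow
with `t`, so no separate computation of distances is needed once the trees have been swept. -/
theorem reaches_oracle (hm : 0 < m) (hn : 0 < n) (hc : net.ContainsSimplePaths) (h : Tables net s)
    {t : Vec n} (ht : ∀ e, 0 ≤ t e) (hs : VecAt s 10 t) :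
    Reaches O oracleCmd s (3000 * (net.S * n * (Nat.log 2 (2 * n) + 1))) fun s' =>
      s'.real 12 0 0 = net.potential 0 t ∧ VecAt s' 11 (shortestFlow net t) := by
  obtain ⟨o, ho1, ho2, ho3⟩ := h.origin.list
  set g : Fin nV → Fin n → ℝ := fun i e => ∑ v ∈ verts net.tgt i (finalTree net.src net.tgt t i),
    net.dem i v * Network.theta e (pathOf net.src net.tgt (finalTree net.src net.tgt t i) v) with hg
  obtain ⟨Y, hY⟩ : ∃ Y, Y = n * (400 * Nat.log 2 (2 * n) + 2000) := ⟨_, rfl⟩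
  obtain ⟨X, hX⟩ : ∃ X, X = net.S * (Y + 40) := ⟨_, rfl⟩
  have hS := net.S_pos hm
  have hT : X + 110 * n + 60 ≤ 3000 * (net.S * n * (Nat.log 2 (2 * n) + 1)) := by
    have h1 : 1 * n ≤ net.S * n := Nat.mul_le_mul_right _ hS
    have h2 : net.S * 1 ≤ net.S * n := Nat.mul_le_mul_left _ hn
    have h3 : X = 400 * (net.S * n * Nat.log 2 (2 * n)) + 2000 * (net.S * n) + 40 * net.S := by
      rw [hX, hY]; ring
    have h4 : 3000 * (net.S * n * (Nat.log 2 (2 * n) + 1)) =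
        3000 * (net.S * n * Nat.log 2 (2 * n)) + 3000 * (net.S * n) := by ring
    rw [h3, h4]
    generalize net.S * n * Nat.log 2 (2 * n) = Z
    generalize net.S * n = Z' at *
    omega
  refine Reaches.mono (T₁ := X + 110 * n + 60) ?_ hT fun _ h => h
  clear hT
  have hn0 := h.origin.data.n_eq
  refine Reaches.bind (T₁ := 30 * n + 20) (Reaches.vmap (n := n) 0 hn0 (by decide) ?_ ?_) (by omega) ?_
  · intro e s' _ _ _ _
    simp [RExp.eval]
  · simp only [RExp.cost]; omega
  rintro s1 ⟨z1, N1, R1⟩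
  have d1 : Tables net s1 := h.congr (fun a ha => N1 a (by omega)) (fun a ha => R1 a (by omega))
  let I : ℕ → Mem → Prop := fun q s' => Tables net s' ∧ s'.nat 20 = s1.nat 20 ∧
    s'.real 10 = s1.real 10 ∧
    ∀ e : Fin n, s'.real 11 0 e =
      ∑ q' ∈ Finset.range q, if hq : q' < net.S then g (o ⟨q', hq⟩) e else 0
  refine Reaches.bind (T₁ := X + 20) (Reaches.forN (N := net.S) (Tb := Y + 10)
    I (by decide) ?_ ?_ ?_ ?_ ?_) (by omega) ?_
  · intro v
    exact ⟨d1.congr (fun a ha => setN_nat_of_ne _ _ _ _ (by omega)) (fun _ _ => rfl),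
      setN_nat_of_ne _ _ _ _ (by decide), rfl, fun e => by simpa using z1 e⟩
  · intro k _ s' h' _
    exact h'.1.origin.count
  · rintro k s' v ⟨h1, h2, h3⟩
    exact ⟨h1.congr (fun a ha => setN_nat_of_ne _ _ _ _ (by omega)) (fun _ _ => rfl),
      (setN_nat_of_ne _ _ _ _ (by decide)).trans h2, h3⟩
  · rintro k hk s3 ⟨h1, h2, h3, h5⟩ hik
    refine Reaches.bind (T₁ := 10) (Reaches.letN (x := (o ⟨k, hk⟩ : ℕ)) ?_ ?_) (by omega) ?_
    · simp only [NExp.eval, hik, h2, N1 20 (by decide)]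
      exact ho1 ⟨k, hk⟩
    · simp [NExp.cost]
    rintro s4 ⟨e4, R4, N4⟩
    have d4 : Fixed net.src net.tgt t (net.dem (o ⟨k, hk⟩)) (o ⟨k, hk⟩) s4 := by
      have h1' := h1.origin.data
      refine ⟨?_, ?_, ?_, ?_, ?_, ?_, ?_, ?_, e4, ?_⟩
      · rw [N4 0 (by decide), h1'.n_eq]
      · intro e; rw [N4 1 (by decide), h1'.src]
      · intro e; rw [N4 2 (by decide), h1'.tgt]
      · rw [N4 26 (by decide)]; exact h1.half
      · rw [N4 25 (by decide)]; exact h1.deg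
      · rw [N4 24 (by decide)]; exact h1.adj
      · rw [N4 24 (by decide)]; exact h1.adj_surj
      · intro e; rw [R4, h3, R1 10 (by decide), hs e]
      · intro j; rw [R4, h1.origin.dem]
    refine (reaches_tree ht hn d4).frame.mono (by rw [← hY]; omega) ?_
    rintro s5 ⟨h9, N5, R5⟩
    have N5' : ∀ a, a < 30 → s5.nat a = s3.nat a := fun a ha => by
      rw [N5 a, N4 a (by omega)]
      intro hmem
      have := treeCmd_wN a hmem
      clear hX hY
      omega
    have R5' : ∀ a, a < 50 → a ≠ 11 → s5.real a = s3.real a := fun a ha ha' => by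
      rw [R5 a, R4]
      intro hmem
      have := treeCmd_wR a hmem
      clear hX hY
      omega
    refine ⟨h1.congr (fun a ha => N5' a (by omega)) (fun a ha => R5' a (by omega) (by omega)), ?_, ?_, ?_⟩
    · rw [N5' 20 (by decide), h2]
    · rw [R5' 10 (by decide) (by decide), h3]
    · intro e
      rw [h9, R4, h5, Finset.sum_range_succ, dif_pos hk]
  · have : net.S * (Y + 10 + 12 + (V 21).cost) ≤ X := by
      rw [hX]; exact Nat.mul_le_mul_left _ (by simp only [NExp.cost]; omega)
    clear hX
    simp only [NExp.cost] at this ⊢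
    omega
  rintro s2 ⟨d2, -, h10, h11⟩
  have hf : VecAt s2 11 (shortestFlow net t) := fun e => by
    rw [h11, shortestFlow_eq hn hc ht ho2 ho3, Finset.sum_range]
    simp only [hg, Fin.is_lt, dif_pos, Fin.eta]
  have hs2 : VecAt s2 10 t := fun e => by rw [h10, R1 10 (by decide), hs e]
  refine (Reaches.vsum (n := n) (fun e => -(shortestFlow net t e * t e)) d2.origin.data.n_eq
    (by decide) ?_ ?_).mono (T₁ := 60 * n + 20) (by omega) ?_
  · intro e s' hN he hR
    simp only [RExp.eval, NExp.eval, he]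
    rw [hR 11 (by decide), hR 10 (by decide), hf e, hs2 e]
    simp
  · simp only [RExp.cost, NExp.cost]; omega
  · rintro s3 ⟨e3, N3, R3⟩
    refine ⟨?_, fun e => by rw [R3 11 (by decide)]; exact hf e⟩
    rw [e3, potential_eq hn hc ht, Composite.inner_eq_sum, Finset.sum_neg_distrib]

theorem oracleSpec (hm : 0 < m) (hn : 0 < n) (hc : net.ContainsSimplePaths) {P : Composite n}
    (hQ : ∀ x ∈ P.Q, ∀ e, 0 ≤ x e) (hΦ : P.Φ = net.potential 0)
    (hG : P.grad = fun t => -shortestFlow net t) :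
    OracleSpec P O oracleCmd (3000 * (net.S * n * (Nat.log 2 (2 * n) + 1))) (Tables net) where
  call s x hxQ hs hx := by
    refine (reaches_oracle hm hn hc hs (hQ x hxQ) hx).mono le_rfl ?_
    rintro s' ⟨h1, h2⟩
    refine ⟨by rw [h1, hΦ], ?_⟩
    rw [hG, neg_neg]
    exact h2
  wN := by decide
  wR := by decide
  inv _ _ hN hR h := h.congr hN hR

end Traffic.Dijkstra

/-! ### The programs of the two models and the final step counts -/

namespace Traffic

section Input

variable {nV n m : ℕ} (net : Network nV n m) (ℓ : ℕ) (γ ε L₀ R : ℝ) (freeTime cap : Vec n)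

theorem netData_input : NetData net (input net ℓ γ ε L₀ R freeTime cap) where
  n_eq := by simp [input]
  m_eq := by simp [input]
  src e := by simp [input]
  tgt e := by simp [input]
  orig w := by simp [input]
  dest w := by simp [input]
  demand w := by simp [input]

theorem input_nat_of_le (a : ℕ) (ha : 20 ≤ a) : (input net ℓ γ ε L₀ R freeTime cap).nat a = 0 := by
  obtain ⟨b, rfl⟩ := Nat.exists_eq_add_of_le' (show 5 ≤ a by omega)
  rfl

theorem input_real_of_le (a : ℕ) (ha : 40 ≤ a) :
    (input net ℓ γ ε L₀ R freeTime cap).real a = 0 := by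
  obtain ⟨b, rfl⟩ := Nat.exists_eq_add_of_le' (show 4 ≤ a by omega)
  rfl

theorem inputSpec {P : Composite n} (hP : P.start = freeTime) :
    InputSpec P (input net ℓ γ ε L₀ R freeTime cap) ε L₀ R where
  hn := by simp [input]
  hε := by simp [input]
  hL := by simp [input]
  hR := by simp [input]
  start e := by simp [input, hP]

variable {net ℓ γ ε L₀ R freeTime cap}

theorem real_two_of_input {s : Mem}
    (h : ∀ b, b < 4 → s.real b = (input net ℓ γ ε L₀ R freeTime cap).real b) (e : Fin n) :
    s.real 2 0 e = freeTime e := by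
  rw [h 2 (by norm_num)]; simp [input]

theorem real_three_of_input {s : Mem}
    (h : ∀ b, b < 4 → s.real b = (input net ℓ γ ε L₀ R freeTime cap).real b) (e : Fin n) :
    s.real 3 0 e = cap e := by
  rw [h 3 (by norm_num)]; simp [input]

end Input

/-- Machine expressions contain no maximum; the absolute value is obtained as `√(v²)`. -/
theorem max_zero_eq_sqrt (v : ℝ) : max v 0 = (v + Real.sqrt (v * v)) / 2 := by
  rw [Real.sqrt_mul_self_eq_abs]
  rcases le_total 0 v with h | h
  · rw [max_eq_left h, abs_of_nonneg h]; ring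
  · rw [max_eq_right h, abs_of_nonpos h]; ring

/-- The positive part. -/
def posExp (v : RExp) : RExp := .div (.add v (.sqrt (.mul v v))) (.const 2)

theorem posExp_eval (O : Oracles) (s : Mem) (v : RExp) :
    (posExp v).eval O s = max (v.eval O s) 0 := by
  rw [max_zero_eq_sqrt]; simp [posExp, RExp.eval]

namespace Beckmann

variable {nV n m : ℕ} {net : Network nV n m} {ℓ : ℕ} {γ ε L₀ : ℝ} {G : Vec n → Vec n}

/-- The method for the Beckmann model. -/
def program (setup orc : Cmd) : Cmd :=
  methodCmd setup orc (.prox (V 10) (S 16) (.sub (.const 0) (W 22 10)))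
    (.add (.sigmaStar (V 10) (W 4 10)) (.sigma (V 10) (W 5 10))) (.const 0)

/-- The program does not compute entropies, which would need the paths. It accumulates the constant
terms of the linearizations instead, and these equal the entropies up to sign. -/
theorem gap_eq {B : Beckmann n} (hT : (B.dual net γ G).IsTraffic net γ)
    (run : (B.dual net γ G).Run L₀ ε) (h0 : 0 < L₀) (N : ℕ) :
    B.gap net γ run N =
      gapVal run (fun e t f => B.σStar e t + B.σ e f) (fun _ _ _ => 0) 0 N := by
  rw [gap, hT.avgEntropy_eq run h0, gapVal, lowSum, Composite.F, Finset.sum_add_distrib]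
  simp only [dual]
  ring

theorem reaches_program (B : Beckmann n) (hT : (B.dual net γ G).IsTraffic net γ)
    (run : (B.dual net γ G).Run L₀ ε) (h0 : 0 < L₀) {setup orc : Cmd} {Ts To : ℕ}
    {Inv : Mem → Prop} (hO : OracleSpec (B.dual net γ G) B.oracles orc To Inv)
    (hsetup : Reaches B.oracles setup (input net ℓ γ ε L₀ 0 B.freeTime 0) Ts fun s =>
      Inv s ∧ s.nat 0 = (input net ℓ γ ε L₀ 0 B.freeTime 0).nat 0 ∧
        ∀ b, b < 4 → s.real b = (input net ℓ γ ε L₀ 0 B.freeTime 0).real b)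
    {N : ℕ} (hN : B.StopsAt net γ run N) :
    Reaches B.oracles (program setup orc) (input net ℓ γ ε L₀ 0 B.freeTime 0)
      (Ts + (run.trials N + 1) * (4000 * (n + 1) + 2 * To))
      fun s' => Outputs s' (run.z N).t (run.avgFlow N) := by
  refine reaches_methodCmd run hT.regular h0 hO hsetup ?_ ?_
    (inputSpec net ℓ γ ε L₀ 0 B.freeTime 0 rfl)
    (g := fun e t f => B.σStar e t + B.σ e f) (q := fun _ _ _ => 0) ?_ ?_ ?_ ?_ ?_
  · intro s e a c ha he h16 h22 _
    have : RExp.eval B.oracles s (.prox (V 10) (S 16) (.sub (.const 0) (W 22 10))) =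
        B.prox e a c := by
      simp [RExp.eval, NExp.eval, he, h16, h22, oracles]
    rw [this]
    exact B.isProx_prox net e c ha
  · simp [RExp.cost, NExp.cost]
  · intro s e he _
    simp [RExp.eval, NExp.eval, he, oracles]
  · simp [RExp.cost, NExp.cost]
  · intro s e he _
    simp [RExp.eval]
  · simp [RExp.cost]
  · unfold StopsAt at hN
    simpa only [gap_eq hT run h0] using hN

end Beckmann

namespace StableDynamics

variable {nV n m : ℕ} {net : Network nV n m} {ℓ : ℕ} {γ ε L₀ R : ℝ} {G : Vec n → Vec n}

/-- The method for the model of stable dynamics. -/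
def program (setup orc : Cmd) : Cmd :=
  methodCmd setup orc (.add (W 2 10) (posExp (.sub (W 22 10) (.mul (S 16) (W 3 10)))))
    (.add (.mul (W 3 10) (.sub (W 4 10) (W 2 10))) (.mul (W 5 10) (W 2 10)))
    (.mul (.sub (W 5 10) (W 3 10)) (posExp (.sub (W 5 10) (W 3 10))))

theorem gap_eq {D : StableDynamics n} (hT : (D.dual net γ G).IsTraffic net γ)
    (run : (D.dual net γ G).Run L₀ ε) (h0 : 0 < L₀) (N : ℕ) :
    D.gap net γ R run N =
      gapVal run (fun e t f => D.cap e * (t - D.freeTime e) + f * D.freeTime e)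
        (fun e _ f => (f - D.cap e) * max (f - D.cap e) 0) R N := by
  have hsq : ∀ v : ℝ, v * max v 0 = max v 0 ^ 2 := fun v => by
    rcases le_total 0 v with h | h
    · rw [max_eq_left h]; ring
    · rw [max_eq_right h]; ring
  rw [gap, hT.avgEntropy_eq run h0, gapVal, lowSum, Composite.F, Finset.sum_add_distrib, excess]
  simp only [dual, hsq]
  ring

theorem reaches_program (D : StableDynamics n) (hT : (D.dual net γ G).IsTraffic net γ)
    (run : (D.dual net γ G).Run L₀ ε) (h0 : 0 < L₀) {setup orc : Cmd} {Ts To : ℕ} {O : Oracles}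
    {Inv : Mem → Prop} (hO : OracleSpec (D.dual net γ G) O orc To Inv)
    (hsetup : Reaches O setup (input net ℓ γ ε L₀ R D.freeTime D.cap) Ts fun s =>
      Inv s ∧ s.nat 0 = (input net ℓ γ ε L₀ R D.freeTime D.cap).nat 0 ∧
        ∀ b, b < 4 → s.real b = (input net ℓ γ ε L₀ R D.freeTime D.cap).real b)
    {N : ℕ} (hN : D.StopsAt net γ R run N) :
    Reaches O (program setup orc) (input net ℓ γ ε L₀ R D.freeTime D.cap)
      (Ts + (run.trials N + 1) * (4000 * (n + 1) + 2 * To))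
      fun s' => Outputs s' (run.z N).t (run.avgFlow N) := by
  refine reaches_methodCmd run hT.regular h0 hO hsetup ?_ ?_
    (inputSpec net ℓ γ ε L₀ R D.freeTime D.cap rfl)
    (g := fun e t f => D.cap e * (t - D.freeTime e) + f * D.freeTime e)
    (q := fun e _ f => (f - D.cap e) * max (f - D.cap e) 0) ?_ ?_ ?_ ?_ ?_
  · intro s e a c ha he h16 h22 hb
    have : RExp.eval O s
        (.add (W 2 10) (posExp (.sub (W 22 10) (.mul (S 16) (W 3 10))))) =
        D.freeTime e + max (-(a * D.cap e + c)) 0 := by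
      simp only [RExp.eval, posExp_eval, NExp.eval, he, h16, h22, real_two_of_input hb,
        real_three_of_input hb]
      ring_nf
    rw [this]
    exact D.isProx_max net e a c
  · simp [RExp.cost, NExp.cost, posExp]
  · intro s e he hb
    simp only [RExp.eval, NExp.eval, he, real_two_of_input hb, real_three_of_input hb]
  · simp [RExp.cost, NExp.cost]
  · intro s e he hb
    simp only [RExp.eval, posExp_eval, NExp.eval, he, real_three_of_input hb]
  · simp [RExp.cost, NExp.cost, posExp]
  · unfold StopsAt at hN
    simpa only [gap_eq hT run h0] using hN

end StableDynamics

section Bounds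

variable {nV n m : ℕ} {net : Network nV n m}

theorem Network.n_pos (net : Network nV n m) (hm : 0 < m) : 0 < n := by
  obtain ⟨e, -⟩ := net.exists_tgt_dest ⟨0, hm⟩
  exact e.pos

theorem reaches_smoothSetup {ℓ : ℕ} {γ ε L₀ R : ℝ} {freeTime cap : Vec n} (O : Oracles) :
    Reaches O originsCmd (input net ℓ γ ε L₀ R freeTime cap) (100 * m + 100) fun s =>
      SmoothData net ℓ γ s ∧ s.nat 0 = (input net ℓ γ ε L₀ R freeTime cap).nat 0 ∧
        ∀ b, b < 4 → s.real b = (input net ℓ γ ε L₀ R freeTime cap).real b := by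
  refine (reaches_originsCmd (netData_input net ℓ γ ε L₀ R freeTime cap)
    (input_nat_of_le net ℓ γ ε L₀ R freeTime cap)
    (input_real_of_le net ℓ γ ε L₀ R freeTime cap) le_rfl).frame.mono le_rfl ?_
  rintro s ⟨h1, hN, hR⟩
  have hN0 := hN 0 (by decide)
  have hR0 : ∀ b, b < 4 → s.real b = (input net ℓ γ ε L₀ R freeTime cap).real b := fun b hb =>
    hR b fun hm => by
      have : ∀ a ∈ originsCmd.wR, 40 ≤ a := by decide
      have := this b hm
      omega
  exact ⟨⟨h1, by rw [hN0]; simp [input], by rw [hR0 0 (by norm_num)]; simp [input]⟩, hN0, hR0⟩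

theorem one_le_smoothCount {γ ε L₀ R : ℝ} (h0 : 0 < L₀)
    (hL : L₀ ≤ net.H * net.d / γ) : 1 ≤ smoothCount net γ ε L₀ R := by
  have h3 : 0 ≤ Real.logb 2 (net.H * net.d / (γ * L₀)) := by
    apply Real.logb_nonneg (by norm_num)
    rw [← div_div, one_le_div h0]; exact hL
  have h4 := Real.sqrt_nonneg (net.H * net.d * R ^ 2 / (γ * ε))
  unfold smoothCount
  linarith

theorem one_le_nonsmoothCount {ε L₀ R : ℝ} (hε : 0 < ε) (h0 : 0 < L₀)
    (hL : L₀ ≤ net.H * net.d ^ 2 / ε) : 1 ≤ nonsmoothCount net ε L₀ R := by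
  have h3 : 0 ≤ Real.logb 2 (net.H * net.d ^ 2 / (ε * L₀)) := by
    apply Real.logb_nonneg (by norm_num)
    rw [← div_div, one_le_div h0]; exact hL
  have h4 : 0 ≤ net.H * net.d ^ 2 * R ^ 2 / ε ^ 2 := by positivity
  unfold nonsmoothCount
  linarith

/-- Everything is absorbed into `S H n`: `ℓ ≤ H`, `m ≤ S n`, and each `+ 1` at most doubles a
quantity that is at least `1`. -/
theorem smooth_steps_le {ℓ : ℕ} (hm : 0 < m) (hW : net.AllWalks ℓ) {steps trials : ℕ} {K : ℝ}
    (hK : 1 ≤ K) (ht : (trials : ℝ) ≤ 48 * K)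
    (hs : steps ≤ 100 * m + 100 +
      (trials + 1) * (4000 * (n + 1) + 2 * (2000 * (net.S * (ℓ + 1) * (n + 1))))) :
    (steps : ℝ) ≤ 10 ^ 7 * (net.S * net.H * n) * K := by
  have hn := net.n_pos hm
  have hS := net.S_pos hm
  have hH := net.H_pos hm
  have hℓ : ℓ ≤ net.H := by
    obtain ⟨w, p, hp, rfl⟩ := hW.2
    exact net.length_le_H hp
  obtain ⟨X, hX⟩ : ∃ X, X = net.S * net.H * n := ⟨_, rfl⟩
  have hnX : n ≤ X := by rw [hX]; exact Nat.le_mul_of_pos_left _ (Nat.mul_pos hS hH)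
  have hmX : m ≤ X := by
    refine net.m_le.trans ?_
    rw [hX]; exact Nat.mul_le_mul_right _ (Nat.le_mul_of_pos_right _ hH)
  have hoX : net.S * (ℓ + 1) * (n + 1) ≤ 4 * X := by
    calc net.S * (ℓ + 1) * (n + 1) ≤ net.S * (2 * net.H) * (2 * n) := by gcongr <;> omega
      _ = 4 * X := by rw [hX]; ring
  have h1 : steps ≤ 200 * X + (trials + 1) * (24000 * X) := by
    refine hs.trans (Nat.add_le_add (by omega) (Nat.mul_le_mul_left _ ?_))
    generalize net.S * (ℓ + 1) * (n + 1) = Y at hoX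
    omega
  have h2 : (steps : ℝ) ≤ 200 * X + (trials + 1) * (24000 * X) := by exact_mod_cast h1
  have hX0 : (0 : ℝ) ≤ X := Nat.cast_nonneg X
  have h3 : ((trials : ℝ) + 1) * (24000 * X) ≤ (49 * K) * (24000 * X) := by
    gcongr; linarith
  have h4 : (X : ℝ) ≤ X * K := le_mul_of_one_le_right hX0 hK
  have h5 : 10 ^ 7 * ((net.S : ℝ) * net.H * n) * K = 10 ^ 7 * (X * K) := by rw [hX]; push_cast; ring
  rw [h5]
  nlinarith

theorem nonsmooth_steps_le (hm : 0 < m) (hn : 2 ≤ n) {steps trials : ℕ} {K : ℝ}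
    (hK : 1 ≤ K) (ht : (trials : ℝ) ≤ 48 * K)
    (hs : steps ≤ 100 * m + 200 * n + 200 +
      (trials + 1) * (4000 * (n + 1) + 2 * (3000 * (net.S * n * (Nat.log 2 (2 * n) + 1))))) :
    (steps : ℝ) ≤ 10 ^ 7 * (net.S * n * Real.log n) * K := by
  have hS := net.S_pos hm
  have hlog2 : 1 / 2 ≤ Real.log 2 := by linarith [Real.log_two_gt_d9]
  have hnR : (2 : ℝ) ≤ n := by exact_mod_cast hn
  have hlogn : Real.log 2 ≤ Real.log n := Real.log_le_log (by norm_num) hnR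
  -- Since `ln 2 ≥ 1/2`, `log₂ n ≤ 2 ln n`, and for `n ≥ 2` the remaining `2` is at most `4 ln n`.
  have hlog : ((Nat.log 2 (2 * n) + 1 : ℕ) : ℝ) ≤ 6 * Real.log n := by
    rw [mul_comm 2 n, Nat.log_mul_base (by norm_num) (by omega)]
    have h1 : (Nat.log 2 n : ℝ) * Real.log 2 ≤ Real.log n := by
      rw [← Real.log_pow]
      exact Real.log_le_log (by positivity) (by exact_mod_cast Nat.pow_log_le_self 2 (by omega))
    have h2 : (0 : ℝ) ≤ Nat.log 2 n := Nat.cast_nonneg _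
    push_cast
    nlinarith
  obtain ⟨Y, hY⟩ : ∃ Y, Y = net.S * n := ⟨_, rfl⟩
  obtain ⟨l, hl⟩ : ∃ l, l = Nat.log 2 (2 * n) + 1 := ⟨_, rfl⟩
  rw [← hl] at hlog hs
  rw [← hY] at hs
  have hnY : n ≤ Y := by rw [hY]; exact Nat.le_mul_of_pos_left _ hS
  have hmY : m ≤ Y := hY ▸ net.m_le
  have h1 : steps ≤ 500 * Y + (trials + 1) * (8000 * Y + 6000 * (Y * l)) := by
    refine hs.trans (Nat.add_le_add (by omega) (Nat.mul_le_mul_left _ ?_))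
    generalize Y * l = Z
    omega
  have h2 : (steps : ℝ) ≤ 500 * Y + (trials + 1) * (8000 * Y + 6000 * (Y * l)) := by
    exact_mod_cast h1
  have hY0 : (0 : ℝ) ≤ Y := Nat.cast_nonneg Y
  obtain ⟨X, hX⟩ : ∃ X : ℝ, X = Y * Real.log n := ⟨_, rfl⟩
  have hYX : (Y : ℝ) ≤ 2 * X := by rw [hX]; nlinarith
  have hYl : (Y : ℝ) * l ≤ 6 * X := by rw [hX]; nlinarith
  have hX0 : 0 ≤ X := by linarith
  have h3 : ((trials : ℝ) + 1) * (8000 * Y + 6000 * (Y * l)) ≤ (49 * K) * (52000 * X) := by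
    gcongr <;> linarith
  have h4 : X ≤ X * K := le_mul_of_one_le_right hX0 hK
  have h5 : 10 ^ 7 * ((net.S : ℝ) * n * Real.log n) * K = 10 ^ 7 * (X * K) := by
    rw [hX, hY]; push_cast; ring
  rw [h5]
  nlinarith

end Bounds

end Traffic

/-! ### Assembly of the four cases -/

theorem mainTheorem10 :
    ∃ C : ℝ, 0 < C ∧
    -- stochastic equilibria in the Beckmann model
    (∃ prog : Cmd, ∀ (nV n m ℓ : ℕ) (net : Network nV n m) (B : Beckmann n) (γ ε L₀ : ℝ),
      0 < m → 0 < γ → 0 < ε → 0 < L₀ → L₀ ≤ net.H * net.d / γ → net.AllWalks ℓ →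
      let G := gradient (net.potential γ)
      Nonempty ((B.dual net γ G).Run L₀ ε) ∧
      (∀ run : (B.dual net γ G).Run L₀ ε, ∃ N, B.StopsAt net γ run N ∧ B.Accurate net γ run N ∧
        (run.trials N : ℝ) ≤ C * smoothCount net γ ε L₀ (B.Rtilde net γ run (N - 1))) ∧
      ∃ (run : (B.dual net γ G).Run L₀ ε) (N : ℕ) (final : Mem) (steps : ℕ),
        B.StopsAt net γ run N ∧
        Exec B.oracles prog (input net ℓ γ ε L₀ 0 B.freeTime 0) final steps ∧
        Outputs final (run.z N).t (run.avgFlow N) ∧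
        (steps : ℝ) ≤ C * (net.S * net.H * n) *
          smoothCount net γ ε L₀ (B.Rtilde net γ run (N - 1))) ∧
    -- stochastic equilibria in the model of stable dynamics
    (∃ prog : Cmd, ∀ (nV n m ℓ : ℕ) (net : Network nV n m) (D : StableDynamics n)
        (γ ε L₀ R : ℝ) (tstar : Vec n),
      0 < m → 0 < γ → 0 < ε → 0 < L₀ → L₀ ≤ net.H * net.d / γ → net.AllWalks ℓ →
      D.IsDualSolution net γ tstar → 0 ≤ R → 1 / 2 * ‖tstar - D.freeTime‖ ^ 2 ≤ R ^ 2 →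
      let G := gradient (net.potential γ)
      Nonempty ((D.dual net γ G).Run L₀ ε) ∧
      (∀ run : (D.dual net γ G).Run L₀ ε, ∃ N, D.StopsAt net γ R run N ∧
        D.Accurate net γ R run N ∧
        (run.trials N : ℝ) ≤ C * smoothCount net γ ε L₀ (Real.sqrt 5 * R)) ∧
      ∃ (run : (D.dual net γ G).Run L₀ ε) (N : ℕ) (final : Mem) (steps : ℕ),
        D.StopsAt net γ R run N ∧
        Exec Oracles.none prog (input net ℓ γ ε L₀ R D.freeTime D.cap) final steps ∧
        Outputs final (run.z N).t (run.avgFlow N) ∧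
        (steps : ℝ) ≤ C * (net.S * net.H * n) * smoothCount net γ ε L₀ (Real.sqrt 5 * R)) ∧
    -- ordinary equilibria in the Beckmann model
    (∃ prog : Cmd, ∀ (nV n m : ℕ) (net : Network nV n m) (B : Beckmann n) (ε L₀ : ℝ),
      0 < m → 2 ≤ n → 0 < ε → 0 < L₀ → L₀ ≤ net.H * net.d ^ 2 / ε → net.ContainsSimplePaths →
      (∀ G : Vec n → Vec n,
        (∀ t ∈ (B.dual net 0 G).Q, IsSubgradientAt (net.potential 0) (G t) t) →
        Nonempty ((B.dual net 0 G).Run L₀ ε) ∧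
        ∀ run : (B.dual net 0 G).Run L₀ ε, ∃ N, B.StopsAt net 0 run N ∧ B.Accurate net 0 run N ∧
          (run.trials N : ℝ) ≤ C * nonsmoothCount net ε L₀ (B.Rtilde net 0 run (N - 1))) ∧
      ∃ G : Vec n → Vec n,
        (∀ t ∈ (B.dual net 0 G).Q, IsSubgradientAt (net.potential 0) (G t) t) ∧
        ∃ (run : (B.dual net 0 G).Run L₀ ε) (N : ℕ) (final : Mem) (steps : ℕ),
          B.StopsAt net 0 run N ∧
          Exec B.oracles prog (input net 0 0 ε L₀ 0 B.freeTime 0) final steps ∧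
          Outputs final (run.z N).t (run.avgFlow N) ∧
          (steps : ℝ) ≤ C * (net.S * n * Real.log n) *
            nonsmoothCount net ε L₀ (B.Rtilde net 0 run (N - 1))) ∧
    -- ordinary equilibria in the model of stable dynamics
    (∃ prog : Cmd, ∀ (nV n m : ℕ) (net : Network nV n m) (D : StableDynamics n)
        (ε L₀ R : ℝ) (tstar : Vec n),
      0 < m → 2 ≤ n → 0 < ε → 0 < L₀ → L₀ ≤ net.H * net.d ^ 2 / ε → net.ContainsSimplePaths →
      D.IsDualSolution net 0 tstar → 0 ≤ R → 1 / 2 * ‖tstar - D.freeTime‖ ^ 2 ≤ R ^ 2 →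
      (∀ G : Vec n → Vec n,
        (∀ t ∈ (D.dual net 0 G).Q, IsSubgradientAt (net.potential 0) (G t) t) →
        Nonempty ((D.dual net 0 G).Run L₀ ε) ∧
        ∀ run : (D.dual net 0 G).Run L₀ ε, ∃ N, D.StopsAt net 0 R run N ∧
          D.Accurate net 0 R run N ∧
          (run.trials N : ℝ) ≤ C * nonsmoothCount net ε L₀ (Real.sqrt 5 * R)) ∧
      ∃ G : Vec n → Vec n,
        (∀ t ∈ (D.dual net 0 G).Q, IsSubgradientAt (net.potential 0) (G t) t) ∧
        ∃ (run : (D.dual net 0 G).Run L₀ ε) (N : ℕ) (final : Mem) (steps : ℕ),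
          D.StopsAt net 0 R run N ∧
          Exec Oracles.none prog (input net 0 0 ε L₀ R D.freeTime D.cap) final steps ∧
          Outputs final (run.z N).t (run.avgFlow N) ∧
          (steps : ℝ) ≤ C * (net.S * n * Real.log n) *
            nonsmoothCount net ε L₀ (Real.sqrt 5 * R)) := by
  -- The constant is dictated by the step counts; the candidate counts need only `48`.
  refine ⟨10 ^ 7, by norm_num, ⟨Beckmann.program originsCmd smoothOracleCmd, ?_⟩,
    ⟨StableDynamics.program originsCmd smoothOracleCmd, ?_⟩,
    ⟨Beckmann.program Dijkstra.tablesCmd Dijkstra.oracleCmd, ?_⟩,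
    ⟨StableDynamics.program Dijkstra.tablesCmd Dijkstra.oracleCmd, ?_⟩⟩
  · intro nV n m ℓ net B γ ε L₀ hm hγ hε h0 hL hW G
    have hT := B.isTraffic_pos (net := net) hγ hm
    have hL' : if 0 < γ then L₀ ≤ net.H * net.d / γ else L₀ ≤ net.H * net.d ^ 2 / ε := by
      rwa [if_pos hγ]
    have hcount : ∀ run : (B.dual net γ G).Run L₀ ε, ∃ N, B.StopsAt net γ run N ∧
        B.Accurate net γ run N ∧
        (run.trials N : ℝ) ≤ 48 * smoothCount net γ ε L₀ (B.Rtilde net γ run (N - 1)) := by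
      intro run
      obtain ⟨N, hN, hacc⟩ := Beckmann.exists_stopsAt hT run h0 hε hL'
      exact ⟨N, hN, Beckmann.accurate hT run h0 hN.1,
        hT.trials_le_smoothCount run h0 hε hγ hL N hacc⟩
    refine ⟨hT.nonempty_run h0 hε, fun run => ?_, ?_⟩
    · obtain ⟨N, hN, hacc, ht⟩ := hcount run
      have h1 : 1 ≤ smoothCount net γ ε L₀ (B.Rtilde net γ run (N - 1)) :=
        one_le_smoothCount h0 hL
      exact ⟨N, hN, hacc, by linarith⟩
    · obtain ⟨run⟩ := hT.nonempty_run h0 hε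
      obtain ⟨N, hN, -, ht⟩ := hcount run
      obtain ⟨s, k, hex, hk, hout⟩ := B.reaches_program (ℓ := ℓ) hT run h0
        (smoothOracleSpec hm hγ hW rfl rfl) (reaches_smoothSetup B.oracles) hN
      exact ⟨run, N, s, k, hN, hex, hout,
        smooth_steps_le hm hW (one_le_smoothCount h0 hL) ht hk⟩
  · intro nV n m ℓ net D γ ε L₀ R tstar hm hγ hε h0 hL hW hs hR hsR G
    have hT := D.isTraffic_pos (net := net) hγ hm
    have hL' : if 0 < γ then L₀ ≤ net.H * net.d / γ else L₀ ≤ net.H * net.d ^ 2 / ε := by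
      rwa [if_pos hγ]
    have h1 : 1 ≤ smoothCount net γ ε L₀ (Real.sqrt 5 * R) := one_le_smoothCount h0 hL
    have hcount : ∀ run : (D.dual net γ G).Run L₀ ε, ∃ N, D.StopsAt net γ R run N ∧
        D.Accurate net γ R run N ∧
        (run.trials N : ℝ) ≤ 48 * smoothCount net γ ε L₀ (Real.sqrt 5 * R) := by
      intro run
      obtain ⟨N, hN, hacc⟩ := StableDynamics.exists_stopsAt hT run h0 (R := R) hε hL'
      exact ⟨N, hN, StableDynamics.accurate hT run h0 hs hR hsR hN.1,
        hT.trials_le_smoothCount run h0 hε hγ hL N hacc⟩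
    refine ⟨hT.nonempty_run h0 hε, fun run => ?_, ?_⟩
    · obtain ⟨N, hN, hacc, ht⟩ := hcount run
      exact ⟨N, hN, hacc, by linarith⟩
    · obtain ⟨run⟩ := hT.nonempty_run h0 hε
      obtain ⟨N, hN, -, ht⟩ := hcount run
      obtain ⟨s, k, hex, hk, hout⟩ := D.reaches_program (ℓ := ℓ) hT run h0
        (smoothOracleSpec hm hγ hW rfl rfl) (reaches_smoothSetup Oracles.none) hN
      exact ⟨run, N, s, k, hN, hex, hout, smooth_steps_le hm hW h1 ht hk⟩
  · intro nV n m net B ε L₀ hm hn hε h0 hL hP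
    have hL' : if (0 : ℝ) < 0 then L₀ ≤ net.H * net.d / 0 else L₀ ≤ net.H * net.d ^ 2 / ε := by
      rwa [if_neg (lt_irrefl _)]
    have hcount : ∀ G : Vec n → Vec n,
        (∀ t ∈ (B.dual net 0 G).Q, IsSubgradientAt (net.potential 0) (G t) t) →
        ∀ run : (B.dual net 0 G).Run L₀ ε, ∃ N, B.StopsAt net 0 run N ∧ B.Accurate net 0 run N ∧
          (run.trials N : ℝ) ≤ 48 * nonsmoothCount net ε L₀ (B.Rtilde net 0 run (N - 1)) := by
      intro G hG run
      have hT := B.isTraffic_zero hm hG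
      obtain ⟨N, hN, hacc⟩ := Beckmann.exists_stopsAt hT run h0 hε hL'
      exact ⟨N, hN, Beckmann.accurate hT run h0 hN.1,
        hT.trials_le_nonsmoothCount run h0 hε rfl hL N hacc⟩
    refine ⟨fun G hG => ⟨(B.isTraffic_zero hm hG).nonempty_run h0 hε, fun run => ?_⟩,
      fun t => -Dijkstra.shortestFlow net t, ?_⟩
    · obtain ⟨N, hN, hacc, ht⟩ := hcount G hG run
      have h1 : 1 ≤ nonsmoothCount net ε L₀ (B.Rtilde net 0 run (N - 1)) :=
        one_le_nonsmoothCount hε h0 hL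
      exact ⟨N, hN, hacc, by linarith⟩
    -- Dijkstra's algorithm requires nonnegative lengths; on `Q` they are at least the free travel
    -- times.
    · have hQ : ∀ t ∈ (B.dual net 0 fun t => -Dijkstra.shortestFlow net t).Q, ∀ e, 0 ≤ t e :=
        fun t ht e => (B.nonneg e).trans (ht e).1
      have hG : ∀ t ∈ (B.dual net 0 fun t => -Dijkstra.shortestFlow net t).Q,
          IsSubgradientAt (net.potential 0) (-Dijkstra.shortestFlow net t) t :=
        fun t ht => Dijkstra.isSubgradientAt (by omega) hP (hQ t ht)
      have hT := B.isTraffic_zero hm hG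
      refine ⟨hG, ?_⟩
      obtain ⟨run⟩ := hT.nonempty_run h0 hε
      obtain ⟨N, hN, -, ht⟩ := hcount _ hG run
      obtain ⟨s, k, hex, hk, hout⟩ := B.reaches_program (ℓ := 0) hT run h0
        (Dijkstra.oracleSpec hm (by omega) hP hQ rfl rfl)
        (Dijkstra.reaches_tables (netData_input net 0 0 ε L₀ 0 B.freeTime 0)
          (input_nat_of_le net 0 0 ε L₀ 0 B.freeTime 0)
          (input_real_of_le net 0 0 ε L₀ 0 B.freeTime 0)) hN
      exact ⟨run, N, s, k, hN, hex, hout,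
        nonsmooth_steps_le hm hn (one_le_nonsmoothCount hε h0 hL) ht hk⟩
  · intro nV n m net D ε L₀ R tstar hm hn hε h0 hL hP hs hR hsR
    have hL' : if (0 : ℝ) < 0 then L₀ ≤ net.H * net.d / 0 else L₀ ≤ net.H * net.d ^ 2 / ε := by
      rwa [if_neg (lt_irrefl _)]
    have h1 : 1 ≤ nonsmoothCount net ε L₀ (Real.sqrt 5 * R) := one_le_nonsmoothCount hε h0 hL
    have hcount : ∀ G : Vec n → Vec n,
        (∀ t ∈ (D.dual net 0 G).Q, IsSubgradientAt (net.potential 0) (G t) t) →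
        ∀ run : (D.dual net 0 G).Run L₀ ε, ∃ N, D.StopsAt net 0 R run N ∧
          D.Accurate net 0 R run N ∧
          (run.trials N : ℝ) ≤ 48 * nonsmoothCount net ε L₀ (Real.sqrt 5 * R) := by
      intro G hG run
      have hT := D.isTraffic_zero hm hG
      obtain ⟨N, hN, hacc⟩ := StableDynamics.exists_stopsAt hT run h0 (R := R) hε hL'
      exact ⟨N, hN, StableDynamics.accurate hT run h0 hs hR hsR hN.1,
        hT.trials_le_nonsmoothCount run h0 hε rfl hL N hacc⟩
    refine ⟨fun G hG => ⟨(D.isTraffic_zero hm hG).nonempty_run h0 hε, fun run => ?_⟩,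
      fun t => -Dijkstra.shortestFlow net t, ?_⟩
    · obtain ⟨N, hN, hacc, ht⟩ := hcount G hG run
      exact ⟨N, hN, hacc, by linarith⟩
    · have hQ : ∀ t ∈ (D.dual net 0 fun t => -Dijkstra.shortestFlow net t).Q, ∀ e, 0 ≤ t e :=
        fun t ht e => (D.freeTime_nonneg e).trans (ht e)
      have hG : ∀ t ∈ (D.dual net 0 fun t => -Dijkstra.shortestFlow net t).Q,
          IsSubgradientAt (net.potential 0) (-Dijkstra.shortestFlow net t) t :=
        fun t ht => Dijkstra.isSubgradientAt (by omega) hP (hQ t ht)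
      have hT := D.isTraffic_zero hm hG
      refine ⟨hG, ?_⟩
      obtain ⟨run⟩ := hT.nonempty_run h0 hε
      obtain ⟨N, hN, -, ht⟩ := hcount _ hG run
      obtain ⟨s, k, hex, hk, hout⟩ := D.reaches_program (ℓ := 0) hT run h0
        (Dijkstra.oracleSpec hm (by omega) hP hQ rfl rfl)
        (Dijkstra.reaches_tables (O := Oracles.none)
          (netData_input net 0 0 ε L₀ R D.freeTime D.cap)
          (input_nat_of_le net 0 0 ε L₀ R D.freeTime D.cap)
          (input_real_of_le net 0 0 ε L₀ R D.freeTime D.cap)) hN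
      exact ⟨run, N, s, k, hN, hex, hout, nonsmooth_steps_le hm hn h1 ht hk⟩
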